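/- **Setting.** Let $\ell>0$, $m\ge 0$, $\alpha\in[0,\pi)$ (Dirichlet: $\alpha=0$; Robin: $\alpha\neq0$) and let $\beta_1,\beta_2,\beta_1',\beta_2'$ be real with $\rho=\beta_1'\beta_2-\beta_1\beta_2'>0$. Let $\mathcal H=L^2((0,\ell))\oplus\mathbb C$ with $(\varphi,\chi)_{\mathcal H}=\int_0^\ell\overline{\varphi_1}\chi_1\,dz+\rho^{-1}\overline{\varphi_2}\chi_2$, and let $$A\varphi=\big(-\varphi_1''+m^2\varphi_1,\;-[\beta_1\varphi_1(\ell)-\beta_2\varphi_1'(\ell)]\big)$$ on the $\varphi\in\mathcal H$ for which $\varphi_1,\varphi_1'$ are absolutely continuous on $[0,\ell]$, $\varphi_1''\in L^2((0,\ell))$, $\cos\alpha\,\varphi_1(0)+\sin\alpha\,\varphi_1'(0)=0$ and $\varphi_2=\beta_1'\varphi_1(\ell)-\beta_2'\varphi_1'(\ell)$. Assume $A>0$. Then $A$ has a complete orthonormal system of eigenfunctions $\Psi_n=(\psi_n,\psi_n^\partial)$, $n\ge1$, with real components and eigenvalues $\omega_n^2$, $0<\omega_1<\omega_2<\cdots$.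 Fix any such system; functions of $A$ are defined through it. Let $\mathscr H$ be the bosonic Fock space over $\ell^2(\mathbb N)$ with vacuum $\Omega_\ell$, mode operators $a_n,a_n^\dagger$, and Segal field operators $\Phi_S(v)=\tfrac1{\sqrt2}\,\overline{\mathcal A(v)+\mathcal A^\dagger(v)}$ (closure from the finite particle vectors). Let $C_{0,R}(\mathbb R,\mathcal H)$ be the continuous compactly supported functions from $\mathbb R$ to $\mathcal H$ whose values have real components, and $C_{0,R}(\mathbb R,D(\sqrt A))$ those that are continuous and compactly supported with values in $D(\sqrt A)$ with its graph norm. For $f\in C_{0,R}(\mathbb R,\mathcal H)$ put $$\hat\Phi(f)=\Phi_S\Big(\Big\{\Big(\Psi_n,\int_{\mathbb R} e^{i\sqrt A t}A^{-1/4}f(t)\,dt\Big)_{\mathcal H}\Big\}_n\Big),\qquad \phi_f(t)=(\mathsf Ef)(t)=-\int_{\mathbb R}\frac{\sin(\sqrt A(t-t'))}{\sqrt A}f(t')\,dt'.$$ Then $\hat\Phi(f)$ generates a unitary group $e^{is\hat\Phi(f)}$, and $\phi_f(t)\in\mathcal H$ has the components $(\phi_f)_1(t,z)$, $(\phi_f)_2(t)$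 given by the eigenfunction expansion $$-\int_{\mathbb R}\sum_n\omega_n^{-1}\sin(\omega_n(t-t'))\,\Psi_n(z)\,(\Psi_n,f(t'))_{\mathcal H}\,dt'.$$ Let $F=e^{i\hat\Phi(f)}\Omega_\ell$. For $\beta>0$ let $\langle\cdot\rangle_\beta$ be the Gibbs state with density matrix $e^{-\beta H}/\operatorname{Tr}e^{-\beta H}$, $H=\sum_n\omega_na_n^\dagger a_n$, and let $\langle\cdot\rangle^F_\beta=\langle e^{-i\hat\Phi(f)}\,\cdot\;e^{i\hat\Phi(f)}\rangle_\beta$. The field at a bulk point $x=(t,z)$ or at a boundary point $x=t$ is $$\hat\Phi(x)=\sum_n(2\omega_n)^{-1/2}\big(e^{-i\omega_nt}\Psi_n(x)\,a_n+e^{i\omega_nt}\Psi_n(x)\,a_n^\dagger\big),$$ with $\Psi_n(x)=\psi_n(z)$ or $\Psi_n(x)=\psi_n^\partial$ respectively; $n$-point functions at points are limits of the expectations of products of the partial sums. Write $\hat\Phi^{\rm B},\hat\Phi^\partial$ for the bulk and boundary components. Below, $(\eta,\eta_f)$ is either $(\langle\Omega_\ell|\cdot\,\Omega_\ell\rangle,\langle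 F|\cdot\,F\rangle)$ or, for some $\beta>0$, $(\langle\cdot\rangle_\beta,\langle\cdot\rangle_\beta^F)$. An equality between $n$-point functions at points, or between renormalized quantities (which are limits), means that one side exists if and only if the other does, and that they are then equal. **1. ($n$-point functions.)** Let $f\in C_{0,R}(\mathbb R,\mathcal H)$. For all $g_1,\dots,g_n\in C_{0,R}(\mathbb R,\mathcal H)$ both sides of $$\eta_f\big(\hat\Phi(g_1)\cdots\hat\Phi(g_n)\big)=\eta\Big(\prod_{i=1}^n\Big(\hat\Phi(g_i)-\int_{\mathbb R}(\phi_f(t),g_i(t))_{\mathcal H}\,dt\Big)\Big)$$ are well defined and equal. For all bulk or boundary points $x_1,\dots,x_n$ (bulk positions in $[0,\ell]$), $$\eta_f\big(\hat\Phi(x_1)\cdots\hat\Phi(x_n)\big)=\eta\Big(\prod_{i=1}^n\big(\hat\Phi(x_i)-\phi_f(x_i)\big)\Big).$$ Moreover, for all points $x,x'$, the difference of the two-point functions of $\eta_f$ and $\eta$, computed with the $N$-th partial sums of the fields, converges to $\phi_f(x)\phi_f(x')$ as $N\to\infty$. **2. (State polarizations.)** For bulk points $x=(t,z)$, $x'=(t',z')$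 let $2\sigma=-(t-t')^2+(z-z')^2$ and, for $\sigma>0$, with $\gamma$ Euler's constant and $\lambda=\ln(\tfrac{m^2}{2}\sigma)$ (if $m=0$, $\lambda=\ln(\tfrac12\sigma)$), $$H_{\rm M}(x,x')=-\tfrac1{4\pi}\Big\{2\gamma+\lambda+\tfrac{m^2}{2}\sigma[\lambda+2\gamma-2]+\tfrac{m^4}{16}\sigma^2[\lambda+2\gamma-3]\Big\}.$$ For a state $\eta$ put $$\eta((\hat\Phi^{\rm B}_{\rm ren})^2(x))=\lim_{x'\to x,\ \sigma>0}\big(\eta(\hat\Phi^{\rm B}(x)\hat\Phi^{\rm B}(x'))-H_{\rm M}(x,x')\big),\qquad \eta((\hat\Phi^{\partial}_{\rm ren})^2(t))=\lim_{t'\to t}\eta(\hat\Phi^\partial(t)\hat\Phi^\partial(t')).$$ Then for $f\in C_{0,R}(\mathbb R,\mathcal H)$, $t\in\mathbb R$ and $0<z<\ell$, $$\eta_f((\hat\Phi^{\rm B}_{\rm ren})^2(t,z))=\eta((\hat\Phi^{\rm B}_{\rm ren})^2(t,z))+\big((\phi_f)_1(t,z)\big)^2,\qquad \eta_f((\hat\Phi^{\partial}_{\rm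 ren})^2(t))=\eta((\hat\Phi^{\partial}_{\rm ren})^2(t))+\big((\phi_f)_2(t)\big)^2 .$$ **3. (Local Casimir energies.)** For a state $\eta$ put $$\eta(\hat H^{\rm B}_{\rm ren}(x))=\lim_{x'\to x,\ \sigma>0}\tfrac12(\partial_t\partial_{t'}+\partial_z\partial_{z'}+m^2)\big(\eta(\hat\Phi^{\rm B}(x)\hat\Phi^{\rm B}(x'))-H_{\rm M}(x,x')\big),$$ $$\eta(\hat H^{\partial}_{\rm ren}(t))=\lim_{t'\to t}\tfrac12\big(|\beta_1'|\partial_t\partial_{t'}-\operatorname{sign}(\beta_1')\beta_1\big)\eta(\hat\Phi^\partial(t)\hat\Phi^\partial(t')).$$ If $f\in C_{0,R}(\mathbb R,D(\sqrt A))$, then $(\phi_f)_1$ is differentiable in $t$ and in $z$ at every $(t,z)$ with $0<z<\ell$, $(\phi_f)_2$ is differentiable, and for $t\in\mathbb R$, $0<z<\ell$, $$\eta_f(\hat H^{\rm B}_{\rm ren}(t,z))=\eta(\hat H^{\rm B}_{\rm ren}(t,z))+\tfrac12\big((\partial_t(\phi_f)_1)^2+(\partial_z(\phi_f)_1)^2+m^2(\phi_f)_1^2\big)(t,z),$$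 $$\eta_f(\hat H^{\partial}_{\rm ren}(t))=\eta(\hat H^{\partial}_{\rm ren}(t))+\tfrac12\big(|\beta_1'|(\partial_t(\phi_f)_2)^2-\operatorname{sign}(\beta_1')\,\beta_1\,(\phi_f)_2^2\big)(t).$$ -/

import Mathlib

open MeasureTheory Filter Topology Set
open scoped InnerProductSpace

noncomputable section

namespace CoherentCasimir

/-! ## Classical system: one-particle data -/

/-- Parameters of the bulk-boundary system on `[0, ℓ]`: mass `m`, angle `α` of the boundary
condition at `0` (`α = 0` is Dirichlet, `α ≠ 0` is Robin), and boundary coefficients at `ℓ`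
(`b₁`, `b₂` stand for `β₁`, `β₂`, and `b₁'`, `b₂'` for `β₁'`, `β₂'`). -/
structure Params where
  ell : ℝ
  m : ℝ
  α : ℝ
  b₁ : ℝ
  b₂ : ℝ
  b₁' : ℝ
  b₂' : ℝ
  ell_pos : 0 < ell
  m_nonneg : 0 ≤ m
  α_mem : α ∈ Ico 0 Real.pi
  det_pos : 0 < b₁' * b₂ - b₁ * b₂'

/-- The determinant `ρ = β₁' β₂ - β₁ β₂'`. -/
def Params.rho (P : Params) : ℝ := P.b₁' * P.b₂ - P.b₁ * P.b₂'

/-- Lebesgue measure on `(0, ℓ)`. -/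
def Params.bulkMeasure (P : Params) : Measure ℝ := volume.restrict (Ioo 0 P.ell)

/-- The boundary summand of the Hilbert space: `ℂ` with inner product `ρ⁻¹ * conj x * y`. -/
def BdryLine (_P : Params) : Type := ℂ

instance (P : Params) : AddCommGroup (BdryLine P) := inferInstanceAs (AddCommGroup ℂ)
instance (P : Params) : Module ℂ (BdryLine P) := inferInstanceAs (Module ℂ ℂ)

/-- The complex number underlying an element of the boundary summand. -/
def BdryLine.val {P : Params} (x : BdryLine P) : ℂ := x

/-- The weighted inner product on the boundary summand. -/
@[reducible] def BdryLine.core (P : Params) : InnerProductSpace.Core ℂ (BdryLine P) where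
  inner x y := ((P.rho⁻¹ : ℝ) : ℂ) * (starRingEnd ℂ x.val * y.val)
  conj_inner_symm x y := by
    simp [mul_comm]
  re_inner_nonneg x := by
    have h : 0 < P.rho⁻¹ := inv_pos.mpr P.det_pos
    rw [← Complex.normSq_eq_conj_mul_self, ← Complex.ofReal_mul]
    simpa using mul_nonneg h.le (Complex.normSq_nonneg x.val)
  add_left x y z := by
    change _ * ((starRingEnd ℂ) (x.val + y.val) * z.val) = _
    rw [map_add]; ring
  smul_left x y r := by
    change _ * ((starRingEnd ℂ) (r * x.val) * y.val) = _
    rw [map_mul]; ring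
  definite x h := by
    have h0 : ((P.rho⁻¹ : ℝ) : ℂ) ≠ 0 :=
      Complex.ofReal_ne_zero.mpr (inv_pos.mpr P.det_pos).ne'
    rw [mul_eq_zero, ← Complex.normSq_eq_conj_mul_self] at h
    rcases h with h | h
    · exact absurd h h0
    · exact Complex.normSq_eq_zero.mp (Complex.ofReal_eq_zero.mp h)

instance (P : Params) : NormedAddCommGroup (BdryLine P) :=
  (BdryLine.core P).toNormedAddCommGroup
instance (P : Params) : InnerProductSpace ℂ (BdryLine P) :=
  InnerProductSpace.ofCore (BdryLine.core P).toCore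
instance (P : Params) : FiniteDimensional ℂ (BdryLine P) :=
  inferInstanceAs (FiniteDimensional ℂ ℂ)
instance (P : Params) : CompleteSpace (BdryLine P) := FiniteDimensional.complete ℂ _

/-- The Hilbert space `L²((0,ℓ)) ⊕ ℂ` with inner product
`∫₀^ℓ conj φ₁ χ₁ dz + ρ⁻¹ conj φ₂ χ₂`. -/
abbrev HSpace (P : Params) : Type := WithLp 2 (Lp ℂ 2 P.bulkMeasure × BdryLine P)

/-- `P.OpGraph u φ χ` says that `φ` belongs to the domain of the operator `A` (with zero
potential), that `u` is the representative of the bulk component `φ₁` for which `u` and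
`v = ∂_z u` are absolutely continuous on `[0, ℓ]` with `w = ∂_z² u` square integrable, and that
`A φ = χ`, i.e. `χ = (-u'' + m² u, -(β₁ u(ℓ) - β₂ u'(ℓ)))`. -/
def Params.OpGraph (P : Params) (u : ℝ → ℂ) (φ χ : HSpace P) : Prop :=
  ∃ v w : ℝ → ℂ, MemLp w 2 P.bulkMeasure ∧
    (∀ z ∈ Icc 0 P.ell, u z = u 0 + ∫ y in (0 : ℝ)..z, v y) ∧
    (∀ z ∈ Icc 0 P.ell, v z = v 0 + ∫ y in (0 : ℝ)..z, w y) ∧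
    (⇑φ.fst =ᵐ[P.bulkMeasure] u) ∧
    (Real.cos P.α : ℂ) * u 0 + (Real.sin P.α : ℂ) * v 0 = 0 ∧
    φ.snd.val = (P.b₁' : ℂ) * u P.ell - (P.b₂' : ℂ) * v P.ell ∧
    (⇑χ.fst =ᵐ[P.bulkMeasure] fun z => -w z + (P.m : ℂ) ^ 2 * u z) ∧
    χ.snd.val = -((P.b₁ : ℂ) * u P.ell - (P.b₂ : ℂ) * v P.ell)

/-- The condition `A > 0`. -/
def Params.Positive (P : Params) : Prop :=
  ∀ (u : ℝ → ℂ) (φ χ : HSpace P), P.OpGraph u φ χ → φ ≠ 0 → 0 < (⟪φ, χ⟫_ℂ).re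

/-- A complete orthonormal set of eigenfunctions `Ψ_n` of `A` with real-valued components and
eigenvalues `ω_n²`, `ω_n > 0`, listed in increasing order; `ψ n` is the continuous representative
on `[0, ℓ]` of the bulk component of `Ψ_n = basis n`. -/
structure EigenSystem (P : Params) where
  ω : ℕ → ℝ
  ω_pos : ∀ n, 0 < ω n
  ω_strictMono : StrictMono ω
  basis : HilbertBasis ℕ ℂ (HSpace P)
  ψ : ℕ → ℝ → ℝ
  eigen : ∀ n, P.OpGraph (fun z => (ψ n z : ℂ)) (basis n) (((ω n : ℂ) ^ 2) • basis n)
  bdry_real : ∀ n, (basis n).snd.val.im = 0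

/-- The test function space `C_{0,R}(ℝ, 𝓗)`: continuous, compactly supported, with values in the
vectors of `𝓗` with real components. -/
def Params.IsTest (P : Params) (f : ℝ → HSpace P) : Prop :=
  Continuous f ∧ HasCompactSupport f ∧
    ∀ t, (∀ᵐ z ∂P.bulkMeasure, ((f t).fst z).im = 0) ∧ (f t).snd.val.im = 0

/-- Spacetime points of the combined system: `(t, some z)` is the bulk point `(t, z)`, and
`(t, none)` is the time `t` on the boundary. -/
abbrev Pt : Type := ℝ × Option ℝ

/-- Bulk positions lie in `[0, ℓ]`. -/
def Params.IsPt (P : Params) (x : Pt) : Prop := ∀ z : ℝ, x.2 = some z → z ∈ Icc 0 P.ell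

/-! ## Bosonic Fock space over `ℓ²(ℕ)` -/

/-- The one-particle space. -/
abbrev OneParticle : Type := lp (fun _ : ℕ => ℂ) 2

/-- The full Fock space: `ℓ²` of the set of words `List ℕ = ⨆ₙ ℕⁿ`; the words of length `n` carry
the `n`-particle component, by the identification of `⊗ⁿ ℓ²(ℕ)` with `ℓ²(ℕⁿ)`. -/
abbrev WordSpace : Type := lp (fun _ : List ℕ => ℂ) 2

/-- The bosonic Fock space `ℂ ⊕ ⨁ₙ ⊗ₛⁿ ℓ²(ℕ)`: the symmetric elements of the full Fock space. -/
def fockSubmodule : Submodule ℂ WordSpace where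
  carrier := {ψ | ∀ l l' : List ℕ, l.Perm l' → ψ l = ψ l'}
  add_mem' := by
    intro a b ha hb l l' h
    rw [lp.coeFn_add, Pi.add_apply, Pi.add_apply, ha l l' h, hb l l' h]
  zero_mem' := by
    intro l l' _
    rfl
  smul_mem' := by
    intro c a ha l l' h
    rw [lp.coeFn_smul, Pi.smul_apply, Pi.smul_apply, ha l l' h]

abbrev Fock : Type := fockSubmodule

/-- Amplitude of the Fock vector `x` at the word `l`. -/
def amp (x : Fock) (l : List ℕ) : ℂ := (x : WordSpace) l

/-- The vacuum vector (ground state) `Ω_ℓ = (1, 0, 0, …)`. -/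
def vacuum : Fock :=
  ⟨lp.single 2 ([] : List ℕ) (1 : ℂ), by
    intro l l' h
    by_cases hl : l = []
    · subst hl
      rw [List.nil_perm.mp h]
    · have hl' : l' ≠ [] := fun h' => hl (List.perm_nil.mp (h' ▸ h))
      rw [lp.single_apply_ne 2 _ _ hl, lp.single_apply_ne 2 _ _ hl']⟩

/-- Annihilation operator: `(𝒜(a) x)⁽ⁿ⁾ = √(n+1) ∑ⱼ conj (aⱼ) x⁽ⁿ⁺¹⁾(j, ·)`. -/
def annih (a : OneParticle) (x : Fock) (l : List ℕ) : ℂ :=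
  (Real.sqrt (l.length + 1) : ℂ) * ∑' j : ℕ, starRingEnd ℂ (a j) * amp x (j :: l)

/-- Creation operator `(𝒜†(a) x)⁽ⁿ⁾ = √n Sₙ (a ⊗ x⁽ⁿ⁻¹⁾)`, with `Sₙ` the symmetrization. -/
def creat (a : OneParticle) (x : Fock) (l : List ℕ) : ℂ :=
  ((Real.sqrt l.length)⁻¹ : ℂ) *
    ∑ i : Fin l.length, a (l.get i) * amp x (l.eraseIdx i)

/-- Unbounded operators on the Fock space. -/
abbrev FockOp : Type := Fock →ₗ.[ℂ] Fock

theorem summable_annih (a : OneParticle) (x : Fock) (l : List ℕ) :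
    Summable fun j : ℕ => starRingEnd ℂ (a j) * amp x (j :: l) := by
  have hinj : Function.Injective (fun j : ℕ => j :: l) := fun i j h => (List.cons.inj h).1
  have hx : Summable fun j : ℕ => ‖amp x (j :: l)‖ ^ (2 : ℕ) := by
    have h := (lp.memℓp (x : WordSpace)).summable (by norm_num)
    have h2 := h.comp_injective hinj
    simpa [Function.comp_def, amp] using h2
  have ha : Summable fun j : ℕ => ‖a j‖ ^ (2 : ℕ) := by
    have h := (lp.memℓp a).summable (by norm_num)
    simpa using h
  refine Summable.of_norm_bounded (ha.add hx) fun j => ?_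
  rw [norm_mul, RCLike.norm_conj]
  nlinarith [sq_nonneg (‖a j‖ - ‖amp x (j :: l)‖), sq_nonneg (‖a j‖), sq_nonneg ‖amp x (j :: l)‖]

/-- Graph of `(1/√2) (𝒜(a) + 𝒜†(a))` on the finite particle vectors `𝓕_{b,0}`. (On such vectors
the amplitudes on the right-hand side are always symmetric and square summable.) -/
def segalCoreGraph (a : OneParticle) : Submodule ℂ (Fock × Fock) where
  carrier := {p | (∃ n : ℕ, ∀ l : List ℕ, n < l.length → amp p.1 l = 0) ∧
    ∀ l, amp p.2 l = ((Real.sqrt 2)⁻¹ : ℂ) * (annih a p.1 l + creat a p.1 l)}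
  add_mem' := by
    rintro p q ⟨⟨n, hn⟩, hp⟩ ⟨⟨k, hk⟩, hq⟩
    have hadd : ∀ (x y : Fock) (l : List ℕ), amp (x + y) l = amp x l + amp y l := fun _ _ _ => rfl
    refine ⟨⟨max n k, fun l hl => ?_⟩, fun l => ?_⟩
    · rw [Prod.fst_add, hadd, hn l (lt_of_le_of_lt (le_max_left _ _) hl),
        hk l (lt_of_le_of_lt (le_max_right _ _) hl), add_zero]
    · have h1 : annih a (p.1 + q.1) l = annih a p.1 l + annih a q.1 l := by
        unfold annih
        rw [← mul_add, ← (summable_annih a p.1 l).tsum_add (summable_annih a q.1 l)]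
        simp only [hadd, mul_add]
      have h2 : creat a (p.1 + q.1) l = creat a p.1 l + creat a q.1 l := by
        unfold creat
        rw [← mul_add, ← Finset.sum_add_distrib]
        simp only [hadd, mul_add]
      rw [Prod.snd_add, Prod.fst_add, hadd, hp l, hq l, h1, h2]
      ring
  zero_mem' := by
    have hz : ∀ l, amp (0 : Fock) l = 0 := fun _ => rfl
    refine ⟨⟨0, fun l _ => hz l⟩, fun l => ?_⟩
    simp [annih, creat, hz]
  smul_mem' := by
    rintro c p ⟨⟨n, hn⟩, hp⟩
    have hsm : ∀ (x : Fock) (l : List ℕ), amp (c • x) l = c * amp x l := fun _ _ => rfl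
    refine ⟨⟨n, fun l hl => ?_⟩, fun l => ?_⟩
    · rw [Prod.smul_fst, hsm, hn l hl, mul_zero]
    · have h1 : annih a (c • p.1) l = c * annih a p.1 l := by
        unfold annih
        have h : ∀ j, starRingEnd ℂ (a j) * amp (c • p.1) (j :: l) =
            c * (starRingEnd ℂ (a j) * amp p.1 (j :: l)) := fun j => by rw [hsm]; ring
        simp_rw [h]
        rw [tsum_mul_left]
        ring
      have h2 : creat a (c • p.1) l = c * creat a p.1 l := by
        unfold creat
        have h : ∀ i : Fin l.length, a (l.get i) * amp (c • p.1) (l.eraseIdx i) =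
            c * (a (l.get i) * amp p.1 (l.eraseIdx i)) := fun i => by rw [hsm]; ring
        simp_rw [h]
        rw [← Finset.mul_sum]
        ring
      rw [Prod.smul_snd, Prod.smul_fst, hsm, hp l, h1, h2]
      ring

theorem segalCoreGraph_single (a : OneParticle) (p : Fock × Fock) (hp : p ∈ segalCoreGraph a)
    (h0 : p.1 = 0) : p.2 = 0 := by
  have hz : ∀ l, amp (0 : Fock) l = 0 := fun _ => rfl
  apply Subtype.ext
  apply lp.ext
  funext l
  have h := hp.2 l
  rw [h0] at h
  simpa [annih, creat, hz, amp] using h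

/-- The operator `(1/√2) (𝒜(a) + 𝒜†(a))` on the finite particle vectors. -/
def segalCore (a : OneParticle) : FockOp := (segalCoreGraph a).toLinearPMap

theorem segalCore_graph (a : OneParticle) : (segalCore a).graph = segalCoreGraph a :=
  Submodule.toLinearPMap_graph_eq _ (segalCoreGraph_single a)

/-- The Segal field operator `Φ_S(a)`. -/
def segal (a : OneParticle) : FockOp := (segalCore a).closure

/-- The operator `T - c 𝟙` with the domain of `T`. -/
def shift (T : FockOp) (c : ℝ) : FockOp := (-(c : ℂ)) • (LinearMap.id : Fock →ₗ[ℂ] Fock) +ᵥ T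

/-- `U` is the strongly continuous one-parameter unitary group `s ↦ e^{i s T}`: its generator is
exactly `T`. -/
def IsUnitaryGroupOf (T : FockOp) (U : ℝ → (Fock ≃ₗᵢ[ℂ] Fock)) : Prop :=
  (∀ s s' x, U (s + s') x = U s (U s' x)) ∧
  (∀ x, Continuous fun s => U s x) ∧
  ∀ x y : Fock, (x, y) ∈ T.graph ↔ HasDerivAt (fun s : ℝ => U s x) (Complex.I • y) 0

open Classical in
/-- The Weyl operator `e^{iT}` (meaningful when `T` generates a unitary group, i.e. is
self-adjoint). -/
def expI (T : FockOp) : Fock ≃ₗᵢ[ℂ] Fock :=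
  if h : ∃ U, IsUnitaryGroupOf T U then h.choose 1 else LinearIsometryEquiv.refl ℂ Fock

/-- `Acts [T₁, …, Tₙ] x y`: the vector `x` is in the domain of `T₁ ⋯ Tₙ`, and
`T₁ ⋯ Tₙ x = y`. -/
def Acts : List FockOp → Fock → Fock → Prop
  | [], x, y => y = x
  | T :: Ts, x, y => ∃ w, Acts Ts x w ∧ (w, y) ∈ T.graph

/-- `VecExp x [T₁, …, Tₙ] v`: `x` is in the domain of `T₁ ⋯ Tₙ`, and `⟨x | T₁ ⋯ Tₙ x⟩ = v`. -/
def VecExp (x : Fock) (L : List FockOp) (v : ℂ) : Prop := ∃ y, Acts L x y ∧ ⟪x, y⟫_ℂ = v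

/-- A state given by its expectation values: `η [T₁, …, Tₙ] v` says that the expectation of
`T₁ ⋯ Tₙ` is defined and equals `v`. -/
abbrev State : Type := List FockOp → ℂ → Prop

open Classical in
/-- The words with letters `s`. -/
def wordsOf (s : Multiset ℕ) : Finset (List ℕ) := s.lists.toFinset

theorem mem_wordsOf (s : Multiset ℕ) (l : List ℕ) : l ∈ wordsOf s ↔ (l : Multiset ℕ) = s := by
  classical
  simp [wordsOf, Multiset.mem_lists_iff, eq_comm]

open Classical in
/-- The normalized occupation number vector in which the modes listed in `s` are occupied. These
vectors form an orthonormal basis of the Fock space. -/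
def occVec (s : Multiset ℕ) : Fock :=
  ⟨⟨fun l => if (l : Multiset ℕ) = s then ((Real.sqrt (wordsOf s).card)⁻¹ : ℂ) else 0, by
      refine (memℓp_zero ?_).of_exponent_ge zero_le
      refine (wordsOf s).finite_toSet.subset fun l hl => ?_
      by_contra h
      exact hl (if_neg fun h' => h (Finset.mem_coe.mpr ((mem_wordsOf s l).mpr h')))⟩, by
    intro l l' h
    have : (l : Multiset ℕ) = l' := Multiset.coe_eq_coe.mpr h
    simp only [this]⟩

/-! ## Fields and states -/

variable {P : Params}

namespace EigenSystem

/-- The component of `Ψ_n` at a bulk position or on the boundary. -/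
def mode (S : EigenSystem P) : Option ℝ → ℕ → ℝ
  | some z, n => S.ψ n z
  | none, n => (S.basis n).snd.val.re

/-- The function of `A` that multiplies `Ψ_n` by `c n`. -/
def spectral (S : EigenSystem P) (c : ℕ → ℂ) (φ : HSpace P) : HSpace P :=
  ∑' n, (c n * ⟪S.basis n, φ⟫_ℂ) • S.basis n

/-- `√A`. -/
def sqrtA (S : EigenSystem P) (φ : HSpace P) : HSpace P := S.spectral (fun n => (S.ω n : ℂ)) φ

/-- The test function space `C_{0,R}(ℝ, D(√A))`, with the graph norm on `D(√A)`. -/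
def IsRegularTest (S : EigenSystem P) (f : ℝ → HSpace P) : Prop :=
  P.IsTest f ∧ (∀ t, Summable fun n => (S.ω n) ^ 2 * ‖⟪S.basis n, f t⟫_ℂ‖ ^ 2) ∧
    Continuous fun t => S.sqrtA (f t)

/-- `E(τ) = - sin(√A τ) / √A`. -/
def propagator (S : EigenSystem P) (τ : ℝ) (φ : HSpace P) : HSpace P :=
  S.spectral (fun n => ((-(Real.sin (S.ω n * τ) / S.ω n) : ℝ) : ℂ)) φ

/-- `(𝖤 f)(t) = ∫ E(t - t') f(t') dt'`. -/
def E (S : EigenSystem P) (f : ℝ → HSpace P) (t : ℝ) : HSpace P :=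
  ∫ t', S.propagator (t - t') (f t')

/-- The classical solution `φ_f = 𝖤 f` evaluated at a point, bulk or boundary component. -/
def phi (S : EigenSystem P) (f : ℝ → HSpace P) (x : Pt) : ℝ :=
  -∫ t', ∑' n, Real.sin (S.ω n * (x.1 - t')) / S.ω n *
    (S.mode x.2 n * (⟪S.basis n, f t'⟫_ℂ).re)

/-- The element `𝐅 ∫ e^{i√A t} A^{-1/4} f(t) dt` of `ℓ²(ℕ)`. -/
def oneParticle (S : EigenSystem P) (f : ℝ → HSpace P) : OneParticle :=
  S.basis.repr (∫ t, S.spectral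
    (fun n => Complex.exp (Complex.I * (S.ω n * t : ℝ)) / (Real.sqrt (S.ω n) : ℂ)) (f t))

/-- The smeared quantum field `Φ̂(f)`. -/
def field (S : EigenSystem P) (f : ℝ → HSpace P) : FockOp := segal (S.oneParticle f)

/-- The `N`-th partial sum
`∑_{n<N} (2ω_n)^{-1/2} (e^{-iω_n t} Ψ_n(z) a_n + e^{iω_n t} Ψ_n(z) a_n†)`
of the field at the point `x`. -/
def pointField (S : EigenSystem P) (N : ℕ) (x : Pt) : FockOp :=
  segal (∑ n ∈ Finset.range N, lp.single 2 n
    (Complex.exp (Complex.I * (S.ω n * x.1 : ℝ)) / (Real.sqrt (S.ω n) : ℂ) * (S.mode x.2 n : ℂ)))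

/-- The coherent state vector `F = e^{iΦ̂(f)} Ω_ℓ`. -/
def coherentVector (S : EigenSystem P) (f : ℝ → HSpace P) : Fock := expI (S.field f) vacuum

/-- Boltzmann factor `e^{-βE}` of the occupation number vector of `s`, `E = ∑_{n ∈ s} ω_n`. -/
def boltzmann (S : EigenSystem P) (β : ℝ) (s : Multiset ℕ) : ℝ :=
  Real.exp (-β * (s.map S.ω).sum)

/-- Expectation in the density matrix `e^{-βH}/Z`, with `H = dΓ(ω)`, conjugated by the
unitary `W`: `Z⁻¹ ∑_s e^{-βE_s} ⟨W e_s | T₁ ⋯ Tₙ W e_s⟩`. -/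
def thermalExp (S : EigenSystem P) (β : ℝ) (W : Fock ≃ₗᵢ[ℂ] Fock) : State := fun L v =>
  ∃ u : Multiset ℕ → ℂ, (∀ s, VecExp (W (occVec s)) L (u s)) ∧ Summable (S.boltzmann β) ∧
    HasSum (fun s => ((S.boltzmann β s / ∑' r, S.boltzmann β r : ℝ) : ℂ) * u s) v

/-- The ground state. -/
def ground (_S : EigenSystem P) : State := VecExp vacuum

/-- The coherent state `⟨F | · F⟩`. -/
def coherent (S : EigenSystem P) (f : ℝ → HSpace P) : State := VecExp (S.coherentVector f)

/-- The Gibbs state `⟨·⟩_β`. -/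
def gibbs (S : EigenSystem P) (β : ℝ) : State := S.thermalExp β (LinearIsometryEquiv.refl ℂ Fock)

/-- The thermal coherent state `⟨e^{-iΦ̂(f)} · e^{iΦ̂(f)}⟩_β`. -/
def thermalCoherent (S : EigenSystem P) (β : ℝ) (f : ℝ → HSpace P) : State :=
  S.thermalExp β (expI (S.field f))

/-- `η` is the ground state and `ηf` the coherent state of `f`, or, for some inverse temperature
`β > 0`, `η` is the Gibbs state and `ηf` the thermal coherent state of `f`. -/
def IsCoherentPair (S : EigenSystem P) (f : ℝ → HSpace P) (η ηf : State) : Prop :=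
  (η = S.ground ∧ ηf = S.coherent f) ∨
    ∃ β : ℝ, 0 < β ∧ η = S.gibbs β ∧ ηf = S.thermalCoherent β f

/-! ## Pointwise n-point functions and renormalized quantities -/

/-- The expectations of the products `ops N` are defined for every cutoff `N` and tend to `v`. -/
def HasLimitExp (η : State) (ops : ℕ → List FockOp) (v : ℂ) : Prop :=
  ∃ u : ℕ → ℂ, (∀ N, η (ops N) (u N)) ∧ Tendsto u atTop (𝓝 v)

/-- `η(Φ̂(x₁) ⋯ Φ̂(xₙ)) = v`, where `Φ̂(x)` is the series of mode operators. -/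
def HasNPoint (S : EigenSystem P) (η : State) (X : List Pt) (v : ℂ) : Prop :=
  HasLimitExp η (fun N => X.map (S.pointField N)) v

/-- `η((Φ̂(x₁) - g(x₁)) ⋯ (Φ̂(xₙ) - g(xₙ))) = v`. -/
def HasShiftedNPoint (S : EigenSystem P) (η : State) (g : Pt → ℝ) (X : List Pt) (v : ℂ) : Prop :=
  HasLimitExp η (fun N => X.map fun x => shift (S.pointField N x) (g x)) v

end EigenSystem

/-- The bulk point `(t, z)`. -/
def bulkPt (x : ℝ × ℝ) : Pt := (x.1, some x.2)

/-- The boundary point at time `t`. -/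
def bdryPt (t : ℝ) : Pt := (t, none)

/-- Half the squared geodesic distance: `2σ = -(t-t')² + (z-z')²`. -/
def sigma (x x' : ℝ × ℝ) : ℝ := (-(x.1 - x'.1) ^ 2 + (x.2 - x'.2) ^ 2) / 2

/-- The Hadamard parametrix of 1+1 Minkowski spacetime at spacelike separated points, up to its
`O(σ³ ln σ)` remainder, which does not contribute to any coincidence limit below. When `m = 0` the
mass scale in the logarithm is set to one. -/
def hadamard (m : ℝ) (x x' : ℝ × ℝ) : ℝ :=
  let s := sigma x x';
  let lg := Real.log ((if m = 0 then 1 else m ^ 2) / 2 * s);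
  let γ := Real.eulerMascheroniConstant;
  -(1 / (4 * Real.pi)) *
    (2 * γ + lg + m ^ 2 / 2 * s * (lg + 2 * γ - 2) + m ^ 4 / 16 * s ^ 2 * (lg + 2 * γ - 3))

/-- `∂_a ∂_b g = D` at `(a, b)`. -/
def HasMixedDerivAt (g : ℝ → ℝ → ℂ) (D : ℂ) (a b : ℝ) : Prop :=
  ∃ k : ℝ → ℂ, (∀ᶠ s in 𝓝 a, HasDerivAt (g s) (k s) b) ∧ HasDerivAt k D a

namespace EigenSystem

/-- `η((Φ̂^B_ren)²(x)) = L`: the limit, as `x' → x` through the spacelike separated points, of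
`η(Φ̂^B(x) Φ̂^B(x')) - H_M(x, x')`. -/
def HasBulkPolarization (S : EigenSystem P) (η : State) (x : ℝ × ℝ) (L : ℂ) : Prop :=
  ∃ G : ℝ × ℝ → ℂ,
    (∀ᶠ x' in 𝓝[{x' | 0 < sigma x x'}] x,
      S.HasNPoint η [bulkPt x, bulkPt x'] (G x' + (hadamard P.m x x' : ℂ))) ∧
    Tendsto G (𝓝[{x' | 0 < sigma x x'}] x) (𝓝 L)

/-- `η((Φ̂^∂_ren)²(t)) = L`: the coincidence limit of the boundary two-point function, which
needs no subtraction. -/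
def HasBdryPolarization (S : EigenSystem P) (η : State) (t : ℝ) (L : ℂ) : Prop :=
  ∃ G : ℝ → ℂ, (∀ᶠ t' in 𝓝[≠] t, S.HasNPoint η [bdryPt t, bdryPt t'] (G t')) ∧
    Tendsto G (𝓝[≠] t) (𝓝 L)

/-- `η(Ĥ^B_ren(x)) = L`: the limit, as `x' → x` through the spacelike separated points, of
`(1/2) (∂_t ∂_t' + ∂_z ∂_z' + m²) (η(Φ̂^B(x) Φ̂^B(x')) - H_M(x, x'))`. -/
def HasBulkEnergy (S : EigenSystem P) (η : State) (x : ℝ × ℝ) (L : ℂ) : Prop :=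
  ∃ (G : ℝ × ℝ → ℝ × ℝ → ℂ) (Dt Dz : ℝ × ℝ → ℂ),
    (∀ᶠ p in 𝓝[{p : (ℝ × ℝ) × (ℝ × ℝ) | 0 < sigma p.1 p.2}] (x, x),
      S.HasNPoint η [bulkPt p.1, bulkPt p.2] (G p.1 p.2 + (hadamard P.m p.1 p.2 : ℂ))) ∧
    (∀ᶠ x' in 𝓝[{x' | 0 < sigma x x'}] x,
      HasMixedDerivAt (fun s s' => G (s, x.2) (s', x'.2)) (Dt x') x.1 x'.1 ∧
      HasMixedDerivAt (fun y y' => G (x.1, y) (x'.1, y')) (Dz x') x.2 x'.2) ∧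
    Tendsto (fun x' => (1 / 2 : ℂ) * (Dt x' + Dz x' + (P.m : ℂ) ^ 2 * G x x'))
      (𝓝[{x' | 0 < sigma x x'}] x) (𝓝 L)

/-- `η(Ĥ^∂_ren(t)) = L`: the limit, as `t' → t`, of
`(1/2) (|β₁'| ∂_t ∂_t' - sign(β₁') β₁) η(Φ̂^∂(t) Φ̂^∂(t'))`. -/
def HasBdryEnergy (S : EigenSystem P) (η : State) (t : ℝ) (L : ℂ) : Prop :=
  ∃ (G : ℝ → ℝ → ℂ) (Dt : ℝ → ℂ),
    (∀ᶠ p in 𝓝[{p : ℝ × ℝ | p.1 ≠ p.2}] (t, t),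
      S.HasNPoint η [bdryPt p.1, bdryPt p.2] (G p.1 p.2)) ∧
    (∀ᶠ t' in 𝓝[≠] t, HasMixedDerivAt G (Dt t') t t') ∧
    Tendsto (fun t' => (1 / 2 : ℂ) * ((|P.b₁'| : ℝ) * Dt t' -
      ((Real.sign P.b₁' * P.b₁ : ℝ) : ℂ) * G t t')) (𝓝[≠] t) (𝓝 L)

/-- Classical bulk energy density
`(1/2) ((∂_t φ₁)² + (∂_z φ₁)² + m² φ₁²)` of `φ = φ_f`. -/
def classicalBulkEnergy (S : EigenSystem P) (f : ℝ → HSpace P) (x : ℝ × ℝ) : ℝ :=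
  1 / 2 * (deriv (fun s => S.phi f (bulkPt (s, x.2))) x.1 ^ 2 +
    deriv (fun y => S.phi f (bulkPt (x.1, y))) x.2 ^ 2 + P.m ^ 2 * S.phi f (bulkPt x) ^ 2)

/-- Classical boundary energy `(1/2) (|β₁'| (∂_t φ₂)² - sign(β₁') β₁ φ₂²)` of `φ = φ_f`. -/
def classicalBdryEnergy (S : EigenSystem P) (f : ℝ → HSpace P) (t : ℝ) : ℝ :=
  1 / 2 * (|P.b₁'| * deriv (fun s => S.phi f (bdryPt s)) t ^ 2 -
    Real.sign P.b₁' * P.b₁ * S.phi f (bdryPt t) ^ 2)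

end EigenSystem

end CoherentCasimir

end

open MeasureTheory Filter Topology Set
open scoped InnerProductSpace

noncomputable section

namespace CoherentCasimir

/-! ## Sums over words with a marked letter -/

/-! Everything rests on one identity. For W = e^{iΦ(a)} the canonical commutation relations give W*
Φ(b) W = Φ(b) − Im⟨b, a⟩, an equality of unbounded operators, domains included (`mem_graph_expI`).
Expectations of fields in the coherent state are therefore expectations of shifted fields in the
original state. When a and b come from test functions f and g, a mode-by-mode computation identifies
Im⟨b, a⟩ with the pairing ∫(φ_f, g) (`integral_E_inner`). When b is a partial sum of the field at x,
the shift is the matching partial sum of φ_f(x) (`inner_pointVector`).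

The Weyl operators exist because finite particle vectors are entire vectors for the Segal operators:
one application of a field to k particles costs a factor of order √k, which n! beats. A symmetric
operator with a dense invariant domain of entire vectors has a closure generating a unitary group
(`EntireVectors.exists_group`), and the group conjugates other fields by summing commutators
(`EntireVectors.conj_mem`).

The vacuum and the Gibbs states enter only through a moment functional on lists of pairs (vector,
shift) (`IsMomentFunctional`). It is bounded by the product of the sizes of the pairs, changes
linearly when one shift is changed, equals one on the empty list, and vanishes on a single unshifted
field. For Gibbs states this requires Tr e^{-βH} < ∞ and absorption of polynomials in the particle
number, hence a lower bound on the growth of ω_n.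

The spectral input comes from ordinary differential equations. Positivity makes a shooting problem
solvable, so A has a bounded inverse; sampling the solution shows that the inverse is compact, and
the spectral theorem yields the eigenfunctions. Bessel's inequality for point evaluations bounds ∑
ω_n⁻⁴. At high frequency the eigenfunctions are trigonometric, and two of them with frequencies
closer than 1/ℓ could not be orthogonal. This gives ω_n ≥ c(n+1), together with uniform bounds on
the eigenfunctions and on their derivatives divided by ω_n.

At points the n-point functions are only limits of partial sums, and those limits need not exist, so
the two sides are compared through their difference. The vectors defining the partial fields have
norm O(log N), so the moments grow at most like a power of log N. The partial sums of φ_f converge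
faster than any power of log N decays, because their coefficients are an ℓ² sequence divided by ω_n.
Hence the difference tends to zero (`IsCoherentPair.hasNPoint_iff`). For two points the difference
between coherent and original state is the exact product of partial sums, with limit φ_f(x)φ_f(x').

The renormalized quantities follow: the Hadamard term is the same for both states and drops out,
leaving the coincidence limit of φ_f(x)φ_f(x') or of its derivatives. Continuity of φ_f suffices for
polarizations. For energies, regularity of f gains a factor ω_n⁻¹, which allows φ_f to be
differentiated term by term. -/

/-- A word with a marked position is the same as a letter, the remaining word, and the position at
which the letter has to be inserted. -/
def markedWordEquiv :
    (Σ l : List ℕ, Fin l.length) ≃ (Σ p : ℕ × List ℕ, Fin (p.2.length + 1)) where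
  toFun x := ⟨(x.1.get x.2, x.1.eraseIdx x.2),
    ⟨x.2, by have h := x.2.2; rw [List.length_eraseIdx_of_lt h]; omega⟩⟩
  invFun y := ⟨y.1.2.insertIdx y.2 y.1.1,
    ⟨y.2, by rw [List.length_insertIdx_of_le_length (Nat.lt_succ_iff.mp y.2.2)]; exact y.2.2⟩⟩
  left_inv x := by
    obtain ⟨l, i⟩ := x
    have h : (l.eraseIdx i).insertIdx i (l.get i) = l := List.insertIdx_eraseIdx_getElem i.2
    refine Sigma.ext h ?_
    rw [Fin.heq_ext_iff (by simp only [h])]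
  right_inv y := by
    obtain ⟨⟨j, l⟩, i⟩ := y
    have h : ((l.insertIdx i j).get ⟨i, by
        rw [List.length_insertIdx_of_le_length (Nat.lt_succ_iff.mp i.2)]; exact i.2⟩,
        (l.insertIdx i j).eraseIdx i) = (j, l) := by
      refine Prod.ext ?_ ?_
      · simp
      · simp
    refine Sigma.ext h ?_
    rw [Fin.heq_ext_iff (by simp)]

/-- Double counting: a letter j can be inserted into a word l at `l.length + 1` positions, so each
pair (j, l) occurs that often. This turns sums produced by creation operators into sums over pairs.
-/
theorem hasSum_markedWord {h : ℕ → List ℕ → ℂ}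
    (hs : Summable fun p : ℕ × List ℕ => ((p.2.length : ℝ) + 1) * ‖h p.1 p.2‖) :
    HasSum (fun l : List ℕ => ∑ i : Fin l.length, h (l.get i) (l.eraseIdx i))
      (∑' p : ℕ × List ℕ, ((p.2.length : ℂ) + 1) * h p.1 p.2) := by
  have hsum : Summable fun y : (Σ p : ℕ × List ℕ, Fin (p.2.length + 1)) => h y.1.1 y.1.2 := by
    refine Summable.of_norm ?_
    refine (summable_sigma_of_nonneg fun _ => norm_nonneg _).mpr
      ⟨fun p => (hasSum_fintype _).summable, ?_⟩
    refine hs.congr fun p => ?_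
    simp [tsum_fintype]
  have h1 : HasSum (fun y : (Σ p : ℕ × List ℕ, Fin (p.2.length + 1)) => h y.1.1 y.1.2)
      (∑' p : ℕ × List ℕ, ((p.2.length : ℂ) + 1) * h p.1 p.2) := by
    have h2 := hsum.hasSum.sigma (fun p => hasSum_fintype _)
    have h3 : (fun p : ℕ × List ℕ => ∑ _i : Fin (p.2.length + 1), h p.1 p.2) =
        fun p : ℕ × List ℕ => ((p.2.length : ℂ) + 1) * h p.1 p.2 := by
      funext p; simp
    rw [h3] at h2
    rw [h2.tsum_eq]
    exact hsum.hasSum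
  have h4 := (markedWordEquiv.hasSum_iff).mpr h1
  exact h4.sigma (fun l => hasSum_fintype _)

theorem hasSum_markedWord_real {h : ℕ → List ℕ → ℝ}
    (hs : Summable fun p : ℕ × List ℕ => ((p.2.length : ℝ) + 1) * ‖h p.1 p.2‖) :
    HasSum (fun l : List ℕ => ∑ i : Fin l.length, h (l.get i) (l.eraseIdx i))
      (∑' p : ℕ × List ℕ, ((p.2.length : ℝ) + 1) * h p.1 p.2) := by
  have h1 := hasSum_markedWord (h := fun j l => (h j l : ℂ)) (by simpa using hs)
  have := Complex.hasSum_re h1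
  simp only [← Complex.ofReal_sum, Complex.ofReal_re] at this
  convert this using 1
  rw [← Complex.ofReal_re (∑' p : ℕ × List ℕ, ((p.2.length : ℝ) + 1) * h p.1 p.2)]
  push_cast
  rfl

/-! ## Amplitudes of Fock vectors -/

theorem amp_perm (x : Fock) {l l' : List ℕ} (h : l.Perm l') : amp x l = amp x l' := x.2 l l' h

@[simp] theorem amp_add (x y : Fock) (l : List ℕ) : amp (x + y) l = amp x l + amp y l := rfl
@[simp] theorem amp_smul (c : ℂ) (x : Fock) (l : List ℕ) : amp (c • x) l = c * amp x l := rfl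

theorem amp_ext {x y : Fock} (h : ∀ l, amp x l = amp y l) : x = y :=
  Subtype.ext (lp.ext (funext h))

theorem summable_lp_sq {ι : Type*} (a : lp (fun _ : ι => ℂ) 2) : Summable fun i => ‖a i‖ ^ 2 := by
  have h := (lp.memℓp a).summable (by norm_num)
  simpa using h

theorem lp_norm_sq {ι : Type*} (a : lp (fun _ : ι => ℂ) 2) : ‖a‖ ^ 2 = ∑' i, ‖a i‖ ^ 2 := by
  have h := lp.norm_rpow_eq_tsum (p := 2) (by norm_num) a
  simpa using h

theorem exists_lp_of_summable {ι : Type*} {F : ι → ℂ} (h : Summable fun i => ‖F i‖ ^ 2) :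
    ∃ a : lp (fun _ : ι => ℂ) 2, ∀ i, a i = F i :=
  ⟨⟨F, memℓp_gen (by simpa using h)⟩, fun _ => rfl⟩

theorem summable_amp_sq (x : Fock) : Summable fun l => ‖amp x l‖ ^ 2 :=
  summable_lp_sq (x : WordSpace)

theorem fock_norm_sq (x : Fock) : ‖x‖ ^ 2 = ∑' l, ‖amp x l‖ ^ 2 := lp_norm_sq (x : WordSpace)

/-- The inner product of the Hilbert space structure, preferred to the one obtained from `ℂ` as a
C⋆-algebra. -/
local instance (priority := high) innerOfInnerProductSpace {H : Type*} [NormedAddCommGroup H]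
    [InnerProductSpace ℂ H] : Inner ℂ H := InnerProductSpace.toInner

theorem fock_inner (x y : Fock) : ⟪x, y⟫_ℂ = ∑' l, starRingEnd ℂ (amp x l) * amp y l := by
  have h := lp.inner_eq_tsum (𝕜 := ℂ) (x : WordSpace) (y : WordSpace)
  rw [Submodule.coe_inner, h]
  refine tsum_congr fun l => ?_
  rw [RCLike.inner_apply, mul_comm]; rfl

theorem exists_fock {F : List ℕ → ℂ} (hF : ∀ l l' : List ℕ, l.Perm l' → F l = F l')
    (hs : Summable fun l => ‖F l‖ ^ 2) : ∃ y : Fock, ∀ l, amp y l = F l := by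
  obtain ⟨a, ha⟩ := exists_lp_of_summable hs
  exact ⟨⟨a, fun l l' h => by rw [ha, ha, hF l l' h]⟩, ha⟩

theorem summable_mul_of_sq {ι : Type*} {f g : ι → ℂ} (hf : Summable fun i => ‖f i‖ ^ 2)
    (hg : Summable fun i => ‖g i‖ ^ 2) : Summable fun i => ‖f i‖ * ‖g i‖ := by
  refine Summable.of_nonneg_of_le (fun i => by positivity) (fun i => ?_) (hf.add hg)
  nlinarith [sq_nonneg (‖f i‖ - ‖g i‖), sq_nonneg ‖f i‖, sq_nonneg ‖g i‖]

theorem norm_sq_tsum_mul_le {ι : Type*} (a : lp (fun _ : ι => ℂ) 2) {g : ι → ℂ}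
    (hg : Summable fun i => ‖g i‖ ^ 2) :
    ‖∑' i, starRingEnd ℂ (a i) * g i‖ ^ 2 ≤ ‖a‖ ^ 2 * ∑' i, ‖g i‖ ^ 2 := by
  obtain ⟨b, hb⟩ := exists_lp_of_summable hg
  have h1 : ∑' i, starRingEnd ℂ (a i) * g i = ⟪a, b⟫_ℂ := by
    rw [lp.inner_eq_tsum]
    refine tsum_congr fun l => ?_
    rw [RCLike.inner_apply, mul_comm, hb]
  have h2 : ∑' i, ‖g i‖ ^ 2 = ‖b‖ ^ 2 := by rw [lp_norm_sq]; simp only [hb]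
  rw [h1, h2, ← mul_pow]
  exact pow_le_pow_left₀ (norm_nonneg _) (norm_inner_le_norm a b) 2

theorem cons_injective : Function.Injective fun p : ℕ × List ℕ => p.1 :: p.2 := fun _ _ h =>
  Prod.ext (List.cons.inj h).1 (List.cons.inj h).2

theorem summable_swap {α β E : Type*} [AddCommMonoid E] [TopologicalSpace E] {f : α × β → E}
    (h : Summable f) : Summable fun q : β × α => f q.swap :=
  (Equiv.prodComm β α).summable_iff.mpr h

theorem summable_amp_cons (x : Fock) : Summable fun p : ℕ × List ℕ => ‖amp x (p.1 :: p.2)‖ ^ 2 :=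
  (summable_amp_sq x).comp_injective cons_injective

theorem tsum_amp_cons_le (x : Fock) : ∑' p : ℕ × List ℕ, ‖amp x (p.1 :: p.2)‖ ^ 2 ≤ ‖x‖ ^ 2 := by
  rw [fock_norm_sq]
  exact tsum_comp_le_tsum_of_inj (summable_amp_sq x) (fun _ => by positivity) cons_injective

/-- The Fock vectors with at most `k` particles. -/
def degLE (k : ℕ) : Submodule ℂ Fock where
  carrier := {x | ∀ l : List ℕ, k < l.length → amp x l = 0}
  add_mem' := fun {x y} hx hy l hl => by rw [amp_add, hx l hl, hy l hl, add_zero]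
  zero_mem' := fun _ _ => rfl
  smul_mem' := fun c x hx l hl => by rw [amp_smul, hx l hl, mul_zero]

theorem degLE_mono {k k' : ℕ} (h : k ≤ k') : degLE k ≤ degLE k' := fun _ hx l hl =>
  hx l (h.trans_lt hl)

/-! ## Annihilation and creation operators on finite particle vectors -/

theorem annih_perm (a : OneParticle) (x : Fock) {l l' : List ℕ} (h : l.Perm l') :
    annih a x l = annih a x l' := by
  unfold annih
  rw [h.length_eq]
  congr 1
  exact tsum_congr fun j => by rw [amp_perm x (h.cons j)]

/-- Erasing position i and erasing the first occurrence of the letter found there give words that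
are permutations of each other. The sum over positions is thus a sum over letters, which only sees
the multiset. -/
theorem creat_perm (a : OneParticle) (x : Fock) {l l' : List ℕ} (h : l.Perm l') :
    creat a x l = creat a x l' := by
  classical
  have key : ∀ l : List ℕ, ∑ i : Fin l.length, a (l.get i) * amp x (l.eraseIdx i) =
      (l.map fun j => a j * amp x (l.erase j)).sum := by
    intro l
    rw [← Fin.sum_univ_fun_getElem]
    refine Finset.sum_congr rfl fun i _ => ?_
    have h1 : (l.eraseIdx i).Perm (l.erase l[i]) := by
      have h2 := List.getElem_cons_eraseIdx_perm i.2
      have h3 := List.perm_cons_erase (List.getElem_mem i.2)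
      exact (List.perm_cons _).mp (h2.trans h3)
    rw [amp_perm x h1]; rfl
  unfold creat
  rw [key, key, h.length_eq]
  congr 1
  have h5 : (fun j => a j * amp x (l.erase j)) = fun j => a j * amp x (l'.erase j) := by
    funext j; rw [amp_perm x (h.erase j)]
  rw [h5]
  exact (h.map _).sum_eq

/-- Cauchy–Schwarz in the contracted letter, followed by summation over the remaining word. The
prefactor `l.length + 1` is at most k wherever the amplitudes do not vanish. -/
theorem summable_annih_sq (a : OneParticle) {k : ℕ} {x : Fock} (hx : x ∈ degLE k) :
    (Summable fun l => ‖annih a x l‖ ^ 2) ∧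
      ∑' l, ‖annih a x l‖ ^ 2 ≤ k * ‖a‖ ^ 2 * ‖x‖ ^ 2 := by
  have hc := summable_amp_cons x
  have hc' := summable_swap hc
  simp only [Prod.fst_swap, Prod.snd_swap] at hc'
  have hrow : ∀ l : List ℕ, Summable fun j : ℕ => ‖amp x (j :: l)‖ ^ 2 := fun l =>
    hc'.prod_factor l
  have hb : ∀ l, ‖annih a x l‖ ^ 2 ≤
      k * ‖a‖ ^ 2 * ∑' j : ℕ, ‖amp x (j :: l)‖ ^ 2 := by
    intro l
    by_cases hl : k < l.length + 1
    · have : annih a x l = 0 := by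
        unfold annih
        simp [fun j : ℕ => hx (j :: l) (by simpa using hl)]
      rw [this]
      simp only [norm_zero, ne_eq, OfNat.ofNat_ne_zero, not_false_eq_true, zero_pow]
      exact mul_nonneg (by positivity) (tsum_nonneg fun _ => by positivity)
    · unfold annih
      rw [norm_mul, mul_pow, Complex.norm_real, Real.norm_eq_abs, sq_abs,
        Real.sq_sqrt (by positivity), mul_assoc]
      refine mul_le_mul ?_ (norm_sq_tsum_mul_le a (hrow l)) (by positivity) (by positivity)
      have : l.length + 1 ≤ k := not_lt.mp hl
      exact_mod_cast this
  have hs : Summable fun l : List ℕ => ∑' j : ℕ, ‖amp x (j :: l)‖ ^ 2 := hc'.prod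
  have hs' := hs.mul_left (k * ‖a‖ ^ 2)
  have h1 : Summable fun l => ‖annih a x l‖ ^ 2 :=
    Summable.of_nonneg_of_le (fun l => sq_nonneg (‖annih a x l‖)) hb hs'
  have h2 : ∑' l, ‖annih a x l‖ ^ 2 ≤ ∑' l, k * ‖a‖ ^ 2 * ∑' j : ℕ, ‖amp x (j :: l)‖ ^ 2 :=
    h1.tsum_le_tsum hb hs'
  have h3 : ∑' l : List ℕ, ∑' j : ℕ, ‖amp x (j :: l)‖ ^ 2 ≤ ‖x‖ ^ 2 := by
    have h6 := hc'.tsum_prod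
    rw [← h6]
    have h4 := (Equiv.prodComm (List ℕ) ℕ).tsum_eq (fun p : ℕ × List ℕ => ‖amp x (p.1 :: p.2)‖ ^ 2)
    have h5 := tsum_amp_cons_le x
    rw [← h4] at h5
    exact h5
  rw [tsum_mul_left] at h2
  exact ⟨h1, h2.trans (mul_le_mul_of_nonneg_left h3 (by positivity))⟩

/-- Cauchy–Schwarz over the positions costs a factor `l.length`, which the normalization of `creat`
cancels. The marked-word count then gives `length + 1`, at most k + 1 on the support of x. -/
theorem summable_creat_sq (a : OneParticle) {k : ℕ} {x : Fock} (hx : x ∈ degLE k) :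
    (Summable fun l => ‖creat a x l‖ ^ 2) ∧
      ∑' l, ‖creat a x l‖ ^ 2 ≤ (k + 1) * ‖a‖ ^ 2 * ‖x‖ ^ 2 := by
  have ha := summable_lp_sq a
  have hxs := summable_amp_sq x
  have hprod := ha.mul_of_nonneg hxs (fun j => sq_nonneg ‖a j‖) (fun l => sq_nonneg ‖amp x l‖)
  have hle : ∀ p : ℕ × List ℕ, ((p.2.length : ℝ) + 1) * (‖a p.1‖ ^ 2 * ‖amp x p.2‖ ^ 2) ≤
      (k + 1) * (‖a p.1‖ ^ 2 * ‖amp x p.2‖ ^ 2) := by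
    intro p
    by_cases hp : k < p.2.length
    · simp [hx p.2 hp]
    · have : (p.2.length : ℝ) ≤ k := by exact_mod_cast not_lt.mp hp
      gcongr
  have hs1 : Summable fun p : ℕ × List ℕ =>
      ((p.2.length : ℝ) + 1) * (‖a p.1‖ ^ 2 * ‖amp x p.2‖ ^ 2) :=
    Summable.of_nonneg_of_le (fun _ => by positivity) hle (hprod.mul_left _)
  have hm := hasSum_markedWord_real (h := fun j l => ‖a j‖ ^ 2 * ‖amp x l‖ ^ 2) (by
    refine hs1.congr fun p => ?_
    rw [Real.norm_of_nonneg (by positivity)])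
  have hb : ∀ l, ‖creat a x l‖ ^ 2 ≤
      ∑ i : Fin l.length, ‖a (l.get i)‖ ^ 2 * ‖amp x (l.eraseIdx i)‖ ^ 2 := by
    intro l
    unfold creat
    rcases Nat.eq_zero_or_pos l.length with h0 | h0
    · have : l = [] := List.length_eq_zero_iff.mp h0
      subst this; simp
    · have h0' : (0 : ℝ) < l.length := by exact_mod_cast h0
      rw [norm_mul, mul_pow, norm_inv, Complex.norm_real, Real.norm_eq_abs, inv_pow, sq_abs,
        Real.sq_sqrt h0'.le, inv_mul_le_iff₀ h0']
      have h1 : ‖∑ i : Fin l.length, a (l.get i) * amp x (l.eraseIdx i)‖ ≤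
          ∑ i : Fin l.length, ‖a (l.get i) * amp x (l.eraseIdx i)‖ := norm_sum_le _ _
      refine (pow_le_pow_left₀ (norm_nonneg _) h1 2).trans ?_
      have h2 := sq_sum_le_card_mul_sum_sq (s := (Finset.univ : Finset (Fin l.length)))
        (f := fun i => ‖a (l.get i) * amp x (l.eraseIdx i)‖)
      simpa [mul_pow] using h2
  refine ⟨Summable.of_nonneg_of_le (fun _ => by positivity) hb hm.summable, ?_⟩
  refine (Summable.tsum_le_tsum hb (Summable.of_nonneg_of_le (fun _ => by positivity) hb
    hm.summable) hm.summable).trans ?_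
  rw [hm.tsum_eq]
  refine (Summable.tsum_le_tsum hle hs1 (hprod.mul_left _)).trans ?_
  rw [tsum_mul_left, mul_assoc, lp_norm_sq a, fock_norm_sq x]
  refine mul_le_mul_of_nonneg_left (le_of_eq ?_) (by positivity)
  rw [ha.tsum_mul_tsum hxs hprod]

theorem norm_le_of_amp {x y : Fock} {F : List ℕ → ℂ} {C : ℝ} (hC : 0 ≤ C)
    (hy : ∀ l, amp y l = F l) (h : ∑' l, ‖F l‖ ^ 2 ≤ C ^ 2 * ‖x‖ ^ 2) : ‖y‖ ≤ C * ‖x‖ := by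
  refine le_of_sq_le_sq ?_ (by positivity)
  rw [fock_norm_sq, mul_pow]
  simpa only [hy] using h

theorem exists_annih (a : OneParticle) {k : ℕ} {x : Fock} (hx : x ∈ degLE k) :
    ∃ y : Fock, (∀ l, amp y l = annih a x l) ∧ y ∈ degLE (k + 1) ∧
      ‖y‖ ≤ Real.sqrt (k + 1) * ‖a‖ * ‖x‖ := by
  obtain ⟨h1, h2⟩ := summable_annih_sq a hx
  obtain ⟨y, hy⟩ := exists_fock (fun l l' h => annih_perm a x h) h1
  refine ⟨y, hy, fun l hl => ?_, norm_le_of_amp (by positivity) hy (h2.trans ?_)⟩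
  · rw [hy]; unfold annih
    simp [fun j : ℕ => hx (j :: l) (by rw [List.length_cons]; omega)]
  · rw [mul_pow, Real.sq_sqrt (by positivity)]; gcongr; linarith

theorem exists_creat (a : OneParticle) {k : ℕ} {x : Fock} (hx : x ∈ degLE k) :
    ∃ y : Fock, (∀ l, amp y l = creat a x l) ∧ y ∈ degLE (k + 1) ∧
      ‖y‖ ≤ Real.sqrt (k + 1) * ‖a‖ * ‖x‖ := by
  obtain ⟨h1, h2⟩ := summable_creat_sq a hx
  obtain ⟨y, hy⟩ := exists_fock (fun l l' h => creat_perm a x h) h1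
  refine ⟨y, hy, fun l hl => ?_, norm_le_of_amp (by positivity) hy (h2.trans ?_)⟩
  · rw [hy]; unfold creat
    rw [Finset.sum_eq_zero, mul_zero]
    intro i _
    rw [hx _ (by rw [List.length_eraseIdx_of_lt i.2]; omega), mul_zero]
  · rw [mul_pow, Real.sq_sqrt (by positivity)]

/-- The finite particle vectors. -/
def finiteParticle : Submodule ℂ Fock where
  carrier := {x | ∃ k, x ∈ degLE k}
  add_mem' := by
    rintro x y ⟨k, hx⟩ ⟨k', hy⟩
    exact ⟨max k k', add_mem (degLE_mono (le_max_left _ _) hx) (degLE_mono (le_max_right _ _) hy)⟩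
  zero_mem' := ⟨0, zero_mem _⟩
  smul_mem' := by
    rintro c x ⟨k, hx⟩
    exact ⟨k, Submodule.smul_mem _ c hx⟩

theorem annih_add (a : OneParticle) (x y : Fock) (l : List ℕ) :
    annih a (x + y) l = annih a x l + annih a y l := by
  unfold annih
  rw [← mul_add, ← (summable_annih a x l).tsum_add (summable_annih a y l)]
  simp only [amp_add, mul_add]

theorem annih_smul (a : OneParticle) (c : ℂ) (x : Fock) (l : List ℕ) :
    annih a (c • x) l = c * annih a x l := by
  unfold annih
  simp only [amp_smul, mul_left_comm _ c, tsum_mul_left]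

theorem creat_add (a : OneParticle) (x y : Fock) (l : List ℕ) :
    creat a (x + y) l = creat a x l + creat a y l := by
  unfold creat
  rw [← mul_add, ← Finset.sum_add_distrib]
  simp only [amp_add, mul_add]

theorem creat_smul (a : OneParticle) (c : ℂ) (x : Fock) (l : List ℕ) :
    creat a (c • x) l = c * creat a x l := by
  unfold creat
  simp only [amp_smul, mul_left_comm _ c, ← Finset.mul_sum]

/-- The annihilation operator on finite particle vectors. -/
def annihOp (a : OneParticle) : finiteParticle →ₗ[ℂ] finiteParticle where
  -- The particle bound picked by choice is immaterial: the amplitudes of the result are those of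
  -- `annih a x` whatever the bound. This is what makes the map linear.
  toFun x := ⟨(exists_annih a x.2.choose_spec).choose,
    _, (exists_annih a x.2.choose_spec).choose_spec.2.1⟩
  map_add' x y := Subtype.ext <| amp_ext fun l => by
    simp only [Submodule.coe_add, amp_add]
    rw [(exists_annih a (x + y).2.choose_spec).choose_spec.1,
      (exists_annih a x.2.choose_spec).choose_spec.1, (exists_annih a y.2.choose_spec).choose_spec.1]
    exact annih_add a x y l
  map_smul' c x := Subtype.ext <| amp_ext fun l => by
    simp only [Submodule.coe_smul, amp_smul, RingHom.id_apply]
    rw [(exists_annih a (c • x).2.choose_spec).choose_spec.1,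
      (exists_annih a x.2.choose_spec).choose_spec.1]
    exact annih_smul a c x l

/-- The creation operator on finite particle vectors. -/
def creatOp (a : OneParticle) : finiteParticle →ₗ[ℂ] finiteParticle where
  toFun x := ⟨(exists_creat a x.2.choose_spec).choose,
    _, (exists_creat a x.2.choose_spec).choose_spec.2.1⟩
  map_add' x y := Subtype.ext <| amp_ext fun l => by
    simp only [Submodule.coe_add, amp_add]
    rw [(exists_creat a (x + y).2.choose_spec).choose_spec.1,
      (exists_creat a x.2.choose_spec).choose_spec.1, (exists_creat a y.2.choose_spec).choose_spec.1]
    exact creat_add a x y l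
  map_smul' c x := Subtype.ext <| amp_ext fun l => by
    simp only [Submodule.coe_smul, amp_smul, RingHom.id_apply]
    rw [(exists_creat a (c • x).2.choose_spec).choose_spec.1,
      (exists_creat a x.2.choose_spec).choose_spec.1]
    exact creat_smul a c x l

@[simp] theorem amp_annihOp (a : OneParticle) (x : finiteParticle) (l : List ℕ) :
    amp (annihOp a x) l = annih a x l := (exists_annih a x.2.choose_spec).choose_spec.1 l

@[simp] theorem amp_creatOp (a : OneParticle) (x : finiteParticle) (l : List ℕ) :
    amp (creatOp a x) l = creat a x l := (exists_creat a x.2.choose_spec).choose_spec.1 l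

theorem annihOp_degLE (a : OneParticle) {k : ℕ} {x : finiteParticle} (hx : (x : Fock) ∈ degLE k) :
    (annihOp a x : Fock) ∈ degLE (k + 1) ∧
      ‖(annihOp a x : Fock)‖ ≤ Real.sqrt (k + 1) * ‖a‖ * ‖(x : Fock)‖ := by
  obtain ⟨y, hy, h⟩ := exists_annih a hx
  rwa [show (annihOp a x : Fock) = y from amp_ext fun l => by rw [amp_annihOp, hy]]

theorem creatOp_degLE (a : OneParticle) {k : ℕ} {x : finiteParticle} (hx : (x : Fock) ∈ degLE k) :
    (creatOp a x : Fock) ∈ degLE (k + 1) ∧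
      ‖(creatOp a x : Fock)‖ ≤ Real.sqrt (k + 1) * ‖a‖ * ‖(x : Fock)‖ := by
  obtain ⟨y, hy, h⟩ := exists_creat a hx
  rwa [show (creatOp a x : Fock) = y from amp_ext fun l => by rw [amp_creatOp, hy]]

/-- The creation operator is the formal adjoint of the annihilation operator. -/
theorem inner_creatOp (a : OneParticle) (x y : finiteParticle) :
    ⟪(y : Fock), creatOp a x⟫_ℂ = ⟪(annihOp a y : Fock), x⟫_ℂ := by
  obtain ⟨k, hk⟩ := x.2
  -- The inverse square root is the normalization of `creat` on a word with one more letter.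
  -- Multiplied by the `length + 1` positions of the marked letter, it becomes the square root in
  -- `annih`.
  set h : ℕ → List ℕ → ℂ := fun j l =>
    ((Real.sqrt (l.length + 1) : ℝ) : ℂ)⁻¹ * starRingEnd ℂ (amp y (j :: l)) * a j * amp x l
    with hdef
  have hax : Summable fun p : ℕ × List ℕ => ‖a p.1 * amp x p.2‖ ^ 2 := by
    simp only [norm_mul, mul_pow]
    have h := (summable_lp_sq a).mul_of_nonneg (summable_amp_sq x) (fun j => sq_nonneg ‖a j‖)
      (fun l => sq_nonneg ‖amp x l‖)
    exact h
  have hprod := (summable_mul_of_sq (summable_amp_cons y) hax)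
  have hnorm : ∀ p : ℕ × List ℕ, ((p.2.length : ℝ) + 1) * ‖h p.1 p.2‖ =
      Real.sqrt (p.2.length + 1) * (‖amp y (p.1 :: p.2)‖ * ‖a p.1 * amp x p.2‖) := by
    intro p
    simp only [hdef, norm_mul, norm_inv, RCLike.norm_conj]
    rw [Complex.norm_real, Real.norm_of_nonneg (Real.sqrt_nonneg _)]
    have h0 : (0 : ℝ) < Real.sqrt (p.2.length + 1) := Real.sqrt_pos.mpr (by positivity)
    have h1 : ((p.2.length : ℝ) + 1) = Real.sqrt (p.2.length + 1) ^ 2 :=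
      (Real.sq_sqrt (by positivity)).symm
    field_simp
    rw [← h1]
  have hs : Summable fun p : ℕ × List ℕ => ((p.2.length : ℝ) + 1) * ‖h p.1 p.2‖ := by
    simp only [hnorm]
    refine Summable.of_nonneg_of_le (fun _ => by positivity) (fun p => ?_)
      (hprod.mul_left (Real.sqrt (k + 1)))
    by_cases hp : k < p.2.length
    · simp [hk p.2 hp]
    · have : (p.2.length : ℝ) ≤ k := by exact_mod_cast not_lt.mp hp
      gcongr
  have hm := hasSum_markedWord hs
  have hL : ⟪(y : Fock), creatOp a x⟫_ℂ =
      ∑' l : List ℕ, ∑ i : Fin l.length, h (l.get i) (l.eraseIdx i) := by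
    rw [fock_inner]
    refine tsum_congr fun l => ?_
    rw [amp_creatOp, creat, ← mul_assoc, Finset.mul_sum]
    refine Finset.sum_congr rfl fun i _ => ?_
    have h1 : amp y (l.get i :: l.eraseIdx i) = amp y l :=
      amp_perm y (List.getElem_cons_eraseIdx_perm i.2)
    have h2 : ((l.eraseIdx i).length : ℝ) + 1 = l.length := by
      have := i.2
      rw [List.length_eraseIdx_of_lt i.2]
      have h3 : l.length - 1 + 1 = l.length := by omega
      exact_mod_cast h3
    simp only [hdef]
    rw [h1, h2]
    ring
  rw [hL, hm.tsum_eq, fock_inner]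
  have hs' : Summable fun p : ℕ × List ℕ => ((p.2.length : ℂ) + 1) * h p.1 p.2 := by
    have h0 : ∀ n : ℕ, ‖(n : ℂ) + 1‖ = (n : ℝ) + 1 := fun n => by
      rw [← Nat.cast_succ, Complex.norm_natCast]; simp
    refine Summable.of_norm (hs.congr fun p => ?_)
    exact ((norm_mul _ _).trans (by rw [h0])).symm
  have hs2 := summable_swap hs'
  simp only [Prod.fst_swap, Prod.snd_swap] at hs2
  have hswap := (Equiv.prodComm (List ℕ) ℕ).tsum_eq
    (fun p : ℕ × List ℕ => ((p.2.length : ℂ) + 1) * h p.1 p.2)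
  simp only [Equiv.prodComm_apply, Prod.fst_swap, Prod.snd_swap] at hswap
  rw [← hswap]
  rw [hs2.tsum_prod]
  refine tsum_congr fun l => ?_
  rw [amp_annihOp, annih, map_mul, Complex.conj_ofReal, Complex.conj_tsum, mul_assoc,
    ← tsum_mul_right, ← tsum_mul_left]
  refine tsum_congr fun j => ?_
  simp only [hdef, map_mul, Complex.conj_conj]
  have h0 : ((Real.sqrt (l.length + 1) : ℝ) : ℂ) ≠ 0 := by
    rw [Complex.ofReal_ne_zero]; exact (Real.sqrt_pos.mpr (by positivity)).ne'
  have h1 : ((l.length : ℂ) + 1) = ((Real.sqrt (l.length + 1) : ℝ) : ℂ) ^ 2 := by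
    rw [← Complex.ofReal_pow, Real.sq_sqrt (by positivity)]; simp
  rw [h1]
  field_simp

theorem inner_annihOp (a : OneParticle) (x y : finiteParticle) :
    ⟪(y : Fock), annihOp a x⟫_ℂ = ⟪(creatOp a y : Fock), x⟫_ℂ := by
  rw [← inner_conj_symm (𝕜 := ℂ), ← inner_creatOp, inner_conj_symm]

/-! ## Canonical commutation relations -/

theorem oneParticle_inner (b a : OneParticle) :
    ⟪b, a⟫_ℂ = ∑' j, starRingEnd ℂ (b j) * a j := by
  rw [lp.inner_eq_tsum]
  refine tsum_congr fun l => ?_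
  rw [RCLike.inner_apply, mul_comm]

/-- In `creat a x (j :: l)` the term that removes the head j contributes a j and, contracted with b,
the scalar ⟨b, a⟩. The terms that remove a letter of l reassemble to creation after annihilation. -/
theorem annihOp_creatOp (b a : OneParticle) (x : finiteParticle) :
    annihOp b (creatOp a x) = creatOp a (annihOp b x) + ⟪b, a⟫_ℂ • x := by
  refine Subtype.ext (amp_ext fun l => ?_)
  rw [Submodule.coe_add, Submodule.coe_smul, amp_add, amp_smul, amp_annihOp, amp_creatOp]
  have hcr : ∀ j : ℕ, amp (creatOp a x) (j :: l) = ((Real.sqrt (l.length + 1) : ℝ) : ℂ)⁻¹ *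
      (a j * amp x l + ∑ i : Fin l.length, a (l.get i) * amp x (j :: l.eraseIdx i)) := by
    intro j
    rw [amp_creatOp, creat]
    congr 1
    · simp
    · exact Fin.sum_univ_succ _
  have h0 : ((Real.sqrt (l.length + 1) : ℝ) : ℂ) ≠ 0 := by
    rw [Complex.ofReal_ne_zero]; exact (Real.sqrt_pos.mpr (by positivity)).ne'
  have hsum1 : Summable fun j => starRingEnd ℂ (b j) * a j * amp x l := by
    refine Summable.mul_right _ (Summable.of_norm ?_)
    refine (summable_mul_of_sq (summable_lp_sq b) (summable_lp_sq a)).congr fun j => ?_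
    rw [norm_mul, RCLike.norm_conj]
  have hsum2 : ∀ i : Fin l.length, Summable fun j =>
      a (l.get i) * (starRingEnd ℂ (b j) * amp x (j :: l.eraseIdx i)) := fun i =>
    (summable_annih b x (l.eraseIdx i)).mul_left _
  have hterm : ∀ j, starRingEnd ℂ (b j) * amp (creatOp a x) (j :: l) =
      ((Real.sqrt (l.length + 1) : ℝ) : ℂ)⁻¹ * (starRingEnd ℂ (b j) * a j * amp x l +
        ∑ i : Fin l.length, a (l.get i) * (starRingEnd ℂ (b j) * amp x (j :: l.eraseIdx i))) := by
    intro j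
    rw [hcr, mul_left_comm, mul_add, Finset.mul_sum]
    congr 2
    · ring
    · exact Finset.sum_congr rfl fun i _ => by ring
  unfold annih creat
  simp only [hterm]
  rw [tsum_mul_left, hsum1.tsum_add (summable_sum fun i _ => hsum2 i), ← mul_assoc,
    mul_inv_cancel₀ h0, one_mul, tsum_mul_right, ← oneParticle_inner, add_comm,
    Summable.tsum_finsetSum (fun i _ => hsum2 i), Finset.mul_sum]
  congr 1
  refine Finset.sum_congr rfl fun i _ => ?_
  rw [tsum_mul_left, amp_annihOp, annih]
  have h2 : ((l.eraseIdx i).length : ℝ) + 1 = l.length := by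
    have := i.2
    rw [List.length_eraseIdx_of_lt i.2]
    have h3 : l.length - 1 + 1 = l.length := by omega
    exact_mod_cast h3
  have h4 : ((Real.sqrt l.length : ℝ) : ℂ) ≠ 0 := by
    rw [Complex.ofReal_ne_zero]
    exact (Real.sqrt_pos.mpr (by exact_mod_cast (Nat.zero_le _).trans_lt i.2)).ne'
  rw [h2]
  field_simp

/-- Both sides are double sums over two contracted letters; Fubini and the symmetry of the
amplitudes exchange them. The relation for creation operators then follows by duality. -/
theorem annihOp_comm (b a : OneParticle) (x : finiteParticle) :
    annihOp b (annihOp a x) = annihOp a (annihOp b x) := by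
  have key : ∀ (b a : OneParticle) (l : List ℕ), annih b (annihOp a x) l =
      (Real.sqrt (l.length + 1) : ℂ) * ((Real.sqrt (l.length + 1 + 1) : ℂ) *
        ∑' j : ℕ, ∑' k : ℕ, starRingEnd ℂ (b j) * starRingEnd ℂ (a k) * amp x (k :: j :: l)) := by
    intro b a l
    have hj : ∀ j, starRingEnd ℂ (b j) * amp (annihOp a x) (j :: l) =
        (Real.sqrt (l.length + 1 + 1) : ℂ) *
        ∑' k : ℕ, starRingEnd ℂ (b j) * starRingEnd ℂ (a k) * amp x (k :: j :: l) := by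
      intro j
      simp only [mul_assoc, tsum_mul_left]
      rw [amp_annihOp, annih, mul_left_comm]
      simp
    rw [annih, tsum_congr hj, tsum_mul_left]
  refine Subtype.ext (amp_ext fun l => ?_)
  rw [amp_annihOp, amp_annihOp, key, key]
  congr 2
  have hinj : Function.Injective fun p : ℕ × ℕ => p.2 :: p.1 :: l := fun p q h => by
    obtain ⟨h1, h2⟩ := List.cons.inj h
    exact Prod.ext (List.cons.inj h2).1 h1
  have h1 := (summable_amp_sq x).comp_injective hinj
  have h2 := (summable_lp_sq b).mul_of_nonneg (summable_lp_sq a) (fun j => sq_nonneg ‖b j‖)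
      (fun l => sq_nonneg ‖a l‖)
  have h3 : Summable fun p : ℕ × ℕ =>
      starRingEnd ℂ (b p.1) * starRingEnd ℂ (a p.2) * amp x (p.2 :: p.1 :: l) := by
    refine Summable.of_norm ?_
    have h4 := summable_mul_of_sq (f := fun p : ℕ × ℕ => b p.1 * a p.2)
      (g := fun p : ℕ × ℕ => amp x (p.2 :: p.1 :: l)) (by simpa only [norm_mul, mul_pow] using h2) h1
    refine h4.congr fun p => ?_
    simp only [norm_mul, RCLike.norm_conj]
  have h5 := Summable.tsum_comm
    (f := fun j k : ℕ => starRingEnd ℂ (b j) * starRingEnd ℂ (a k) * amp x (k :: j :: l)) h3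
  rw [← h5]
  refine tsum_congr fun j => tsum_congr fun k => ?_
  rw [amp_perm x (List.Perm.swap k j l)]
  ring

theorem finiteParticle_ext {x y : finiteParticle}
    (h : ∀ z : finiteParticle, ⟪(z : Fock), x⟫_ℂ = ⟪(z : Fock), y⟫_ℂ) : x = y := by
  have h1 := h (x - y)
  rw [← sub_eq_zero, ← inner_sub_right, ← Submodule.coe_sub, inner_self_eq_zero,
    Submodule.coe_eq_zero] at h1
  exact sub_eq_zero.mp h1

theorem creatOp_comm (b a : OneParticle) (x : finiteParticle) :
    creatOp b (creatOp a x) = creatOp a (creatOp b x) := by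
  refine finiteParticle_ext fun z => ?_
  rw [inner_creatOp, inner_creatOp, inner_creatOp, inner_creatOp, annihOp_comm]

/-- The Segal field operator on finite particle vectors. -/
def segalOp (a : OneParticle) : finiteParticle →ₗ[ℂ] finiteParticle :=
  ((Real.sqrt 2)⁻¹ : ℂ) • (annihOp a + creatOp a)

theorem segalOp_apply (a : OneParticle) (x : finiteParticle) :
    segalOp a x = ((Real.sqrt 2)⁻¹ : ℂ) • (annihOp a x + creatOp a x) := rfl

theorem sqrt_two_inv_mul_self : ((Real.sqrt 2 : ℝ) : ℂ)⁻¹ * ((Real.sqrt 2 : ℝ) : ℂ)⁻¹ = 1 / 2 := by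
  rw [← mul_inv, ← Complex.ofReal_mul, Real.mul_self_sqrt (by norm_num)]
  norm_num

/-- Only the mixed commutators survive, with total ½(⟨b, a⟩ − ⟨a, b⟩) = i Im⟨b, a⟩. This scalar
later becomes the classical field. -/
theorem segalOp_comm (b a : OneParticle) (x : finiteParticle) :
    segalOp b (segalOp a x) = segalOp a (segalOp b x) + (Complex.I * (⟪b, a⟫_ℂ).im) • x := by
  have h : (Complex.I * (⟪b, a⟫_ℂ).im : ℂ) =
      ((Real.sqrt 2 : ℝ) : ℂ)⁻¹ * ((Real.sqrt 2 : ℝ) : ℂ)⁻¹ * (⟪b, a⟫_ℂ - ⟪a, b⟫_ℂ) := by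
    rw [sqrt_two_inv_mul_self, ← inner_conj_symm a b, Complex.sub_conj]
    push_cast
    ring
  have hsub : ∀ p q : ℂ, (p - q) • x = p • x - q • x := fun p q => sub_smul p q x
  rw [h, mul_sub, hsub]
  simp only [segalOp_apply, map_smul, map_add, annihOp_creatOp, smul_add, smul_smul,
    mul_assoc, creatOp_comm b a, annihOp_comm b a]
  abel

theorem inner_segalOp (a : OneParticle) (x y : finiteParticle) :
    ⟪(y : Fock), segalOp a x⟫_ℂ = ⟪(segalOp a y : Fock), x⟫_ℂ := by
  rw [segalOp_apply, segalOp_apply, Submodule.coe_smul, Submodule.coe_smul, inner_smul_left,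
    inner_smul_right, Submodule.coe_add, Submodule.coe_add, inner_add_left, inner_add_right,
    inner_creatOp, inner_annihOp, ← Complex.ofReal_inv, Complex.conj_ofReal, add_comm]

theorem segalOp_degLE (a : OneParticle) {k : ℕ} {x : finiteParticle} (hx : (x : Fock) ∈ degLE k) :
    (segalOp a x : Fock) ∈ degLE (k + 1) ∧
      ‖(segalOp a x : Fock)‖ ≤ Real.sqrt 2 * ‖a‖ * Real.sqrt (k + 1) * ‖(x : Fock)‖ := by
  obtain ⟨h1, h2⟩ := annihOp_degLE a hx
  obtain ⟨h3, h4⟩ := creatOp_degLE a hx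
  refine ⟨Submodule.smul_mem _ _ (add_mem h1 h3), ?_⟩
  rw [segalOp_apply, Submodule.coe_smul, norm_smul, Submodule.coe_add, norm_inv, Complex.norm_real,
    Real.norm_of_nonneg (Real.sqrt_nonneg _), inv_mul_le_iff₀ (by positivity)]
  calc _ ≤ _ := norm_add_le _ _
    _ ≤ _ := add_le_add h2 h4
    _ = (2 : ℝ) * (‖a‖ * Real.sqrt (k + 1) * ‖(x : Fock)‖) := by ring
    _ = _ := by
      nth_rewrite 1 [← Real.mul_self_sqrt (show (0 : ℝ) ≤ 2 by norm_num)]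
      ring

theorem mem_segalCoreGraph (a : OneParticle) (x y : Fock) :
    (x, y) ∈ segalCoreGraph a ↔ ∃ z : finiteParticle, (z : Fock) = x ∧ (segalOp a z : Fock) = y := by
  have key : ∀ (z : finiteParticle) l, amp (segalOp a z) l =
      ((Real.sqrt 2)⁻¹ : ℂ) * (annih a z l + creat a z l) := by
    intro z l
    rw [segalOp_apply, Submodule.coe_smul, Submodule.coe_add, amp_smul, amp_add, amp_annihOp,
      amp_creatOp]
  constructor
  · rintro ⟨hx, hy⟩
    exact ⟨⟨x, hx⟩, rfl, amp_ext fun l => by rw [key, hy]⟩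
  · rintro ⟨z, rfl, rfl⟩
    exact ⟨z.2, key z⟩

instance : CompleteSpace Fock := by
  have h1 : Continuous fun x : WordSpace => (x : List ℕ → ℂ) :=
    (lp.uniformContinuous_coe (E := fun _ : List ℕ => ℂ) (p := 2)).continuous
  have h : IsClosed (fockSubmodule : Set WordSpace) := by
    have h2 : (fockSubmodule : Set WordSpace) =
        ⋂ (l : List ℕ) (l' : List ℕ) (_ : l.Perm l'), {ψ : WordSpace | ψ l = ψ l'} := by
      ext ψ
      simp only [mem_iInter]
      exact Iff.rfl
    rw [h2]
    refine isClosed_iInter fun l => isClosed_iInter fun l' => isClosed_iInter fun _ => ?_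
    exact isClosed_eq ((continuous_apply l).comp h1) ((continuous_apply l').comp h1)
  exact h.completeSpace_coe

/-- If y is orthogonal to all finite particle vectors, so is it to its own truncation z to words of
bounded length. But ⟨z, z⟩ = ⟨z, y⟩, so every truncation vanishes. -/
theorem dense_finiteParticle : Dense (finiteParticle : Set Fock) := by
  rw [Submodule.dense_iff_topologicalClosure_eq_top, Submodule.topologicalClosure_eq_top_iff,
    Submodule.eq_bot_iff]
  intro y hy
  refine amp_ext fun l => ?_
  have hs : Summable fun l' : List ℕ => ‖if l'.length ≤ l.length then amp y l' else 0‖ ^ 2 := by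
    refine Summable.of_nonneg_of_le (fun _ => sq_nonneg _) (fun l' => ?_) (summable_amp_sq y)
    split_ifs <;> simp
  obtain ⟨z, hz⟩ := exists_fock (F := fun l' => if l'.length ≤ l.length then amp y l' else 0)
    (fun l₁ l₂ h => by simp only [h.length_eq, amp_perm y h]) hs
  have hzD : z ∈ finiteParticle := ⟨l.length, fun l' hl' => by rw [hz, if_neg (not_le.mpr hl')]⟩
  have h1 : ⟪z, z⟫_ℂ = ⟪z, y⟫_ℂ := by
    rw [fock_inner, fock_inner]
    refine tsum_congr fun l' => ?_
    rw [hz]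
    split_ifs <;> simp
  rw [Submodule.inner_right_of_mem_orthogonal hzD hy, inner_self_eq_zero] at h1
  have h2 := hz l
  rw [h1, if_pos le_rfl] at h2
  exact h2.symm

/-! ## Unitary groups generated by symmetric operators with entire vectors -/

section EntireVectors

variable {H : Type*} [NormedAddCommGroup H] [InnerProductSpace ℂ H]

/-- Solutions of f' = iTf with T symmetric have constant norm. Applied to differences of solutions,
this serves three times: for isometry of the exponential series, for the group law, and for
uniqueness of the group. -/
theorem norm_eq_of_hasDerivAt {Γ : Submodule ℂ (H × H)}
    (hΓ : ∀ p ∈ Γ, inner ℂ p.1 p.2 = inner ℂ p.2 p.1) {f g : ℝ → H}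
    (hm : ∀ s, (f s, g s) ∈ Γ) (hd : ∀ s, HasDerivAt f (Complex.I • g s) s) (s : ℝ) :
    ‖f s‖ = ‖f 0‖ := by
  have h1 : ∀ s, HasDerivAt (fun s => inner ℂ (f s) (f s)) (0 : ℂ) s := by
    intro s
    have h := (hd s).inner ℂ (hd s)
    rw [inner_smul_left, inner_smul_right, hΓ _ (hm s), Complex.conj_I] at h
    simpa using h
  have h2 := is_const_of_deriv_eq_zero (fun s => (h1 s).differentiableAt) (fun s => (h1 s).deriv) s 0
  simp only [inner_self_eq_norm_sq_to_K] at h2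
  have h3 : ‖f s‖ ^ 2 = ‖f 0‖ ^ 2 := by exact_mod_cast h2
  exact (sq_eq_sq₀ (norm_nonneg _) (norm_nonneg _)).mp h3

/-- Term-by-term differentiation of an exponential series. -/
theorem hasDerivAt_expSeries {E : Type*} [NormedAddCommGroup E] [NormedSpace ℝ E] [CompleteSpace E]
    {c : ℕ → E} (hc : ∀ r : ℝ, Summable fun n : ℕ => |r| ^ n / n.factorial * ‖c n‖) (s : ℝ) :
    HasDerivAt (fun s : ℝ => ∑' n : ℕ, (s ^ n / n.factorial) • c n)
      (∑' n : ℕ, (s ^ n / n.factorial) • c (n + 1)) s := by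
  set R : ℝ := |s| + 1
  have hR : 0 < R := by positivity
  set u : ℕ → ℝ := fun n => (n * R ^ (n - 1) / n.factorial) * ‖c n‖ with hu
  have hfac : ∀ n : ℕ, ((n : ℝ) + 1) / (n + 1).factorial = 1 / n.factorial := fun n => by
    rw [Nat.factorial_succ]; push_cast; field_simp
  -- The factor n produced by differentiation is absorbed by n ≤ 2ⁿ, that is, by doubling the radius
  -- R. This is harmless since the series converges absolutely at every radius.
  have hu1 : ∀ n, u (n + 1) ≤ (2 * R) ^ (n + 1) / (n + 1).factorial * ‖c (n + 1)‖ / R := by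
    intro n
    have h2 : (n : ℝ) + 1 ≤ 2 ^ (n + 1) := by
      exact_mod_cast (Nat.lt_two_pow_self (n := n + 1)).le
    simp only [hu, Nat.add_sub_cancel]
    push_cast
    rw [mul_pow, pow_succ R n]
    have : 2 ^ (n + 1) * (R ^ n * R) / ((n + 1).factorial : ℝ) * ‖c (n + 1)‖ / R =
      2 ^ (n + 1) * R ^ n / ((n + 1).factorial : ℝ) * ‖c (n + 1)‖ := by field_simp
    rw [this]
    gcongr
  have hsu : Summable u := by
    rw [← summable_nat_add_iff 1]
    refine Summable.of_nonneg_of_le (fun n => by positivity) hu1 ?_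
    have h := hc (2 * R)
    rw [abs_of_pos (by positivity)] at h
    exact ((summable_nat_add_iff 1).mpr h).div_const R
  have hd := hasDerivAt_tsum_of_isPreconnected (𝕜 := ℝ) (t := Ioo (-R) R) (y₀ := 0)
    (g := fun n s => (s ^ n / n.factorial) • c n)
    (g' := fun n s => (n * s ^ (n - 1) / n.factorial) • c n) (y := s) hsu isOpen_Ioo
    isPreconnected_Ioo
    (fun n y _ => ((hasDerivAt_pow n y).div_const _).smul_const _)
    (fun n y hy => by
      rw [norm_smul, Real.norm_eq_abs, abs_div, abs_mul, abs_pow, Nat.abs_cast, Nat.abs_cast]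
      have : |y| ≤ R := (abs_lt.mpr hy).le
      simp only [hu]
      gcongr)
    ⟨by linarith, hR⟩
    (by
      refine summable_of_ne_finset_zero (s := {0}) fun n hn => ?_
      rw [Finset.mem_singleton] at hn
      simp [hn])
    (abs_lt.mp (by simp [R]))
  convert hd using 1
  have hs : Summable fun n : ℕ => (n * s ^ (n - 1) / n.factorial) • c n := by
    refine Summable.of_norm_bounded hsu fun n => ?_
    rw [norm_smul, Real.norm_eq_abs, abs_div, abs_mul, abs_pow, Nat.abs_cast, Nat.abs_cast]
    have : |s| ≤ R := by simp [R]
    simp only [hu]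
    gcongr
  rw [hs.tsum_eq_zero_add]
  simp only [Nat.cast_zero, zero_mul, zero_div, zero_smul, zero_add, Nat.add_sub_cancel]
  refine tsum_congr fun n => ?_
  congr 1
  rw [mul_div_right_comm]
  push_cast
  rw [hfac]
  ring

variable {D : Submodule ℂ H} (Φ : D →ₗ[ℂ] D)

/-- The closure of the graph of `Φ`. -/
def closedGraph : Submodule ℂ (H × H) :=
  (LinearMap.range (D.subtype.prod (D.subtype ∘ₗ Φ))).topologicalClosure

theorem isClosed_closedGraph : IsClosed (closedGraph Φ : Set (H × H)) :=
  Submodule.isClosed_topologicalClosure _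

theorem mem_closedGraph (x : D) : ((x : H), (Φ x : H)) ∈ closedGraph Φ :=
  Submodule.le_topologicalClosure _ ⟨x, rfl⟩

/-- A closed condition on pairs holds on the closure of the graph once it holds on the graph over D.
-/
theorem closedGraph_induction {p : H × H → Prop} (hp : IsClosed {q | p q})
    (h : ∀ x : D, p ((x : H), (Φ x : H))) {q : H × H} (hq : q ∈ closedGraph Φ) : p q := by
  refine closure_minimal (t := {q | p q}) ?_ hp hq
  rintro _ ⟨x, rfl⟩
  exact h x

/-- The entire vector condition. -/
def EntireVectors : Prop :=
  ∀ (x : D) (r : ℝ), Summable fun n : ℕ => |r| ^ n / n.factorial * ‖((Φ ^ n) x : H)‖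

/-- The exponential series `∑ (is)ⁿ/n! Φⁿ x`. -/
def expSeries (s : ℝ) (x : D) : H :=
  ∑' n : ℕ, (s ^ n / n.factorial) • (Complex.I ^ n • ((Φ ^ n) x : H))

variable {Φ}

theorem closedGraph_symm (hsym : ∀ x y : D, inner ℂ (y : H) (Φ x : H) = inner ℂ (Φ y : H) (x : H))
    (p : H × H) (hp : p ∈ closedGraph Φ) : inner ℂ p.1 p.2 = inner ℂ p.2 p.1 :=
  closedGraph_induction Φ (p := fun p => inner ℂ p.1 p.2 = inner ℂ p.2 p.1)
    (isClosed_eq (continuous_fst.inner continuous_snd) (continuous_snd.inner continuous_fst))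
    (fun x => hsym x x) hp

theorem norm_I_pow_smul (n : ℕ) (x : H) : ‖Complex.I ^ n • x‖ = ‖x‖ := by
  rw [norm_smul, norm_pow, Complex.norm_I, one_pow, one_mul]

theorem EntireVectors.summable (hΦ : EntireVectors Φ) (x : D) (s : ℝ) :
    Summable fun n : ℕ => ‖(s ^ n / n.factorial) • (Complex.I ^ n • ((Φ ^ n) x : H))‖ := by
  refine (hΦ x s).congr fun n => ?_
  rw [norm_smul, norm_I_pow_smul, Real.norm_eq_abs, abs_div, abs_pow, Nat.abs_cast]

@[simp] theorem expSeries_zero (x : D) : expSeries Φ 0 x = x := by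
  rw [expSeries, tsum_eq_single 0]
  · simp
  · intro n hn; simp [hn]

theorem mem_closedGraph_of_hasSum {a b : ℕ → H} {x y : H}
    (ha : HasSum a x) (hb : HasSum b y) (h : ∀ n, (a n, b n) ∈ closedGraph Φ) :
    (x, y) ∈ closedGraph Φ := by
  refine (isClosed_closedGraph Φ).mem_of_tendsto (ha.prodMk hb) (Eventually.of_forall fun s => ?_)
  exact Submodule.sum_mem _ fun n _ => h n

theorem real_smul_mem (Γ : Submodule ℂ (H × H)) {x y : H} (r : ℝ) (h : (x, y) ∈ Γ) :
    (r • x, r • y) ∈ Γ := by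
  have h1 := Γ.smul_mem (r : ℂ) h
  simpa using h1

variable [CompleteSpace H]

theorem EntireVectors.hasSum (hΦ : EntireVectors Φ) (x : D) (s : ℝ) :
    HasSum (fun n : ℕ => (s ^ n / n.factorial) • (Complex.I ^ n • ((Φ ^ n) x : H)))
      (expSeries Φ s x) := (hΦ.summable x s).of_norm.hasSum

theorem EntireVectors.hasDerivAt (hΦ : EntireVectors Φ) (x : D) (s : ℝ) :
    HasDerivAt (fun s => expSeries Φ s x) (Complex.I • expSeries Φ s (Φ x)) s := by
  have h := hasDerivAt_expSeries (c := fun n => Complex.I ^ n • ((Φ ^ n) x : H))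
    (fun r => by simpa only [norm_I_pow_smul] using hΦ x r) s
  refine HasDerivAt.congr_deriv h ?_
  unfold expSeries
  rw [← tsum_const_smul'']
  refine tsum_congr fun n => ?_
  rw [smul_comm, pow_succ' Complex.I, mul_smul, pow_succ Φ, Module.End.mul_apply,
    smul_comm (Complex.I ^ n)]

theorem EntireVectors.mem (hΦ : EntireVectors Φ) (x : D) (s : ℝ) :
    (expSeries Φ s x, expSeries Φ s (Φ x)) ∈ closedGraph Φ := by
  refine mem_closedGraph_of_hasSum (hΦ.hasSum x s) (hΦ.hasSum (Φ x) s) fun n => ?_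
  refine real_smul_mem _ _ ?_
  have h1 := (closedGraph Φ).smul_mem (Complex.I ^ n) (mem_closedGraph Φ ((Φ ^ n) x))
  rwa [← Module.End.mul_apply, ← pow_succ', pow_succ, Module.End.mul_apply] at h1

/-- The exponential series as a linear map. -/
def expLinear (hΦ : EntireVectors Φ) (s : ℝ) : D →ₗ[ℂ] H where
  toFun x := expSeries Φ s x
  map_add' x y := by
    refine ((hΦ.hasSum (x + y) s).unique ?_)
    have h := (hΦ.hasSum x s).add (hΦ.hasSum y s)
    simpa only [map_add, Submodule.coe_add, smul_add] using h
  map_smul' c x := by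
    refine ((hΦ.hasSum (c • x) s).unique ?_)
    have h := (hΦ.hasSum x s).const_smul c
    simp only [map_smul, Submodule.coe_smul, RingHom.id_apply]
    convert h using 2 with n
    rw [smul_comm c, smul_comm c]

theorem EntireVectors.norm_expSeries (hΦ : EntireVectors Φ)
    (hsym : ∀ x y : D, inner ℂ (y : H) (Φ x : H) = inner ℂ (Φ y : H) (x : H)) (x : D) (s : ℝ) :
    ‖expSeries Φ s x‖ = ‖(x : H)‖ := by
  rw [norm_eq_of_hasDerivAt (closedGraph_symm hsym) (fun s => hΦ.mem x s)
    (fun s => hΦ.hasDerivAt x s) s, expSeries_zero]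

/-- `V` is a strongly continuous unitary group whose generator has the graph `Γ`. -/
def HasGenerator (Γ : Submodule ℂ (H × H)) (V : ℝ → (H ≃ₗᵢ[ℂ] H)) : Prop :=
  (∀ s s' x, V (s + s') x = V s (V s' x)) ∧ (∀ x, Continuous fun s => V s x) ∧
    ∀ x y : H, (x, y) ∈ Γ ↔ HasDerivAt (fun s : ℝ => V s x) (Complex.I • y) 0

omit [CompleteSpace H] in
theorem HasGenerator.zero {Γ : Submodule ℂ (H × H)} {V : ℝ → (H ≃ₗᵢ[ℂ] H)}
    (hV : HasGenerator Γ V) (x : H) : V 0 x = x := by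
  have h := hV.1 0 0 x
  rw [add_zero] at h
  exact ((V 0).injective h).symm

omit [CompleteSpace H] in
theorem HasGenerator.neg {Γ : Submodule ℂ (H × H)} {V : ℝ → (H ≃ₗᵢ[ℂ] H)}
    (hV : HasGenerator Γ V) (s : ℝ) (x : H) : V (-s) x = (V s).symm x := by
  rw [LinearIsometryEquiv.eq_symm_apply, ← hV.1, add_neg_cancel, hV.zero]

omit [CompleteSpace H] in
theorem HasGenerator.hasDerivAt {Γ : Submodule ℂ (H × H)} {V : ℝ → (H ≃ₗᵢ[ℂ] H)}
    (hV : HasGenerator Γ V) {x y : H} (h : (x, y) ∈ Γ) (s : ℝ) :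
    HasDerivAt (fun s => V s x) (Complex.I • V s y) s := by
  have h1 := (hV.2.2 x y).mp h
  have h2 : HasDerivAt (fun r : ℝ => V r x) (Complex.I • y) (s - s) := by rwa [sub_self]
  have h3 : HasDerivAt (fun r : ℝ => V (r - s) x) (Complex.I • y) s := h2.comp_sub_const s s
  have h4 := (((V s).toContinuousLinearEquiv.toContinuousLinearMap.restrictScalars ℝ).hasFDerivAt
    (x := V (s - s) x)).comp_hasDerivAt s h3
  have h5 : (fun r => V r x) = fun r => V s (V (r - s) x) := by
    funext r; rw [← hV.1, add_sub_cancel]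
  rw [h5]
  exact HasDerivAt.congr_deriv h4 ((V s).map_smul Complex.I y)

omit [CompleteSpace H] in
theorem HasGenerator.mem {Γ : Submodule ℂ (H × H)} {V : ℝ → (H ≃ₗᵢ[ℂ] H)}
    (hV : HasGenerator Γ V) {x y : H} (h : (x, y) ∈ Γ) (s : ℝ) : (V s x, V s y) ∈ Γ := by
  rw [hV.2.2]
  have h1 := hV.hasDerivAt h s
  have h2 : HasDerivAt (fun r : ℝ => V r x) (Complex.I • V s y) (0 + s) := by rwa [zero_add]
  have h3 := HasDerivAt.comp_add_const 0 s h2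
  simpa only [hV.1] using h3

omit [CompleteSpace H] in
/-- A unitary group is determined by its generator. -/
theorem HasGenerator.unique {Γ : Submodule ℂ (H × H)}
    (hΓ : ∀ p ∈ Γ, inner ℂ p.1 p.2 = inner ℂ p.2 p.1) (hd : Dense {x : H | ∃ y, (x, y) ∈ Γ})
    {V V' : ℝ → (H ≃ₗᵢ[ℂ] H)} (hV : HasGenerator Γ V) (hV' : HasGenerator Γ V') : V = V' := by
  funext s
  refine LinearIsometryEquiv.ext fun x => ?_
  refine congrFun (Continuous.ext_on hd (V s).continuous (V' s).continuous ?_) x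
  rintro x ⟨y, hxy⟩
  have h := norm_eq_of_hasDerivAt hΓ (f := fun s => V s x - V' s x) (g := fun s => V s y - V' s y)
    (fun s => Γ.sub_mem (hV.mem hxy s) (hV'.mem hxy s))
    (fun s => by
      rw [smul_sub]
      exact (hV.hasDerivAt hxy s).sub (hV'.hasDerivAt hxy s)) s
  rw [hV.zero, hV'.zero, sub_self, norm_zero, norm_eq_zero, sub_eq_zero] at h
  exact h

/-- A closed subspace is complete, so the integral can be formed inside it and then mapped by the
inclusion. -/
theorem intervalIntegral_mem {E : Type*} [NormedAddCommGroup E] [NormedSpace ℂ E] [CompleteSpace E]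
    {Γ : Submodule ℂ E} (hΓ : IsClosed (Γ : Set E)) {f : ℝ → E} (hf : Continuous f)
    (hm : ∀ s, f s ∈ Γ) (a b : ℝ) : ∫ s in a..b, f s ∈ Γ := by
  have : CompleteSpace Γ := hΓ.completeSpace_coe
  have hc : Continuous fun s => (⟨f s, hm s⟩ : Γ) := hf.subtype_mk hm
  have h := (Γ.subtypeL.restrictScalars ℝ).intervalIntegral_comp_comm
    (hc.intervalIntegrable (μ := volume) a b)
  have h2 : ∫ s in a..b, f s = ((∫ s in a..b, (⟨f s, hm s⟩ : Γ) : Γ) : E) := h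
  rw [h2]
  exact Subtype.coe_prop _

/-- A symmetric operator with a dense invariant domain of entire vectors generates a unitary group,
given on the domain by the exponential series. -/
theorem EntireVectors.exists_group (hΦ : EntireVectors Φ)
    (hsym : ∀ x y : D, inner ℂ (y : H) (Φ x : H) = inner ℂ (Φ y : H) (x : H))
    (hD : Dense (D : Set H)) :
    ∃ V : ℝ → (H ≃ₗᵢ[ℂ] H), HasGenerator (closedGraph Φ) V ∧ ∀ s (x : D), V s x = expSeries Φ s x := by
  have hDr : DenseRange D.subtype := by
    simpa [DenseRange] using hD
  have hb : ∀ s, ∃ C : ℝ, ∀ x : D, ‖expLinear hΦ s x‖ ≤ C * ‖D.subtype x‖ := fun s =>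
    ⟨1, fun x => by rw [one_mul]; exact (hΦ.norm_expSeries hsym x s).le⟩
  set W : ℝ → (H →L[ℂ] H) := fun s => (expLinear hΦ s).extendOfNorm D.subtype with hW
  have hWx : ∀ s (x : D), W s x = expSeries Φ s x := fun s x =>
    LinearMap.extendOfNorm_eq hDr (hb s) x
  have hWn : ∀ s x, ‖W s x‖ = ‖x‖ := fun s x => by
    refine congrFun (Continuous.ext_on hD (W s).continuous.norm continuous_norm ?_) x
    intro x hx
    have := hWx s ⟨x, hx⟩
    simp only at this ⊢
    rw [this, hΦ.norm_expSeries hsym]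
  -- The vector W s' x need not lie in D, so it is approximated by the partial sums p M of its
  -- series, which do. The difference of the trajectories started at W s' x and at p M solves the
  -- differential equation, so its norm stays equal to its initial value, which tends to zero.
  have hgrpD : ∀ s s' (x : D), W s (W s' x) = W (s + s') x := by
    intro s s' x
    have hp := (hΦ.hasSum x s').tendsto_sum_nat
    set p : ℕ → D := fun M => ∑ n ∈ Finset.range M,
      (((s' ^ n / n.factorial : ℝ) : ℂ) * Complex.I ^ n) • ((Φ ^ n) x) with hpdef
    have hp' : Tendsto (fun M => (p M : H)) atTop (𝓝 (W s' x)) := by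
      rw [hWx]
      convert hp using 2 with M
      simp only [hpdef, Submodule.coe_sum, Submodule.coe_smul, mul_smul]
      rfl
    have h1 : ∀ M, ‖W (s + s') x - W s (p M)‖ = ‖W s' x - p M‖ := by
      intro M
      have h := norm_eq_of_hasDerivAt (closedGraph_symm hsym)
        (f := fun r => expSeries Φ (r + s') x - expSeries Φ r (p M))
        (g := fun r => expSeries Φ (r + s') (Φ x) - expSeries Φ r (Φ (p M)))
        (fun r => (closedGraph Φ).sub_mem (hΦ.mem x (r + s')) (hΦ.mem (p M) r))
        (fun r => by
          rw [smul_sub]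
          exact ((hΦ.hasDerivAt x (r + s')).comp_add_const r s').sub (hΦ.hasDerivAt (p M) r)) s
      simp only [zero_add, expSeries_zero] at h
      rw [hWx, hWx, hWx, h]
    have h2 : Tendsto (fun M => W (s + s') x - W s (p M)) atTop (𝓝 0) := by
      rw [tendsto_zero_iff_norm_tendsto_zero]
      simp only [h1]
      rw [← tendsto_zero_iff_norm_tendsto_zero]
      simpa using hp'.const_sub (W s' x)
    have h3 : Tendsto (fun M => W (s + s') x - W s (p M)) atTop
        (𝓝 (W (s + s') x - W s (W s' x))) :=
      (((W s).continuous.tendsto _).comp hp').const_sub _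
    exact (sub_eq_zero.mp (tendsto_nhds_unique h3 h2)).symm
  have hgrp : ∀ s s' x, W s (W s' x) = W (s + s') x := fun s s' x => by
    refine congrFun (Continuous.ext_on hD ((W s).continuous.comp (W s').continuous)
      (W (s + s')).continuous ?_) x
    intro x hx
    exact hgrpD s s' ⟨x, hx⟩
  have hW0 : ∀ x, W 0 x = x := fun x => by
    refine congrFun (Continuous.ext_on hD (W 0).continuous continuous_id ?_) x
    intro x hx
    exact (hWx 0 ⟨x, hx⟩).trans (expSeries_zero _)
  have hcont : ∀ x, Continuous fun s => W s x := by
    intro x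
    refine continuous_of_uniform_approx_of_continuous fun u hu => ?_
    obtain ⟨ε, hε, hεu⟩ := Metric.mem_uniformity_dist.mp hu
    obtain ⟨y, hy, hyx⟩ := Metric.dense_iff.mp hD x ε hε
    refine ⟨fun s => W s y, ?_, fun s => hεu ?_⟩
    · have h : (fun s => W s y) = fun s => expSeries Φ s ⟨y, hyx⟩ := funext fun s => hWx s ⟨y, hyx⟩
      rw [h]
      exact continuous_iff_continuousAt.mpr fun s => (hΦ.hasDerivAt ⟨y, hyx⟩ s).continuousAt
    · rw [dist_eq_norm, ← map_sub, hWn, ← dist_eq_norm, dist_comm]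
      exact hy
  let V : ℝ → (H ≃ₗᵢ[ℂ] H) := fun s =>
    LinearIsometryEquiv.ofSurjective ⟨(W s).toLinearMap, hWn s⟩
      (fun x => ⟨W (-s) x, (hgrp s (-s) x).trans (by rw [add_neg_cancel, hW0])⟩)
  have hVW : ∀ s x, V s x = W s x := fun s x => rfl
  have hLip : ∀ h : ℝ, Continuous fun y : H => ∫ r in (0 : ℝ)..h, W r y := by
    intro h
    refine (LipschitzWith.of_dist_le_mul (K := Real.toNNReal |h|) fun y y' => ?_).continuous
    rw [dist_eq_norm, ← intervalIntegral.integral_sub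
      ((hcont y).intervalIntegrable _ _) ((hcont y').intervalIntegrable _ _)]
    have h := intervalIntegral.norm_integral_le_of_norm_le_const (a := 0) (b := h)
      (f := fun r => W r y - W r y') (C := dist y y') (fun r _ => by
        rw [← map_sub, hWn, dist_eq_norm])
    rw [sub_zero] at h
    rw [Real.coe_toNNReal _ (abs_nonneg _), mul_comm]
    exact h
  -- the integrated form of the differential equation
  have hint : ∀ q ∈ closedGraph Φ, ∀ s : ℝ, W s q.1 - q.1 = ∫ r in (0 : ℝ)..s, Complex.I • W r q.2 := by
    intro q hq s
    have hLip : Continuous fun y : H => ∫ r in (0 : ℝ)..s, Complex.I • W r y := by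
      simp only [intervalIntegral.integral_smul]
      exact (hLip s).const_smul _
    refine closedGraph_induction Φ (p := fun q => W s q.1 - q.1 = ∫ r in (0 : ℝ)..s, Complex.I • W r q.2)
      (isClosed_eq (((W s).continuous.comp continuous_fst).sub continuous_fst)
        (hLip.comp continuous_snd)) (fun x => ?_) hq
    have h := intervalIntegral.integral_eq_sub_of_hasDerivAt (a := 0) (b := s)
      (f := fun r => W r x) (f' := fun r => Complex.I • W r (Φ x))
      (fun r _ => by
        simp only [hWx]
        exact hΦ.hasDerivAt x r)
      (((hcont _).const_smul _).intervalIntegrable _ _)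
    rw [h, hW0]
  -- Time averages regularize: for every x in H the integral over [0, h] lies in the domain of the
  -- closure. If the orbit of x is differentiable at 0, dividing by h and letting h → 0 puts x and
  -- its derivative in the closed graph. The generator is thus no larger than the closure.
  have hmem : ∀ x : H, ∀ h : ℝ,
      ((∫ r in (0 : ℝ)..h, W r x), (-Complex.I) • (W h x - x)) ∈ closedGraph Φ := by
    intro x h
    have hcl : IsClosed {x : H | ((∫ r in (0 : ℝ)..h, W r x), (-Complex.I) • (W h x - x)) ∈
        closedGraph Φ} :=
      (isClosed_closedGraph Φ).preimage
        ((hLip h).prodMk (((W h).continuous.sub continuous_id).const_smul _))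
    refine closure_minimal (s := (D : Set H)) (fun x hx => ?_) hcl (hD x)
    have h1 := hint _ (mem_closedGraph Φ ⟨x, hx⟩) h
    have hc : Continuous fun r => (W r x, W r (Φ ⟨x, hx⟩ : H)) := (hcont _).prodMk (hcont _)
    have h2 : ∫ r in (0 : ℝ)..h, (W r x, W r (Φ ⟨x, hx⟩ : H)) ∈ closedGraph Φ :=
      intervalIntegral_mem (isClosed_closedGraph Φ) hc (fun r => by
        have h3 := hΦ.mem ⟨x, hx⟩ r
        rwa [← hWx, ← hWx] at h3) 0 h
    have h4 : ∫ r in (0 : ℝ)..h, (W r x, W r (Φ ⟨x, hx⟩ : H)) =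
        ((∫ r in (0 : ℝ)..h, W r x), ∫ r in (0 : ℝ)..h, W r (Φ ⟨x, hx⟩ : H)) := by
      refine Prod.ext ?_ ?_
      · exact ((ContinuousLinearMap.fst ℝ H H).intervalIntegral_comp_comm
          (hc.intervalIntegrable (μ := volume) 0 h)).symm
      · exact ((ContinuousLinearMap.snd ℝ H H).intervalIntegral_comp_comm
          (hc.intervalIntegrable (μ := volume) 0 h)).symm
    rw [h4] at h2
    simp only [mem_ofPred_eq]
    rw [h1, intervalIntegral.integral_smul, smul_smul]
    simpa using h2
  refine ⟨V, ⟨fun s s' x => (hgrp s s' x).symm, hcont, fun x y => ⟨fun hxy => ?_, fun hxy => ?_⟩⟩,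
    hWx⟩
  · have h1 : (fun s => V s x) = fun s => x + ∫ r in (0 : ℝ)..s, Complex.I • W r y := by
      funext s
      rw [← hint _ hxy s]
      simp [hVW]
    rw [h1]
    have hc : Continuous fun r => Complex.I • W r y := (hcont y).const_smul _
    have h2 := intervalIntegral.integral_hasDerivAt_right (hc.intervalIntegrable 0 0)
      (hc.stronglyMeasurableAtFilter _ _) hc.continuousAt
    rw [hW0] at h2
    exact h2.const_add x
  · have h1 : Tendsto (fun h : ℝ => h⁻¹ • ∫ r in (0 : ℝ)..h, W r x) (𝓝[≠] 0) (𝓝 x) := by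
      have h2 := intervalIntegral.integral_hasDerivAt_right ((hcont x).intervalIntegrable 0 0)
        ((hcont x).stronglyMeasurableAtFilter _ _) (hcont x).continuousAt
      rw [hW0, hasDerivAt_iff_tendsto_slope] at h2
      refine h2.congr fun h => ?_
      simp [slope_def_module]
    have h2 : Tendsto (fun h : ℝ => h⁻¹ • ((-Complex.I) • (W h x - x))) (𝓝[≠] 0) (𝓝 y) := by
      rw [hasDerivAt_iff_tendsto_slope] at hxy
      have h3 := hxy.const_smul (-Complex.I)
      rw [smul_smul, neg_mul, Complex.I_mul_I, neg_neg, one_smul] at h3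
      refine h3.congr fun h => ?_
      simp only [slope_def_module, sub_zero, hVW, hW0]
      rw [smul_comm]
    refine (isClosed_closedGraph Φ).mem_of_tendsto (h1.prodMk_nhds h2)
      (Eventually.of_forall fun h => real_smul_mem _ _ (hmem x h))

end EntireVectors

/-! ### Conjugation of one operator by the unitary group of another -/

section Conjugation

variable {H : Type*} [NormedAddCommGroup H] [InnerProductSpace ℂ H] [CompleteSpace H]
  {D : Submodule ℂ H} {Φ Ψ : D →ₗ[ℂ] D}

/-- Conjugation by the unitary group of `Φ` shifts `Ψ` by a multiple of the identity if the
commutator of `Ψ` and `Φ` is a multiple of the identity. -/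
theorem EntireVectors.conj_mem (hΦ : EntireVectors Φ) {c : ℝ}
    (hc : ∀ x, Ψ (Φ x) = Φ (Ψ x) + (Complex.I * c) • x) {V : ℝ → (H ≃ₗᵢ[ℂ] H)}
    (hV : ∀ s (x : D), V s x = expSeries Φ s x) (s : ℝ) {q : H × H} (hq : q ∈ closedGraph Ψ) :
    (V s q.1, V s (q.2 - (s * c : ℂ) • q.1)) ∈ closedGraph Ψ := by
  have hpow : ∀ (n : ℕ) (x : D), Ψ ((Φ ^ (n + 1)) x) =
      (Φ ^ (n + 1)) (Ψ x) + ((n + 1 : ℂ) * (Complex.I * c)) • (Φ ^ n) x := by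
    intro n
    induction n with
    | zero => intro x; simp [hc]
    | succ n ih =>
      intro x
      rw [pow_succ Φ (n + 1), Module.End.mul_apply, ih, hc, map_add, Module.End.mul_apply, map_smul,
        ← Module.End.mul_apply (Φ ^ n), ← pow_succ, add_assoc, ← add_smul]
      congr 2
      push_cast; ring
  refine closedGraph_induction Ψ (p := fun q => (V s q.1, V s (q.2 - (s * c : ℂ) • q.1)) ∈
    closedGraph Ψ) ?_ (fun x => ?_) hq
  · exact (isClosed_closedGraph Ψ).preimage (((V s).continuous.comp continuous_fst).prodMk
      ((V s).continuous.comp (continuous_snd.sub (continuous_fst.const_smul _))))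
  · have h1 := hΦ.hasSum x s
    have h2 : HasSum (fun n : ℕ => (s ^ n / n.factorial) • (Complex.I ^ n • (Ψ ((Φ ^ n) x) : H)))
        (expSeries Φ s (Ψ x) - (s * c : ℂ) • expSeries Φ s x) := by
      have h3 := hΦ.hasSum (Ψ x) s
      -- This is the series of commutators. The term n = 0 vanishes; in the term n + 1 the factor n
      -- + 1 cancels against the factorial and i · i^{n+1} = −iⁿ, so the shifted series is −sc times
      -- the exponential series of x.
      have h4 : HasSum (fun n : ℕ => (s ^ n / n.factorial) • (Complex.I ^ n •
          ((Ψ ((Φ ^ n) x) : H) - ((Φ ^ n) (Ψ x) : H)))) (-(s * c : ℂ) • expSeries Φ s x) := by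
        rw [← hasSum_nat_add_iff' 1]
        simp only [Finset.range_one, Finset.sum_singleton, pow_zero, Module.End.one_apply, sub_self,
          smul_zero, sub_zero]
        convert h1.const_smul (-(s * c : ℂ)) using 2 with n
        rw [hpow, Submodule.coe_add, add_sub_cancel_left, Submodule.coe_smul]
        simp only [← Complex.coe_smul (E := H), smul_smul]
        congr 1
        have hf : (n.factorial : ℂ) ≠ 0 := by exact_mod_cast n.factorial_ne_zero
        have hn : ((n : ℂ) + 1) ≠ 0 := by exact_mod_cast n.succ_ne_zero
        push_cast [Nat.factorial_succ]
        field_simp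
        rw [pow_succ Complex.I]
        linear_combination ((s : ℂ) ^ (n + 1) * c * Complex.I ^ n) * Complex.I_sq
      have h5 := h3.add h4
      rw [neg_smul, ← sub_eq_add_neg] at h5
      convert h5 using 2 with n
      rw [← smul_add, ← smul_add, add_sub_cancel]
    rw [map_sub, map_smul, hV, hV]
    refine mem_closedGraph_of_hasSum h1 h2 fun n => real_smul_mem _ _ ?_
    exact (closedGraph Ψ).smul_mem _ (mem_closedGraph Ψ _)

end Conjugation

/-! ## Segal field operators -/

theorem segalOp_pow_degLE (a : OneParticle) {k : ℕ} {x : finiteParticle}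
    (hx : (x : Fock) ∈ degLE k) (n : ℕ) : (((segalOp a) ^ n) x : Fock) ∈ degLE (k + n) := by
  induction n with
  | zero => simpa using hx
  | succ n ih =>
    rw [pow_succ', Module.End.mul_apply]
    exact (segalOp_degLE a ih).1

/-- Ratio test: the quotient of successive terms is at most |r| √2 ‖a‖ √(k + n + 1) / (n + 1), which
tends to zero. -/
theorem entireVectors_segalOp (a : OneParticle) : EntireVectors (segalOp a) := by
  rintro ⟨x, k, hx⟩ r
  refine summable_of_ratio_norm_eventually_le (r := 1 / 2) (by norm_num) ?_
  -- Squaring the requirement that the quotient be at most 1/2 gives K (k + n + 1) ≤ (n + 1)², which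
  -- holds once n ≥ K (k + 1).
  set K : ℝ := 8 * r ^ 2 * ‖a‖ ^ 2
  have hK : 0 ≤ K := by positivity
  filter_upwards [eventually_ge_atTop ⌈K * (k + 1)⌉₊] with n hn
  have hn' : K * (k + 1) ≤ n := Nat.ceil_le.mp hn
  have h1 := (segalOp_degLE a (segalOp_pow_degLE a (x := ⟨x, k, hx⟩) hx n)).2
  rw [← Module.End.mul_apply, ← pow_succ'] at h1
  set A := ‖(((segalOp a) ^ n) ⟨x, k, hx⟩ : Fock)‖
  rw [Real.norm_of_nonneg (by positivity), Real.norm_of_nonneg (by positivity)]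
  have h2 : |r| * (Real.sqrt 2 * ‖a‖ * Real.sqrt ((k + n : ℕ) + 1)) ≤ (n + 1) / 2 := by
    refine le_of_sq_le_sq ?_ (by positivity)
    rw [mul_pow, mul_pow, mul_pow, Real.sq_sqrt (by norm_num), Real.sq_sqrt (by positivity), sq_abs]
    push_cast
    have h3 : K * (k + n + 1) ≤ (n + 1) ^ 2 := by
      nlinarith [mul_nonneg hK (mul_nonneg (Nat.cast_nonneg (α := ℝ) k) (Nat.cast_nonneg (α := ℝ) n)),
        mul_nonneg (sub_nonneg.mpr hn') (Nat.cast_nonneg (α := ℝ) n)]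
    simp only [K] at h3
    nlinarith
  have hf : (0 : ℝ) < n.factorial := by exact_mod_cast n.factorial_pos
  calc |r| ^ (n + 1) / (n + 1).factorial * ‖(((segalOp a) ^ (n + 1)) ⟨x, k, hx⟩ : Fock)‖
      ≤ |r| ^ (n + 1) / (n + 1).factorial * (Real.sqrt 2 * ‖a‖ * Real.sqrt ((k + n : ℕ) + 1) * A) := by
        gcongr
    _ = |r| ^ n / (n + 1).factorial * A *
        (|r| * (Real.sqrt 2 * ‖a‖ * Real.sqrt ((k + n : ℕ) + 1))) := by rw [pow_succ]; ring
    _ ≤ |r| ^ n / (n + 1).factorial * A * ((n + 1) / 2) := by gcongr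
    _ = 1 / 2 * (|r| ^ n / n.factorial * A) := by
        rw [Nat.factorial_succ]; push_cast; field_simp

theorem closedGraph_segalOp_symm (a : OneParticle) (p : Fock × Fock)
    (hp : p ∈ closedGraph (segalOp a)) : inner ℂ p.1 p.2 = inner ℂ p.2 p.1 :=
  closedGraph_symm (inner_segalOp a) p hp

theorem segalCoreGraph_eq (a : OneParticle) : segalCoreGraph a =
    LinearMap.range (finiteParticle.subtype.prod (finiteParticle.subtype ∘ₗ segalOp a)) := by
  ext ⟨x, y⟩
  rw [mem_segalCoreGraph]
  constructor
  · rintro ⟨z, rfl, rfl⟩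
    exact ⟨z, rfl⟩
  · rintro ⟨z, hz⟩
    exact ⟨z, congrArg Prod.fst hz, congrArg Prod.snd hz⟩

/-- The closure is taken of the graph, so closability has to be checked first: if (0, y) is a limit
of graph points, symmetry makes y orthogonal to the dense set of finite particle vectors. -/
theorem segal_graph (a : OneParticle) : (segal a).graph = closedGraph (segalOp a) := by
  have h0 : (segalCore a).graph.topologicalClosure = closedGraph (segalOp a) := by
    rw [segalCore_graph, segalCoreGraph_eq]; rfl
  have h1 : (segalCore a).IsClosable := by
    refine ⟨(closedGraph (segalOp a)).toLinearPMap, ?_⟩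
    rw [Submodule.toLinearPMap_graph_eq, h0]
    rintro ⟨x, y⟩ hp h
    have hxy : ∀ z : finiteParticle, inner ℂ (z : Fock) y = inner ℂ (segalOp a z : Fock) x :=
      fun z => closedGraph_induction (segalOp a)
        (p := fun q => inner ℂ (z : Fock) q.2 = inner ℂ (segalOp a z : Fock) q.1)
        (isClosed_eq (continuous_const.inner continuous_snd)
          (continuous_const.inner continuous_fst)) (fun x => inner_segalOp a x z) hp
    have h : x = 0 := h
    subst h
    simp only [inner_zero_right] at hxy
    refine dense_finiteParticle.eq_zero_of_inner_right (𝕜 := ℂ) ?_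
    intro z hz
    exact hxy ⟨z, hz⟩
  rw [segal, ← h1.graph_closure_eq_closure_graph, h0]

theorem exists_segal_group (a : OneParticle) : ∃ V : ℝ → (Fock ≃ₗᵢ[ℂ] Fock),
    HasGenerator (closedGraph (segalOp a)) V ∧
      ∀ s (x : finiteParticle), V s x = expSeries (segalOp a) s x :=
  (entireVectors_segalOp a).exists_group (inner_segalOp a) dense_finiteParticle

theorem isUnitaryGroupOf_segal_iff (a : OneParticle) (V : ℝ → (Fock ≃ₗᵢ[ℂ] Fock)) :
    IsUnitaryGroupOf (segal a) V ↔ HasGenerator (closedGraph (segalOp a)) V := by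
  unfold IsUnitaryGroupOf HasGenerator
  rw [segal_graph]
  exact Iff.rfl

/-- The Weyl operators shift the field operators. -/
theorem mem_graph_expI (a b : OneParticle) (x y : Fock) :
    (expI (segal a) x, expI (segal a) y) ∈ (segal b).graph ↔
      (x, y + ((⟪b, a⟫_ℂ).im : ℂ) • x) ∈ (segal b).graph := by
  obtain ⟨V, hV, hVs⟩ := exists_segal_group a
  have hex : ∃ U, IsUnitaryGroupOf (segal a) U := ⟨V, (isUnitaryGroupOf_segal_iff a V).mpr hV⟩
  have hW : expI (segal a) = V 1 := by
    rw [expI, dif_pos hex]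
    have h := (isUnitaryGroupOf_segal_iff a _).mp hex.choose_spec
    have hd : Dense {x : Fock | ∃ y, (x, y) ∈ closedGraph (segalOp a)} :=
      dense_finiteParticle.mono fun x hx => ⟨_, mem_closedGraph (segalOp a) ⟨x, hx⟩⟩
    rw [h.unique (closedGraph_segalOp_symm a) hd hV]
  have hconj : ∀ (s : ℝ) {q : Fock × Fock}, q ∈ closedGraph (segalOp b) →
      (V s q.1, V s (q.2 - (s * (⟪b, a⟫_ℂ).im : ℂ) • q.1)) ∈ closedGraph (segalOp b) := fun s q hq =>
    (entireVectors_segalOp a).conj_mem (segalOp_comm b a) hVs s hq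
  rw [hW, segal_graph]
  constructor
  · intro h
    have h1 := hconj (-1) h
    simp only [map_sub, map_smul, hV.neg, LinearIsometryEquiv.symm_apply_apply] at h1
    simpa using h1
  · intro h
    have h1 := hconj 1 h
    simpa using h1

theorem mem_graph_shift (T : FockOp) (c : ℝ) (x y : Fock) :
    (x, y) ∈ (shift T c).graph ↔ (x, y + (c : ℂ) • x) ∈ T.graph := by
  simp only [LinearPMap.mem_graph_iff, shift]
  constructor
  · rintro ⟨z, hz, hy⟩
    refine ⟨⟨z, z.2⟩, hz, ?_⟩
    rw [LinearPMap.vadd_apply] at hy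
    rw [← hy, ← hz]
    simp
  · rintro ⟨z, hz, hy⟩
    refine ⟨⟨z, z.2⟩, hz, ?_⟩
    rw [LinearPMap.vadd_apply]
    have hy' : T z = y + (c : ℂ) • x := hy
    rw [show (⟨(z : Fock), z.2⟩ : T.domain) = z from rfl, hy', ← hz]
    simp

theorem shift_zero (T : FockOp) : shift T 0 = T := by
  refine LinearPMap.eq_of_eq_graph ?_
  ext ⟨x, y⟩
  rw [mem_graph_shift]
  simp

/-- The unitary is moved through the product one factor at a time. Since the shift law is an
equivalence of graph memberships, domains are transported exactly and no regularity of x is needed.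
-/
theorem acts_expI (a : OneParticle) (L : List OneParticle) (x y : Fock) :
    Acts (L.map segal) (expI (segal a) x) y ↔
      ∃ z, y = expI (segal a) z ∧
        Acts (L.map fun b => shift (segal b) (⟪b, a⟫_ℂ).im) x z := by
  induction L generalizing y with
  | nil => simp [Acts]
  | cons b L ih =>
    simp only [List.map_cons, Acts, ih]
    constructor
    · rintro ⟨_, ⟨z, rfl, hz⟩, h⟩
      obtain ⟨w, rfl⟩ := (expI (segal a)).surjective y
      exact ⟨w, rfl, z, hz, (mem_graph_shift _ _ _ _).mpr ((mem_graph_expI a b z w).mp h)⟩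
    · rintro ⟨w, rfl, z, hz, h⟩
      exact ⟨_, ⟨z, rfl, hz⟩, (mem_graph_expI a b z w).mpr ((mem_graph_shift _ _ _ _).mp h)⟩

theorem vecExp_expI (a : OneParticle) (L : List OneParticle) (x : Fock) (v : ℂ) :
    VecExp (expI (segal a) x) (L.map segal) v ↔
      VecExp x (L.map fun b => shift (segal b) (⟪b, a⟫_ℂ).im) v := by
  unfold VecExp
  simp only [acts_expI]
  constructor
  · rintro ⟨_, ⟨z, rfl, hz⟩, h⟩
    exact ⟨z, hz, by rw [← h]; exact ((expI (segal a)).inner_map_map x z).symm⟩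
  · rintro ⟨z, hz, h⟩
    exact ⟨_, ⟨z, rfl, hz⟩, by rw [← h]; exact (expI (segal a)).inner_map_map x z⟩

/-! ## Products of shifted field operators on finite particle vectors -/

/-- The operator `Φ(b) - c` for `p = (b, c)`. -/
def shiftedField (p : OneParticle × ℝ) : FockOp := shift (segal p.1) p.2

/-- The operator `Φ(b) - c` on finite particle vectors. -/
def shiftedOp (p : OneParticle × ℝ) : finiteParticle →ₗ[ℂ] finiteParticle :=
  segalOp p.1 - (p.2 : ℂ) • LinearMap.id

/-- The product of the operators `Φ(b) - c` on finite particle vectors. -/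
def prodOp (L : List (OneParticle × ℝ)) : finiteParticle →ₗ[ℂ] finiteParticle :=
  (L.map shiftedOp).prod

theorem prodOp_cons (p : OneParticle × ℝ) (L : List (OneParticle × ℝ)) (x : finiteParticle) :
    prodOp (p :: L) x = shiftedOp p (prodOp L x) := by
  simp [prodOp]

theorem shiftedOp_apply (p : OneParticle × ℝ) (x : finiteParticle) :
    shiftedOp p x = segalOp p.1 x - (p.2 : ℂ) • x := rfl

theorem mem_graph_shiftedField (p : OneParticle × ℝ) (x : finiteParticle) (y : Fock) :
    ((x : Fock), y) ∈ (shiftedField p).graph ↔ y = shiftedOp p x := by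
  have h : ((x : Fock), (shiftedOp p x : Fock)) ∈ (shiftedField p).graph := by
    rw [shiftedField, mem_graph_shift, segal_graph, shiftedOp_apply, Submodule.coe_sub,
      Submodule.coe_smul, sub_add_cancel]
    exact mem_closedGraph _ x
  constructor
  · intro h1
    exact LinearPMap.mem_graph_snd_inj _ h1 h rfl
  · rintro rfl
    exact h

theorem acts_shiftedField (L : List (OneParticle × ℝ)) (x : finiteParticle) (y : Fock) :
    Acts (L.map shiftedField) x y ↔ y = prodOp L x := by
  induction L generalizing y with
  | nil => simp [Acts, prodOp]
  | cons p L ih =>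
    simp only [List.map_cons, Acts, ih, exists_eq_left, mem_graph_shiftedField, prodOp_cons]

theorem vecExp_shiftedField (L : List (OneParticle × ℝ)) (x : finiteParticle) (v : ℂ) :
    VecExp x (L.map shiftedField) v ↔ v = ⟪(x : Fock), prodOp L x⟫_ℂ := by
  unfold VecExp
  simp only [acts_shiftedField, exists_eq_left]
  exact eq_comm

/-- Each factor raises the particle number by at most one, so K bounds it throughout the product and
the same constant 2√(K + 1) serves for every factor. -/
theorem prodOp_degLE (L : List (OneParticle × ℝ)) {k K : ℕ} {x : finiteParticle}
    (hx : (x : Fock) ∈ degLE k) (hK : k + L.length ≤ K) :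
    (prodOp L x : Fock) ∈ degLE (k + L.length) ∧ ‖(prodOp L x : Fock)‖ ≤
      (2 * Real.sqrt (K + 1)) ^ L.length * (L.map fun p => ‖p.1‖ + |p.2|).prod * ‖(x : Fock)‖ := by
  induction L with
  | nil => simpa [prodOp] using hx
  | cons p L ih =>
    rw [List.length_cons] at hK
    obtain ⟨h1, h2⟩ := ih (by omega)
    obtain ⟨h3, h4⟩ := segalOp_degLE p.1 h1
    rw [prodOp_cons, shiftedOp_apply, List.length_cons]
    refine ⟨sub_mem h3 (Submodule.smul_mem _ _ (degLE_mono (by omega) h1)), ?_⟩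
    set A := ‖(prodOp L x : Fock)‖
    have hs1 : Real.sqrt ((k + L.length : ℕ) + 1) ≤ Real.sqrt (K + 1) := by
      refine Real.sqrt_le_sqrt ?_
      have : ((k + L.length : ℕ) : ℝ) ≤ K := by exact_mod_cast (by omega)
      linarith
    have hs2 : 1 ≤ Real.sqrt (K + 1) := by
      rw [Real.one_le_sqrt]; linarith [Nat.cast_nonneg (α := ℝ) K]
    have hs3 : Real.sqrt 2 ≤ 2 := by
      rw [Real.sqrt_le_left (by norm_num)]; norm_num
    have hb : ‖(segalOp p.1 (prodOp L x) : Fock) - (p.2 : ℂ) • (prodOp L x : Fock)‖ ≤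
        2 * Real.sqrt (K + 1) * (‖p.1‖ + |p.2|) * A := by
      refine (norm_sub_le _ _).trans ?_
      rw [norm_smul, Complex.norm_real, Real.norm_eq_abs]
      have e1 : Real.sqrt 2 * ‖p.1‖ * Real.sqrt ((k + L.length : ℕ) + 1) * A ≤
          2 * ‖p.1‖ * Real.sqrt (K + 1) * A := by gcongr
      have e2 : |p.2| * A ≤ 2 * Real.sqrt (K + 1) * |p.2| * A := by
        have : 1 * (|p.2| * A) ≤ (2 * Real.sqrt (K + 1)) * (|p.2| * A) := by
          gcongr; linarith
        linarith
      have h4' : ‖(segalOp p.1 (prodOp L x) : Fock)‖ ≤ _ := h4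
      linarith
    refine hb.trans ?_
    rw [List.map_cons, List.prod_cons, pow_succ]
    calc 2 * Real.sqrt (K + 1) * (‖p.1‖ + |p.2|) * A
        ≤ 2 * Real.sqrt (K + 1) * (‖p.1‖ + |p.2|) * ((2 * Real.sqrt (K + 1)) ^ L.length *
          (L.map fun p => ‖p.1‖ + |p.2|).prod * ‖(x : Fock)‖) := by gcongr
      _ = _ := by ring

theorem prodOp_append (L₁ L₂ : List (OneParticle × ℝ)) (x : finiteParticle) :
    prodOp (L₁ ++ L₂) x = prodOp L₁ (prodOp L₂ x) := by
  simp [prodOp]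

/-- The product is affine in each shift, and the slope is minus the product with that factor
removed. -/
theorem prodOp_sub (L₁ L₂ : List (OneParticle × ℝ)) (b : OneParticle) (c c' : ℝ)
    (x : finiteParticle) :
    prodOp (L₁ ++ (b, c) :: L₂) x - prodOp (L₁ ++ (b, c') :: L₂) x =
      ((c' - c : ℝ) : ℂ) • prodOp (L₁ ++ L₂) x := by
  have hsub : ∀ (p q : ℂ) (x : finiteParticle), (p - q) • x = p • x - q • x :=
    fun p q x => sub_smul p q x
  rw [prodOp_append, prodOp_append, prodOp_append, ← map_sub, prodOp_cons, prodOp_cons,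
    shiftedOp_apply, shiftedOp_apply, sub_sub_sub_cancel_left, ← hsub, map_smul,
    Complex.ofReal_sub]

/-- Parity: a field changes the particle number by one, so its diagonal matrix elements vanish on
vectors of definite particle number. -/
theorem inner_segalOp_self (b : OneParticle) {n : ℕ} {x : finiteParticle}
    (hx : ∀ l : List ℕ, l.length ≠ n → amp x l = 0) : ⟪(x : Fock), segalOp b x⟫_ℂ = 0 := by
  rw [fock_inner]
  convert tsum_zero with l
  by_cases hl : l.length = n
  · have h1 : annih b x l = 0 := by
      unfold annih
      simp [fun j : ℕ => hx (j :: l) (by simp [hl])]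
    have h2 : creat b x l = 0 := by
      unfold creat
      rw [Finset.sum_eq_zero, mul_zero]
      intro i _
      rw [hx _ (by rw [List.length_eraseIdx_of_lt i.2]; have := i.2; omega), mul_zero]
    rw [segalOp_apply, Submodule.coe_smul, Submodule.coe_add, amp_smul, amp_add, amp_annihOp,
      amp_creatOp, h1, h2]
    simp
  · rw [hx l hl]; simp

/-! ## Occupation number vectors -/

theorem amp_occVec (s : Multiset ℕ) (l : List ℕ) : amp (occVec s) l =
    if (l : Multiset ℕ) = s then ((Real.sqrt (wordsOf s).card)⁻¹ : ℂ) else 0 := by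
  unfold occVec amp
  simp only

theorem amp_occVec_of_length_ne {s : Multiset ℕ} {l : List ℕ} (h : l.length ≠ s.card) :
    amp (occVec s) l = 0 := by
  rw [amp_occVec, if_neg]
  rintro rfl
  simp at h

theorem occVec_mem_degLE (s : Multiset ℕ) : occVec s ∈ degLE s.card := fun _ hl =>
  amp_occVec_of_length_ne hl.ne'

theorem norm_occVec (s : Multiset ℕ) : ‖occVec s‖ = 1 := by
  have hne : (wordsOf s).Nonempty := by
    obtain ⟨l, rfl⟩ := Quot.exists_rep s
    exact ⟨l, (mem_wordsOf _ _).mpr rfl⟩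
  have hc : ((wordsOf s).card : ℝ) ≠ 0 := by exact_mod_cast hne.card_pos.ne'
  have h : ‖occVec s‖ ^ 2 = 1 := by
    rw [fock_norm_sq, tsum_eq_sum (s := wordsOf s)]
    · rw [Finset.sum_congr rfl (g := fun _ => ((wordsOf s).card : ℝ)⁻¹)]
      · rw [Finset.sum_const, nsmul_eq_mul, mul_inv_cancel₀ hc]
      · intro l hl
        rw [amp_occVec, if_pos ((mem_wordsOf s l).mp hl), norm_inv, Complex.norm_real,
          Real.norm_of_nonneg (Real.sqrt_nonneg _), inv_pow, Real.sq_sqrt (Nat.cast_nonneg _)]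
    · intro l hl
      rw [amp_occVec, if_neg fun h => hl ((mem_wordsOf s l).mpr h)]
      simp
  exact (sq_eq_sq₀ (norm_nonneg _) zero_le_one).mp (by rw [h, one_pow])

/-- The occupation number vectors as finite particle vectors. -/
def occVec' (s : Multiset ℕ) : finiteParticle := ⟨occVec s, s.card, occVec_mem_degLE s⟩

theorem vacuum_eq_occVec : vacuum = occVec 0 := by
  refine amp_ext fun l => ?_
  have hw : wordsOf 0 = {[]} := by
    ext l
    simp [mem_wordsOf]
  rw [amp_occVec, hw]
  by_cases hl : l = []
  · subst hl
    simp [amp, vacuum]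
  · have h1 : (l : Multiset ℕ) ≠ 0 := by simpa using hl
    rw [if_neg h1]
    exact lp.single_apply_ne 2 _ _ hl

/-- The diagonal matrix elements of products of shifted fields in the occupation number basis. -/
def occExp (s : Multiset ℕ) (L : List (OneParticle × ℝ)) : ℂ :=
  ⟪occVec s, (prodOp L (occVec' s) : Fock)⟫_ℂ

theorem vecExp_occVec (s : Multiset ℕ) (L : List (OneParticle × ℝ)) (v : ℂ) :
    VecExp (occVec s) (L.map shiftedField) v ↔ v = occExp s L :=
  vecExp_shiftedField L (occVec' s) v

/-- What matters is that the bound is polynomial in the number of particles, with degree the number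
of fields, so that Boltzmann factors can absorb it. -/
theorem norm_occExp_le (s : Multiset ℕ) (L : List (OneParticle × ℝ)) :
    ‖occExp s L‖ ≤ (2 * (s.card + L.length + 1)) ^ L.length *
      (L.map fun p => ‖p.1‖ + |p.2|).prod := by
  have h := (prodOp_degLE L (x := occVec' s) (occVec_mem_degLE s) le_rfl).2
  have h0 : ‖((occVec' s : finiteParticle) : Fock)‖ = 1 := norm_occVec s
  rw [h0, mul_one] at h
  have hp : 0 ≤ (L.map fun p => ‖p.1‖ + |p.2|).prod :=
    List.prod_nonneg fun a ha => by
      obtain ⟨p, -, rfl⟩ := List.mem_map.mp ha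
      positivity
  have hs : Real.sqrt ((s.card + L.length : ℕ) + 1) ≤ s.card + L.length + 1 := by
    rw [Real.sqrt_le_left (by positivity)]
    push_cast
    nlinarith [Nat.cast_nonneg (α := ℝ) s.card, Nat.cast_nonneg (α := ℝ) L.length]
  calc ‖occExp s L‖ ≤ ‖occVec s‖ * ‖(prodOp L (occVec' s) : Fock)‖ := norm_inner_le_norm _ _
    _ = ‖(prodOp L (occVec' s) : Fock)‖ := by rw [norm_occVec, one_mul]
    _ ≤ _ := h
    _ ≤ _ := by gcongr

theorem occExp_nil (s : Multiset ℕ) : occExp s [] = 1 := by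
  have h : ((prodOp [] (occVec' s) : finiteParticle) : Fock) = occVec s := by simp [prodOp]; rfl
  rw [occExp, h, inner_self_eq_norm_sq_to_K, norm_occVec]
  simp

theorem occExp_odd (s : Multiset ℕ) (b : OneParticle) : occExp s [(b, 0)] = 0 := by
  have h : (prodOp [(b, 0)] (occVec' s) : finiteParticle) = segalOp b (occVec' s) := by
    simp [prodOp, shiftedOp]
  rw [occExp, h]
  exact inner_segalOp_self b (n := s.card) (x := occVec' s) fun l hl =>
    amp_occVec_of_length_ne hl

theorem occExp_replace (s : Multiset ℕ) (L₁ L₂ : List (OneParticle × ℝ)) (b : OneParticle)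
    (c c' : ℝ) : occExp s (L₁ ++ (b, c) :: L₂) - occExp s (L₁ ++ (b, c') :: L₂) =
      ((c' - c : ℝ) : ℂ) * occExp s (L₁ ++ L₂) := by
  unfold occExp
  rw [← inner_sub_right, ← inner_smul_right, ← Submodule.coe_sub, prodOp_sub, Submodule.coe_smul]

/-! ## Summability of the Boltzmann factors -/

/-- The bosonic partition function: a multiset of numbers at most N is the multiplicity of N
together with a multiset of smaller numbers. Each mode therefore contributes one geometric series.
-/
theorem sum_multiset_le {q : ℕ → ℝ} (hq : ∀ n, 0 ≤ q n) (hq1 : ∀ n, q n < 1) (N : ℕ)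
    (F : Finset (Multiset ℕ)) (hF : ∀ s ∈ F, ∀ n ∈ s, n < N) :
    ∑ s ∈ F, (s.map q).prod ≤ ∏ n ∈ Finset.range N, (1 - q n)⁻¹ := by
  classical
  induction N generalizing F with
  | zero =>
    have hF' : F ⊆ {0} := by
      intro s hs
      rw [Finset.mem_singleton]
      exact Multiset.eq_zero_of_forall_notMem fun n hn => absurd (hF s hs n hn) (by omega)
    refine (Finset.sum_le_sum_of_subset_of_nonneg hF' fun s hs _ => ?_).trans (by simp)
    rw [Finset.mem_singleton.mp hs]
    simp
  | succ N ih =>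
    have hw : ∀ s : Multiset ℕ, 0 ≤ (s.map q).prod := fun s =>
      Multiset.prod_nonneg fun a ha => by
        obtain ⟨n, -, rfl⟩ := Multiset.mem_map.mp ha
        exact hq n
    let g : Multiset ℕ → ℕ × Multiset ℕ := fun s => (s.count N, s.filter (N ≠ ·))
    have hsplit : ∀ s : Multiset ℕ, Multiset.replicate (s.count N) N + s.filter (N ≠ ·) = s := by
      intro s
      rw [← Multiset.filter_eq s N]
      exact Multiset.filter_add_not _ s
    have hg : Function.Injective g := by
      intro s s' h
      rw [← hsplit s, ← hsplit s']
      simp only [g, Prod.mk.injEq] at h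
      rw [h.1, h.2]
    have hgw : ∀ s : Multiset ℕ, (s.map q).prod = q N ^ (g s).1 * ((g s).2.map q).prod := by
      intro s
      conv_lhs => rw [← hsplit s]
      simp [g]
    have hsub : F.image g ⊆ Finset.range (F.sup (Multiset.count N) + 1) ×ˢ
        F.image (fun s => s.filter (N ≠ ·)) := by
      intro p hp
      obtain ⟨s, hs, rfl⟩ := Finset.mem_image.mp hp
      rw [Finset.mem_product]
      exact ⟨Finset.mem_range.mpr (Nat.lt_succ_of_le (Finset.le_sup (f := Multiset.count N) hs)),
        Finset.mem_image_of_mem _ hs⟩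
    have hgeom : ∀ K, ∑ k ∈ Finset.range K, q N ^ k ≤ (1 - q N)⁻¹ := fun K => by
      rw [← tsum_geometric_of_lt_one (hq N) (hq1 N)]
      exact (summable_geometric_of_lt_one (hq N) (hq1 N)).sum_le_tsum _
        fun k _ => pow_nonneg (hq N) k
    calc ∑ s ∈ F, (s.map q).prod = ∑ p ∈ F.image g, q N ^ p.1 * (p.2.map q).prod := by
          rw [Finset.sum_image fun a _ b _ h => hg h]
          exact Finset.sum_congr rfl fun s _ => hgw s
      _ ≤ ∑ p ∈ Finset.range (F.sup (Multiset.count N) + 1) ×ˢ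
            F.image (fun s => s.filter (N ≠ ·)), q N ^ p.1 * (p.2.map q).prod :=
          Finset.sum_le_sum_of_subset_of_nonneg hsub fun p _ _ =>
            mul_nonneg (pow_nonneg (hq N) _) (hw _)
      _ = (∑ k ∈ Finset.range (F.sup (Multiset.count N) + 1), q N ^ k) *
            ∑ s ∈ F.image (fun s => s.filter (N ≠ ·)), (s.map q).prod := by
          rw [Finset.sum_product, Finset.sum_mul_sum]
      _ ≤ (1 - q N)⁻¹ * ∏ n ∈ Finset.range N, (1 - q n)⁻¹ := by
          refine mul_le_mul (hgeom _) (ih _ ?_) (Finset.sum_nonneg fun s _ => hw s)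
            (inv_nonneg.mpr (sub_nonneg.mpr (hq1 N).le))
          intro s hs n hn
          obtain ⟨r, hr, rfl⟩ := Finset.mem_image.mp hs
          obtain ⟨h1, h2⟩ := Multiset.mem_filter.mp hn
          have := hF r hr n h1
          omega
      _ = _ := by rw [Finset.prod_range_succ, mul_comm]

/-- The infinite product of the (1 − q n)⁻¹ is controlled by (1 − q)⁻¹ = 1 + q/(1 − q) ≤ exp(q/(1 −
q₀)), where q ≤ q₀ < 1. -/
theorem summable_multiset {q : ℕ → ℝ} (hq : ∀ n, 0 ≤ q n) {q₀ : ℝ} (hq₀ : q₀ < 1)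
    (hq1 : ∀ n, q n ≤ q₀) (hs : Summable q) : Summable fun s : Multiset ℕ => (s.map q).prod := by
  have hw : ∀ s : Multiset ℕ, 0 ≤ (s.map q).prod := fun s =>
    Multiset.prod_nonneg fun a ha => by
      obtain ⟨n, -, rfl⟩ := Multiset.mem_map.mp ha
      exact hq n
  refine summable_of_sum_le (c := Real.exp (∑' n, q n / (1 - q₀))) hw fun F => ?_
  obtain ⟨N, hN⟩ : ∃ N, ∀ s ∈ F, ∀ n ∈ s, n < N := by
    refine ⟨(F.sup fun s => s.toFinset.sup id) + 1, fun s hs n hn => Nat.lt_succ_of_le ?_⟩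
    exact (Finset.le_sup (f := id) (Multiset.mem_toFinset.mpr hn)).trans
      (Finset.le_sup (f := fun s : Multiset ℕ => s.toFinset.sup id) hs)
  refine (sum_multiset_le hq (fun n => (hq1 n).trans_lt hq₀) N F hN).trans ?_
  have h1 : ∀ n, (1 - q n)⁻¹ ≤ Real.exp (q n / (1 - q₀)) := fun n => by
    have ha : 0 < 1 - q n := sub_pos.mpr ((hq1 n).trans_lt hq₀)
    have hb : 0 < 1 - q₀ := sub_pos.mpr hq₀
    have hc : (1 - q n)⁻¹ = q n / (1 - q n) + 1 := by field_simp; ring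
    have hd : q n / (1 - q n) ≤ q n / (1 - q₀) :=
      div_le_div_of_nonneg_left (hq n) hb (by linarith [hq1 n])
    rw [hc]
    exact (add_le_add_left hd 1).trans (Real.add_one_le_exp _)
  calc ∏ n ∈ Finset.range N, (1 - q n)⁻¹
      ≤ ∏ n ∈ Finset.range N, Real.exp (q n / (1 - q₀)) :=
        Finset.prod_le_prod (fun n _ => inv_nonneg.mpr (sub_nonneg.mpr ((hq1 n).trans hq₀.le)))
          fun n _ => h1 n
    _ = Real.exp (∑ n ∈ Finset.range N, q n / (1 - q₀)) := (Real.exp_sum _ _).symm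
    _ ≤ _ := Real.exp_le_exp.mpr ((hs.div_const _).sum_le_tsum _ fun n _ =>
        div_nonneg (hq n) (sub_nonneg.mpr hq₀.le))

variable {P : Params}

theorem EigenSystem.boltzmann_eq (S : EigenSystem P) (β : ℝ) (s : Multiset ℕ) :
    S.boltzmann β s = (s.map fun n => Real.exp (-β * S.ω n)).prod := by
  unfold boltzmann
  induction s using Multiset.induction with
  | empty => simp
  | cons a s ih => rw [Multiset.map_cons, Multiset.sum_cons, mul_add, Real.exp_add, ih,
      Multiset.map_cons, Multiset.prod_cons]

theorem EigenSystem.boltzmann_pos (S : EigenSystem P) (β : ℝ) (s : Multiset ℕ) :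
    0 < S.boltzmann β s := Real.exp_pos _

theorem EigenSystem.summable_exp (S : EigenSystem P) {c : ℝ} (hc : 0 < c)
    (hω : ∀ n : ℕ, c * (n + 1) ≤ S.ω n) {β : ℝ} (hβ : 0 < β) :
    Summable fun n => Real.exp (-β * S.ω n) := by
  have h : Summable fun n : ℕ => Real.exp (n * (-(β * c))) :=
    Real.summable_exp_nat_mul_iff.mpr (by nlinarith)
  refine Summable.of_nonneg_of_le (fun n => (Real.exp_pos _).le) (fun n => ?_) h
  refine Real.exp_le_exp.mpr ?_
  nlinarith [mul_le_mul_of_nonneg_left (hω n) hβ.le, mul_pos hβ hc]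

theorem EigenSystem.summable_boltzmann (S : EigenSystem P) {c : ℝ} (hc : 0 < c)
    (hω : ∀ n : ℕ, c * (n + 1) ≤ S.ω n) {β : ℝ} (hβ : 0 < β) : Summable (S.boltzmann β) := by
  have h := summable_multiset (q := fun n => Real.exp (-β * S.ω n)) (q₀ := Real.exp (-β * S.ω 0))
    (fun n => (Real.exp_pos _).le) ?_ (fun n => ?_) (S.summable_exp hc hω hβ)
  · exact h.congr fun s => (S.boltzmann_eq β s).symm
  · rw [Real.exp_lt_one_iff]
    nlinarith [mul_pos hβ (S.ω_pos 0)]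
  · refine Real.exp_le_exp.mpr ?_
    nlinarith [mul_le_mul_of_nonneg_left (S.ω_strictMono.monotone (Nat.zero_le n)) hβ.le]

/-- Each particle has energy at least ω 0, so half of the Boltzmann exponent dominates e^{δ card s},
and with it any polynomial in the particle number. The other half remains as the Boltzmann factor at
inverse temperature β/2, which is still summable. -/
theorem EigenSystem.boltzmann_mul_pow_le (S : EigenSystem P) {β : ℝ} (hβ : 0 < β) (n : ℕ) :
    ∃ C, 0 ≤ C ∧ ∀ s : Multiset ℕ,
      S.boltzmann β s * (2 * (s.card + n + 1)) ^ n ≤ C * S.boltzmann (β / 2) s := by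
  -- Half the smallest energy of a particle, in units of the temperature.
  set δ := β / 2 * S.ω 0
  have hδ : 0 < δ := mul_pos (half_pos hβ) (S.ω_pos 0)
  refine ⟨(2 / δ) ^ n * n.factorial * Real.exp (δ * (n + 1)), by positivity, fun s => ?_⟩
  have hE : S.ω 0 * s.card ≤ (s.map S.ω).sum := by
    induction s using Multiset.induction with
    | empty => simp
    | cons a s ih =>
      have := S.ω_strictMono.monotone (Nat.zero_le a)
      simp only [Multiset.card_cons, Multiset.map_cons, Multiset.sum_cons]
      push_cast
      linarith
  have h1 := Real.pow_div_factorial_le_exp (δ * (s.card + n + 1)) (by positivity) n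
  rw [div_le_iff₀ (by positivity)] at h1
  have h2 : (2 * ((s.card : ℝ) + n + 1)) ^ n ≤
      (2 / δ) ^ n * n.factorial * Real.exp (δ * (n + 1)) * Real.exp (δ * s.card) := by
    have h3 : (2 * ((s.card : ℝ) + n + 1)) ^ n = (2 / δ) ^ n * (δ * (s.card + n + 1)) ^ n := by
      rw [← mul_pow]; congr 1; field_simp
    rw [h3]
    calc (2 / δ) ^ n * (δ * (s.card + n + 1)) ^ n
        ≤ (2 / δ) ^ n * (Real.exp (δ * (s.card + n + 1)) * n.factorial) := by gcongr
      _ = _ := by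
        rw [show δ * ((s.card : ℝ) + n + 1) = δ * (n + 1) + δ * s.card by ring, Real.exp_add]; ring
  have h4 : S.boltzmann β s * Real.exp (δ * s.card) ≤ S.boltzmann (β / 2) s := by
    unfold boltzmann
    rw [← Real.exp_add]
    refine Real.exp_le_exp.mpr ?_
    simp only [δ]
    nlinarith [mul_le_mul_of_nonneg_left hE (half_pos hβ).le]
  calc S.boltzmann β s * (2 * (s.card + n + 1)) ^ n
      ≤ S.boltzmann β s * ((2 / δ) ^ n * n.factorial * Real.exp (δ * (n + 1)) *
        Real.exp (δ * s.card)) := by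
        have := (S.boltzmann_pos β s).le
        gcongr
    _ = (2 / δ) ^ n * n.factorial * Real.exp (δ * (n + 1)) *
        (S.boltzmann β s * Real.exp (δ * s.card)) := by ring
    _ ≤ _ := by gcongr

/-! ## Moment functionals of states -/

/-- The expectations of products of shifted fields in the state `η` are given by the functional
`M`. -/
structure IsMomentFunctional (η : State) (M : List (OneParticle × ℝ) → ℂ) : Prop where
  iff : ∀ L v, η (L.map shiftedField) v ↔ v = M L
  bound : ∀ n, ∃ K, 0 ≤ K ∧ ∀ L : List (OneParticle × ℝ), L.length = n →
    ‖M L‖ ≤ K * (L.map fun p => ‖p.1‖ + |p.2|).prod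
  replace : ∀ L₁ L₂ b c c', M (L₁ ++ (b, c) :: L₂) - M (L₁ ++ (b, c') :: L₂) =
    ((c' - c : ℝ) : ℂ) * M (L₁ ++ L₂)
  nil : M [] = 1
  odd : ∀ b, M [(b, 0)] = 0

theorem EigenSystem.isMomentFunctional_ground (S : EigenSystem P) :
    IsMomentFunctional S.ground (occExp 0) where
  iff L v := by
    rw [ground, vacuum_eq_occVec]
    exact vecExp_occVec 0 L v
  bound n := ⟨(2 * ((0 : Multiset ℕ).card + n + 1)) ^ n, by positivity, fun L hL => by
    subst hL
    exact norm_occExp_le 0 L⟩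
  replace := occExp_replace 0
  nil := occExp_nil 0
  odd := occExp_odd 0

/-- The moment functional of the Gibbs state. -/
def EigenSystem.gibbsExp (S : EigenSystem P) (β : ℝ) (L : List (OneParticle × ℝ)) : ℂ :=
  ∑' s, ((S.boltzmann β s / ∑' r, S.boltzmann β r : ℝ) : ℂ) * occExp s L

/-- The unitary W and the operators T are kept general to cover two cases at once: W = 1 with
shifted fields (the Gibbs state), and W a Weyl operator with unshifted fields (the thermal coherent
state). Both have the same diagonal matrix elements `occExp s L`. -/
theorem EigenSystem.thermalExp_iff (S : EigenSystem P) {c : ℝ} (hc : 0 < c)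
    (hω : ∀ n : ℕ, c * (n + 1) ≤ S.ω n) {β : ℝ} (hβ : 0 < β) (W : Fock ≃ₗᵢ[ℂ] Fock)
    (T : List FockOp) (L : List (OneParticle × ℝ))
    (hT : ∀ s v, VecExp (W (occVec s)) T v ↔ v = occExp s L) :
    (∀ v, S.thermalExp β W T v ↔ v = S.gibbsExp β L) ∧
      (Summable fun s => ((S.boltzmann β s / ∑' r, S.boltzmann β r : ℝ) : ℂ) * occExp s L) ∧
      ∃ K, 0 ≤ K ∧ ∀ L' : List (OneParticle × ℝ), L'.length = L.length →
        ‖S.gibbsExp β L'‖ ≤ K * (L'.map fun p => ‖p.1‖ + |p.2|).prod := by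
  have hsum := S.summable_boltzmann hc hω hβ
  have hsum2 := S.summable_boltzmann hc hω (half_pos hβ)
  obtain ⟨C, hC, hCs⟩ := S.boltzmann_mul_pow_le hβ L.length
  set Z := ∑' r, S.boltzmann β r
  have hZ : 0 ≤ Z := tsum_nonneg fun s => (S.boltzmann_pos β s).le
  have hterm : ∀ L' : List (OneParticle × ℝ), L'.length = L.length → ∀ s,
      ‖((S.boltzmann β s / Z : ℝ) : ℂ) * occExp s L'‖ ≤
      C / Z * (L'.map fun p => ‖p.1‖ + |p.2|).prod * S.boltzmann (β / 2) s := by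
    intro L' hL' s
    have hp : 0 ≤ (L'.map fun p => ‖p.1‖ + |p.2|).prod :=
      List.prod_nonneg fun a ha => by
        obtain ⟨p, -, rfl⟩ := List.mem_map.mp ha
        positivity
    rw [norm_mul, Complex.norm_real,
      Real.norm_of_nonneg (div_nonneg (S.boltzmann_pos β s).le hZ)]
    have h1 := norm_occExp_le s L'
    rw [hL'] at h1
    have hb := (S.boltzmann_pos β s).le
    calc S.boltzmann β s / Z * ‖occExp s L'‖
        ≤ S.boltzmann β s / Z * ((2 * (s.card + L.length + 1)) ^ L.length *
          (L'.map fun p => ‖p.1‖ + |p.2|).prod) := by gcongr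
      _ = S.boltzmann β s * (2 * (s.card + L.length + 1)) ^ L.length *
          ((L'.map fun p => ‖p.1‖ + |p.2|).prod / Z) := by ring
      _ ≤ C * S.boltzmann (β / 2) s * ((L'.map fun p => ‖p.1‖ + |p.2|).prod / Z) := by
          exact mul_le_mul_of_nonneg_right (hCs s) (div_nonneg hp hZ)
      _ = _ := by ring
  have hsummable : Summable fun s => ((S.boltzmann β s / Z : ℝ) : ℂ) * occExp s L :=
    Summable.of_norm_bounded (hsum2.mul_left _) (hterm L rfl)
  refine ⟨fun v => ⟨?_, ?_⟩, hsummable, C / Z * ∑' s, S.boltzmann (β / 2) s,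
    mul_nonneg (div_nonneg hC hZ) (tsum_nonneg fun s => (S.boltzmann_pos _ s).le), ?_⟩
  · rintro ⟨u, hu, -, hv⟩
    have : u = fun s => occExp s L := funext fun s => (hT s _).mp (hu s)
    subst this
    exact hv.tsum_eq.symm
  · rintro rfl
    exact ⟨fun s => occExp s L, fun s => (hT s _).mpr rfl, hsum, hsummable.hasSum⟩
  · intro L' hL'
    refine (tsum_of_norm_bounded (hsum2.mul_left _).hasSum (hterm L' hL')).trans ?_
    rw [tsum_mul_left]
    exact le_of_eq (by ring)

theorem EigenSystem.isMomentFunctional_gibbs (S : EigenSystem P) {c : ℝ} (hc : 0 < c)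
    (hω : ∀ n : ℕ, c * (n + 1) ≤ S.ω n) {β : ℝ} (hβ : 0 < β) :
    IsMomentFunctional (S.gibbs β) (S.gibbsExp β) := by
  have h := fun L : List (OneParticle × ℝ) =>
    S.thermalExp_iff hc hω hβ (LinearIsometryEquiv.refl ℂ Fock)
      (L.map shiftedField) L fun s v => vecExp_occVec s L v
  refine ⟨fun L v => (h L).1 v, fun n => ?_, fun L₁ L₂ b r r' => ?_, ?_, fun b => ?_⟩
  · obtain ⟨K, hK, hKL⟩ := (h (List.replicate n 0)).2.2
    exact ⟨K, hK, fun L hL => hKL L (by simpa using hL)⟩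
  · unfold gibbsExp
    rw [← Summable.tsum_sub (h _).2.1 (h _).2.1, ← tsum_mul_left]
    refine tsum_congr fun s => ?_
    rw [← mul_sub, occExp_replace]
    ring
  · unfold gibbsExp
    simp only [occExp_nil, mul_one]
    rw [← Complex.ofReal_tsum, tsum_div_const, div_self, Complex.ofReal_one]
    exact ((S.summable_boltzmann hc hω hβ).tsum_pos (fun s => (S.boltzmann_pos β s).le) 0
      (S.boltzmann_pos β 0)).ne'
  · unfold gibbsExp
    simp only [occExp_odd, mul_zero, tsum_zero]

/-- Expectations in a coherent state are expectations of shifted fields. -/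
theorem EigenSystem.IsCoherentPair.exists_momentFunctional {S : EigenSystem P}
    {f : ℝ → HSpace P} {η ηf : State} (h : S.IsCoherentPair f η ηf) {c : ℝ} (hc : 0 < c)
    (hω : ∀ n : ℕ, c * (n + 1) ≤ S.ω n) :
    ∃ M, IsMomentFunctional η M ∧ ∀ (L : List OneParticle) (v : ℂ), ηf (L.map segal) v ↔
      v = M (L.map fun b => (b, (⟪b, S.oneParticle f⟫_ℂ).im)) := by
  have hL : ∀ L : List OneParticle,
      (L.map fun b => shift (segal b) (⟪b, S.oneParticle f⟫_ℂ).im) =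
        (L.map fun b => (b, (⟪b, S.oneParticle f⟫_ℂ).im)).map shiftedField := fun L => by
    rw [List.map_map]; rfl
  rcases h with ⟨rfl, rfl⟩ | ⟨β, hβ, rfl, rfl⟩
  · refine ⟨_, S.isMomentFunctional_ground, fun L v => ?_⟩
    have h1 := vecExp_expI (S.oneParticle f) L vacuum v
    rw [hL, vacuum_eq_occVec] at h1
    rw [← vecExp_occVec 0]
    rw [EigenSystem.coherent, EigenSystem.coherentVector, vacuum_eq_occVec]
    exact h1
  · refine ⟨_, S.isMomentFunctional_gibbs hc hω hβ, fun L v => ?_⟩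
    refine (S.thermalExp_iff hc hω hβ (expI (S.field f)) (L.map segal) _ fun s v => ?_).1 v
    have h1 := vecExp_expI (S.oneParticle f) L (occVec s) v
    rw [hL] at h1
    exact h1.trans (vecExp_occVec s _ v)

/-! ## Absolutely continuous functions and their derivatives -/

/-- `F` is absolutely continuous on `[0, L]` with derivative `f`. -/
def IsPrim (L : ℝ) (F f : ℝ → ℂ) : Prop :=
  IntervalIntegrable f volume 0 L ∧ ∀ z ∈ Icc 0 L, F z = F 0 + ∫ y in (0 : ℝ)..z, f y

namespace IsPrim

variable {L : ℝ} {F f G g : ℝ → ℂ}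

theorem intervalIntegrable (h : IsPrim L F f) {a b : ℝ} (ha : a ∈ Icc 0 L) (hb : b ∈ Icc 0 L) :
    IntervalIntegrable f volume a b := by
  refine h.1.mono_set (uIcc_subset_uIcc ?_ ?_) <;> rw [uIcc_of_le (ha.1.trans ha.2)] <;> assumption

theorem sub_eq (h : IsPrim L F f) {a b : ℝ} (ha : a ∈ Icc 0 L) (hb : b ∈ Icc 0 L) :
    F b - F a = ∫ y in a..b, f y := by
  have h0 : (0 : ℝ) ∈ Icc 0 L := ⟨le_rfl, ha.1.trans ha.2⟩
  rw [h.2 b hb, h.2 a ha, add_sub_add_left_eq_sub,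
    intervalIntegral.integral_interval_sub_left (h.intervalIntegrable h0 hb)
      (h.intervalIntegrable h0 ha)]

theorem integral_eq (h : IsPrim L F f) (hL : 0 ≤ L) : ∫ y in (0 : ℝ)..L, f y = F L - F 0 :=
  (h.sub_eq ⟨le_rfl, hL⟩ ⟨hL, le_rfl⟩).symm

theorem continuousOn (h : IsPrim L F f) (hL : 0 ≤ L) : ContinuousOn F (Icc 0 L) := by
  have h1 := intervalIntegral.continuousOn_primitive_interval' h.1 (left_mem_uIcc)
  rw [uIcc_of_le hL] at h1
  exact (continuousOn_const.add h1).congr h.2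

theorem absolutelyContinuousOnInterval (h : IsPrim L F f) (hL : 0 ≤ L) :
    AbsolutelyContinuousOnInterval F 0 L := by
  have h1 := h.1.norm.absolutelyContinuousOnInterval_intervalIntegral (c := 0) left_mem_uIcc
  rw [absolutelyContinuousOnInterval_iff] at h1 ⊢
  intro ε hε
  obtain ⟨δ, hδ, H⟩ := h1 ε hε
  refine ⟨δ, hδ, fun E hE hd => (Finset.sum_le_sum fun i hi => ?_).trans_lt (H E hE hd)⟩
  have hm := hE.1 i hi
  rw [uIcc_of_le hL] at hm
  have h0 : (0 : ℝ) ∈ Icc 0 L := ⟨le_rfl, hL⟩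
  rw [dist_comm, dist_eq_norm, h.sub_eq hm.1 hm.2, dist_comm, Real.dist_eq,
    intervalIntegral.integral_interval_sub_left (h.intervalIntegrable h0 hm.2).norm
      (h.intervalIntegrable h0 hm.1).norm]
  exact intervalIntegral.norm_integral_le_abs_integral_norm

theorem ae_hasDerivAt (h : IsPrim L F f) (hL : 0 ≤ L) :
    ∀ᵐ x, x ∈ uIcc 0 L → HasDerivAt F (f x) x := by
  have h1 : ∀ᵐ x : ℝ, x ≠ 0 := by simp [ae_iff, measure_singleton]
  have h2 : ∀ᵐ x : ℝ, x ≠ L := by simp [ae_iff, measure_singleton]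
  filter_upwards [h.1.ae_hasDerivAt_integral, h1, h2] with x hx hx0 hxL hxm
  have h3 := hx hxm 0 left_mem_uIcc
  rw [uIcc_of_le hL] at hxm
  refine (h3.const_add (F 0)).congr_of_eventuallyEq ?_
  filter_upwards [Icc_mem_nhds (lt_of_le_of_ne hxm.1 hx0.symm) (lt_of_le_of_ne hxm.2 hxL)] with y hy
  exact h.2 y hy

/-- The difference of F and the primitive of f is absolutely continuous with zero derivative almost
everywhere, hence constant. The product and sum rules thereby reduce to almost-everywhere
derivatives. -/
theorem of_absolutelyContinuous (hL : 0 ≤ L) (hF : AbsolutelyContinuousOnInterval F 0 L)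
    (hf : IntervalIntegrable f volume 0 L) (hd : ∀ᵐ x, x ∈ uIcc 0 L → HasDerivAt F (f x) x) :
    IsPrim L F f := by
  have hP : IsPrim L (fun z => ∫ y in (0 : ℝ)..z, f y) f := ⟨hf, fun z _ => by simp⟩
  obtain ⟨C, hC⟩ := (hF.fun_sub
    (hP.absolutelyContinuousOnInterval hL)).const_of_ae_hasDerivAt_zero (by
      filter_upwards [hd, hP.ae_hasDerivAt hL] with x h1 h2 hx
      exact ((h1 hx).sub (h2 hx)).congr_deriv (sub_self _))
  refine ⟨hf, fun z hz => ?_⟩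
  rw [uIcc_of_le hL] at hC
  have h0 := hC 0 ⟨le_rfl, hL⟩
  have hz' := hC z hz
  simp only [intervalIntegral.integral_same, sub_zero] at h0
  rw [h0, ← hz']
  ring

theorem congr_ae (h : IsPrim L F f) (hL : 0 ≤ L) (hfg : ∀ᵐ x, x ∈ uIcc 0 L → f x = g x) :
    IsPrim L F g := by
  have hfg' : ∀ᵐ x, x ∈ uIoc 0 L → f x = g x := by
    filter_upwards [hfg] with x hx hxm using hx (uIoc_subset_uIcc hxm)
  refine of_absolutelyContinuous hL (h.absolutelyContinuousOnInterval hL)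
    (h.1.congr_ae ((ae_restrict_iff' measurableSet_uIoc).mpr hfg')) ?_
  filter_upwards [h.ae_hasDerivAt hL, hfg] with x h1 h2 hx
  rw [← h2 hx]
  exact h1 hx

theorem mul (h : IsPrim L F f) (h' : IsPrim L G g) (hL : 0 ≤ L) :
    IsPrim L (fun z => F z * G z) (fun z => f z * G z + F z * g z) := by
  refine of_absolutelyContinuous hL
    ((h.absolutelyContinuousOnInterval hL).fun_smul (h'.absolutelyContinuousOnInterval hL)) ?_ ?_
  · have hF := h.continuousOn hL
    have hG := h'.continuousOn hL
    rw [← uIcc_of_le hL] at hF hG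
    exact (h.1.mul_continuousOn hG).add (h'.1.continuousOn_mul hF)
  · filter_upwards [h.ae_hasDerivAt hL, h'.ae_hasDerivAt hL] with x h1 h2 hx
    exact (h1 hx).mul (h2 hx)

theorem add (h : IsPrim L F f) (h' : IsPrim L G g) (hL : 0 ≤ L) :
    IsPrim L (fun z => F z + G z) (fun z => f z + g z) := by
  refine of_absolutelyContinuous hL
    ((h.absolutelyContinuousOnInterval hL).fun_add (h'.absolutelyContinuousOnInterval hL))
    (h.1.add h'.1) ?_
  filter_upwards [h.ae_hasDerivAt hL, h'.ae_hasDerivAt hL] with x h1 h2 hx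
  exact (h1 hx).add (h2 hx)

theorem const_mul (h : IsPrim L F f) (c : ℂ) : IsPrim L (fun z => c * F z) (fun z => c * f z) :=
  ⟨h.1.const_mul c, fun z hz => by
    simp only [intervalIntegral.integral_const_mul]
    rw [h.2 z hz, mul_add]⟩

theorem conj (h : IsPrim L F f) : IsPrim L (fun z => starRingEnd ℂ (F z))
    (fun z => starRingEnd ℂ (f z)) :=
  ⟨⟨Complex.conjCLE.integrable_comp_iff.mpr h.1.1, Complex.conjCLE.integrable_comp_iff.mpr h.1.2⟩,
    fun z hz => by
      simp only
      rw [h.2 z hz, map_add]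
      congr 1
      rw [intervalIntegral.integral_of_le hz.1, intervalIntegral.integral_of_le hz.1]
      exact integral_conj.symm⟩

theorem of_hasDerivAt (hF : ∀ z, HasDerivAt F (f z) z) (hf : Continuous f) : IsPrim L F f :=
  ⟨hf.intervalIntegrable _ _, fun z _ => by
    rw [intervalIntegral.integral_eq_sub_of_hasDerivAt (fun x _ => hF x)
      (hf.intervalIntegrable _ _)]
    ring⟩

theorem const_of_zero (h : IsPrim L F f) (hL : 0 ≤ L) (hf : ∀ᵐ x, x ∈ uIcc 0 L → f x = 0) {z : ℝ}
    (hz : z ∈ Icc 0 L) : F z = F 0 := by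
  have h1 := (h.congr_ae (g := fun _ => 0) hL hf).2 z hz
  simpa using h1

theorem norm_le (h : IsPrim L F f) {C : ℝ} (hf : ∀ z ∈ Icc 0 L, ‖f z‖ ≤ C) {a b : ℝ}
    (ha : a ∈ Icc 0 L) (hb : b ∈ Icc 0 L) : ‖F b - F a‖ ≤ C * |b - a| := by
  rw [h.sub_eq ha hb]
  refine intervalIntegral.norm_integral_le_of_norm_le_const fun x hx => hf x ?_
  have := uIcc_subset_Icc ha hb (uIoc_subset_uIcc hx)
  exact this

end IsPrim

/-! ## The equation `u'' = κ² u + g` -/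

/-- A fundamental system of solutions of `u'' = l u`. -/
structure FundSys (l : ℂ) (c s : ℝ → ℂ) : Prop where
  deriv_c : ∀ z, HasDerivAt c (l * s z) z
  deriv_s : ∀ z, HasDerivAt s (c z) z
  c_zero : c 0 = 1
  s_zero : s 0 = 0
  wronskian : ∀ z, c z ^ 2 - l * s z ^ 2 = 1

namespace FundSys

theorem exists_fundSys (l : ℂ) : ∃ c s, FundSys l c s := by
  obtain ⟨κ, hκ⟩ : ∃ κ : ℂ, κ ^ 2 = l := IsAlgClosed.exists_pow_nat_eq l two_pos
  have hlin : ∀ z : ℝ, HasDerivAt (fun z : ℝ => κ * (z : ℂ)) κ z := fun z => by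
    simpa using (Complex.ofRealCLM.hasDerivAt (x := z)).const_mul κ
  by_cases h0 : κ = 0
  · subst h0
    refine ⟨fun _ => 1, fun z => z, ?_, ?_, rfl, by simp, ?_⟩
    · intro z; rw [← hκ]; simpa using hasDerivAt_const z (1 : ℂ)
    · intro z; exact Complex.ofRealCLM.hasDerivAt
    · intro z; rw [← hκ]; simp
  · refine ⟨fun z => Complex.cosh (κ * z), fun z => Complex.sinh (κ * z) / κ, ?_, ?_, by simp,
      by simp, ?_⟩
    · intro z
      have h := (Complex.hasDerivAt_cosh (κ * z)).comp z (hlin z)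
      refine h.congr_deriv ?_
      rw [← hκ]; field_simp
    · intro z
      have h := ((Complex.hasDerivAt_sinh (κ * z)).comp z (hlin z)).div_const κ
      refine h.congr_deriv ?_
      field_simp
    · intro z
      rw [← hκ]
      field_simp
      linear_combination Complex.cosh_sq (κ * z)

theorem trig {k : ℝ} (hk : k ≠ 0) : FundSys (-(k : ℂ) ^ 2) (fun z => (Real.cos (k * z) : ℂ))
    (fun z => (Real.sin (k * z) / k : ℝ)) := by
  have hk' : (k : ℂ) ≠ 0 := by exact_mod_cast hk
  refine ⟨fun z => ?_, fun z => ?_, by simp, by simp, fun z => ?_⟩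
  · have h : HasDerivAt (fun z : ℝ => Real.cos (k * z)) (-Real.sin (k * z) * (k * 1)) z :=
      ((hasDerivAt_id z).const_mul k).cos
    refine h.ofReal_comp.congr_deriv ?_
    push_cast; field_simp
  · have h : HasDerivAt (fun z : ℝ => Real.sin (k * z) / k) (Real.cos (k * z) * (k * 1) / k) z :=
      ((hasDerivAt_id z).const_mul k).sin.div_const k
    refine h.ofReal_comp.congr_deriv ?_
    push_cast; field_simp
  · have h := Real.sin_sq_add_cos_sq (k * z)
    have h' : ((Real.sin (k * z) : ℝ) : ℂ) ^ 2 + ((Real.cos (k * z) : ℝ) : ℂ) ^ 2 = 1 := by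
      exact_mod_cast h
    rw [Complex.ofReal_div]
    field_simp
    linear_combination h'

variable {l : ℂ} {c s : ℝ → ℂ}

theorem continuous_c (hS : FundSys l c s) : Continuous c :=
  continuous_iff_continuousAt.mpr fun z => (hS.deriv_c z).continuousAt

theorem continuous_s (hS : FundSys l c s) : Continuous s :=
  continuous_iff_continuousAt.mpr fun z => (hS.deriv_s z).continuousAt

theorem isPrim_c (hS : FundSys l c s) (L : ℝ) : IsPrim L c (fun z => l * s z) :=
  IsPrim.of_hasDerivAt hS.deriv_c (continuous_const.mul hS.continuous_s)

theorem isPrim_s (hS : FundSys l c s) (L : ℝ) : IsPrim L s c :=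
  IsPrim.of_hasDerivAt hS.deriv_s hS.continuous_c

/-- Solutions of the homogeneous equation are determined by their Cauchy data. -/
theorem eq_of_solution (hS : FundSys l c s) {L : ℝ} (hL : 0 ≤ L) {u v w : ℝ → ℂ}
    (hu : IsPrim L u v) (hv : IsPrim L v w) (hw : ∀ᵐ x, x ∈ uIcc 0 L → w x = l * u x) {z : ℝ}
    (hz : z ∈ Icc 0 L) :
    u z = u 0 * c z + v 0 * s z ∧ v z = l * (u 0 * s z) + v 0 * c z := by
  -- The Wronskian-type combinations u c − v s and v c − l u s have zero derivative, so they keep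
  -- their initial values u 0 and v 0. Since c² − l s² = 1, this linear system can be solved for u z
  -- and v z.
  have h1 := ((hu.mul (hS.isPrim_c L) hL).add ((hv.mul (hS.isPrim_s L) hL).const_mul (-1))
    hL).const_of_zero hL (by
      filter_upwards [hw] with x hx hxm
      rw [hx hxm]; ring) hz
  have h2 := ((hv.mul (hS.isPrim_c L) hL).add ((hu.mul (hS.isPrim_s L) hL).const_mul (-l))
    hL).const_of_zero hL (by
      filter_upwards [hw] with x hx hxm
      rw [hx hxm]; ring) hz
  have hW := hS.wronskian z
  simp only [hS.c_zero, hS.s_zero, mul_one, mul_zero, add_zero] at h1 h2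
  constructor
  · rw [← h1, ← h2]
    linear_combination -(u z) * hW
  · rw [← h1, ← h2]
    linear_combination -(v z) * hW

/-- Variation of parameters. -/
def sol (c s g : ℝ → ℂ) (A B : ℂ) (z : ℝ) : ℂ :=
  c z * (A + -1 * ∫ y in (0 : ℝ)..z, s y * g y) + s z * (B + ∫ y in (0 : ℝ)..z, c y * g y)

/-- The derivative of the solution given by variation of parameters. -/
def solDeriv (l : ℂ) (c s g : ℝ → ℂ) (A B : ℂ) (z : ℝ) : ℂ :=
  l * s z * (A + -1 * ∫ y in (0 : ℝ)..z, s y * g y) + c z * (B + ∫ y in (0 : ℝ)..z, c y * g y)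

theorem isPrim_primitive {L : ℝ} {g : ℝ → ℂ} (hg : IntervalIntegrable g volume 0 L) (A : ℂ) :
    IsPrim L (fun z => A + ∫ y in (0 : ℝ)..z, g y) g := ⟨hg, fun z _ => by simp⟩

/-- The terms with g cancel in the first derivative. In the second they combine to (c² − l s²) g =
g. -/
theorem isPrim_sol (hS : FundSys l c s) {L : ℝ} (hL : 0 ≤ L) {g : ℝ → ℂ}
    (hg : IntervalIntegrable g volume 0 L) (A B : ℂ) :
    IsPrim L (sol c s g A B) (solDeriv l c s g A B) ∧
      IsPrim L (solDeriv l c s g A B) (fun z => l * sol c s g A B z + g z) := by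
  have hsg : IntervalIntegrable (fun y => s y * g y) volume 0 L :=
    hg.continuousOn_mul hS.continuous_s.continuousOn
  have hcg : IntervalIntegrable (fun y => c y * g y) volume 0 L :=
    hg.continuousOn_mul hS.continuous_c.continuousOn
  have h1 : IsPrim L (fun z => A + -1 * ∫ y in (0 : ℝ)..z, s y * g y) (fun y => -1 * (s y * g y)) :=
    ⟨hsg.const_mul (-1), fun z _ => by simp⟩
  have h2 := isPrim_primitive hcg B
  constructor
  · refine (((hS.isPrim_c L).mul h1 hL).add ((hS.isPrim_s L).mul h2 hL) hL).congr_ae hL ?_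
    refine ae_of_all _ fun x _ => ?_
    simp only [solDeriv]
    ring
  · refine ((((hS.isPrim_s L).const_mul l).mul h1 hL).add
      ((hS.isPrim_c L).mul h2 hL) hL).congr_ae hL ?_
    refine ae_of_all _ fun x _ => ?_
    simp only [sol]
    linear_combination g x * hS.wronskian x

theorem sol_zero (hS : FundSys l c s) (g : ℝ → ℂ) (A B : ℂ) : sol c s g A B 0 = A := by
  simp [sol, hS.c_zero, hS.s_zero]

theorem solDeriv_zero (hS : FundSys l c s) (g : ℝ → ℂ) (A B : ℂ) :
    solDeriv l c s g A B 0 = B := by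
  simp [solDeriv, hS.c_zero, hS.s_zero]

end FundSys

variable {P : Params}

/-! ## The Hilbert space of bulk and boundary functions -/

theorem Params.rho_pos (P : Params) : 0 < P.rho := P.det_pos

instance (P : Params) : IsFiniteMeasure P.bulkMeasure := by
  unfold Params.bulkMeasure
  infer_instance

theorem BdryLine.inner_def (x y : BdryLine P) :
    ⟪x, y⟫_ℂ = ((P.rho⁻¹ : ℝ) : ℂ) * (starRingEnd ℂ x.val * y.val) := rfl

theorem hspace_inner (φ χ : HSpace P) : ⟪φ, χ⟫_ℂ =
    ∫ z, starRingEnd ℂ (φ.fst z) * χ.fst z ∂P.bulkMeasure +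
      ((P.rho⁻¹ : ℝ) : ℂ) * (starRingEnd ℂ φ.snd.val * χ.snd.val) := by
  have h : ⟪φ, χ⟫_ℂ = ⟪φ.fst, χ.fst⟫_ℂ + ⟪φ.snd, χ.snd⟫_ℂ := WithLp.prod_inner_apply φ χ
  rw [h, BdryLine.inner_def]
  congr 1
  have h2 := L2.inner_def (𝕜 := ℂ) φ.fst χ.fst
  refine h2.trans (integral_congr_ae (ae_of_all _ fun z => ?_))
  simp only [RCLike.inner_apply]
  exact mul_comm _ _

theorem integrable_hspace_mul (φ χ : HSpace P) :
    Integrable (fun z => starRingEnd ℂ (φ.fst z) * χ.fst z) P.bulkMeasure := by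
  refine (L2.integrable_inner (𝕜 := ℂ) φ.fst χ.fst).congr (ae_of_all _ fun z => ?_)
  simp only [RCLike.inner_apply]
  exact mul_comm _ _

theorem integrable_hspace_sq (φ : HSpace P) :
    Integrable (fun z => ‖φ.fst z‖ ^ 2) P.bulkMeasure :=
  (Lp.memLp φ.fst).integrable_norm_pow (by norm_num)

theorem hspace_norm_sq (φ : HSpace P) : ‖φ‖ ^ 2 =
    ∫ z, ‖φ.fst z‖ ^ 2 ∂P.bulkMeasure + P.rho⁻¹ * ‖φ.snd.val‖ ^ 2 := by
  have h := hspace_inner φ φ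
  rw [inner_self_eq_norm_sq_to_K] at h
  have h1 : ∀ z, starRingEnd ℂ (φ.fst z) * φ.fst z = ((‖φ.fst z‖ ^ 2 : ℝ) : ℂ) := fun z => by
    rw [RCLike.conj_mul]; simp
  simp only [h1] at h
  have h2 : ∫ z, ((‖φ.fst z‖ ^ 2 : ℝ) : ℂ) ∂P.bulkMeasure =
      ((∫ z, ‖φ.fst z‖ ^ 2 ∂P.bulkMeasure : ℝ) : ℂ) := integral_ofReal
  rw [RCLike.conj_mul, h2] at h
  refine Complex.ofReal_injective ?_
  rw [Complex.ofReal_add, Complex.ofReal_mul, Complex.ofReal_pow, Complex.ofReal_pow]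
  exact h

theorem hspace_ext {φ χ : HSpace P} (h1 : ⇑φ.fst =ᵐ[P.bulkMeasure] χ.fst)
    (h2 : φ.snd.val = χ.snd.val) : φ = χ :=
  WithLp.ofLp_injective 2 (Prod.ext (Lp.ext h1) h2)

theorem exists_hspace {g : ℝ → ℂ} (hg : MemLp g 2 P.bulkMeasure) (r : ℂ) :
    ∃ φ : HSpace P, ⇑φ.fst =ᵐ[P.bulkMeasure] g ∧ φ.snd.val = r :=
  ⟨WithLp.toLp 2 (hg.toLp g, (r : ℂ)), hg.coeFn_toLp, rfl⟩

theorem hspace_add_fst (φ χ : HSpace P) :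
    ⇑(φ + χ).fst =ᵐ[P.bulkMeasure] fun z => φ.fst z + χ.fst z := Lp.coeFn_add φ.fst χ.fst

theorem hspace_smul_fst (c : ℂ) (φ : HSpace P) :
    ⇑(c • φ).fst =ᵐ[P.bulkMeasure] fun z => c * φ.fst z := Lp.coeFn_smul c φ.fst

theorem hspace_zero_fst : ⇑(0 : HSpace P).fst =ᵐ[P.bulkMeasure] fun _ => (0 : ℂ) :=
  Lp.coeFn_zero ℂ 2 P.bulkMeasure

theorem hspace_add_snd (φ χ : HSpace P) : (φ + χ).snd.val = φ.snd.val + χ.snd.val := rfl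

theorem hspace_smul_snd (c : ℂ) (φ : HSpace P) : (c • φ).snd.val = c * φ.snd.val := rfl

theorem hspace_zero_snd : (0 : HSpace P).snd.val = 0 := rfl

theorem norm_snd_le (φ : HSpace P) : ‖φ.snd.val‖ ^ 2 ≤ P.rho * ‖φ‖ ^ 2 := by
  have h := hspace_norm_sq φ
  have h1 : 0 ≤ ∫ z, ‖φ.fst z‖ ^ 2 ∂P.bulkMeasure := integral_nonneg fun z => by positivity
  have hr := P.rho_pos
  have h2 : P.rho * ‖φ‖ ^ 2 = P.rho * (∫ z, ‖φ.fst z‖ ^ 2 ∂P.bulkMeasure) + ‖φ.snd.val‖ ^ 2 := by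
    rw [h]; field_simp
  nlinarith [mul_nonneg hr.le h1]

theorem integral_norm_fst_le (φ : HSpace P) :
    ∫ z, ‖φ.fst z‖ ∂P.bulkMeasure ≤ (P.ell + 1) * ‖φ‖ := by
  have hμ : P.bulkMeasure.real univ = P.ell := by
    simp [Params.bulkMeasure, Measure.real, P.ell_pos.le]
  have hsq : ∫ z, ‖φ.fst z‖ ^ 2 ∂P.bulkMeasure ≤ ‖φ‖ ^ 2 := by
    rw [hspace_norm_sq φ]
    have := P.rho_pos
    have : 0 ≤ P.rho⁻¹ * ‖φ.snd.val‖ ^ 2 := by positivity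
    linarith
  rcases (norm_nonneg φ).eq_or_lt with h0 | h0
  · have hz : φ = 0 := norm_eq_zero.mp h0.symm
    subst hz
    rw [integral_congr_ae (g := fun _ => (0 : ℝ)) (by
      filter_upwards [hspace_zero_fst (P := P)] with z hz
      rw [hz, norm_zero])]
    simp
  · have hb : ∀ z, ‖φ.fst z‖ ≤ ‖φ‖ + ‖φ.fst z‖ ^ 2 * ‖φ‖⁻¹ := fun z => by
      have h1 : ‖φ.fst z‖ * ‖φ‖ ≤ ‖φ‖ * ‖φ‖ + ‖φ.fst z‖ ^ 2 := by
        nlinarith [sq_nonneg (‖φ.fst z‖ - ‖φ‖), sq_nonneg ‖φ.fst z‖, sq_nonneg ‖φ‖]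
      rw [← div_eq_mul_inv, ← sub_le_iff_le_add', le_div_iff₀ h0]
      linarith
    calc ∫ z, ‖φ.fst z‖ ∂P.bulkMeasure
        ≤ ∫ z, (‖φ‖ + ‖φ.fst z‖ ^ 2 * ‖φ‖⁻¹) ∂P.bulkMeasure :=
          integral_mono_of_nonneg (ae_of_all _ fun z => norm_nonneg _)
            ((integrable_const _).add ((integrable_hspace_sq φ).mul_const _)) (ae_of_all _ hb)
      _ = P.ell * ‖φ‖ + (∫ z, ‖φ.fst z‖ ^ 2 ∂P.bulkMeasure) * ‖φ‖⁻¹ := by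
          rw [integral_add (integrable_const _) ((integrable_hspace_sq φ).mul_const _),
            integral_const, integral_mul_const, hμ, smul_eq_mul]
      _ ≤ P.ell * ‖φ‖ + ‖φ‖ ^ 2 * ‖φ‖⁻¹ := by gcongr
      _ = (P.ell + 1) * ‖φ‖ := by field_simp

theorem bulk_integral (P : Params) (f : ℝ → ℂ) :
    ∫ z, f z ∂P.bulkMeasure = ∫ z in (0 : ℝ)..P.ell, f z := by
  rw [intervalIntegral.integral_of_le P.ell_pos.le, integral_Ioc_eq_integral_Ioo]
  rfl

theorem bulk_integrable_iff (P : Params) (f : ℝ → ℂ) :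
    Integrable f P.bulkMeasure ↔ IntervalIntegrable f volume 0 P.ell := by
  rw [intervalIntegrable_iff_integrableOn_Ioo_of_le P.ell_pos.le]
  rfl

theorem bulk_ae_iff (P : Params) {p : ℝ → Prop} :
    (∀ᵐ z ∂P.bulkMeasure, p z) ↔ ∀ᵐ z, z ∈ uIcc 0 P.ell → p z := by
  have h0 : ∀ᵐ x : ℝ, x ≠ 0 := by simp [ae_iff, measure_singleton]
  have h1 : ∀ᵐ x : ℝ, x ≠ P.ell := by simp [ae_iff, measure_singleton]
  rw [Params.bulkMeasure, ae_restrict_iff' measurableSet_Ioo, uIcc_of_le P.ell_pos.le]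
  constructor
  · intro h
    filter_upwards [h, h0, h1] with x hx hx0 hx1 hm
    exact hx ⟨lt_of_le_of_ne hm.1 hx0.symm, lt_of_le_of_ne hm.2 hx1⟩
  · intro h
    filter_upwards [h] with x hx hm
    exact hx ⟨hm.1.le, hm.2.le⟩

/-! ## The operator `A` -/

/-- The data of an element of the graph of `A`: the derivatives `v`, `w` of `u`. -/
structure Params.OpData (P : Params) (u v w : ℝ → ℂ) (φ χ : HSpace P) : Prop where
  memLp : MemLp w 2 P.bulkMeasure
  prim_u : IsPrim P.ell u v
  prim_v : IsPrim P.ell v w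
  fst_eq : ⇑φ.fst =ᵐ[P.bulkMeasure] u
  bc : (Real.cos P.α : ℂ) * u 0 + (Real.sin P.α : ℂ) * v 0 = 0
  snd_eq : φ.snd.val = (P.b₁' : ℂ) * u P.ell - (P.b₂' : ℂ) * v P.ell
  fst_eq' : ⇑χ.fst =ᵐ[P.bulkMeasure] fun z => -w z + (P.m : ℂ) ^ 2 * u z
  snd_eq' : χ.snd.val = -((P.b₁ : ℂ) * u P.ell - (P.b₂ : ℂ) * v P.ell)

theorem opGraph_iff {u : ℝ → ℂ} {φ χ : HSpace P} :
    P.OpGraph u φ χ ↔ ∃ v w, P.OpData u v w φ χ := by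
  constructor
  · rintro ⟨v, w, hw, hu, hv, h1, h2, h3, h4, h5⟩
    have hv' : IsPrim P.ell v w :=
      ⟨(bulk_integrable_iff P w).mp (hw.integrable (by norm_num)), hv⟩
    have hc := hv'.continuousOn P.ell_pos.le
    rw [← uIcc_of_le P.ell_pos.le] at hc
    exact ⟨v, w, hw, ⟨hc.intervalIntegrable, hu⟩, hv', h1, h2, h3, h4, h5⟩
  · rintro ⟨v, w, h⟩
    exact ⟨v, w, h.memLp, h.prim_u.2, h.prim_v.2, h.fst_eq, h.bc, h.snd_eq, h.fst_eq', h.snd_eq'⟩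

namespace Params.OpData

variable {u v w u' v' w' : ℝ → ℂ} {φ χ φ' χ' : HSpace P}

theorem opGraph (h : P.OpData u v w φ χ) : P.OpGraph u φ χ := opGraph_iff.mpr ⟨v, w, h⟩

theorem add (h : P.OpData u v w φ χ) (h' : P.OpData u' v' w' φ' χ') :
    P.OpData (fun z => u z + u' z) (fun z => v z + v' z) (fun z => w z + w' z)
      (φ + φ') (χ + χ') where
  memLp := h.memLp.add h'.memLp
  prim_u := h.prim_u.add h'.prim_u P.ell_pos.le
  prim_v := h.prim_v.add h'.prim_v P.ell_pos.le
  fst_eq := by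
    filter_upwards [hspace_add_fst φ φ', h.fst_eq, h'.fst_eq] with z h1 h2 h3
    rw [h1, h2, h3]
  bc := by linear_combination h.bc + h'.bc
  snd_eq := by rw [hspace_add_snd, h.snd_eq, h'.snd_eq]; ring
  fst_eq' := by
    filter_upwards [hspace_add_fst χ χ', h.fst_eq', h'.fst_eq'] with z h1 h2 h3
    rw [h1, h2, h3]; ring
  snd_eq' := by rw [hspace_add_snd, h.snd_eq', h'.snd_eq']; ring

theorem smul (h : P.OpData u v w φ χ) (c : ℂ) :
    P.OpData (fun z => c * u z) (fun z => c * v z) (fun z => c * w z) (c • φ) (c • χ) where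
  memLp := h.memLp.const_mul c
  prim_u := h.prim_u.const_mul c
  prim_v := h.prim_v.const_mul c
  fst_eq := by
    filter_upwards [hspace_smul_fst c φ, h.fst_eq] with z h1 h2
    rw [h1, h2]
  bc := by linear_combination c * h.bc
  snd_eq := by rw [hspace_smul_snd, h.snd_eq]; ring
  fst_eq' := by
    filter_upwards [hspace_smul_fst c χ, h.fst_eq'] with z h1 h2
    rw [h1, h2]; ring
  snd_eq' := by rw [hspace_smul_snd, h.snd_eq']; ring

theorem ode (h : P.OpData u v w φ χ) :
    ∀ᵐ z, z ∈ uIcc 0 P.ell → w z = (P.m : ℂ) ^ 2 * u z - χ.fst z := by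
  rw [← bulk_ae_iff]
  filter_upwards [h.fst_eq'] with z hz
  rw [hz]; ring

/-- Lagrange identity: `A` is symmetric. -/
theorem inner_eq (h : P.OpData u v w φ χ) (h' : P.OpData u' v' w' φ' χ') :
    ⟪χ, φ'⟫_ℂ = ⟪φ, χ'⟫_ℂ := by
  have hL := P.ell_pos.le
  have hr : (P.rho : ℂ) ≠ 0 := by exact_mod_cast P.rho_pos.ne'
  have hI := (((h.prim_v.conj.mul h'.prim_u hL).const_mul (-1)).add
    (h.prim_u.conj.mul h'.prim_v hL) hL).integral_eq hL
  -- Both sets of Cauchy data at 0 are orthogonal to the same real vector (cos α, sin α), so their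
  -- determinant vanishes.
  have h0 : starRingEnd ℂ (u 0) * v' 0 - starRingEnd ℂ (v 0) * u' 0 = 0 := by
    have e1 := congrArg (starRingEnd ℂ) h.bc
    have e2 := h'.bc
    simp only [map_add, map_mul, Complex.conj_ofReal, map_zero] at e1
    have hcs : (Real.cos P.α : ℂ) ^ 2 + (Real.sin P.α : ℂ) ^ 2 = 1 := by
      exact_mod_cast Real.cos_sq_add_sin_sq P.α
    linear_combination (-(starRingEnd ℂ (u 0) * v' 0 - starRingEnd ℂ (v 0) * u' 0)) * hcs +
      ((Real.cos P.α : ℂ) * v' 0 - (Real.sin P.α : ℂ) * u' 0) * e1 +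
      ((Real.sin P.α : ℂ) * starRingEnd ℂ (u 0) - (Real.cos P.α : ℂ) * starRingEnd ℂ (v 0)) * e2
  rw [hspace_inner, hspace_inner, ← sub_eq_zero, add_sub_add_comm,
    ← integral_sub (integrable_hspace_mul χ φ') (integrable_hspace_mul φ χ')]
  have hint : ∫ z, (starRingEnd ℂ (χ.fst z) * φ'.fst z - starRingEnd ℂ (φ.fst z) * χ'.fst z)
      ∂P.bulkMeasure = (starRingEnd ℂ (u P.ell) * v' P.ell -
        starRingEnd ℂ (v P.ell) * u' P.ell) := by
    rw [bulk_integral]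
    rw [intervalIntegral.integral_congr_ae (g := fun z => -1 * (starRingEnd ℂ (w z) * u' z +
      starRingEnd ℂ (v z) * v' z) + (starRingEnd ℂ (v z) * v' z + starRingEnd ℂ (u z) * w' z)), hI]
    · linear_combination -h0
    · have hae := bulk_ae_iff P |>.mp (h.fst_eq.and (h'.fst_eq.and (h.fst_eq'.and h'.fst_eq')))
      filter_upwards [hae] with z hz hm
      obtain ⟨e1, e2, e3, e4⟩ := hz (uIoc_subset_uIcc hm)
      rw [e1, e2, e3, e4]
      simp only [map_add, map_neg, map_mul, map_pow, Complex.conj_ofReal]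
      ring
  -- The boundary term left at ℓ is cancelled by the second components: the determinant of the
  -- boundary coefficients is ρ, matching the weight ρ⁻¹ of the inner product.
  rw [hint, h.snd_eq, h'.snd_eq, h.snd_eq', h'.snd_eq']
  have hrho : (P.rho : ℂ) = P.b₁' * P.b₂ - P.b₁ * P.b₂' := by simp [Params.rho]
  simp only [map_sub, map_neg, map_mul, Complex.conj_ofReal, Complex.ofReal_inv]
  have hinv : (P.rho : ℂ)⁻¹ * P.rho = 1 := inv_mul_cancel₀ hr
  rw [hrho] at hinv ⊢
  linear_combination -(starRingEnd ℂ (u P.ell) * v' P.ell -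
    starRingEnd ℂ (v P.ell) * u' P.ell) * hinv

/-- A continuous function vanishing almost everywhere on the interval vanishes on its closure; the
same then holds for its derivative. So an element of the domain with zero bulk component also has
zero boundary component. -/
theorem eqOn_zero_of_fst (h : P.OpData u v w φ χ)
    (hφ : ⇑φ.fst =ᵐ[P.bulkMeasure] fun _ => (0 : ℂ)) : ∀ z ∈ Icc 0 P.ell, u z = 0 ∧ v z = 0 := by
  have hL := P.ell_pos.le
  have hz : ∀ f g : ℝ → ℂ, IsPrim P.ell f g → (f =ᵐ[P.bulkMeasure] fun _ => (0 : ℂ)) →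
      ∀ z ∈ Icc 0 P.ell, f z = 0 := by
    intro f g hf h0
    have hf' := hf.continuousOn hL
    have h1 : EqOn f (fun _ => (0 : ℂ)) (Ioo 0 P.ell) :=
      Measure.eqOn_open_of_ae_eq h0 isOpen_Ioo (hf'.mono Ioo_subset_Icc_self) continuousOn_const
    have h2 := h1.of_subset_closure hf' continuousOn_const Ioo_subset_Icc_self
      (closure_Ioo P.ell_pos.ne).ge
    exact fun z hz => h2 hz
  have hu0 := hz u v h.prim_u (by
    filter_upwards [h.fst_eq, hφ] with z h1 h2
    rw [← h1, h2])
  refine fun z hzm => ⟨hu0 z hzm, hz v w h.prim_v ?_ z hzm⟩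
  refine (bulk_ae_iff P).mpr ?_
  have h0 : ∀ᵐ x : ℝ, x ≠ 0 := by simp [ae_iff, measure_singleton]
  have h1 : ∀ᵐ x : ℝ, x ≠ P.ell := by simp [ae_iff, measure_singleton]
  filter_upwards [h.prim_u.ae_hasDerivAt hL, h0, h1] with x hx hx0 hx1 hm
  have hd := hx hm
  rw [uIcc_of_le hL] at hm
  refine hd.unique ((hasDerivAt_const x (0 : ℂ)).congr_of_eventuallyEq ?_)
  filter_upwards [Icc_mem_nhds (lt_of_le_of_ne hm.1 hx0.symm) (lt_of_le_of_ne hm.2 hx1)] with y hy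
  exact hu0 y hy

theorem eqOn_zero (h : P.OpData u v w φ χ) (hφ : φ = 0) :
    ∀ z ∈ Icc 0 P.ell, u z = 0 ∧ v z = 0 :=
  h.eqOn_zero_of_fst (hφ ▸ hspace_zero_fst)

theorem ne_zero_of_cauchy (h : P.OpData u v w φ χ) (h0 : u 0 ≠ 0 ∨ v 0 ≠ 0) : φ ≠ 0 := fun hφ => by
  have := h.eqOn_zero hφ 0 ⟨le_rfl, P.ell_pos.le⟩
  tauto

/-- Positivity makes A injective: a nonzero difference with image zero would have vanishing
quadratic form. This makes the solution of Aφ = χ unique, hence linear in χ. -/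
theorem eq_of_eq (hA : P.Positive) (h : P.OpData u v w φ χ) (h' : P.OpData u' v' w' φ' χ) :
    φ = φ' ∧ ∀ z ∈ Icc 0 P.ell, u z = u' z ∧ v z = v' z := by
  have h1 := h.add (h'.smul (-1))
  have hχ : χ + (-1 : ℂ) • χ = 0 := by rw [neg_one_smul, add_neg_cancel]
  rw [hχ] at h1
  have hφ : φ + (-1 : ℂ) • φ' = 0 := by
    by_contra hne
    have := hA _ _ _ h1.opGraph hne
    have h2 : ⟪φ + (-1 : ℂ) • φ', (0 : HSpace P)⟫_ℂ = 0 := inner_zero_right _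
    have h3 : (0 : ℝ) < (⟪φ + (-1 : ℂ) • φ', (0 : HSpace P)⟫_ℂ).re := this
    rw [h2] at h3
    simp at h3
  refine ⟨?_, fun z hz => ?_⟩
  · rw [neg_one_smul] at hφ
    exact add_neg_eq_zero.mp hφ
  · obtain ⟨e1, e2⟩ := h1.eqOn_zero hφ z hz
    exact ⟨by linear_combination e1, by linear_combination e2⟩

/-- The boundary condition at 0 leaves one complex parameter. This is behind both the shooting
argument and the simplicity of the eigenvalues. -/
theorem cauchy (h : P.OpData u v w φ χ) :
    ∃ a : ℂ, u 0 = a * Real.sin P.α ∧ v 0 = -(a * Real.cos P.α) := by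
  have hcs : (Real.cos P.α : ℂ) ^ 2 + (Real.sin P.α : ℂ) ^ 2 = 1 := by
    exact_mod_cast Real.cos_sq_add_sin_sq P.α
  refine ⟨Real.sin P.α * u 0 - Real.cos P.α * v 0, ?_, ?_⟩
  · linear_combination -(u 0) * hcs + Real.cos P.α * h.bc
  · linear_combination -(v 0) * hcs + Real.sin P.α * h.bc

end Params.OpData

variable {P : Params}

/-! ## The inverse of `A` -/

theorem IsPrim.memLp {F f : ℝ → ℂ} (h : IsPrim P.ell F f) : MemLp F 2 P.bulkMeasure := by
  have hc := h.continuousOn P.ell_pos.le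
  obtain ⟨C, hC⟩ := isCompact_Icc.exists_bound_of_continuousOn hc
  refine MemLp.of_bound ((hc.mono Ioo_subset_Icc_self).aestronglyMeasurable measurableSet_Ioo) C ?_
  exact (ae_restrict_iff' measurableSet_Ioo).mpr (ae_of_all _ fun z hz =>
    hC z (Ioo_subset_Icc_self hz))

theorem norm_snd_le' (φ : HSpace P) : ‖φ.snd.val‖ ≤ Real.sqrt P.rho * ‖φ‖ := by
  refine le_of_sq_le_sq ?_ (by positivity)
  rw [mul_pow, Real.sq_sqrt P.rho_pos.le]
  exact norm_snd_le φ

theorem exists_opData_sol {c s : ℝ → ℂ} (hS : FundSys ((P.m : ℂ) ^ 2) c s) {χ : HSpace P}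
    {g : ℝ → ℂ} (hg : g =ᵐ[P.bulkMeasure] fun z => -χ.fst z) (a : ℂ)
    (hχ : χ.snd.val = -((P.b₁ : ℂ) *
        FundSys.sol c s g (a * Real.sin P.α) (-(a * Real.cos P.α)) P.ell -
      (P.b₂ : ℂ) * FundSys.solDeriv ((P.m : ℂ) ^ 2) c s g (a * Real.sin P.α)
        (-(a * Real.cos P.α)) P.ell)) :
    ∃ w φ, P.OpData (FundSys.sol c s g (a * Real.sin P.α) (-(a * Real.cos P.α)))
      (FundSys.solDeriv ((P.m : ℂ) ^ 2) c s g (a * Real.sin P.α) (-(a * Real.cos P.α))) w φ χ := by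
  have hgL : MemLp g 2 P.bulkMeasure := (Lp.memLp χ.fst).neg.ae_eq hg.symm
  obtain ⟨h1, h2⟩ := hS.isPrim_sol P.ell_pos.le
    ((bulk_integrable_iff P g).mp (hgL.integrable (by norm_num)))
    (a * Real.sin P.α) (-(a * Real.cos P.α))
  obtain ⟨φ, hφ1, hφ2⟩ := exists_hspace h1.memLp
    ((P.b₁' : ℂ) * FundSys.sol c s g (a * Real.sin P.α) (-(a * Real.cos P.α)) P.ell -
      (P.b₂' : ℂ) * FundSys.solDeriv ((P.m : ℂ) ^ 2) c s g (a * Real.sin P.α)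
        (-(a * Real.cos P.α)) P.ell)
  refine ⟨_, φ, (h1.memLp.const_mul _).add hgL, h1, h2, hφ1, ?_, hφ2, ?_, hχ⟩
  · rw [hS.sol_zero, hS.solDeriv_zero]; ring
  · filter_upwards [hg] with z hz
    simp only [Pi.add_apply]
    rw [hz]; ring

theorem FundSys.sol_eq (c s g : ℝ → ℂ) (a A B : ℂ) (z : ℝ) :
    FundSys.sol c s g (a * A) (-(a * B)) z =
      a * FundSys.sol c s 0 A (-B) z + FundSys.sol c s g 0 0 z := by
  simp [FundSys.sol]; ring

theorem FundSys.solDeriv_eq (l : ℂ) (c s g : ℝ → ℂ) (a A B : ℂ) (z : ℝ) :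
    FundSys.solDeriv l c s g (a * A) (-(a * B)) z =
      a * FundSys.solDeriv l c s 0 A (-B) z + FundSys.solDeriv l c s g 0 0 z := by
  simp [FundSys.solDeriv]; ring

theorem norm_integral_mul_le {c g : ℝ → ℂ} (hg : Integrable g P.bulkMeasure) {M : ℝ}
    (hc : Continuous c) (hM : ∀ z ∈ Icc 0 P.ell, ‖c z‖ ≤ M) {z : ℝ} (hz : z ∈ Icc 0 P.ell) :
    ‖∫ y in (0 : ℝ)..z, c y * g y‖ ≤ M * ∫ y, ‖g y‖ ∂P.bulkMeasure := by
  have hg' := (bulk_integrable_iff P g).mp hg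
  have hcg : IntervalIntegrable (fun y => c y * g y) volume 0 P.ell :=
    hg'.continuousOn_mul hc.continuousOn
  have h0 : uIcc 0 z ⊆ uIcc 0 P.ell := by
    rw [uIcc_of_le hz.1, uIcc_of_le P.ell_pos.le]; exact Icc_subset_Icc_right hz.2
  have hint : ∫ y, ‖g y‖ ∂P.bulkMeasure = ∫ y in (0 : ℝ)..P.ell, ‖g y‖ := by
    rw [intervalIntegral.integral_of_le P.ell_pos.le, integral_Ioc_eq_integral_Ioo]; rfl
  rw [hint, ← intervalIntegral.integral_const_mul]
  calc ‖∫ y in (0 : ℝ)..z, c y * g y‖ ≤ ∫ y in (0 : ℝ)..z, ‖c y * g y‖ :=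
        intervalIntegral.norm_integral_le_integral_norm hz.1
    _ ≤ ∫ y in (0 : ℝ)..z, M * ‖g y‖ := by
        refine intervalIntegral.integral_mono_on hz.1 (hcg.norm.mono_set h0)
          ((hg'.norm.const_mul M).mono_set h0) fun y hy => ?_
        rw [norm_mul]
        exact mul_le_mul_of_nonneg_right (hM y ⟨hy.1, hy.2.trans hz.2⟩) (norm_nonneg _)
    _ ≤ _ := by
        have hM0 : 0 ≤ M := (norm_nonneg _).trans (hM 0 ⟨le_rfl, P.ell_pos.le⟩)
        refine intervalIntegral.integral_mono_interval le_rfl hz.1 hz.2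
          (ae_of_all _ fun y => by positivity) (hg'.norm.const_mul M)

/-- Shooting from 0. The bulk equation and the condition at 0 leave a one-parameter family of
solutions, and the boundary part of Aφ = χ is an affine equation a D + N = χ₂ for the parameter. The
bounds come from variation of parameters. -/
theorem exists_opData (hA : P.Positive) : ∃ C, 0 ≤ C ∧ ∀ χ : HSpace P, ∃ u v w φ,
    P.OpData u v w φ χ ∧ ∀ z ∈ Icc 0 P.ell, ‖u z‖ ≤ C * ‖χ‖ ∧ ‖v z‖ ≤ C * ‖χ‖ := by
  have hL := P.ell_pos.le
  have hℓ : P.ell ∈ Icc 0 P.ell := ⟨hL, le_rfl⟩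
  obtain ⟨c, s, hS⟩ := FundSys.exists_fundSys ((P.m : ℂ) ^ 2)
  obtain ⟨M₁, hM₁⟩ := isCompact_Icc.exists_bound_of_continuousOn
    (s := Icc 0 P.ell) hS.continuous_c.continuousOn
  obtain ⟨M₂, hM₂⟩ := isCompact_Icc.exists_bound_of_continuousOn
    (s := Icc 0 P.ell) hS.continuous_s.continuousOn
  obtain ⟨M₃, hM₃⟩ := isCompact_Icc.exists_bound_of_continuousOn (s := Icc 0 P.ell)
    (continuous_const.mul hS.continuous_s).continuousOn (f := fun z => (P.m : ℂ) ^ 2 * s z)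
  set M := max M₁ (max M₂ M₃)
  have hc : ∀ z ∈ Icc 0 P.ell, ‖c z‖ ≤ M := fun z hz => (hM₁ z hz).trans (le_max_left _ _)
  have hs : ∀ z ∈ Icc 0 P.ell, ‖s z‖ ≤ M := fun z hz =>
    (hM₂ z hz).trans ((le_max_left _ _).trans (le_max_right _ _))
  have hls : ∀ z ∈ Icc 0 P.ell, ‖(P.m : ℂ) ^ 2 * s z‖ ≤ M := fun z hz =>
    (hM₃ z hz).trans ((le_max_right _ _).trans (le_max_right _ _))
  have hM : 0 ≤ M := (norm_nonneg _).trans (hc 0 ⟨le_rfl, hL⟩)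
  have hbound : ∀ (g : ℝ → ℂ) (A B : ℂ), Integrable g P.bulkMeasure → ∀ z ∈ Icc 0 P.ell,
      ‖FundSys.sol c s g A B z‖ ≤
        M * (‖A‖ + ‖B‖) + 2 * M ^ 2 * ∫ y, ‖g y‖ ∂P.bulkMeasure ∧
      ‖FundSys.solDeriv ((P.m : ℂ) ^ 2) c s g A B z‖ ≤
        M * (‖A‖ + ‖B‖) + 2 * M ^ 2 * ∫ y, ‖g y‖ ∂P.bulkMeasure := by
    intro g A B hg z hz
    have i1 := norm_integral_mul_le hg hS.continuous_c hc hz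
    have i2 := norm_integral_mul_le hg hS.continuous_s hs hz
    have j1 : ‖A + -1 * ∫ y in (0 : ℝ)..z, s y * g y‖ ≤ ‖A‖ + M * ∫ y, ‖g y‖ ∂P.bulkMeasure := by
      refine (norm_add_le _ _).trans ?_
      rw [norm_mul, norm_neg, norm_one, one_mul]
      linarith
    have j2 : ‖B + ∫ y in (0 : ℝ)..z, c y * g y‖ ≤ ‖B‖ + M * ∫ y, ‖g y‖ ∂P.bulkMeasure :=
      (norm_add_le _ _).trans (by linarith)
    have comb : ∀ p q : ℂ, ‖p‖ ≤ M → ‖q‖ ≤ M →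
        ‖p * (A + -1 * ∫ y in (0 : ℝ)..z, s y * g y) + q * (B + ∫ y in (0 : ℝ)..z, c y * g y)‖ ≤
        M * (‖A‖ + ‖B‖) + 2 * M ^ 2 * ∫ y, ‖g y‖ ∂P.bulkMeasure := by
      intro p q hp hq
      refine (norm_add_le _ _).trans ?_
      rw [norm_mul, norm_mul]
      have k1 := mul_le_mul hp j1 (norm_nonneg _) hM
      have k2 := mul_le_mul hq j2 (norm_nonneg _) hM
      nlinarith
    exact ⟨comb _ _ (hc z hz) (hs z hz), comb _ _ (hls z hz) (hc z hz)⟩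
  -- The boundary component of A applied to the homogeneous solution with a = 1.
  set D : ℂ := -((P.b₁ : ℂ) * FundSys.sol c s 0 (Real.sin P.α) (-Real.cos P.α) P.ell -
    (P.b₂ : ℂ) * FundSys.solDeriv ((P.m : ℂ) ^ 2) c s 0 (Real.sin P.α) (-Real.cos P.α) P.ell)
    with hDdef
  -- If D were zero, that homogeneous solution would be a nonzero vector in the kernel of A, against
  -- positivity.
  have hD : D ≠ 0 := by
    intro hD0
    obtain ⟨w, φ, h⟩ := exists_opData_sol hS (χ := 0) (g := 0) (by
      filter_upwards [hspace_zero_fst (P := P)] with z hz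
      rw [hz]; simp) 1 (by rw [one_mul, one_mul, hspace_zero_snd, ← hD0])
    rw [one_mul, one_mul] at h
    have hne := h.ne_zero_of_cauchy (by
      rw [hS.sol_zero, hS.solDeriv_zero]
      by_contra! hcon
      have h1 : Real.sin P.α = 0 := by exact_mod_cast hcon.1
      have h2 : Real.cos P.α = 0 := by exact_mod_cast neg_eq_zero.mp hcon.2
      have h3 := Real.sin_sq_add_cos_sq P.α
      rw [h1, h2] at h3
      norm_num at h3)
    have h3 : (0 : ℝ) < (⟪φ, (0 : HSpace P)⟫_ℂ).re := hA _ _ _ h.opGraph hne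
    rw [inner_zero_right] at h3
    simp at h3
  set K : ℝ := 2 * M ^ 2 * (P.ell + 1)
  have hK : 0 ≤ K := by have := P.ell_pos; positivity
  set a₀ : ℝ := (Real.sqrt P.rho + (|P.b₁| * K + |P.b₂| * K)) / ‖D‖
  have ha₀ : 0 ≤ a₀ := by positivity
  refine ⟨M * (a₀ * 2) + K, by positivity, fun χ => ?_⟩
  set g : ℝ → ℂ := fun z => -χ.fst z
  have hg : Integrable g P.bulkMeasure := ((Lp.memLp χ.fst).integrable (by norm_num)).neg
  have hgn : 2 * M ^ 2 * ∫ y, ‖g y‖ ∂P.bulkMeasure ≤ K * ‖χ‖ := by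
    have h1 := integral_norm_fst_le χ
    have h2 : ∫ y, ‖g y‖ ∂P.bulkMeasure = ∫ y, ‖χ.fst y‖ ∂P.bulkMeasure := by simp [g]
    rw [h2]
    calc 2 * M ^ 2 * ∫ y, ‖χ.fst y‖ ∂P.bulkMeasure ≤ 2 * M ^ 2 * ((P.ell + 1) * ‖χ‖) := by gcongr
      _ = K * ‖χ‖ := by simp only [K]; ring
  set N : ℂ := -((P.b₁ : ℂ) * FundSys.sol c s g 0 0 P.ell -
    (P.b₂ : ℂ) * FundSys.solDeriv ((P.m : ℂ) ^ 2) c s g 0 0 P.ell)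
  set a : ℂ := (χ.snd.val - N) / D
  have ha : ‖a‖ ≤ a₀ * ‖χ‖ := by
    obtain ⟨b1, b2⟩ := hbound g 0 0 hg P.ell hℓ
    simp only [norm_zero, add_zero, mul_zero, zero_add] at b1 b2
    have hN : ‖N‖ ≤ (|P.b₁| * K + |P.b₂| * K) * ‖χ‖ := by
      simp only [N]
      rw [norm_neg]
      refine (norm_sub_le _ _).trans ?_
      rw [norm_mul, norm_mul, Complex.norm_real, Complex.norm_real, Real.norm_eq_abs,
        Real.norm_eq_abs]
      have e1 := mul_le_mul_of_nonneg_left (b1.trans hgn) (abs_nonneg P.b₁)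
      have e2 := mul_le_mul_of_nonneg_left (b2.trans hgn) (abs_nonneg P.b₂)
      linarith
    simp only [a, a₀]
    rw [norm_div, div_mul_eq_mul_div]
    gcongr
    refine (norm_sub_le _ _).trans ?_
    have := norm_snd_le' χ
    linarith
  obtain ⟨w, φ, h⟩ := exists_opData_sol hS (χ := χ) (g := g) (ae_of_all _ fun _ => rfl) a (by
    rw [FundSys.sol_eq, FundSys.solDeriv_eq]
    have h1 : a * D = χ.snd.val - N := div_mul_cancel₀ _ hD
    have h2 : χ.snd.val = a * D + N := by rw [h1]; ring
    rw [h2, hDdef]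
    simp only [N]
    ring)
  refine ⟨_, _, w, φ, h, fun z hz => ?_⟩
  obtain ⟨b1, b2⟩ := hbound g (a * Real.sin P.α) (-(a * Real.cos P.α)) hg z hz
  have hA1 : ‖a * (Real.sin P.α : ℂ)‖ ≤ a₀ * ‖χ‖ := by
    rw [norm_mul, Complex.norm_real, Real.norm_eq_abs]
    nlinarith [Real.abs_sin_le_one P.α, norm_nonneg a]
  have hA2 : ‖-(a * (Real.cos P.α : ℂ))‖ ≤ a₀ * ‖χ‖ := by
    rw [norm_neg, norm_mul, Complex.norm_real, Real.norm_eq_abs]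
    nlinarith [Real.abs_cos_le_one P.α, norm_nonneg a]
  have hfin : M * (‖a * (Real.sin P.α : ℂ)‖ + ‖-(a * (Real.cos P.α : ℂ))‖) +
      2 * M ^ 2 * ∫ y, ‖g y‖ ∂P.bulkMeasure ≤ (M * (a₀ * 2) + K) * ‖χ‖ := by
    nlinarith [mul_le_mul_of_nonneg_left (add_le_add hA1 hA2) hM]
  exact ⟨b1.trans hfin, b2.trans hfin⟩

variable {P : Params}

theorem bulk_measureReal_univ (P : Params) : P.bulkMeasure.real univ = P.ell := by
  simp [Params.bulkMeasure, Measure.real, P.ell_pos.le]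

theorem hspace_norm_sq_le {φ : HSpace P} {a : ℝ} (h : ∀ᵐ z ∂P.bulkMeasure, ‖φ.fst z‖ ≤ a) :
    ‖φ‖ ^ 2 ≤ P.ell * a ^ 2 + P.rho⁻¹ * ‖φ.snd.val‖ ^ 2 := by
  rw [hspace_norm_sq]
  gcongr
  calc ∫ z, ‖φ.fst z‖ ^ 2 ∂P.bulkMeasure ≤ ∫ _, a ^ 2 ∂P.bulkMeasure :=
        integral_mono_of_nonneg (ae_of_all _ fun z => by positivity) (integrable_const _) (by
          filter_upwards [h] with z hz
          gcongr)
    _ = P.ell * a ^ 2 := by rw [integral_const, bulk_measureReal_univ, smul_eq_mul]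

theorem bulk_ae_mem (P : Params) : ∀ᵐ z ∂P.bulkMeasure, z ∈ Ioo 0 P.ell :=
  (ae_restrict_iff' measurableSet_Ioo).mpr (ae_of_all _ fun _ h => h)

/-- The inverse `T` of `A`, and the continuous functionals that evaluate `T χ` at a point of the
bulk. -/
theorem exists_resolvent (hA : P.Positive) :
    ∃ (T : HSpace P →L[ℂ] HSpace P) (e : ℝ → (HSpace P →L[ℂ] ℂ)) (C : ℝ), 0 ≤ C ∧
      ∀ χ, ∃ u v w, P.OpData u v w (T χ) χ ∧
        ∀ z ∈ Icc 0 P.ell, e z χ = u z ∧ ‖u z‖ ≤ C * ‖χ‖ ∧ ‖v z‖ ≤ C * ‖χ‖ := by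
  classical
  obtain ⟨C, hC, H⟩ := exists_opData hA
  choose u v w φ hd hb using H
  have hadd : ∀ χ χ', φ (χ + χ') = φ χ + φ χ' ∧
      ∀ z ∈ Icc 0 P.ell, u (χ + χ') z = u χ z + u χ' z := fun χ χ' => by
    obtain ⟨h1, h2⟩ := (hd (χ + χ')).eq_of_eq hA ((hd χ).add (hd χ'))
    exact ⟨h1, fun z hz => (h2 z hz).1⟩
  have hsmul : ∀ (c : ℂ) χ, φ (c • χ) = c • φ χ ∧
      ∀ z ∈ Icc 0 P.ell, u (c • χ) z = c * u χ z := fun c χ => by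
    obtain ⟨h1, h2⟩ := (hd (c • χ)).eq_of_eq hA ((hd χ).smul c)
    exact ⟨h1, fun z hz => (h2 z hz).1⟩
  let T₀ : HSpace P →ₗ[ℂ] HSpace P :=
    { toFun := φ
      map_add' := fun χ χ' => (hadd χ χ').1
      map_smul' := fun c χ => (hsmul c χ).1 }
  have hT₀ : ∀ χ, ‖T₀ χ‖ ≤ Real.sqrt (P.ell * C ^ 2 +
      P.rho⁻¹ * ((|P.b₁'| + |P.b₂'|) * C) ^ 2) * ‖χ‖ := fun χ => by
    have hr := P.rho_pos
    have hl := P.ell_pos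
    refine le_of_sq_le_sq ?_ (by positivity)
    rw [mul_pow, Real.sq_sqrt (by positivity)]
    have h1 : ‖φ χ‖ ^ 2 ≤ P.ell * (C * ‖χ‖) ^ 2 + P.rho⁻¹ * ‖(φ χ).snd.val‖ ^ 2 := by
      refine hspace_norm_sq_le ?_
      filter_upwards [(hd χ).fst_eq, bulk_ae_mem P] with z hz hm
      rw [hz]
      exact (hb χ z (Ioo_subset_Icc_self hm)).1
    have h2 : ‖(φ χ).snd.val‖ ≤ (|P.b₁'| + |P.b₂'|) * C * ‖χ‖ := by
      obtain ⟨b1, b2⟩ := hb χ P.ell ⟨P.ell_pos.le, le_rfl⟩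
      rw [(hd χ).snd_eq]
      refine (norm_sub_le _ _).trans ?_
      rw [norm_mul, norm_mul, Complex.norm_real, Complex.norm_real, Real.norm_eq_abs,
        Real.norm_eq_abs]
      have e1 := mul_le_mul_of_nonneg_left b1 (abs_nonneg P.b₁')
      have e2 := mul_le_mul_of_nonneg_left b2 (abs_nonneg P.b₂')
      linarith
    calc ‖φ χ‖ ^ 2 ≤ P.ell * (C * ‖χ‖) ^ 2 + P.rho⁻¹ * ‖(φ χ).snd.val‖ ^ 2 := h1
      _ ≤ P.ell * (C * ‖χ‖) ^ 2 + P.rho⁻¹ * ((|P.b₁'| + |P.b₂'|) * C * ‖χ‖) ^ 2 := by gcongr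
      _ = _ := by ring
  let e₀ : (z : ℝ) → z ∈ Icc 0 P.ell → (HSpace P →L[ℂ] ℂ) := fun z hz =>
    LinearMap.mkContinuous
      { toFun := fun χ => u χ z
        map_add' := fun χ χ' => (hadd χ χ').2 z hz
        map_smul' := fun c χ => (hsmul c χ).2 z hz } C fun χ => (hb χ z hz).1
  refine ⟨T₀.mkContinuous _ hT₀, fun z => if hz : z ∈ Icc 0 P.ell then e₀ z hz else 0, C, hC,
    fun χ => ⟨u χ, v χ, w χ, hd χ, fun z hz => ⟨?_, hb χ z hz⟩⟩⟩
  simp only [dif_pos hz]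
  rfl

/-- The boundary component as a continuous functional. -/
def bdryL (P : Params) : HSpace P →L[ℂ] ℂ :=
  LinearMap.mkContinuous
    { toFun := fun φ => φ.snd.val
      map_add' := hspace_add_snd
      map_smul' := hspace_smul_snd } (Real.sqrt P.rho) norm_snd_le'

theorem bdryL_apply (φ : HSpace P) : bdryL P φ = φ.snd.val := rfl

/-! ### Compactness of the inverse of A -/

theorem isCompactOperator_smulRight (e : HSpace P →L[ℂ] ℂ) (x : HSpace P) :
    IsCompactOperator (e.smulRight x : HSpace P →L[ℂ] HSpace P) := by
  have h := (isCompactOperator_of_locallyCompactSpace_rng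
    (ContinuousLinearMap.toSpanSingleton ℂ x)).comp_clm e
  exact h

theorem isCompactOperator_sum {ι : Type*} (s : Finset ι) (F : ι → (HSpace P →L[ℂ] HSpace P))
    (hF : ∀ i, IsCompactOperator (F i)) :
    IsCompactOperator (∑ i ∈ s, F i : HSpace P →L[ℂ] HSpace P) := by
  classical
  induction s using Finset.induction with
  | empty => simpa using isCompactOperator_zero
  | insert i s hi ih =>
    rw [Finset.sum_insert hi]
    exact (hF i).add ih

theorem hspace_sum_fst {ι : Type*} (s : Finset ι) (φ : ι → HSpace P) :
    ⇑(∑ i ∈ s, φ i).fst =ᵐ[P.bulkMeasure] fun z => ∑ i ∈ s, (φ i).fst z := by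
  classical
  induction s using Finset.induction with
  | empty => simpa using hspace_zero_fst
  | insert i s hi ih =>
    rw [Finset.sum_insert hi]
    filter_upwards [hspace_add_fst (φ i) (∑ i ∈ s, φ i), ih] with z h1 h2
    rw [h1, h2, Finset.sum_insert hi]

/-- The function T χ is replaced by a step function sampling it on a grid of mesh ℓ/(n + 1), with
its boundary component kept. This has finite rank because point evaluations of T χ are bounded
functionals. The bound on the derivative makes the sampling error at most C ‖χ‖ ℓ/(n + 1), so the
convergence is in operator norm. -/
theorem isCompactOperator_resolvent {T : HSpace P →L[ℂ] HSpace P}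
    {e : ℝ → (HSpace P →L[ℂ] ℂ)} {C : ℝ} (hC : 0 ≤ C)
    (H : ∀ χ, ∃ u v w, P.OpData u v w (T χ) χ ∧
        ∀ z ∈ Icc 0 P.ell, e z χ = u z ∧ ‖u z‖ ≤ C * ‖χ‖ ∧ ‖v z‖ ≤ C * ‖χ‖) :
    IsCompactOperator T := by
  have hl := P.ell_pos
  have hind : ∀ a b : ℝ, ∃ φ : HSpace P, ⇑φ.fst =ᵐ[P.bulkMeasure]
      (Ico a b).indicator (fun _ => (1 : ℂ)) ∧ φ.snd.val = 0 := fun a b =>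
    exists_hspace ((memLp_const 1).indicator measurableSet_Ico) 0
  choose I hI hI' using hind
  obtain ⟨B, hB, hB'⟩ := exists_hspace (P := P) (g := fun _ => 0) MemLp.zero' 1
  let h : ℕ → ℝ := fun n => P.ell / (n + 1)
  have hh : ∀ n, 0 < h n := fun n => by positivity
  let F : ℕ → (HSpace P →L[ℂ] HSpace P) := fun n =>
    (∑ j ∈ Finset.range (n + 1), (e (j * h n)).smulRight (I (j * h n) ((j + 1) * h n))) +
      ((bdryL P).comp T).smulRight B
  have hF : ∀ n, IsCompactOperator (F n) := fun n =>
    (isCompactOperator_sum _ _ fun j => isCompactOperator_smulRight _ _).add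
      (isCompactOperator_smulRight _ _)
  refine isCompactOperator_of_tendsto (F := F) (l := atTop) ?_ (Eventually.of_forall hF)
  rw [tendsto_iff_norm_sub_tendsto_zero]
  have hlim : Tendsto (fun n : ℕ => Real.sqrt P.ell * (C * P.ell) * (1 / ((n : ℝ) + 1))) atTop
      (𝓝 0) := by
    simpa using tendsto_one_div_add_atTop_nhds_zero_nat.const_mul
      (Real.sqrt P.ell * (C * P.ell))
  refine squeeze_zero (fun n => norm_nonneg _) (fun n => ?_) hlim
  refine ContinuousLinearMap.opNorm_le_bound _ (by positivity) fun χ => ?_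
  obtain ⟨u, v, w, hd, hb⟩ := H χ
  have hjm : ∀ j < n + 1, (j * h n) ∈ Icc 0 P.ell := fun j hj => by
    refine ⟨by have := hh n; positivity, ?_⟩
    have : (j : ℝ) ≤ n + 1 := by exact_mod_cast hj.le
    calc j * h n ≤ (n + 1) * h n := by gcongr
      _ = P.ell := by simp only [h]; field_simp
  set ψ : HSpace P := (F n - T) χ with hψ
  have hψ' : ψ = ((∑ j ∈ Finset.range (n + 1), e (j * h n) χ • I (j * h n) ((j + 1) * h n)) +
      (T χ).snd.val • B) + (-1 : ℂ) • T χ := by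
    rw [hψ, sub_apply, neg_one_smul, sub_eq_add_neg]
    congr 1
    simp only [F, add_apply, sum_apply]
    rfl
  have hsnd : ψ.snd.val = 0 := by
    have : ∀ s : Finset ℕ, (∑ j ∈ s, e (j * h n) χ • I (j * h n) ((j + 1) * h n)).snd.val = 0 := by
      intro s
      rw [← bdryL_apply, map_sum]
      refine Finset.sum_eq_zero fun j _ => ?_
      rw [map_smul, bdryL_apply, hI', smul_zero]
    rw [hψ', hspace_add_snd, hspace_add_snd, this, hspace_smul_snd, hspace_smul_snd, hB']
    ring
  have hfst : ∀ᵐ z ∂P.bulkMeasure, ‖ψ.fst z‖ ≤ C * ‖χ‖ * h n := by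
    have hall : ∀ᵐ z ∂P.bulkMeasure, ∀ j : ℕ,
        (e (j * h n) χ • I (j * h n) ((j + 1) * h n)).fst z =
          e (j * h n) χ * (Ico (j * h n) ((j + 1) * h n)).indicator (fun _ => (1 : ℂ)) z := by
      refine ae_all_iff.mpr fun j => ?_
      filter_upwards [hspace_smul_fst (e (j * h n) χ) (I (j * h n) ((j + 1) * h n)),
        hI (j * h n) ((j + 1) * h n)] with z h1 h2
      rw [h1, h2]
    rw [hψ']
    filter_upwards [hspace_add_fst ((∑ j ∈ Finset.range (n + 1),
      e (j * h n) χ • I (j * h n) ((j + 1) * h n)) + (T χ).snd.val • B) ((-1 : ℂ) • T χ),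
      hspace_add_fst (∑ j ∈ Finset.range (n + 1),
        e (j * h n) χ • I (j * h n) ((j + 1) * h n)) ((T χ).snd.val • B),
      hspace_sum_fst (Finset.range (n + 1))
        (fun j => e (j * h n) χ • I (j * h n) ((j + 1) * h n)),
      hspace_smul_fst (-1) (T χ), hspace_smul_fst (T χ).snd.val B, hB, hall, hd.fst_eq,
      bulk_ae_mem P] with z h1 h2 h3 h4 h5 h6 h7 h8 hz
    rw [h1, h2, h3, h4, h5, h6, h8, mul_zero, add_zero]
    -- The cell that contains z; all other indicator functions vanish at z.
    set j := ⌊z / h n⌋₊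
    have hj1 : j * h n ≤ z := by
      rw [← le_div_iff₀ (hh n)]
      exact Nat.floor_le (div_nonneg hz.1.le (hh n).le)
    have hj2 : z < (j + 1) * h n := by
      rw [← div_lt_iff₀ (hh n)]
      exact Nat.lt_floor_add_one _
    have hj : j < n + 1 := by
      by_contra! hcon
      have h9 : ((n : ℝ) + 1) ≤ j := by exact_mod_cast hcon
      have h10 : P.ell ≤ j * h n := by
        calc P.ell = (n + 1) * h n := by simp only [h]; field_simp
          _ ≤ j * h n := by gcongr
      linarith [hz.2]
    rw [Finset.sum_eq_single j]
    · rw [h7, indicator_of_mem (mem_Ico.mpr ⟨hj1, hj2⟩), mul_one, (hb _ (hjm j hj)).1]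
      have hn := hd.prim_u.norm_le (fun z hz => (hb z hz).2.2) (Ioo_subset_Icc_self hz) (hjm j hj)
      rw [neg_one_mul, ← sub_eq_add_neg]
      refine hn.trans ?_
      have hCχ : 0 ≤ C * ‖χ‖ := by positivity
      gcongr
      rw [abs_le]
      constructor <;> linarith
    · intro i _ hij
      rw [h7, indicator_of_notMem, mul_zero]
      rintro ⟨h9, h10⟩
      apply hij
      have a1 : (i : ℝ) < j + 1 := lt_of_mul_lt_mul_right (h9.trans_lt hj2) (hh n).le
      have a2 : (j : ℝ) < i + 1 := lt_of_mul_lt_mul_right (hj1.trans_lt h10) (hh n).le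
      have a3 : i < j + 1 := by exact_mod_cast a1
      have a4 : j < i + 1 := by exact_mod_cast a2
      omega
    · intro hcon
      exact absurd (Finset.mem_range.mpr hj) hcon
  have hfin := hspace_norm_sq_le hfst
  rw [hsnd, norm_zero] at hfin
  refine le_of_sq_le_sq ?_ (by positivity)
  rw [mul_pow, mul_pow, mul_pow, Real.sq_sqrt hl.le]
  calc ‖ψ‖ ^ 2 ≤ _ := hfin
    _ = _ := by simp only [h]; ring

variable {P : Params}

/-! ## Eigenfunctions -/

theorem Params.OpGraph.congr {u u' : ℝ → ℂ} {φ χ : HSpace P} (h : P.OpGraph u φ χ)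
    (hu : EqOn u u' (Icc 0 P.ell)) : P.OpGraph u' φ χ := by
  have hL := P.ell_pos.le
  obtain ⟨v, w, h⟩ := opGraph_iff.mp h
  have h0 := hu ⟨le_rfl, hL⟩
  have hl := hu ⟨hL, le_rfl⟩
  have hae : u =ᵐ[P.bulkMeasure] u' := by
    filter_upwards [bulk_ae_mem P] with z hz using hu (Ioo_subset_Icc_self hz)
  refine opGraph_iff.mpr ⟨v, w, h.memLp, ⟨h.prim_u.1, fun z hz => ?_⟩, h.prim_v,
    h.fst_eq.trans hae, ?_, ?_, ?_, ?_⟩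
  · rw [← hu hz, ← h0, h.prim_u.2 z hz]
  · rw [← h0, h.bc]
  · rw [← hl, h.snd_eq]
  · filter_upwards [h.fst_eq', hae] with z h1 h2
    rw [h1, h2]
  · rw [← hl, h.snd_eq']

namespace Params.OpData

variable {u v w u' v' w' : ℝ → ℂ} {φ χ φ' χ' : HSpace P} {l : ℂ}

theorem ode_eigen (h : P.OpData u v w φ (l • φ)) :
    ∀ᵐ z, z ∈ uIcc 0 P.ell → w z = ((P.m : ℂ) ^ 2 - l) * u z := by
  have h1 := (bulk_ae_iff P).mp (h.fst_eq.and (hspace_smul_fst l φ))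
  filter_upwards [h.ode, h1] with z hz h2 hm
  obtain ⟨e1, e2⟩ := h2 hm
  rw [hz hm, e2, e1]; ring

theorem smul_eigen (h : P.OpData u v w φ (l • φ)) (c : ℂ) :
    P.OpData (fun z => c * u z) (fun z => c * v z) (fun z => c * w z) (c • φ) (l • c • φ) := by
  have h1 := h.smul c
  rwa [smul_comm c l φ] at h1

theorem eq_zero_of_cauchy (h : P.OpData u v w φ (l • φ)) (hu : u 0 = 0) (hv : v 0 = 0) :
    φ = 0 := by
  have hL := P.ell_pos.le
  obtain ⟨c, s, hS⟩ := FundSys.exists_fundSys ((P.m : ℂ) ^ 2 - l)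
  have hz : ∀ z ∈ Icc 0 P.ell, u z = 0 ∧ v z = 0 := fun z hz => by
    obtain ⟨e1, e2⟩ := hS.eq_of_solution hL h.prim_u h.prim_v h.ode_eigen hz
    rw [e1, e2, hu, hv]
    simp
  refine hspace_ext ?_ ?_
  · filter_upwards [h.fst_eq, hspace_zero_fst (P := P), bulk_ae_mem P] with z h1 h2 h3
    rw [h1, h2, (hz z (Ioo_subset_Icc_self h3)).1]
  · obtain ⟨e1, e2⟩ := hz P.ell ⟨hL, le_rfl⟩
    rw [h.snd_eq, e1, e2, hspace_zero_snd]
    simp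

/-- The eigenvalues of `A` are simple. -/
theorem exists_smul_eq (h : P.OpData u v w φ (l • φ)) (h' : P.OpData u' v' w' φ' (l • φ'))
    (hφ : φ ≠ 0) : ∃ c : ℂ, φ' = c • φ := by
  obtain ⟨a, ha1, ha2⟩ := h.cauchy
  obtain ⟨a', ha1', ha2'⟩ := h'.cauchy
  have ha : a ≠ 0 := by
    rintro rfl
    exact hφ (h.eq_zero_of_cauchy (by simp [ha1]) (by simp [ha2]))
  have h1 := h'.add (h.smul (-(a' / a)))
  have hχ : l • φ' + (-(a' / a)) • l • φ = l • (φ' + (-(a' / a)) • φ) := by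
    rw [smul_add, smul_comm]
  rw [hχ] at h1
  have h2 := h1.eq_zero_of_cauchy (by rw [ha1, ha1']; field_simp; ring)
    (by rw [ha2, ha2']; field_simp; ring)
  rw [neg_smul] at h2
  exact ⟨a' / a, add_neg_eq_zero.mp h2⟩

/-- Eigenfunctions can be chosen real and normalized. -/
theorem exists_real {r : ℝ} (h : P.OpData u v w φ ((r : ℂ) • φ)) (hφ : φ ≠ 0) :
    ∃ (ψ : ℝ → ℝ) (Ψ : HSpace P), P.OpGraph (fun z => (ψ z : ℂ)) Ψ ((r : ℂ) • Ψ) ∧ ‖Ψ‖ = 1 ∧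
      Ψ.snd.val.im = 0 := by
  have hL := P.ell_pos.le
  obtain ⟨a, ha1, ha2⟩ := h.cauchy
  have ha : a ≠ 0 := by
    rintro rfl
    exact hφ (h.eq_zero_of_cauchy (by simp [ha1]) (by simp [ha2]))
  -- After division by a, the Cauchy data at 0 are the real pair (sin α, −cos α). The equation has
  -- real coefficients, so the solution coincides with its complex conjugate; the normalization that
  -- follows is real.
  have h1 := h.smul_eigen a⁻¹
  have hne : a⁻¹ • φ ≠ 0 := smul_ne_zero (inv_ne_zero ha) hφ
  have h2 := h1.smul_eigen ((‖a⁻¹ • φ‖⁻¹ : ℝ) : ℂ)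
  set Ψ : HSpace P := ((‖a⁻¹ • φ‖⁻¹ : ℝ) : ℂ) • a⁻¹ • φ
  set U : ℝ → ℂ := fun z => ((‖a⁻¹ • φ‖⁻¹ : ℝ) : ℂ) * (a⁻¹ * u z)
  set V : ℝ → ℂ := fun z => ((‖a⁻¹ • φ‖⁻¹ : ℝ) : ℂ) * (a⁻¹ * v z)
  obtain ⟨c, s, hS⟩ := FundSys.exists_fundSys ((P.m : ℂ) ^ 2 - r)
  have hU0 : U 0 = ((‖a⁻¹ • φ‖⁻¹ * Real.sin P.α : ℝ) : ℂ) := by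
    simp only [U]; rw [ha1]; push_cast; field_simp
  have hV0 : V 0 = ((-(‖a⁻¹ • φ‖⁻¹ * Real.cos P.α) : ℝ) : ℂ) := by
    simp only [V]; rw [ha2]; push_cast; field_simp
  have hreal : ∀ z ∈ Icc 0 P.ell, starRingEnd ℂ (U z) = U z ∧ starRingEnd ℂ (V z) = V z := by
    intro z hz
    obtain ⟨e1, e2⟩ := hS.eq_of_solution hL h2.prim_u h2.prim_v h2.ode_eigen hz
    obtain ⟨e3, e4⟩ := hS.eq_of_solution hL h2.prim_u.conj h2.prim_v.conj (by
      filter_upwards [h2.ode_eigen] with x hx hm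
      rw [hx hm]; simp) hz
    have eU : starRingEnd ℂ (U 0) = U 0 := by rw [hU0, Complex.conj_ofReal]
    have eV : starRingEnd ℂ (V 0) = V 0 := by rw [hV0, Complex.conj_ofReal]
    constructor
    · exact e3.trans (by rw [eU, eV]; exact e1.symm)
    · exact e4.trans (by rw [eU, eV]; exact e2.symm)
  refine ⟨fun z => (U z).re, Ψ, h2.opGraph.congr fun z hz =>
    (Complex.conj_eq_iff_re.mp (hreal z hz).1).symm, ?_, ?_⟩
  · simp only [Ψ]
    rw [norm_smul, Complex.norm_real, norm_inv, norm_norm, inv_mul_cancel₀ (norm_ne_zero_iff.mpr hne)]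
  · obtain ⟨e1, e2⟩ := hreal P.ell ⟨hL, le_rfl⟩
    have hreal' : ∀ p q : ℂ, starRingEnd ℂ p = p → starRingEnd ℂ q = q →
        starRingEnd ℂ ((P.b₁' : ℂ) * p - (P.b₂' : ℂ) * q) = (P.b₁' : ℂ) * p - (P.b₂' : ℂ) * q :=
      fun p q hp hq => by
        rw [map_sub, map_mul, map_mul, Complex.conj_ofReal, Complex.conj_ofReal, hp, hq]
    rw [← Complex.conj_eq_iff_im, h2.snd_eq]
    exact hreal' _ _ e1 e2

/-- Eigenvectors for different eigenvalues are orthogonal. -/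
theorem inner_eq_zero {r r' : ℝ} (h : P.OpData u v w φ ((r : ℂ) • φ))
    (h' : P.OpData u' v' w' φ' ((r' : ℂ) • φ')) (hne : r ≠ r') : ⟪φ, φ'⟫_ℂ = 0 := by
  have h1 := h.inner_eq h'
  rw [inner_smul_left, inner_smul_right, Complex.conj_ofReal, ← sub_eq_zero, ← sub_mul] at h1
  refine (mul_eq_zero.mp h1).resolve_left ?_
  intro h2
  exact hne (by exact_mod_cast sub_eq_zero.mp h2)

end Params.OpData

/-- Bessel's inequality for the Riesz representative of the functional. -/
theorem sum_norm_sq_apply_le {ι : Type} (e : HSpace P →L[ℂ] ℂ) {Ψ : ι → HSpace P}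
    (hΨ : Orthonormal ℂ Ψ) (s : Finset ι) : ∑ i ∈ s, ‖e (Ψ i)‖ ^ 2 ≤ ‖e‖ ^ 2 := by
  have h := hΨ.sum_inner_products_le (s := s) ((InnerProductSpace.toDual ℂ (HSpace P)).symm e)
  rw [LinearIsometryEquiv.norm_map] at h
  refine le_trans (le_of_eq (Finset.sum_congr rfl fun i _ => ?_)) h
  rw [← InnerProductSpace.toDual_symm_apply (𝕜 := ℂ), ← norm_inner_symm]

/-- The sum over the eigenvalues of `ω⁻⁴` is finite. -/
theorem exists_sum_inv_le (hA : P.Positive) : ∃ K : ℝ, ∀ {ι : Type} (s : Finset ι) (ω : ι → ℝ)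
    (Ψ : ι → HSpace P), Orthonormal ℂ Ψ → (∀ i, 0 < ω i ∧
      ∃ u v w, P.OpData u v w (Ψ i) (((ω i ^ 2 : ℝ) : ℂ) • Ψ i)) →
    ∑ i ∈ s, ((ω i ^ 2)⁻¹) ^ 2 ≤ K := by
  obtain ⟨T, e, C, hC, H⟩ := exists_resolvent hA
  have hr := P.rho_pos
  refine ⟨P.ell * C ^ 2 + P.rho⁻¹ * ‖(bdryL P).comp T‖ ^ 2, fun {ι} s ω Ψ hΨ hω => ?_⟩
  have hT : ∀ i, T (Ψ i) = (((ω i ^ 2)⁻¹ : ℝ) : ℂ) • Ψ i := fun i => by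
    obtain ⟨u, v, w, hd, -⟩ := H (Ψ i)
    obtain ⟨hpos, u', v', w', hd'⟩ := hω i
    have h1 := hd'.smul (((ω i ^ 2)⁻¹ : ℝ) : ℂ)
    rw [smul_smul, ← Complex.ofReal_mul, inv_mul_cancel₀ (by positivity), Complex.ofReal_one,
      one_smul] at h1
    exact (hd.eq_of_eq hA h1).1
  -- The sum of these terms is a Hilbert–Schmidt norm of T. The bulk value of T Ψ_i at z is a
  -- functional of Ψ_i of norm at most C, so Bessel bounds the sum over i for fixed z before
  -- integration; the boundary part is one more functional.
  have hnorm : ∀ i, ((ω i ^ 2)⁻¹) ^ 2 = ∫ z, ‖(T (Ψ i)).fst z‖ ^ 2 ∂P.bulkMeasure +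
      P.rho⁻¹ * ‖((bdryL P).comp T) (Ψ i)‖ ^ 2 := fun i => by
    have h1 := hspace_norm_sq (T (Ψ i))
    have h2 : ‖T (Ψ i)‖ = (ω i ^ 2)⁻¹ := by
      rw [hT, norm_smul, hΨ.1 i, Complex.norm_real, Real.norm_of_nonneg (by positivity), mul_one]
    rw [h2] at h1
    exact h1
  rw [Finset.sum_congr rfl fun i _ => hnorm i, Finset.sum_add_distrib, ← Finset.mul_sum,
    ← integral_finsetSum _ fun i _ => integrable_hspace_sq (T (Ψ i))]
  gcongr
  · calc ∫ z, ∑ i ∈ s, ‖(T (Ψ i)).fst z‖ ^ 2 ∂P.bulkMeasure ≤ ∫ _, C ^ 2 ∂P.bulkMeasure := by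
          refine integral_mono_of_nonneg (ae_of_all _ fun z => Finset.sum_nonneg fun i _ =>
            by positivity) (integrable_const _) ?_
          have hall : ∀ᵐ z ∂P.bulkMeasure, ∀ i ∈ s, (T (Ψ i)).fst z = e z (Ψ i) := by
            refine (ae_ball_iff s.countable_toSet).mpr fun i _ => ?_
            obtain ⟨u, v, w, hd, hb⟩ := H (Ψ i)
            filter_upwards [hd.fst_eq, bulk_ae_mem P] with z h1 h2
            rw [h1, (hb z (Ioo_subset_Icc_self h2)).1]
          filter_upwards [hall, bulk_ae_mem P] with z hz hm
          have he : ‖e z‖ ≤ C := ContinuousLinearMap.opNorm_le_bound _ hC fun χ => by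
            obtain ⟨u, v, w, hd, hb⟩ := H χ
            obtain ⟨h1, h2, -⟩ := hb z (Ioo_subset_Icc_self hm)
            rw [h1]; exact h2
          calc ∑ i ∈ s, ‖(T (Ψ i)).fst z‖ ^ 2 = ∑ i ∈ s, ‖e z (Ψ i)‖ ^ 2 :=
                Finset.sum_congr rfl fun i hi => by rw [hz i hi]
            _ ≤ ‖e z‖ ^ 2 := sum_norm_sq_apply_le _ hΨ s
            _ ≤ C ^ 2 := by gcongr
    _ = P.ell * C ^ 2 := by rw [integral_const, bulk_measureReal_univ, smul_eq_mul]
  · exact sum_norm_sq_apply_le _ hΨ s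

/-! ## Existence of the eigenfunction system -/

/-- The square roots of the eigenvalues of `A`. -/
def Params.freqs (P : Params) : Set ℝ :=
  {ω | 0 < ω ∧ ∃ (φ : HSpace P) (u v w : ℝ → ℂ), φ ≠ 0 ∧ P.OpData u v w φ (((ω ^ 2 : ℝ) : ℂ) • φ)}

theorem exists_eigenfunctions (P : Params) : ∃ (ψ : P.freqs → ℝ → ℝ) (Ψ : P.freqs → HSpace P),
    Orthonormal ℂ Ψ ∧ (∀ ω : P.freqs,
      P.OpGraph (fun z => (ψ ω z : ℂ)) (Ψ ω) ((((ω : ℝ) ^ 2 : ℝ) : ℂ) • Ψ ω)) ∧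
      ∀ ω, (Ψ ω).snd.val.im = 0 := by
  have h : ∀ ω : P.freqs, ∃ (ψ : ℝ → ℝ) (Ψ : HSpace P),
      P.OpGraph (fun z => (ψ z : ℂ)) Ψ ((((ω : ℝ) ^ 2 : ℝ) : ℂ) • Ψ) ∧ ‖Ψ‖ = 1 ∧
      Ψ.snd.val.im = 0 := by
    rintro ⟨ω, hω, φ, u, v, w, hφ, h⟩
    exact h.exists_real hφ
  choose ψ Ψ h1 h2 h3 using h
  refine ⟨ψ, Ψ, ⟨h2, fun ω ω' hne => ?_⟩, h1, h3⟩
  obtain ⟨v, w, h⟩ := opGraph_iff.mp (h1 ω)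
  obtain ⟨v', w', h'⟩ := opGraph_iff.mp (h1 ω')
  refine h.inner_eq_zero h' fun heq => hne (Subtype.ext ?_)
  exact (sq_eq_sq₀ ω.2.1.le ω'.2.1.le).mp heq

/-- Each frequency at most x contributes at least x⁻⁴ to a sum bounded by K. -/
theorem finite_freqs_le (hA : P.Positive) (x : ℝ) : {ω : P.freqs | (ω : ℝ) ≤ x}.Finite := by
  obtain ⟨K, hK⟩ := exists_sum_inv_le hA
  obtain ⟨ψ, Ψ, hΨ, h1, -⟩ := exists_eigenfunctions P
  rcases le_or_gt x 0 with hx | hx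
  · convert Set.finite_empty
    ext ω
    simpa using hx.trans_lt ω.2.1
  by_contra hinf
  obtain ⟨n, hn⟩ := exists_nat_gt (K / ((x ^ 2)⁻¹ ^ 2))
  obtain ⟨t, ht, htn⟩ := Set.Infinite.exists_subset_card_eq hinf n
  have h2 := hK t (fun ω => (ω : ℝ)) Ψ hΨ fun ω => ⟨ω.2.1, by
    obtain ⟨v, w, h⟩ := opGraph_iff.mp (h1 ω)
    exact ⟨_, v, w, h⟩⟩
  have h3 : ∑ ω ∈ t, (x ^ 2)⁻¹ ^ 2 ≤ ∑ ω ∈ t, (((ω : ℝ) ^ 2)⁻¹) ^ 2 :=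
    Finset.sum_le_sum fun ω hω => by
      have h4 : (ω : ℝ) ≤ x := ht hω
      have h5 := ω.2.1
      gcongr
  rw [Finset.sum_const, htn, nsmul_eq_mul] at h3
  rw [div_lt_iff₀ (by positivity)] at hn
  linarith

/-- The spectral theorem for the compact symmetric inverse T. Zero is not an eigenvalue of T, since
A of the zero vector is zero; an eigenvector for μ ≠ 0 belongs to the eigenvalue μ⁻¹ of A, which is
positive, and by simplicity is a multiple of some Ψ ω. -/
theorem orthogonal_eigenfunctions_eq_bot (hA : P.Positive) {T : HSpace P →L[ℂ] HSpace P}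
    (hT : IsCompactOperator T) (hTA : ∀ χ, ∃ u v w, P.OpData u v w (T χ) χ)
    {Ψ : P.freqs → HSpace P} (hΨ : Orthonormal ℂ Ψ)
    (hg : ∀ ω, ∃ u v w, P.OpData u v w (Ψ ω) ((((ω : ℝ) ^ 2 : ℝ) : ℂ) • Ψ ω)) :
    (Submodule.span ℂ (Set.range Ψ))ᗮ = ⊥ := by
  have hsym : (T : HSpace P →ₗ[ℂ] HSpace P).IsSymmetric := fun x y => by
    obtain ⟨u, v, w, h⟩ := hTA x
    obtain ⟨u', v', w', h'⟩ := hTA y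
    exact (h.inner_eq h').symm
  have hbot := ContinuousLinearMap.orthogonalComplement_iSup_eigenspaces_eq_bot hT hsym
  rw [eq_bot_iff, ← hbot]
  refine Submodule.orthogonal_le (iSup_le fun μ y hy => ?_)
  rw [Module.End.mem_eigenspace_iff] at hy
  have hy' : T y = μ • y := hy
  by_cases hy0 : y = 0
  · rw [hy0]; exact zero_mem _
  obtain ⟨u, v, w, h⟩ := hTA y
  rw [hy'] at h
  have hμ : μ ≠ 0 := by
    rintro rfl
    rw [zero_smul] at h
    have hz := h.eqOn_zero rfl
    refine hy0 (hspace_ext ?_ ?_)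
    · have hw : ∀ᵐ z ∂P.bulkMeasure, w z = 0 := by
        refine (bulk_ae_iff P).mpr ?_
        have h0 : ∀ᵐ x : ℝ, x ≠ 0 := by simp [ae_iff, measure_singleton]
        have h1 : ∀ᵐ x : ℝ, x ≠ P.ell := by simp [ae_iff, measure_singleton]
        filter_upwards [h.prim_v.ae_hasDerivAt P.ell_pos.le, h0, h1] with x hx hx0 hx1 hm
        have hd := hx hm
        rw [uIcc_of_le P.ell_pos.le] at hm
        refine hd.unique ((hasDerivAt_const x (0 : ℂ)).congr_of_eventuallyEq ?_)
        filter_upwards [Icc_mem_nhds (lt_of_le_of_ne hm.1 hx0.symm)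
          (lt_of_le_of_ne hm.2 hx1)] with y hy
        exact (hz y hy).2
      filter_upwards [h.fst_eq', hw, bulk_ae_mem P, hspace_zero_fst (P := P)] with z h1 h2 h3 h4
      rw [h1, h2, h4, (hz z (Ioo_subset_Icc_self h3)).1]
      simp
    · obtain ⟨e1, e2⟩ := hz P.ell ⟨P.ell_pos.le, le_rfl⟩
      rw [h.snd_eq', e1, e2, hspace_zero_snd]
      simp
  have h1 := h.smul μ⁻¹
  rw [smul_smul, inv_mul_cancel₀ hμ, one_smul] at h1
  have hreal : starRingEnd ℂ μ⁻¹ = μ⁻¹ := by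
    have h2 := h1.inner_eq h1
    rw [inner_smul_left, inner_smul_right] at h2
    exact mul_right_cancel₀ (inner_self_ne_zero.mpr hy0) h2
  obtain ⟨r, hr⟩ := Complex.conj_eq_iff_real.mp hreal
  rw [hr] at h1
  have hpos : 0 < r := by
    have h2 : (0 : ℝ) < (⟪y, (r : ℂ) • y⟫_ℂ).re := hA _ _ _ h1.opGraph hy0
    rw [inner_smul_right, inner_self_eq_norm_sq_to_K] at h2
    have h3 : ((r : ℂ) * ((‖y‖ : ℝ) : ℂ) ^ 2).re = r * ‖y‖ ^ 2 := by
      rw [← Complex.ofReal_pow, ← Complex.ofReal_mul, Complex.ofReal_re]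
    have h4 : (0 : ℝ) < ((r : ℂ) * ((‖y‖ : ℝ) : ℂ) ^ 2).re := h2
    rw [h3] at h4
    exact pos_of_mul_pos_left h4 (by positivity)
  have hsq : Real.sqrt r ^ 2 = r := Real.sq_sqrt hpos.le
  rw [← hsq] at h1
  set ω : P.freqs := ⟨Real.sqrt r, Real.sqrt_pos.mpr hpos, y, _, _, _, hy0, h1⟩
  obtain ⟨u', v', w', h'⟩ := hg ω
  obtain ⟨c, hc⟩ := h'.exists_smul_eq h1 (hΨ.ne_zero ω)
  rw [hc]
  exact Submodule.smul_mem _ _ (Submodule.subset_span ⟨ω, rfl⟩)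

/-- With finitely many frequencies the eigenvectors would span the space, and, lying in the range of
T, would make T surjective. But the vector with zero bulk part and boundary part 1 is not in the
domain of A, which is that range. -/
theorem infinite_freqs (hA : P.Positive) {T : HSpace P →L[ℂ] HSpace P}
    (hTA : ∀ χ, ∃ u v w, P.OpData u v w (T χ) χ) {Ψ : P.freqs → HSpace P}
    (hg : ∀ ω, ∃ u v w, P.OpData u v w (Ψ ω) ((((ω : ℝ) ^ 2 : ℝ) : ℂ) • Ψ ω))
    (hbot : (Submodule.span ℂ (Set.range Ψ))ᗮ = ⊥) : Infinite P.freqs := by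
  by_contra hfin
  rw [not_infinite_iff_finite] at hfin
  have hfd : FiniteDimensional ℂ (Submodule.span ℂ (Set.range Ψ)) :=
    FiniteDimensional.span_of_finite ℂ (Set.finite_range Ψ)
  rw [Submodule.orthogonal_eq_bot_iff] at hbot
  have hle : Submodule.span ℂ (Set.range Ψ) ≤ LinearMap.range (T : HSpace P →ₗ[ℂ] HSpace P) := by
    rw [Submodule.span_le]
    rintro _ ⟨ω, rfl⟩
    obtain ⟨u, v, w, h⟩ := hTA ((((ω : ℝ) ^ 2 : ℝ) : ℂ) • Ψ ω)
    obtain ⟨u', v', w', h'⟩ := hg ω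
    exact ⟨_, (h.eq_of_eq hA h').1⟩
  rw [hbot] at hle
  obtain ⟨y, hy, hy'⟩ := exists_hspace (P := P) (g := fun _ => 0) MemLp.zero' 1
  obtain ⟨χ, hχ⟩ := hle (Submodule.mem_top (x := y))
  obtain ⟨u, v, w, h⟩ := hTA χ
  have hχ' : T χ = y := hχ
  rw [hχ'] at h
  obtain ⟨e1, e2⟩ := h.eqOn_zero_of_fst hy P.ell ⟨P.ell_pos.le, le_rfl⟩
  have h3 := h.snd_eq
  rw [hy', e1, e2] at h3
  simp at h3

/-- A linear order that is locally finite, has a least element and has no greatest one is order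
isomorphic to ℕ. -/
theorem exists_orderIso_nat {s : Set ℝ} (hs : Infinite s)
    (hfin : ∀ x : ℝ, {ω : s | (ω : ℝ) ≤ x}.Finite) : Nonempty (s ≃o ℕ) := by
  classical
  have : LocallyFiniteOrder s := LocallyFiniteOrder.ofFiniteIcc fun a b =>
    (hfin b).subset fun ω hω => hω.2
  have : NoMaxOrder s := ⟨fun a => by
    by_contra! h
    exact hs.not_finite (Set.finite_univ_iff.mp ((hfin a).subset fun ω _ => h ω))⟩
  obtain ⟨a⟩ : Nonempty s := inferInstance
  obtain ⟨b, hb, hmin⟩ := Set.exists_min_image {ω : s | (ω : ℝ) ≤ a} id (hfin a) ⟨a, le_refl (a : ℝ)⟩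
  let _ : OrderBot s :=
    { bot := b
      bot_le := fun ω => by
        rcases le_total (ω : ℝ) a with h | h
        · exact hmin ω h
        · exact le_trans (hmin a (le_refl (a : ℝ))) h }
  let _ : SuccOrder s := LinearLocallyFiniteOrder.succOrder s
  let _ : PredOrder s := LinearLocallyFiniteOrder.predOrder s
  exact ⟨orderIsoNatOfLinearSuccPredArch⟩

theorem nonempty_eigenSystem (hA : P.Positive) : Nonempty (EigenSystem P) := by
  obtain ⟨T, e, C, hC, H⟩ := exists_resolvent hA
  have hT := isCompactOperator_resolvent hC H
  have hTA : ∀ χ, ∃ u v w, P.OpData u v w (T χ) χ := fun χ => by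
    obtain ⟨u, v, w, h, -⟩ := H χ
    exact ⟨u, v, w, h⟩
  obtain ⟨ψ, Ψ, hΨ, h1, h2⟩ := exists_eigenfunctions P
  have hg : ∀ ω, ∃ u v w, P.OpData u v w (Ψ ω) ((((ω : ℝ) ^ 2 : ℝ) : ℂ) • Ψ ω) := fun ω => by
    obtain ⟨v, w, h⟩ := opGraph_iff.mp (h1 ω)
    exact ⟨_, v, w, h⟩
  have hbot := orthogonal_eigenfunctions_eq_bot hA hT hTA hΨ hg
  obtain ⟨iso⟩ := exists_orderIso_nat (infinite_freqs hA hTA hg hbot) (finite_freqs_le hA)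
  have hrange : Set.range (Ψ ∘ iso.symm) = Set.range Ψ := iso.symm.surjective.range_comp Ψ
  have hcomp : Orthonormal ℂ (Ψ ∘ iso.symm) := hΨ.comp _ iso.symm.injective
  let b : HilbertBasis ℕ ℂ (HSpace P) := HilbertBasis.mkOfOrthogonalEqBot hcomp (by rw [hrange, hbot])
  have hb : ∀ n, b n = Ψ (iso.symm n) := fun n => by
    have := HilbertBasis.coe_mkOfOrthogonalEqBot hcomp (by rw [hrange, hbot])
    exact congrFun this n
  exact ⟨{
    ω := fun n => iso.symm n
    ω_pos := fun n => (iso.symm n).2.1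
    ω_strictMono := fun n m h => iso.symm.strictMono h
    basis := b
    ψ := fun n => ψ (iso.symm n)
    eigen := fun n => by
      rw [hb, ← Complex.ofReal_pow]
      exact h1 _
    bdry_real := fun n => by rw [hb]; exact h2 _ }⟩

variable {P : Params}

/-! ## Trigonometric integrals -/

/-- The oscillation `A cos kz + B sin kz`. -/
def osc (k A B z : ℝ) : ℝ := A * Real.cos (k * z) + B * Real.sin (k * z)

theorem continuous_osc (k A B : ℝ) : Continuous (osc k A B) := by
  unfold osc; fun_prop

theorem osc_sq_le (k A B z : ℝ) : osc k A B z ^ 2 ≤ A ^ 2 + B ^ 2 := by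
  have h := Real.sin_sq_add_cos_sq (k * z)
  unfold osc
  nlinarith [sq_nonneg (A * Real.sin (k * z) - B * Real.cos (k * z))]

theorem hasDerivAt_lin (k z : ℝ) : HasDerivAt (fun z => k * z) k z := by
  simpa using (hasDerivAt_id z).const_mul k

/-- The mean of the square is (A² + B²)/2. The oscillating part of the antiderivative has modulus at
most (A² + B²)/(4k), and it is evaluated at two endpoints. -/
theorem integral_osc_sq_ge {k : ℝ} (hk : 0 < k) (A B : ℝ) {L : ℝ} :
    (A ^ 2 + B ^ 2) * (L / 2 - 1 / (2 * k)) ≤ ∫ z in (0 : ℝ)..L, osc k A B z ^ 2 := by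
  set F : ℝ → ℝ := fun z => (A ^ 2 + B ^ 2) / 2 * z +
    ((A ^ 2 - B ^ 2) * Real.sin (2 * k * z) - 2 * (A * B) * Real.cos (2 * k * z)) / (4 * k)
  have hF : ∀ z, HasDerivAt F (osc k A B z ^ 2) z := fun z => by
    have h := ((hasDerivAt_lin ((A ^ 2 + B ^ 2) / 2) z).add
      ((((hasDerivAt_lin (2 * k) z).sin.const_mul (A ^ 2 - B ^ 2)).sub
        ((hasDerivAt_lin (2 * k) z).cos.const_mul (2 * (A * B)))).div_const (4 * k)))
    refine h.congr_deriv ?_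
    have e1 : Real.cos (2 * k * z) = 2 * Real.cos (k * z) ^ 2 - 1 := by
      rw [← Real.cos_two_mul]; ring_nf
    have e2 : Real.sin (2 * k * z) = 2 * Real.sin (k * z) * Real.cos (k * z) := by
      rw [← Real.sin_two_mul]; ring_nf
    have e3 := Real.sin_sq_add_cos_sq (k * z)
    rw [e1, e2]
    unfold osc
    field_simp
    linear_combination (-8 * B ^ 2) * e3
  rw [intervalIntegral.integral_eq_sub_of_hasDerivAt (fun z _ => hF z)
    (((continuous_osc k A B).pow 2).intervalIntegrable _ _)]
  have hb : ∀ z, |(A ^ 2 - B ^ 2) * Real.sin (2 * k * z) - 2 * (A * B) * Real.cos (2 * k * z)| ≤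
      A ^ 2 + B ^ 2 := fun z => by
    refine abs_le_of_sq_le_sq ?_ (by positivity)
    have h := Real.sin_sq_add_cos_sq (2 * k * z)
    nlinarith [sq_nonneg ((A ^ 2 - B ^ 2) * Real.cos (2 * k * z) +
      2 * (A * B) * Real.sin (2 * k * z))]
  have h1 := (abs_le.mp (hb L)).1
  have h0 := (abs_le.mp (hb 0)).2
  have h2 : F L - F 0 = (A ^ 2 + B ^ 2) / 2 * L +
      (((A ^ 2 - B ^ 2) * Real.sin (2 * k * L) - 2 * (A * B) * Real.cos (2 * k * L)) -
      ((A ^ 2 - B ^ 2) * Real.sin (2 * k * 0) - 2 * (A * B) * Real.cos (2 * k * 0))) / (4 * k) := by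
    simp only [F]; ring
  rw [h2]
  have h3 : (-(2 * (A ^ 2 + B ^ 2))) / (4 * k) ≤
      (((A ^ 2 - B ^ 2) * Real.sin (2 * k * L) - 2 * (A * B) * Real.cos (2 * k * L)) -
      ((A ^ 2 - B ^ 2) * Real.sin (2 * k * 0) - 2 * (A * B) * Real.cos (2 * k * 0))) / (4 * k) := by
    gcongr
    linarith
  have h4 : (-(2 * (A ^ 2 + B ^ 2))) / (4 * k) = -((A ^ 2 + B ^ 2) * (1 / (2 * k))) := by
    field_simp; ring
  rw [h4] at h3
  linarith

/-- Nearby frequencies cannot decorrelate over a length L: if |k − k'| L ≤ 1 then cos((k − k')z) ≥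
1/2 on the whole interval, so the diagonal part of the product contributes a definite amount. The
part with k + k' integrates to O(1/K), and the mixed terms are estimated in modulus. -/
theorem integral_osc_mul_ge {L : ℝ} (hL : 0 < L) {K k k' : ℝ} (hK : 1 ≤ K) (hk : K ≤ k)
    (hk' : K ≤ k') (hkk : |k - k'| * L ≤ 1) (A : ℝ) {B B' : ℝ} (hB : 0 ≤ B * B') :
    (A ^ 2 + B * B') * (L / 4) - (|A| * (|B| + |B'|) * L + (A ^ 2 + |B| * |B'|) * (1 / K)) ≤
      ∫ z in (0 : ℝ)..L, osc k A B z * osc k' A B' z := by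
  have hkk0 : 0 < k + k' := by linarith
  have hint : ∫ z in (0 : ℝ)..L, Real.cos ((k + k') * z) = Real.sin ((k + k') * L) / (k + k') := by
    rw [intervalIntegral.integral_eq_sub_of_hasDerivAt
      (f := fun z => Real.sin ((k + k') * z) / (k + k')) (fun z _ => ?_)
      ((by fun_prop : Continuous fun z => Real.cos ((k + k') * z)).intervalIntegrable _ _)]
    · simp
    · refine ((hasDerivAt_lin (k + k') z).sin.div_const (k + k')).congr_deriv ?_
      field_simp
  have hS : |(A ^ 2 - B * B') / 2 * (Real.sin ((k + k') * L) / (k + k'))| ≤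
      (A ^ 2 + |B| * |B'|) * (1 / K) := by
    rw [abs_mul, abs_div, abs_div, abs_of_pos hkk0, abs_two]
    have h1 : |A ^ 2 - B * B'| ≤ A ^ 2 + |B| * |B'| := by
      refine (abs_sub _ _).trans ?_
      rw [abs_mul, abs_of_nonneg (sq_nonneg A)]
    have h2 : |Real.sin ((k + k') * L)| / (k + k') ≤ 1 / K := by
      have := Real.abs_sin_le_one ((k + k') * L)
      gcongr
      linarith
    have h3 : |A ^ 2 - B * B'| / 2 ≤ A ^ 2 + |B| * |B'| := by
      linarith [abs_nonneg (A ^ 2 - B * B')]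
    gcongr
  have hptw : ∀ z ∈ Icc 0 L, (A ^ 2 + B * B') / 4 - |A| * (|B| + |B'|) +
      (A ^ 2 - B * B') / 2 * Real.cos ((k + k') * z) ≤ osc k A B z * osc k' A B' z := by
    intro z hz
    have hc : 1 / 2 ≤ Real.cos ((k - k') * z) := by
      have h1 := Real.one_sub_sq_div_two_le_cos (x := (k - k') * z)
      have h2 : |(k - k') * z| ≤ 1 := by
        rw [abs_mul, abs_of_nonneg hz.1]
        exact (mul_le_mul_of_nonneg_left hz.2 (abs_nonneg _)).trans hkk
      have h3 : ((k - k') * z) ^ 2 ≤ 1 := by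
        rw [← sq_abs]; nlinarith [abs_nonneg ((k - k') * z)]
      linarith
    have hc1 := Real.cos_le_one ((k - k') * z)
    have e1 : Real.cos ((k - k') * z) = Real.cos (k * z) * Real.cos (k' * z) +
        Real.sin (k * z) * Real.sin (k' * z) := by rw [sub_mul, Real.cos_sub]
    have e2 : Real.cos ((k + k') * z) = Real.cos (k * z) * Real.cos (k' * z) -
        Real.sin (k * z) * Real.sin (k' * z) := by rw [add_mul, Real.cos_add]
    have hprod : osc k A B z * osc k' A B' z = (A ^ 2 + B * B') / 2 * Real.cos ((k - k') * z) +
        (A ^ 2 - B * B') / 2 * Real.cos ((k + k') * z) +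
        (A * B' * (Real.cos (k * z) * Real.sin (k' * z)) +
          A * B * (Real.sin (k * z) * Real.cos (k' * z))) := by
      rw [e1, e2]; unfold osc; ring
    have hx : ∀ p q r : ℝ, |p| ≤ 1 → |q| ≤ 1 → |r * (p * q)| ≤ |r| := fun p q r hp hq => by
      rw [abs_mul, abs_mul]
      have := mul_le_one₀ hp (abs_nonneg q) hq
      nlinarith [abs_nonneg r]
    have x1 := (abs_le.mp (hx _ _ (A * B') (Real.abs_cos_le_one (k * z))
      (Real.abs_sin_le_one (k' * z)))).1
    have x2 := (abs_le.mp (hx _ _ (A * B) (Real.abs_sin_le_one (k * z))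
      (Real.abs_cos_le_one (k' * z)))).1
    rw [abs_mul] at x1 x2
    rw [hprod]
    have y1 : A ^ 2 * (1 / 2) ≤ A ^ 2 * Real.cos ((k - k') * z) := by gcongr
    have y2 : B * B' * (1 / 2) ≤ B * B' * Real.cos ((k - k') * z) := by gcongr
    nlinarith
  have hmono : ∫ z in (0 : ℝ)..L, ((A ^ 2 + B * B') / 4 - |A| * (|B| + |B'|) +
      (A ^ 2 - B * B') / 2 * Real.cos ((k + k') * z)) ≤
      ∫ z in (0 : ℝ)..L, osc k A B z * osc k' A B' z :=
    intervalIntegral.integral_mono_on hL.le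
      ((by fun_prop : Continuous fun z => (A ^ 2 + B * B') / 4 -
        |A| * (|B| + |B'|) + (A ^ 2 - B * B') / 2 * Real.cos ((k + k') * z)).intervalIntegrable _ _)
      (((continuous_osc k A B).mul (continuous_osc k' A B')).intervalIntegrable _ _) hptw
  rw [intervalIntegral.integral_add (by simp)
    ((by fun_prop : Continuous fun z => (A ^ 2 - B * B') / 2 *
      Real.cos ((k + k') * z)).intervalIntegrable _ _),
    intervalIntegral.integral_const, intervalIntegral.integral_const_mul, hint, smul_eq_mul,
    sub_zero] at hmono
  have := (abs_le.mp hS).1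
  nlinarith

/-! ## High frequency eigenfunctions -/

theorem Params.OpData.eq_trig {u v w : ℝ → ℂ} {φ : HSpace P} {k : ℝ} (hk : k ≠ 0)
    (h : P.OpData u v w φ ((((k ^ 2 + P.m ^ 2 : ℝ) : ℂ)) • φ)) {z : ℝ} (hz : z ∈ Icc 0 P.ell) :
    u z = u 0 * (Real.cos (k * z) : ℝ) + v 0 * (Real.sin (k * z) / k : ℝ) ∧
      v z = -(k : ℂ) ^ 2 * (u 0 * (Real.sin (k * z) / k : ℝ)) + v 0 * (Real.cos (k * z) : ℝ) := by
  refine (FundSys.trig hk).eq_of_solution P.ell_pos.le h.prim_u h.prim_v ?_ hz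
  filter_upwards [h.ode_eigen] with x hx hm
  rw [hx hm]
  push_cast
  ring

theorem integral_sq_le_one {u v w : ℝ → ℂ} {φ χ : HSpace P} (h : P.OpData u v w φ χ)
    (hφ : ‖φ‖ = 1) : ∫ z in (0 : ℝ)..P.ell, ‖u z‖ ^ 2 ≤ 1 := by
  have h1 := hspace_norm_sq φ
  have h2 : ∫ z, ‖φ.fst z‖ ^ 2 ∂P.bulkMeasure = ∫ z in (0 : ℝ)..P.ell, ‖u z‖ ^ 2 := by
    rw [intervalIntegral.integral_of_le P.ell_pos.le, integral_Ioc_eq_integral_Ioo]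
    refine integral_congr_ae ?_
    filter_upwards [h.fst_eq] with z hz
    rw [hz]
  rw [h2, hφ] at h1
  have := P.rho_pos
  have : 0 ≤ P.rho⁻¹ * ‖φ.snd.val‖ ^ 2 := by positivity
  linarith

/-- Normalized real eigenfunctions of high frequency are bounded by a constant. -/
theorem Params.OpData.bound_of_high {u v w : ℝ → ℂ} {φ : HSpace P} {k : ℝ} (hk : 2 / P.ell ≤ k)
    (h : P.OpData u v w φ ((((k ^ 2 + P.m ^ 2 : ℝ) : ℂ)) • φ)) (hφ : ‖φ‖ = 1)
    {ψ : ℝ → ℝ} (hu : ∀ z, u z = ψ z) {z : ℝ} (hz : z ∈ Icc 0 P.ell) :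
    ‖u z‖ ≤ 2 / Real.sqrt P.ell ∧ ‖v z‖ ≤ 2 / Real.sqrt P.ell * k := by
  have hl := P.ell_pos
  have hk0 : 0 < k := lt_of_lt_of_le (by positivity) hk
  obtain ⟨a, ha1, ha2⟩ := h.cauchy
  -- the Cauchy data are real
  have hreal : ∃ A B : ℝ, u 0 = A ∧ v 0 = (B * k : ℝ) := by
    by_cases hs : Real.sin P.α = 0
    · have hu0 : u 0 = 0 := by rw [ha1, hs]; simp
      -- In the Dirichlet case u 0 = 0 says nothing about v 0, which is read off where the sine
      -- equals one. The point π/(2k) lies in the interval because kℓ ≥ 2 ≥ π/2.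
      obtain ⟨z₀, hz₀, hz₀s⟩ : ∃ z₀ ∈ Icc 0 P.ell, Real.sin (k * z₀) = 1 := by
        refine ⟨Real.pi / 2 / k, ⟨by positivity, ?_⟩, by rw [mul_div_cancel₀ _ hk0.ne',
          Real.sin_pi_div_two]⟩
        rw [div_le_iff₀ hk0]
        rw [div_le_iff₀ hl] at hk
        linarith [Real.pi_le_four]
      have h1 := (h.eq_trig hk0.ne' hz₀).1
      rw [hu0, hz₀s, hu] at h1
      refine ⟨0, ψ z₀, by simpa using hu0, ?_⟩
      have hkc : (k : ℂ) ≠ 0 := by exact_mod_cast hk0.ne'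
      push_cast at h1 ⊢
      rw [h1]
      field_simp
      ring
    · have hsc : (Real.sin P.α : ℂ) ≠ 0 := by exact_mod_cast hs
      refine ⟨ψ 0, -(ψ 0 / Real.sin P.α * Real.cos P.α) / k, hu 0, ?_⟩
      rw [div_mul_cancel₀ _ hk0.ne']
      have h1 : a = ψ 0 / Real.sin P.α := by rw [eq_div_iff hsc, ← ha1, hu]
      rw [ha2, h1]
      push_cast
      ring
  obtain ⟨A, B, hA, hB⟩ := hreal
  have hkc : (k : ℂ) ≠ 0 := by exact_mod_cast hk0.ne'
  have hU : ∀ z ∈ Icc 0 P.ell, u z = (osc k A B z : ℝ) ∧ v z = (k * osc k B (-A) z : ℝ) :=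
    fun z hz => by
      obtain ⟨e1, e2⟩ := h.eq_trig hk0.ne' hz
      rw [e1, e2, hA, hB]
      unfold osc
      constructor
      · push_cast; field_simp
      · push_cast; field_simp; ring
  have hint := integral_sq_le_one h hφ
  rw [intervalIntegral.integral_congr (g := fun z => osc k A B z ^ 2) (fun z hz => by
    rw [uIcc_of_le hl.le] at hz
    simp only
    rw [(hU z hz).1, Complex.norm_real, Real.norm_eq_abs, sq_abs])] at hint
  have hge := (integral_osc_sq_ge hk0 A B (L := P.ell)).trans hint
  have hR : A ^ 2 + B ^ 2 ≤ 4 / P.ell := by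
    -- The threshold k ≥ 2/ℓ is what leaves half of the mean value, and normalization then yields A²
    -- + B² ≤ 4/ℓ.
    have h1 : P.ell / 4 ≤ P.ell / 2 - 1 / (2 * k) := by
      have h2 : 1 / (2 * k) ≤ P.ell / 4 := by
        rw [div_le_div_iff₀ (by positivity) (by norm_num)]
        rw [div_le_iff₀ hl] at hk
        linarith
      linarith
    have h2 := (mul_le_mul_of_nonneg_left h1 (by positivity : 0 ≤ A ^ 2 + B ^ 2)).trans hge
    rw [le_div_iff₀ hl]
    linarith
  have hs : (2 / Real.sqrt P.ell) ^ 2 = 4 / P.ell := by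
    rw [div_pow, Real.sq_sqrt hl.le]; norm_num
  obtain ⟨e1, e2⟩ := hU z hz
  rw [e1, e2, Complex.norm_real, Complex.norm_real, Real.norm_eq_abs, Real.norm_eq_abs, abs_mul,
    abs_of_pos hk0, mul_comm k]
  have c1 : |osc k A B z| ≤ 2 / Real.sqrt P.ell := abs_le_of_sq_le_sq
    ((osc_sq_le k A B z).trans (hs ▸ hR)) (by positivity)
  have c2 : |osc k B (-A) z| ≤ 2 / Real.sqrt P.ell := abs_le_of_sq_le_sq
    ((osc_sq_le k B (-A) z).trans (by rw [hs, neg_sq, add_comm]; exact hR)) (by positivity)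
  exact ⟨c1, mul_le_mul_of_nonneg_right c2 hk0.le⟩

/-- Rescaled eigenfunctions: `A cos kz + B sin kz`. -/
theorem Params.OpData.exists_osc {u v w : ℝ → ℂ} {φ : HSpace P} {k : ℝ} (hk : 1 ≤ k)
    (h : P.OpData u v w φ ((((k ^ 2 + P.m ^ 2 : ℝ) : ℂ)) • φ)) (hφ : φ ≠ 0) :
    ∃ (c : ℂ), (∀ z ∈ Icc 0 P.ell, c * u z =
      (osc k (Real.sin P.α) (if Real.sin P.α = 0 then 1 else -(Real.cos P.α / k)) z : ℝ)) ∧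
      ‖(c • φ).snd.val‖ ≤ 2 * (|P.b₁| + |P.b₂|) / k := by
  have hk0 : 0 < k := by linarith
  have hkc : (k : ℂ) ≠ 0 := by exact_mod_cast hk0.ne'
  obtain ⟨a, ha1, ha2⟩ := h.cauchy
  have ha : a ≠ 0 := by
    rintro rfl
    exact hφ (h.eq_zero_of_cauchy (by simp [ha1]) (by simp [ha2]))
  set B : ℝ := if Real.sin P.α = 0 then 1 else -(Real.cos P.α / k)
  have hBabs : |B| ≤ 1 := by
    simp only [B]
    split_ifs
    · simp
    · rw [abs_neg, abs_div, abs_of_pos hk0, div_le_one hk0]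
      exact (Real.abs_cos_le_one _).trans hk
  -- The Cauchy data are rescaled to (sin α, −cos α) in the Robin case and to (0, k) in the
  -- Dirichlet case, so that the leading amplitude does not depend on k.
  obtain ⟨c, hc⟩ : ∃ c : ℂ, c * u 0 = (Real.sin P.α : ℝ) ∧ c * v 0 = (B * k : ℝ) := by
    by_cases hs : Real.sin P.α = 0
    · have hB : B = 1 := if_pos hs
      have hcos : (Real.cos P.α : ℂ) ≠ 0 := by
        intro h0
        have h1 : Real.cos P.α = 0 := by exact_mod_cast h0
        have := Real.sin_sq_add_cos_sq P.α
        rw [hs, h1] at this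
        norm_num at this
      refine ⟨-k / (a * Real.cos P.α), ?_, ?_⟩
      · rw [ha1, hs]; simp
      · rw [ha2, hB]; field_simp
    · have hB : B = -(Real.cos P.α / k) := if_neg hs
      refine ⟨a⁻¹, ?_, ?_⟩
      · rw [ha1]; field_simp
      · rw [ha2, hB]; push_cast; field_simp
  have hU : ∀ z ∈ Icc 0 P.ell, c * u z = (osc k (Real.sin P.α) B z : ℝ) ∧
      c * v z = (k * osc k B (-Real.sin P.α) z : ℝ) := fun z hz => by
    obtain ⟨e1, e2⟩ := h.eq_trig hk0.ne' hz
    have e3 : c * u z = (c * u 0) * (Real.cos (k * z) : ℝ) +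
        (c * v 0) * (Real.sin (k * z) / k : ℝ) := by rw [e1]; ring
    have e4 : c * v z = -(k : ℂ) ^ 2 * ((c * u 0) * (Real.sin (k * z) / k : ℝ)) +
        (c * v 0) * (Real.cos (k * z) : ℝ) := by rw [e2]; ring
    rw [e3, e4, hc.1, hc.2]
    unfold osc
    constructor
    · push_cast; field_simp
    · push_cast; field_simp; ring
  refine ⟨c, fun z hz => (hU z hz).1, ?_⟩
  have h1 := (h.smul_eigen c).snd_eq'
  rw [hspace_smul_snd] at h1
  obtain ⟨e1, e2⟩ := hU P.ell ⟨P.ell_pos.le, le_rfl⟩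
  rw [e1, e2] at h1
  set s := (c • φ).snd.val
  have hosc : ∀ A B z : ℝ, |A| ≤ 1 → |B| ≤ 1 → |osc k A B z| ≤ 2 := fun A B z hA hB => by
    unfold osc
    refine (abs_add_le _ _).trans ?_
    rw [abs_mul, abs_mul]
    have x1 := mul_le_one₀ hA (abs_nonneg _) (Real.abs_cos_le_one (k * z))
    have x2 := mul_le_one₀ hB (abs_nonneg _) (Real.abs_sin_le_one (k * z))
    linarith
  -- The boundary part of the eigenvalue equation reads (k² + m²) s = −(β₁ u(ℓ) − β₂ u'(ℓ)), and the
  -- right-hand side is O(k). So the boundary component is O(1/k).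
  have h2 : k ^ 2 * ‖s‖ ≤ 2 * (|P.b₁| + |P.b₂|) * k := by
    have h3 := congrArg norm h1
    rw [norm_mul, Complex.norm_real, Real.norm_of_nonneg (by positivity), norm_neg] at h3
    have h4 := norm_sub_le ((P.b₁ : ℂ) * (osc k (Real.sin P.α) B P.ell : ℝ))
      ((P.b₂ : ℂ) * (k * osc k B (-Real.sin P.α) P.ell : ℝ))
    rw [norm_mul, norm_mul, Complex.norm_real, Complex.norm_real, Complex.norm_real,
      Complex.norm_real, Real.norm_eq_abs, Real.norm_eq_abs, Real.norm_eq_abs, Real.norm_eq_abs,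
      abs_mul, abs_of_pos hk0] at h4
    have x1 := mul_le_mul_of_nonneg_left (hosc _ _ P.ell (Real.abs_sin_le_one P.α) hBabs)
      (abs_nonneg P.b₁)
    have x2 := mul_le_mul_of_nonneg_left (hosc B (-Real.sin P.α) P.ell hBabs
      (by rw [abs_neg]; exact Real.abs_sin_le_one P.α)) (mul_nonneg (abs_nonneg P.b₂) hk0.le)
    have x3 : 0 ≤ P.m ^ 2 * ‖s‖ := by positivity
    have x4 : |P.b₁| ≤ |P.b₁| * k := by nlinarith [abs_nonneg P.b₁]
    nlinarith
  rw [le_div_iff₀ hk0]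
  nlinarith

/-- High frequencies are separated by `1 / ℓ`. -/
theorem exists_gap (P : Params) : ∃ K : ℝ, 1 ≤ K ∧ ∀ (k k' : ℝ), K ≤ k → K ≤ k' → k ≠ k' →
    ∀ (φ φ' : HSpace P) (u v w u' v' w' : ℝ → ℂ), φ ≠ 0 → φ' ≠ 0 →
    P.OpData u v w φ ((((k ^ 2 + P.m ^ 2 : ℝ) : ℂ)) • φ) →
    P.OpData u' v' w' φ' ((((k' ^ 2 + P.m ^ 2 : ℝ) : ℂ)) • φ') → 1 < |k - k'| * P.ell := by
  have hl := P.ell_pos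
  have hr := P.rho_pos
  set b : ℝ := 2 * (|P.b₁| + |P.b₂|)
  set A := Real.sin P.α
  -- A lower bound for the diagonal contribution (A² + BB') ℓ/4: BB' = 1 in the Dirichlet case, and
  -- BB' ≥ 0 in the Robin case.
  set c₀ : ℝ := (if A = 0 then 1 else A ^ 2) * (P.ell / 4)
  have hc₀ : 0 < c₀ := by
    simp only [c₀]
    split_ifs with h
    · positivity
    · positivity
  -- The sum of the three errors, each divided by K below: the boundary part of the inner product,
  -- the mixed terms, and the term with frequency k + k'. Orthogonality at close frequencies would
  -- give c₀ ≤ D/K, contradicting K > D/c₀.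
  set D : ℝ := P.rho⁻¹ * b ^ 2 + 2 * P.ell + 2
  have hD : 0 < D := by positivity
  refine ⟨max 1 (D / c₀ + 1), le_max_left _ _, ?_⟩
  intro k k' hk hk' hne φ φ' u v w u' v' w' hφ hφ' h h'
  set K := max 1 (D / c₀ + 1)
  have hK1 : 1 ≤ K := le_max_left _ _
  have hK0 : 0 < K := by linarith
  by_contra! hle
  obtain ⟨c, hc1, hc2⟩ := h.exists_osc (hK1.trans hk) hφ
  obtain ⟨c', hc1', hc2'⟩ := h'.exists_osc (hK1.trans hk') hφ'
  have horth := (h.smul_eigen c).inner_eq_zero (h'.smul_eigen c') (by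
    intro heq
    have : k ^ 2 = k' ^ 2 := by linarith
    exact hne ((sq_eq_sq₀ (by linarith) (by linarith)).mp this))
  rw [hspace_inner, bulk_integral] at horth
  set B : ℝ := if A = 0 then 1 else -(Real.cos P.α / k)
  set B' : ℝ := if A = 0 then 1 else -(Real.cos P.α / k')
  have hint : ∫ z in (0 : ℝ)..P.ell, starRingEnd ℂ ((c • φ).fst z) * (c' • φ').fst z =
      ((∫ z in (0 : ℝ)..P.ell, osc k A B z * osc k' A B' z : ℝ) : ℂ) := by
    rw [← intervalIntegral.integral_ofReal]
    refine intervalIntegral.integral_congr_ae ?_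
    have hae := (bulk_ae_iff P).mp ((h.smul_eigen c).fst_eq.and (h'.smul_eigen c').fst_eq)
    filter_upwards [hae] with z hz hm
    have hm' := uIoc_subset_uIcc hm
    obtain ⟨e1, e2⟩ := hz hm'
    rw [uIcc_of_le hl.le] at hm'
    rw [e1, e2, hc1 z hm', hc1' z hm', Complex.conj_ofReal, Complex.ofReal_mul]
  rw [hint] at horth
  have hsmall : ∫ z in (0 : ℝ)..P.ell, osc k A B z * osc k' A B' z ≤ P.rho⁻¹ * b ^ 2 * (1 / K) := by
    have h1 : ((∫ z in (0 : ℝ)..P.ell, osc k A B z * osc k' A B' z : ℝ) : ℂ) =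
        -(((P.rho⁻¹ : ℝ) : ℂ) * (starRingEnd ℂ (c • φ).snd.val * (c' • φ').snd.val)) := by
      linear_combination horth
    have h2 := congrArg norm h1
    rw [Complex.norm_real, norm_neg, norm_mul, norm_mul, RCLike.norm_conj, Complex.norm_real,
      Real.norm_of_nonneg (inv_pos.mpr hr).le, Real.norm_eq_abs] at h2
    refine (le_abs_self _).trans (h2.le.trans ?_)
    rw [mul_assoc]
    refine mul_le_mul_of_nonneg_left ?_ (inv_pos.mpr hr).le
    calc ‖(c • φ).snd.val‖ * ‖(c' • φ').snd.val‖ ≤ (b / K) * b := by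
          refine mul_le_mul (hc2.trans ?_) (hc2'.trans ?_) (norm_nonneg _) (by positivity)
          · exact div_le_div_of_nonneg_left (by positivity) hK0 hk
          · exact div_le_self (by positivity) (hK1.trans hk')
      _ = b ^ 2 * (1 / K) := by ring
  have hAle : |A| ≤ 1 := Real.abs_sin_le_one P.α
  have hBB : 0 ≤ B * B' := by
    simp only [B, B']
    split_ifs
    · norm_num
    · rw [neg_mul_neg, div_mul_div_comm]
      exact div_nonneg (mul_self_nonneg _) (mul_nonneg (by linarith) (by linarith))
  have hlow := integral_osc_mul_ge hl hK1 hk hk' hle A hBB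
  have hB1 : |A| * (|B| + |B'|) ≤ 2 * (1 / K) ∧ |B| * |B'| ≤ 1 ∧
      c₀ ≤ (A ^ 2 + B * B') * (P.ell / 4) := by
    by_cases hA : A = 0
    · simp only [c₀, B, B', if_pos hA]
      rw [hA]
      simp
      positivity
    · have hcos := Real.abs_cos_le_one P.α
      have x : ∀ q, K ≤ q → |-(Real.cos P.α / q)| ≤ 1 / K := fun q hq => by
        rw [abs_neg, abs_div, abs_of_pos (hK0.trans_le hq)]
        gcongr
      have eB : B = -(Real.cos P.α / k) := if_neg hA
      have eB' : B' = -(Real.cos P.α / k') := if_neg hA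
      have x1 := x k hk
      have x2 := x k' hk'
      rw [← eB] at x1
      rw [← eB'] at x2
      have x3 : 1 / K ≤ 1 := by rw [div_le_one hK0]; exact hK1
      refine ⟨?_, mul_le_one₀ (x1.trans x3) (abs_nonneg _) (x2.trans x3), ?_⟩
      · calc |A| * (|B| + |B'|) ≤ 1 * (1 / K + 1 / K) := by gcongr
          _ = 2 * (1 / K) := by ring
      · simp only [c₀, if_neg hA]
        gcongr
        linarith
  obtain ⟨y1, y2, y3⟩ := hB1
  have hA2 : A ^ 2 ≤ 1 := by rw [← sq_abs]; nlinarith [abs_nonneg A]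
  have hKi : 0 < 1 / K := by positivity
  have z1 : |A| * (|B| + |B'|) * P.ell ≤ 2 * (1 / K) * P.ell := by gcongr
  have z2 : (A ^ 2 + |B| * |B'|) * (1 / K) ≤ 2 * (1 / K) := by gcongr; linarith
  have hfin : c₀ ≤ D * (1 / K) := by
    simp only [D]
    linarith
  have hKD : D / c₀ < K := lt_of_lt_of_le (by linarith) (le_max_right _ _)
  rw [div_lt_iff₀ hc₀] at hKD
  rw [mul_one_div, le_div_iff₀ hK0] at hfin
  linarith

variable {P : Params}

/-! ## Estimates for a system of eigenfunctions -/

theorem IsPrim.hasDerivAt {L : ℝ} {F f : ℝ → ℂ} (h : IsPrim L F f) (hf : ContinuousOn f (Icc 0 L))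
    {z : ℝ} (hz : z ∈ Ioo 0 L) : HasDerivAt F (f z) z := by
  have hnhds := Icc_mem_nhds hz.1 hz.2
  have h1 : HasDerivAt (fun z => ∫ y in (0 : ℝ)..z, f y) (f z) z := by
    refine intervalIntegral.integral_hasDerivAt_right (h.intervalIntegrable
      ⟨le_rfl, (hz.1.trans hz.2).le⟩ (Ioo_subset_Icc_self hz)) ?_ (hf.continuousAt hnhds)
    exact ⟨Icc 0 L, hnhds, (hf.aestronglyMeasurable measurableSet_Icc)⟩
  refine (h1.const_add (F 0)).congr_of_eventuallyEq ?_
  filter_upwards [hnhds] with y hy using h.2 y hy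

namespace EigenSystem

variable (S : EigenSystem P)

theorem exists_opData (n : ℕ) : ∃ v w : ℝ → ℂ, P.OpData (fun z => (S.ψ n z : ℂ)) v w (S.basis n)
    (((S.ω n ^ 2 : ℝ) : ℂ) • S.basis n) := by
  obtain ⟨v, w, h⟩ := opGraph_iff.mp (S.eigen n)
  rw [← Complex.ofReal_pow] at h
  exact ⟨v, w, h⟩

theorem norm_basis (n : ℕ) : ‖S.basis n‖ = 1 := S.basis.orthonormal.1 n

theorem basis_ne_zero (n : ℕ) : S.basis n ≠ 0 := S.basis.orthonormal.ne_zero n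

/-- A bounded sequence of frequencies would make the partial sums of ω⁻⁴ grow linearly. -/
theorem tendsto_omega (hA : P.Positive) : Tendsto S.ω atTop atTop := by
  refine tendsto_atTop_atTop_of_monotone S.ω_strictMono.monotone fun b => ?_
  by_contra! hb
  obtain ⟨K, hK⟩ := exists_sum_inv_le hA
  have hb0 : 0 < b := (S.ω_pos 0).trans (hb 0)
  obtain ⟨n, hn⟩ := exists_nat_gt (K / ((b ^ 2)⁻¹ ^ 2))
  rw [div_lt_iff₀ (by positivity)] at hn
  have h1 := hK (Finset.range n) S.ω S.basis S.basis.orthonormal fun i =>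
    ⟨S.ω_pos i, _, S.exists_opData i⟩
  have h2 : ∑ i ∈ Finset.range n, (b ^ 2)⁻¹ ^ 2 ≤ ∑ i ∈ Finset.range n, ((S.ω i ^ 2)⁻¹) ^ 2 :=
    Finset.sum_le_sum fun i _ => by
      have h3 := (hb i).le
      have h4 := S.ω_pos i
      gcongr
  rw [Finset.sum_const, Finset.card_range, nsmul_eq_mul] at h2
  linarith

/-- Above a threshold the wave numbers k n = √(ω n² − m²) increase by at least 1/ℓ at each step, by
the gap between high frequencies, and ω n ≥ k n. -/
theorem exists_linear_growth (hA : P.Positive) :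
    ∃ c, 0 < c ∧ ∀ n : ℕ, c * (n + 1) ≤ S.ω n := by
  have hl := P.ell_pos
  obtain ⟨K, hK1, hK⟩ := exists_gap P
  have hm := P.m_nonneg
  let k : ℕ → ℝ := fun n => Real.sqrt (S.ω n ^ 2 - P.m ^ 2)
  obtain ⟨N, hN⟩ := eventually_atTop.mp ((S.tendsto_omega hA).eventually_ge_atTop (K + P.m))
  have hk : ∀ n, N ≤ n → k n ^ 2 = S.ω n ^ 2 - P.m ^ 2 ∧ K ≤ k n := fun n hn => by
    have h1 := hN n hn
    have h2 : K ^ 2 ≤ S.ω n ^ 2 - P.m ^ 2 := by nlinarith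
    exact ⟨Real.sq_sqrt (by nlinarith), Real.le_sqrt_of_sq_le h2⟩
  have hstep : ∀ n, N ≤ n → k n + 1 / P.ell ≤ k (n + 1) := fun n hn => by
    obtain ⟨e1, l1⟩ := hk n hn
    obtain ⟨e2, l2⟩ := hk (n + 1) (by omega)
    have hlt : k n < k (n + 1) := by
      have := S.ω_strictMono (Nat.lt_succ_self n)
      have h0 := S.ω_pos n
      refine lt_of_pow_lt_pow_left₀ 2 (by linarith) ?_
      rw [e1, e2]
      gcongr
    obtain ⟨v, w, h⟩ := S.exists_opData n
    obtain ⟨v', w', h'⟩ := S.exists_opData (n + 1)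
    have hg := hK (k n) (k (n + 1)) l1 l2 hlt.ne _ _ _ _ _ _ _ _ (S.basis_ne_zero n)
      (S.basis_ne_zero (n + 1)) (by rw [e1, sub_add_cancel]; exact h)
      (by rw [e2, sub_add_cancel]; exact h')
    rw [abs_sub_comm, abs_of_pos (sub_pos.mpr hlt), ← div_lt_iff₀ hl] at hg
    linarith
  have hind : ∀ j : ℕ, j / P.ell ≤ k (N + j) := fun j => by
    induction j with
    | zero => simp [k, Real.sqrt_nonneg]
    | succ j ih =>
      have := hstep (N + j) (by omega)
      rw [← add_assoc]
      push_cast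
      rw [add_div]
      linarith
  have hωk : ∀ j : ℕ, j / P.ell ≤ S.ω (N + j) := fun j => by
    refine (hind j).trans ?_
    refine le_of_sq_le_sq ?_ (S.ω_pos _).le
    rw [(hk (N + j) (by omega)).1]
    nlinarith [sq_nonneg P.m]
  have hω0 := S.ω_pos 0
  -- The first entry handles n ≤ 2N + 1 through ω n ≥ ω 0. The second handles n = N + j beyond,
  -- where n + 1 ≤ 2j.
  set c := min (S.ω 0 / (2 * N + 2)) (1 / (2 * P.ell))
  have hc : 0 < c := lt_min (by positivity) (by positivity)
  refine ⟨c, hc, fun n => ?_⟩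
  rcases le_or_gt (n + 1) (2 * N + 2) with h | h
  · have h' : (n : ℝ) + 1 ≤ 2 * N + 2 := by exact_mod_cast h
    calc c * (n + 1) ≤ S.ω 0 / (2 * N + 2) * (2 * N + 2) := by
          gcongr
          exact min_le_left _ _
      _ = S.ω 0 := by field_simp
      _ ≤ S.ω n := S.ω_strictMono.monotone (Nat.zero_le n)
  · obtain ⟨j, rfl⟩ := Nat.exists_eq_add_of_le (show N ≤ n by omega)
    have h' : ((N + j : ℕ) : ℝ) + 1 ≤ 2 * j := by
      have : N + j + 1 ≤ 2 * j := by omega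
      exact_mod_cast this
    calc c * ((N + j : ℕ) + 1) ≤ 1 / (2 * P.ell) * (2 * j) := by
          gcongr
          exact min_le_right _ _
      _ = j / P.ell := by field_simp
      _ ≤ _ := hωk j

/-- The derivative of the bulk component of an eigenfunction. -/
def dψ (n : ℕ) (z : ℝ) : ℝ := ((S.exists_opData n).choose z).re

theorem dψ_spec (n : ℕ) : ∃ w : ℝ → ℂ, P.OpData (fun z => (S.ψ n z : ℂ))
    (S.exists_opData n).choose w (S.basis n) (((S.ω n ^ 2 : ℝ) : ℂ) • S.basis n) :=
  (S.exists_opData n).choose_spec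

theorem continuousOn_ψ (n : ℕ) : ContinuousOn (S.ψ n) (Icc 0 P.ell) := by
  obtain ⟨w, h⟩ := S.dψ_spec n
  exact (Complex.continuous_re.comp_continuousOn (h.prim_u.continuousOn P.ell_pos.le)).congr
    fun z _ => (Complex.ofReal_re _).symm

theorem continuousOn_dψ (n : ℕ) : ContinuousOn (S.dψ n) (Icc 0 P.ell) := by
  obtain ⟨w, h⟩ := S.dψ_spec n
  exact Complex.continuous_re.comp_continuousOn (h.prim_v.continuousOn P.ell_pos.le)

theorem hasDerivAt_ψ (n : ℕ) {z : ℝ} (hz : z ∈ Ioo 0 P.ell) :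
    HasDerivAt (S.ψ n) (S.dψ n z) z := by
  obtain ⟨w, h⟩ := S.dψ_spec n
  have h1 := h.prim_u.hasDerivAt (h.prim_v.continuousOn P.ell_pos.le) hz
  exact Complex.reCLM.hasFDerivAt.comp_hasDerivAt z h1

theorem basis_fst (n : ℕ) : ⇑(S.basis n).fst =ᵐ[P.bulkMeasure] fun z => (S.ψ n z : ℂ) := by
  obtain ⟨w, h⟩ := S.dψ_spec n
  exact h.fst_eq

theorem basis_snd (n : ℕ) : (S.basis n).snd.val = (S.mode none n : ℂ) :=
  Complex.ext rfl (S.bdry_real n)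

/-- High frequencies obey the uniform trigonometric bound, the finitely many low ones are continuous
on a compact interval, and the boundary component is controlled by the norm. -/
theorem exists_bounds (hA : P.Positive) : ∃ C, 0 ≤ C ∧ ∀ n,
    (∀ z ∈ Icc 0 P.ell, |S.ψ n z| ≤ C ∧ |S.dψ n z| ≤ C * S.ω n) ∧ |S.mode none n| ≤ C := by
  have hl := P.ell_pos
  have hm := P.m_nonneg
  obtain ⟨N, hN⟩ := eventually_atTop.mp
    ((S.tendsto_omega hA).eventually_ge_atTop (2 / P.ell + P.m))
  have hhigh : ∀ n, N ≤ n → ∀ z ∈ Icc 0 P.ell,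
      |S.ψ n z| ≤ 2 / Real.sqrt P.ell ∧ |S.dψ n z| ≤ 2 / Real.sqrt P.ell * S.ω n := by
    intro n hn z hz
    obtain ⟨w, h⟩ := S.dψ_spec n
    have h1 := hN n hn
    have h0 : 0 < 2 / P.ell := by positivity
    have hk : Real.sqrt (S.ω n ^ 2 - P.m ^ 2) ^ 2 = S.ω n ^ 2 - P.m ^ 2 :=
      Real.sq_sqrt (by nlinarith)
    have hk2 : 2 / P.ell ≤ Real.sqrt (S.ω n ^ 2 - P.m ^ 2) :=
      Real.le_sqrt_of_sq_le (by nlinarith)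
    have hk3 : Real.sqrt (S.ω n ^ 2 - P.m ^ 2) ≤ S.ω n := by
      rw [Real.sqrt_le_left (S.ω_pos n).le]
      nlinarith
    have h2 := Params.OpData.bound_of_high hk2 (by rw [hk, sub_add_cancel]; exact h)
      (S.norm_basis n) (fun _ => rfl) hz
    rw [Complex.norm_real] at h2
    refine ⟨h2.1, (Complex.abs_re_le_norm _).trans (h2.2.trans ?_)⟩
    gcongr
  have hlow : ∀ n, ∃ B, 0 ≤ B ∧ ∀ z ∈ Icc 0 P.ell, |S.ψ n z| ≤ B ∧ |S.dψ n z| ≤ B * S.ω n := by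
    intro n
    obtain ⟨B₁, hB₁⟩ := isCompact_Icc.exists_bound_of_continuousOn (S.continuousOn_ψ n)
    obtain ⟨B₂, hB₂⟩ := isCompact_Icc.exists_bound_of_continuousOn (S.continuousOn_dψ n)
    have h0 : (0 : ℝ) ∈ Icc 0 P.ell := ⟨le_rfl, hl.le⟩
    have p1 : 0 ≤ B₁ := (norm_nonneg _).trans (hB₁ 0 h0)
    have p2 : 0 ≤ B₂ / S.ω n := div_nonneg ((norm_nonneg _).trans (hB₂ 0 h0)) (S.ω_pos n).le
    refine ⟨B₁ + B₂ / S.ω n, add_nonneg p1 p2, fun z hz =>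
      ⟨(hB₁ z hz).trans (by linarith), (hB₂ z hz).trans ?_⟩⟩
    rw [add_mul, div_mul_cancel₀ _ (S.ω_pos n).ne']
    nlinarith [S.ω_pos n]
  choose B hB0 hB using hlow
  refine ⟨(∑ n ∈ Finset.range N, B n) + 2 / Real.sqrt P.ell + Real.sqrt P.rho, ?_, fun n => ?_⟩
  · have := Finset.sum_nonneg fun n (_ : n ∈ Finset.range N) => hB0 n
    positivity
  have hsum := Finset.sum_nonneg fun n (_ : n ∈ Finset.range N) => hB0 n
  have hs1 : 0 ≤ 2 / Real.sqrt P.ell := by positivity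
  have hs2 := Real.sqrt_nonneg P.rho
  constructor
  · intro z hz
    have hω := S.ω_pos n
    rcases lt_or_ge n N with h | h
    · obtain ⟨h1, h2⟩ := hB n z hz
      have h3 := Finset.single_le_sum (fun n _ => hB0 n) (Finset.mem_range.mpr h)
      refine ⟨by linarith, h2.trans ?_⟩
      gcongr
      linarith
    · obtain ⟨h1, h2⟩ := hhigh n h z hz
      refine ⟨by linarith, h2.trans ?_⟩
      gcongr
      linarith
  · have h1 := norm_snd_le' (S.basis n)
    rw [S.norm_basis, mul_one, S.basis_snd, Complex.norm_real, Real.norm_eq_abs] at h1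
    linarith

end EigenSystem

variable {P : Params}

/-! ## The classical solution -/

theorem summable_mul_of_sq_real {f g : ℕ → ℝ} (hf : Summable fun i => f i ^ 2)
    (hg : Summable fun i => g i ^ 2) : Summable fun i => |f i| * |g i| := by
  refine Summable.of_nonneg_of_le (fun i => by positivity) (fun i => ?_) (hf.add hg)
  nlinarith [sq_nonneg (|f i| - |g i|), sq_abs (f i), sq_abs (g i)]

/-- Cauchy–Schwarz in time gives (∫|a n|)² ≤ 2R ∫ (a n)², and the sum over n is taken under the
integral. -/
theorem summable_sq_integral_abs {a : ℕ → ℝ → ℝ} (hc : ∀ n, Continuous (a n)) {R B : ℝ}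
    (hR : 0 < R) (hsupp : ∀ n t, R < |t| → a n t = 0)
    (hB : ∀ (s : Finset ℕ) t, ∑ n ∈ s, a n t ^ 2 ≤ B) :
    Summable fun n => (∫ t, |a n t|) ^ 2 := by
  have hset : ∀ n, ∫ t, |a n t| = ∫ t in (-R)..R, |a n t| := fun n => by
    rw [intervalIntegral.integral_of_le (by linarith), ← integral_Icc_eq_integral_Ioc,
      setIntegral_eq_integral_of_forall_compl_eq_zero]
    intro t ht
    rw [hsupp n t (lt_of_not_ge fun h => ht (abs_le.mp h)), abs_zero]
  have hint : ∀ n, IntervalIntegrable (fun t => a n t ^ 2) volume (-R) R := fun n =>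
    ((hc n).pow 2).intervalIntegrable _ _
  have key : ∀ n, (∫ t, |a n t|) ^ 2 ≤ 2 * R * ∫ t in (-R)..R, a n t ^ 2 := fun n => by
    set L := ∫ t, |a n t| with hL
    have h1 : L * L = ∫ t in (-R)..R, L * |a n t| := by
      rw [intervalIntegral.integral_const_mul, ← hset n]
    -- Pointwise L|a| ≤ L²/(4R) + R a². Integrated over an interval of length 2R, the first term
    -- becomes L²/2, which is absorbed on the left.
    have h2 : ∫ t in (-R)..R, L * |a n t| ≤ ∫ t in (-R)..R, (L ^ 2 / (4 * R) + R * a n t ^ 2) := by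
      refine intervalIntegral.integral_mono_on (by linarith)
        ((continuous_const.mul (hc n).abs).intervalIntegrable _ _)
        ((continuous_const.add (continuous_const.mul ((hc n).pow 2))).intervalIntegrable _ _)
        fun t _ => ?_
      have h3 : L ^ 2 / (4 * R) + R * a n t ^ 2 - L * |a n t| =
          (L - 2 * R * |a n t|) ^ 2 / (4 * R) := by
        rw [← sq_abs (a n t)]
        field_simp
        ring
      have h4 : 0 ≤ (L - 2 * R * |a n t|) ^ 2 / (4 * R) := by positivity
      linarith
    have h3 : ∫ t in (-R)..R, (L ^ 2 / (4 * R) + R * a n t ^ 2) =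
        L ^ 2 / 2 + R * ∫ t in (-R)..R, a n t ^ 2 := by
      rw [intervalIntegral.integral_add intervalIntegrable_const ((hint n).const_mul R),
        intervalIntegral.integral_const, intervalIntegral.integral_const_mul, smul_eq_mul]
      congr 1
      field_simp
      ring
    nlinarith
  refine summable_of_sum_le (c := 2 * R * (2 * R * B)) (fun n => by positivity) fun s => ?_
  calc ∑ n ∈ s, (∫ t, |a n t|) ^ 2 ≤ ∑ n ∈ s, 2 * R * ∫ t in (-R)..R, a n t ^ 2 :=
        Finset.sum_le_sum fun n _ => key n
    _ = 2 * R * ∫ t in (-R)..R, ∑ n ∈ s, a n t ^ 2 := by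
        rw [← Finset.mul_sum, intervalIntegral.integral_finsetSum fun n _ => hint n]
    _ ≤ 2 * R * ∫ t in (-R)..R, B := by
        gcongr
        exact intervalIntegral.integral_mono_on (by linarith)
          ((continuous_finsetSum _ fun n _ => (hc n).pow 2).intervalIntegrable _ _)
          intervalIntegrable_const fun t _ => hB s t
    _ = 2 * R * (2 * R * B) := by
        rw [intervalIntegral.integral_const, smul_eq_mul]
        ring

/-- Sums weighted by a square summable sequence commute with the time integral. -/
theorem hasSum_integral_smul {E : Type*} [NormedAddCommGroup E] [NormedSpace ℝ E]
    {a : ℕ → ℝ → ℝ} (hc : ∀ n, Continuous (a n)) (hs : ∀ n, HasCompactSupport (a n))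
    (hsum : Summable fun n => (∫ t, |a n t|) ^ 2) {h : ℕ → ℝ → E} (hh : ∀ n, Continuous (h n))
    {q : ℕ → ℝ} (hq : Summable fun n => q n ^ 2) (hhq : ∀ n t, ‖h n t‖ ≤ q n) :
    HasSum (fun n => ∫ t, a n t • h n t) (∫ t, ∑' n, a n t • h n t) := by
  have hint : ∀ n, Integrable (fun t => a n t • h n t) := fun n =>
    ((hc n).smul (hh n)).integrable_of_hasCompactSupport (hs n).smul_right
  refine hasSum_integral_of_summable_integral_norm hint ?_
  refine Summable.of_nonneg_of_le (fun n => integral_nonneg fun t => norm_nonneg _) (fun n => ?_)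
    (summable_mul_of_sq_real hsum hq)
  have hL : 0 ≤ ∫ t, |a n t| := integral_nonneg fun t => abs_nonneg _
  have hi : Integrable (fun t => |a n t| * q n) := by
    have : Integrable (fun t => |a n t|) :=
      ((hc n).abs).integrable_of_hasCompactSupport (hs n).norm
    exact this.mul_const _
  have hle : ∀ t, ‖a n t • h n t‖ ≤ |a n t| * q n := fun t => by
    rw [norm_smul, Real.norm_eq_abs]
    exact mul_le_mul_of_nonneg_left (hhq n t) (abs_nonneg _)
  calc ∫ t, ‖a n t • h n t‖ ≤ ∫ t, |a n t| * q n := integral_mono (hint n).norm hi hle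
    _ = (∫ t, |a n t|) * q n := integral_mul_const _ _
    _ ≤ |(∫ t, |a n t|)| * |q n| := by
        rw [abs_of_nonneg hL]
        exact mul_le_mul_of_nonneg_left (le_abs_self _) hL

theorem abs_integral_mul_le {a h : ℝ → ℝ} (hc : Continuous a) (hs : HasCompactSupport a)
    (hh : ∀ t, |h t| ≤ 1) : |∫ t, h t * a t| ≤ ∫ t, |a t| := by
  have hi : Integrable fun t => |a t| := hc.abs.integrable_of_hasCompactSupport hs.norm
  rw [← Real.norm_eq_abs]
  refine norm_integral_le_of_norm_le hi (ae_of_all _ fun t => ?_)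
  rw [Real.norm_eq_abs, abs_mul]
  nlinarith [hh t, abs_nonneg (a t)]

namespace EigenSystem

variable (S : EigenSystem P)

/-- The real part of the coefficient of `f t` along the eigenfunction `Ψ_n`. -/
def coef (f : ℝ → HSpace P) (n : ℕ) (t : ℝ) : ℝ := (⟪S.basis n, f t⟫_ℂ).re

/-- The amplitude of `Ψ_n` in a solution of the wave equation with the given source. -/
def amplitude (f : ℝ → HSpace P) (n : ℕ) (t : ℝ) : ℝ :=
  -(Real.sin (S.ω n * t) * (∫ s, Real.cos (S.ω n * s) * S.coef f n s) -
    Real.cos (S.ω n * t) * ∫ s, Real.sin (S.ω n * s) * S.coef f n s) / S.ω n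

/-- The time derivative of the amplitude of `Ψ_n`. -/
def amplitudeDeriv (f : ℝ → HSpace P) (n : ℕ) (t : ℝ) : ℝ :=
  -(Real.cos (S.ω n * t) * (∫ s, Real.cos (S.ω n * s) * S.coef f n s) +
    Real.sin (S.ω n * t) * ∫ s, Real.sin (S.ω n * s) * S.coef f n s)

/-- The total variation of the source in the mode `Ψ_n`. -/
def mass (f : ℝ → HSpace P) (n : ℕ) : ℝ := ∫ t, |S.coef f n t|

variable {S} {f : ℝ → HSpace P}

theorem mass_nonneg (n : ℕ) : 0 ≤ S.mass f n := integral_nonneg fun _ => abs_nonneg _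

theorem continuous_coef (hf : Continuous f) (n : ℕ) : Continuous (S.coef f n) :=
  Complex.continuous_re.comp (continuous_const.inner hf)

theorem hasCompactSupport_coef (hf : HasCompactSupport f) (n : ℕ) :
    HasCompactSupport (S.coef f n) :=
  hf.comp_left (g := fun φ => (⟪S.basis n, φ⟫_ℂ).re) (by simp)

theorem hasSum_norm_sq (φ : HSpace P) :
    HasSum (fun n => ‖⟪S.basis n, φ⟫_ℂ‖ ^ 2) (‖φ‖ ^ 2) := by
  have h1 : ‖φ‖ = ‖S.basis.repr φ‖ := (LinearIsometryEquiv.norm_map _ _).symm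
  rw [h1, lp_norm_sq]
  have h2 := (summable_lp_sq (S.basis.repr φ)).hasSum
  simp only [HilbertBasis.repr_apply_apply] at h2 ⊢
  exact h2

/-- Bessel at each time, with ‖f t‖ bounded and the time support compact. All convergence statements
for the classical solution derive from this. -/
theorem summable_mass_sq (hf : Continuous f) (hs : HasCompactSupport f) :
    Summable fun n => S.mass f n ^ 2 := by
  obtain ⟨B, hB⟩ := hs.exists_bound_of_continuous hf
  obtain ⟨R, hR⟩ := hs.isCompact.isBounded.subset_closedBall 0
  refine summable_sq_integral_abs (continuous_coef hf) (R := max R 1) (B := B ^ 2) (by positivity)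
    (fun n t ht => ?_) fun s t => ?_
  · have : f t = 0 := by
      by_contra h
      have := hR (subset_tsupport f h)
      rw [mem_closedBall_zero_iff, Real.norm_eq_abs] at this
      linarith [le_max_left R 1]
    simp [coef, this]
  · calc ∑ n ∈ s, S.coef f n t ^ 2 ≤ ∑ n ∈ s, ‖⟪S.basis n, f t⟫_ℂ‖ ^ 2 := by
          refine Finset.sum_le_sum fun n _ => ?_
          exact sq_le_sq' (neg_le_of_abs_le (Complex.abs_re_le_norm _)) (Complex.re_le_norm _)
      _ ≤ ‖f t‖ ^ 2 := sum_le_hasSum _ (fun n _ => by positivity) (hasSum_norm_sq (f t))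
      _ ≤ B ^ 2 := by
          gcongr
          exact hB t

/-- The addition theorem for the sine. The definition separates t from the source time, which makes
differentiation in t immediate. -/
theorem amplitude_eq (hf : Continuous f) (hs : HasCompactSupport f) (n : ℕ) (t : ℝ) :
    S.amplitude f n t = -∫ s, Real.sin (S.ω n * (t - s)) / S.ω n * S.coef f n s := by
  have hi : ∀ h : ℝ → ℝ, Continuous h → Integrable fun s => h s * S.coef f n s := fun h hh =>
    (hh.mul (continuous_coef hf n)).integrable_of_hasCompactSupport
      (hasCompactSupport_coef hs n).mul_left
  have h1 : ∀ s, Real.sin (S.ω n * (t - s)) / S.ω n * S.coef f n s =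
      Real.sin (S.ω n * t) / S.ω n * (Real.cos (S.ω n * s) * S.coef f n s) -
        Real.cos (S.ω n * t) / S.ω n * (Real.sin (S.ω n * s) * S.coef f n s) := fun s => by
    rw [mul_sub, Real.sin_sub]
    ring
  simp_rw [h1]
  rw [integral_sub ((hi _ (by fun_prop)).const_mul _) ((hi _ (by fun_prop)).const_mul _),
    integral_const_mul, integral_const_mul, amplitude]
  ring

theorem abs_amplitudes_le (hf : Continuous f) (hs : HasCompactSupport f) (n : ℕ) (t : ℝ) :
    |S.amplitude f n t| ≤ 2 * S.mass f n / S.ω n ∧ |S.amplitudeDeriv f n t| ≤ 2 * S.mass f n := by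
  have hω := S.ω_pos n
  have h1 := abs_integral_mul_le (h := fun s => Real.cos (S.ω n * s)) (continuous_coef (S := S) hf n)
    (hasCompactSupport_coef hs n) fun s => Real.abs_cos_le_one _
  have h2 := abs_integral_mul_le (h := fun s => Real.sin (S.ω n * s)) (continuous_coef (S := S) hf n)
    (hasCompactSupport_coef hs n) fun s => Real.abs_sin_le_one _
  have key : ∀ x y : ℝ, |x| ≤ S.mass f n → |y| ≤ S.mass f n → ∀ a b : ℝ, |a| ≤ 1 → |b| ≤ 1 →
      |a * x| + |b * y| ≤ 2 * S.mass f n := fun x y hx hy a b ha hb => by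
    rw [abs_mul, abs_mul]
    nlinarith [abs_nonneg x, abs_nonneg y]
  constructor
  · rw [amplitude, abs_div, abs_neg, abs_of_pos hω]
    gcongr
    exact (abs_sub _ _).trans (key _ _ h1 h2 _ _ (Real.abs_sin_le_one _) (Real.abs_cos_le_one _))
  · rw [amplitudeDeriv, abs_neg]
    exact (abs_add_le _ _).trans
      (key _ _ h1 h2 _ _ (Real.abs_cos_le_one _) (Real.abs_sin_le_one _))

theorem hasDerivAt_amplitude (n : ℕ) (t : ℝ) :
    HasDerivAt (S.amplitude f n) (S.amplitudeDeriv f n t) t := by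
  have hω := (S.ω_pos n).ne'
  have h0 : HasDerivAt (fun t => S.ω n * t) (S.ω n) t := by
    simpa using (hasDerivAt_id t).const_mul (S.ω n)
  have h1 := ((h0.sin.mul_const (∫ s, Real.cos (S.ω n * s) * S.coef f n s)).sub
    (h0.cos.mul_const (∫ s, Real.sin (S.ω n * s) * S.coef f n s))).neg.div_const (S.ω n)
  refine h1.congr_deriv ?_
  rw [amplitudeDeriv]
  field_simp
  ring

theorem continuous_amplitude (n : ℕ) : Continuous (S.amplitude f n) :=
  continuous_iff_continuousAt.mpr fun t => (hasDerivAt_amplitude n t).continuousAt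

theorem continuous_amplitudeDeriv (n : ℕ) : Continuous (S.amplitudeDeriv f n) := by
  unfold amplitudeDeriv
  fun_prop

theorem summable_inv_omega_sq (hA : P.Positive) : Summable fun n => (S.ω n)⁻¹ ^ 2 := by
  obtain ⟨c, hc, h⟩ := S.exists_linear_growth hA
  have h1 : Summable fun n : ℕ => (c⁻¹) ^ 2 * (1 / ((n + 1 : ℕ) : ℝ) ^ 2) :=
    ((summable_nat_add_iff 1).mpr (Real.summable_one_div_nat_pow.mpr one_lt_two)).mul_left _
  refine Summable.of_nonneg_of_le (fun n => by positivity) (fun n => ?_) h1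
  have h2 : (S.ω n)⁻¹ ≤ (c * (n + 1))⁻¹ := inv_anti₀ (by positivity) (h n)
  have h3 := inv_pos.mpr (S.ω_pos n)
  calc (S.ω n)⁻¹ ^ 2 ≤ (c * (n + 1))⁻¹ ^ 2 := by gcongr
    _ = _ := by
        push_cast
        field_simp

/-- Cauchy–Schwarz: the masses and the inverse frequencies are both square summable. -/
theorem summable_mass_div (hA : P.Positive) (hf : Continuous f) (hs : HasCompactSupport f) :
    Summable fun n => S.mass f n / S.ω n := by
  refine (summable_mul_of_sq_real (summable_mass_sq (S := S) hf hs)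
    (summable_inv_omega_sq (S := S) hA)).congr fun n => ?_
  rw [abs_of_nonneg (mass_nonneg n), abs_of_pos (inv_pos.mpr (S.ω_pos n)), div_eq_mul_inv]

theorem exists_mode_bound (hA : P.Positive) :
    ∃ C, 0 ≤ C ∧ ∀ x : Pt, P.IsPt x → ∀ n, |S.mode x.2 n| ≤ C := by
  obtain ⟨C, hC, h⟩ := S.exists_bounds hA
  refine ⟨C, hC, fun x hx n => ?_⟩
  rcases x with ⟨t, _ | z⟩
  · exact (h n).2
  · exact ((h n).1 z (hx z rfl)).1

/-- Uniformly bounded modes make ω_n⁻¹ Ψ_n(x) square summable in n, so sum and time integral may be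
exchanged at every point, and not merely almost everywhere. -/
theorem hasSum_phi (hA : P.Positive) (hf : Continuous f) (hs : HasCompactSupport f) {x : Pt}
    (hx : P.IsPt x) : HasSum (fun n => S.mode x.2 n * S.amplitude f n x.1) (S.phi f x) := by
  obtain ⟨C, hC, hm⟩ := exists_mode_bound (S := S) hA
  have h1 := hasSum_integral_smul (continuous_coef (S := S) hf) (hasCompactSupport_coef hs)
    (summable_mass_sq hf hs)
    (h := fun n s => Real.sin (S.ω n * (x.1 - s)) / S.ω n * S.mode x.2 n) (fun n => by fun_prop)
    (q := fun n => (S.ω n)⁻¹ * C) (by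
      simp_rw [mul_pow]
      exact (summable_inv_omega_sq hA).mul_right _) (fun n s => by
      rw [Real.norm_eq_abs, abs_mul, abs_div, abs_of_pos (S.ω_pos n), div_eq_inv_mul]
      have h0 := inv_pos.mpr (S.ω_pos n)
      refine mul_le_mul ?_ (hm x hx n) (abs_nonneg _) h0.le
      nlinarith [Real.abs_sin_le_one (S.ω n * (x.1 - s))])
  have h2 : S.phi f x = -∫ s, ∑' n, S.coef f n s •
      (Real.sin (S.ω n * (x.1 - s)) / S.ω n * S.mode x.2 n) := by
    have h3 : S.phi f x = -∫ s, ∑' n, Real.sin (S.ω n * (x.1 - s)) / S.ω n *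
      (S.mode x.2 n * S.coef f n s) := rfl
    rw [h3]
    congr 2
    funext s
    congr 1
    funext n
    rw [smul_eq_mul]
    ring
  rw [h2]
  have h4 : (fun n => S.mode x.2 n * S.amplitude f n x.1) = fun n => -∫ s, S.coef f n s •
      (Real.sin (S.ω n * (x.1 - s)) / S.ω n * S.mode x.2 n) := funext fun n => ?_
  · rw [h4]
    exact h1.neg
  rw [amplitude_eq hf hs, mul_neg, ← integral_const_mul]
  congr 2
  funext s
  rw [smul_eq_mul]
  ring

end EigenSystem

variable {P : Params}

/-! ## Functions of `A` and the components of the classical solution -/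

namespace EigenSystem

variable {S : EigenSystem P} {f : ℝ → HSpace P}

theorem hasSum_spectral {c : ℕ → ℂ} {φ : HSpace P}
    (h : Summable fun n => ‖c n * ⟪S.basis n, φ⟫_ℂ‖ ^ 2) :
    HasSum (fun n => (c n * ⟪S.basis n, φ⟫_ℂ) • S.basis n) (S.spectral c φ) ∧
      ∀ n, ⟪S.basis n, S.spectral c φ⟫_ℂ = c n * ⟪S.basis n, φ⟫_ℂ := by
  obtain ⟨a, ha⟩ := exists_lp_of_summable h
  have h1 := S.basis.hasSum_repr_symm a
  have h2 : (fun n => a n • S.basis n) = fun n => (c n * ⟪S.basis n, φ⟫_ℂ) • S.basis n :=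
    funext fun n => by rw [ha]
  rw [h2] at h1
  have h3 : S.spectral c φ = S.basis.repr.symm a := h1.tsum_eq
  refine ⟨h3 ▸ h1, fun n => ?_⟩
  rw [h3, ← HilbertBasis.repr_apply_apply, LinearIsometryEquiv.apply_symm_apply, ha]

theorem summable_spectral_of_bounded {c : ℕ → ℂ} {K : ℝ} (hc : ∀ n, ‖c n‖ ≤ K) (φ : HSpace P) :
    Summable fun n => ‖c n * ⟪S.basis n, φ⟫_ℂ‖ ^ 2 := by
  refine Summable.of_nonneg_of_le (fun n => by positivity) (fun n => ?_)
    ((hasSum_norm_sq (S := S) φ).summable.mul_left (K ^ 2))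
  rw [norm_mul, mul_pow]
  gcongr
  exact hc n

theorem norm_spectral_le {c : ℕ → ℂ} {K : ℝ} (hc : ∀ n, ‖c n‖ ≤ K) (φ : HSpace P) :
    ‖S.spectral c φ‖ ≤ K * ‖φ‖ := by
  have hK : 0 ≤ K := (norm_nonneg _).trans (hc 0)
  refine le_of_sq_le_sq ?_ (by positivity)
  have h1 := hasSum_norm_sq (S := S) (S.spectral c φ)
  rw [mul_pow]
  refine hasSum_le (fun n => ?_) h1 ((hasSum_norm_sq (S := S) φ).mul_left (K ^ 2))
  rw [(hasSum_spectral (summable_spectral_of_bounded hc φ)).2, norm_mul, mul_pow]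
  gcongr
  exact hc n

theorem inner_eq_coef (hf : P.IsTest f) (n : ℕ) (t : ℝ) :
    ⟪S.basis n, f t⟫_ℂ = (S.coef f n t : ℂ) := by
  refine Complex.ext rfl ?_
  rw [Complex.ofReal_im, hspace_inner]
  have h1 : ∫ z, starRingEnd ℂ ((S.basis n).fst z) * (f t).fst z ∂P.bulkMeasure =
      ∫ z, ((S.ψ n z * ((f t).fst z).re : ℝ) : ℂ) ∂P.bulkMeasure := by
    refine integral_congr_ae ?_
    filter_upwards [S.basis_fst n, (hf.2.2 t).1] with z h1 h2
    rw [h1, Complex.conj_ofReal, Complex.ofReal_mul]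
    congr 1
    exact Complex.ext (by simp) (by simp [h2])
  have h2 : ∫ z, ((S.ψ n z * ((f t).fst z).re : ℝ) : ℂ) ∂P.bulkMeasure =
      ((∫ z, S.ψ n z * ((f t).fst z).re ∂P.bulkMeasure : ℝ) : ℂ) := integral_ofReal
  rw [h1, h2, S.basis_snd]
  simp [(hf.2.2 t).2]

theorem hasSum_E (hA : P.Positive) (hf : P.IsTest f) (t : ℝ) :
    HasSum (fun n => (S.amplitude f n t : ℂ) • S.basis n) (S.E f t) := by
  have h1 := hasSum_integral_smul (continuous_coef (S := S) hf.1) (hasCompactSupport_coef hf.2.1)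
    (summable_mass_sq hf.1 hf.2.1)
    (h := fun n s => (-(Real.sin (S.ω n * (t - s)) / S.ω n)) • S.basis n) (fun n => by fun_prop)
    (q := fun n => (S.ω n)⁻¹) (summable_inv_omega_sq hA) (fun n s => by
      rw [norm_smul, S.norm_basis, mul_one, norm_neg, Real.norm_eq_abs, abs_div,
        abs_of_pos (S.ω_pos n), div_eq_inv_mul]
      nlinarith [Real.abs_sin_le_one (S.ω n * (t - s)), inv_pos.mpr (S.ω_pos n)])
  have h2 : S.E f t = ∫ s, ∑' n, S.coef f n s •
      ((-(Real.sin (S.ω n * (t - s)) / S.ω n)) • S.basis n) := by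
    refine integral_congr_ae (ae_of_all _ fun s => ?_)
    show ∑' n, _ = _
    congr 1
    funext n
    have h3 : ((-(Real.sin (S.ω n * (t - s)) / S.ω n) : ℝ) : ℂ) * ⟪S.basis n, f s⟫_ℂ =
      ((S.coef f n s * -(Real.sin (S.ω n * (t - s)) / S.ω n) : ℝ) : ℂ) := by
      rw [inner_eq_coef hf]
      push_cast
      ring
    rw [smul_smul]
    exact (congrArg (· • S.basis n) h3).trans (Complex.coe_smul _ _)
  rw [h2]
  have h4 : (fun n => (S.amplitude f n t : ℂ) • S.basis n) = fun n => ∫ s, S.coef f n s •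
      ((-(Real.sin (S.ω n * (t - s)) / S.ω n)) • S.basis n) := funext fun n => by
    simp_rw [smul_smul]
    rw [integral_smul_const, amplitude_eq hf.1 hf.2.1, ← integral_neg, Complex.coe_smul]
    congr 2
    funext s
    ring
  rw [h4]
  exact h1

theorem E_snd (hA : P.Positive) (hf : P.IsTest f) (t : ℝ) :
    (S.E f t).snd.val = (S.phi f (t, none) : ℂ) := by
  have h1 := (hasSum_E (S := S) hA hf t).mapL (bdryL P)
  have h2 := (hasSum_phi (S := S) hA hf.1 hf.2.1 (x := (t, none)) (by simp [Params.IsPt])).mapL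
    Complex.ofRealCLM
  have h3 : (fun n => bdryL P ((S.amplitude f n t : ℂ) • S.basis n)) =
      fun n => Complex.ofRealCLM (S.mode none n * S.amplitude f n t) := funext fun n => by
    rw [bdryL_apply, hspace_smul_snd, S.basis_snd, mul_comm, Complex.ofRealCLM_apply,
      Complex.ofReal_mul]
  rw [h3] at h1
  exact h1.unique h2

/-- The eigenfunction series converges to the vector in L², hence almost everywhere along a
subsequence; at every point it converges to `S.phi`, so the two limits agree. -/
theorem E_fst (hA : P.Positive) (hf : P.IsTest f) (t : ℝ) :
    ⇑(S.E f t).fst =ᵐ[P.bulkMeasure] fun z => (S.phi f (t, some z) : ℂ) := by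
  have h1 := (hasSum_E (S := S) hA hf t).tendsto_sum_nat
  have h2 : Tendsto (fun N => (∑ n ∈ Finset.range N, (S.amplitude f n t : ℂ) • S.basis n).fst)
      atTop (𝓝 (S.E f t).fst) :=
    ((WithLp.fstL 2 ℂ (Lp ℂ 2 P.bulkMeasure) (BdryLine P)).continuous.tendsto _).comp h1
  obtain ⟨ns, hns, h3⟩ := (tendstoInMeasure_of_tendsto_Lp h2).exists_seq_tendsto_ae
  have h4 : ∀ᵐ z ∂P.bulkMeasure, ∀ N : ℕ,
      (∑ n ∈ Finset.range N, (S.amplitude f n t : ℂ) • S.basis n).fst z =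
        ∑ n ∈ Finset.range N, (S.amplitude f n t : ℂ) * (S.ψ n z : ℂ) := by
    refine ae_all_iff.mpr fun N => ?_
    have h5 : ∀ᵐ z ∂P.bulkMeasure, ∀ n, (S.basis n).fst z = (S.ψ n z : ℂ) :=
      ae_all_iff.mpr fun n => S.basis_fst n
    have h6 : ∀ᵐ z ∂P.bulkMeasure, ∀ n, ((S.amplitude f n t : ℂ) • S.basis n).fst z =
        (S.amplitude f n t : ℂ) * (S.basis n).fst z :=
      ae_all_iff.mpr fun n => hspace_smul_fst _ _
    filter_upwards [h5, h6, hspace_sum_fst (Finset.range N)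
      fun n => (S.amplitude f n t : ℂ) • S.basis n] with z h5 h6 h7
    rw [h7]
    exact Finset.sum_congr rfl fun n _ => by rw [h6, h5]
  filter_upwards [h3, h4, bulk_ae_mem P] with z h3 h4 hz
  have h5 := ((hasSum_phi (S := S) hA hf.1 hf.2.1 (x := (t, some z)) (by
    intro y hy
    obtain rfl : z = y := by simpa using hy
    exact Ioo_subset_Icc_self hz)).mapL Complex.ofRealCLM).tendsto_sum_nat.comp hns.tendsto_atTop
  refine tendsto_nhds_unique h3 (h5.congr fun i => ?_)
  rw [h4]
  refine Finset.sum_congr rfl fun n _ => ?_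
  simp [mode, mul_comm]

/-- Measurability needs an argument, since t enters both the multiplier and the vector: the
integrand is a pointwise limit of continuous partial sums. The norm is dominated by K ‖f t‖. -/
theorem integrable_spectral (hf : Continuous f) (hs : HasCompactSupport f) {c : ℕ → ℝ → ℂ}
    (hc : ∀ n, Continuous (c n)) {K : ℝ} (hK : ∀ n t, ‖c n t‖ ≤ K) :
    Integrable fun t => S.spectral (fun n => c n t) (f t) := by
  have hm : AEStronglyMeasurable fun t => S.spectral (fun n => c n t) (f t) := by
    refine aestronglyMeasurable_of_tendsto_ae atTop
      (f := fun N t => ∑ n ∈ Finset.range N, (c n t * ⟪S.basis n, f t⟫_ℂ) • S.basis n)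
      (fun N => ?_) (ae_of_all _ fun t => (hasSum_spectral
        (summable_spectral_of_bounded (fun n => hK n t) (f t))).1.tendsto_sum_nat)
    refine (continuous_finsetSum _ fun n _ => ?_).aestronglyMeasurable
    exact ((hc n).mul (continuous_const.inner hf)).smul continuous_const
  refine ((hf.integrable_of_hasCompactSupport hs).norm.const_mul K).mono' hm
    (ae_of_all _ fun t => norm_spectral_le (fun n => hK n t) (f t))

/-- The inner product with Ψ_n passes through the time integral, and the coefficients of f are real.
Each component is thus given by a cosine and a sine transform, in terms of which the amplitudes are
also written. -/
theorem oneParticle_apply (hf : P.IsTest f) (n : ℕ) :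
    S.oneParticle f n = ((Real.sqrt (S.ω n))⁻¹ : ℂ) *
      (((∫ s, Real.cos (S.ω n * s) * S.coef f n s : ℝ) : ℂ) +
        Complex.I * ((∫ s, Real.sin (S.ω n * s) * S.coef f n s : ℝ) : ℂ)) := by
  set c : ℕ → ℝ → ℂ := fun n t =>
    Complex.exp (Complex.I * (S.ω n * t : ℝ)) / (Real.sqrt (S.ω n) : ℂ) with hc
  have hK : ∀ n t, ‖c n t‖ ≤ (Real.sqrt (S.ω 0))⁻¹ := fun n t => by
    rw [hc, norm_div, mul_comm Complex.I, Complex.norm_exp_ofReal_mul_I, Complex.norm_real,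
      Real.norm_of_nonneg (Real.sqrt_nonneg _), one_div]
    exact inv_anti₀ (Real.sqrt_pos.mpr (S.ω_pos 0))
      (Real.sqrt_le_sqrt (S.ω_strictMono.monotone (Nat.zero_le n)))
  have hcc : ∀ n, Continuous (c n) := fun n => by fun_prop
  have h1 : S.oneParticle f n = ⟪S.basis n, ∫ t, S.spectral (fun n => c n t) (f t)⟫_ℂ :=
    HilbertBasis.repr_apply_apply _ _ _
  have h2 := integral_inner (𝕜 := ℂ) (integrable_spectral (S := S) hf.1 hf.2.1 hcc hK) (S.basis n)
  rw [h1, ← h2]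
  have hi : ∀ h : ℝ → ℝ, Continuous h → Integrable fun s => h s * S.coef f n s := fun h hh =>
    (hh.mul (continuous_coef hf.1 n)).integrable_of_hasCompactSupport
      (hasCompactSupport_coef hf.2.1 n).mul_left
  have h3 : ∀ s, ⟪S.basis n, S.spectral (fun n => c n s) (f s)⟫_ℂ = ((Real.sqrt (S.ω n))⁻¹ : ℂ) *
      (((Real.cos (S.ω n * s) * S.coef f n s : ℝ) : ℂ) +
        Complex.I * ((Real.sin (S.ω n * s) * S.coef f n s : ℝ) : ℂ)) := fun s => by
    rw [(hasSum_spectral (summable_spectral_of_bounded (fun n => hK n s) (f s))).2,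
      inner_eq_coef hf]
    show Complex.exp (Complex.I * (S.ω n * s : ℝ)) / (Real.sqrt (S.ω n) : ℂ) * _ = _
    rw [mul_comm Complex.I, Complex.exp_mul_I, ← Complex.ofReal_cos, ← Complex.ofReal_sin]
    push_cast
    ring
  simp_rw [h3]
  have h4 : ∫ s, ((Real.cos (S.ω n * s) * S.coef f n s : ℝ) : ℂ) =
    ((∫ s, Real.cos (S.ω n * s) * S.coef f n s : ℝ) : ℂ) := integral_ofReal
  have h5 : ∫ s, ((Real.sin (S.ω n * s) * S.coef f n s : ℝ) : ℂ) =
    ((∫ s, Real.sin (S.ω n * s) * S.coef f n s : ℝ) : ℂ) := integral_ofReal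
  have i4 : Integrable fun s => ((Real.cos (S.ω n * s) * S.coef f n s : ℝ) : ℂ) :=
    (hi _ (by fun_prop)).ofReal
  have i5 : Integrable fun s => ((Real.sin (S.ω n * s) * S.coef f n s : ℝ) : ℂ) :=
    (hi _ (by fun_prop)).ofReal
  rw [integral_const_mul, integral_add i4 (i5.const_mul _), integral_const_mul, h4, h5]

end EigenSystem

variable {P : Params}

/-! ## Field commutators and the classical solution -/

/-- Any power of the harmonic sums is dominated by a square root. -/
theorem exists_one_add_log_pow_le (m : ℕ) :
    ∃ K, 0 ≤ K ∧ ∀ x : ℝ, 1 ≤ x → (1 + Real.log x) ^ m ≤ K * x ^ (1 / 2 : ℝ) := by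
  set ε : ℝ := 1 / (2 * (m + 1)) with hε
  have hε0 : 0 < ε := by positivity
  refine ⟨(1 + 1 / ε) ^ m, by positivity, fun x hx => ?_⟩
  have h1 : 1 ≤ x ^ ε := Real.one_le_rpow hx hε0.le
  have h2 := Real.log_le_rpow_div (by linarith : 0 ≤ x) hε0
  have h3 := Real.log_nonneg hx
  calc (1 + Real.log x) ^ m ≤ ((1 + 1 / ε) * x ^ ε) ^ m := by
        gcongr
        rw [add_mul, one_mul, div_mul_eq_mul_div, one_mul]
        exact add_le_add h1 h2
    _ = (1 + 1 / ε) ^ m * x ^ (ε * m) := by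
        rw [mul_pow, ← Real.rpow_natCast (x ^ ε), ← Real.rpow_mul (by linarith)]
    _ ≤ (1 + 1 / ε) ^ m * x ^ (1 / 2 : ℝ) := by
        refine mul_le_mul_of_nonneg_left (Real.rpow_le_rpow_of_exponent_le hx ?_) (by positivity)
        rw [hε, div_mul_eq_mul_div, one_mul, div_le_div_iff₀ (by positivity) two_pos]
        linarith

/-- The growth rate of the norms of the point fields. -/
def logGrowth (N : ℕ) : ℝ := 1 + Real.log ((N : ℝ) + 1)

theorem one_le_logGrowth (N : ℕ) : 1 ≤ logGrowth N := by
  have : 0 ≤ Real.log ((N : ℝ) + 1) := Real.log_nonneg (by linarith [N.cast_nonneg (α := ℝ)])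
  unfold logGrowth
  linarith

theorem logGrowth_mono {N n : ℕ} (h : N ≤ n) : logGrowth N ≤ logGrowth n := by
  unfold logGrowth
  gcongr

/-- Every power of the logarithm is O(n^{1/2}), so the terms are O(n^{-3/2}). -/
theorem summable_logGrowth (k : ℕ) : Summable fun n : ℕ => (logGrowth n ^ k / (n + 1)) ^ 2 := by
  obtain ⟨K, hK, h⟩ := exists_one_add_log_pow_le (k * 2)
  have h1 : Summable fun n : ℕ => K * (1 / ((n + 1 : ℕ) : ℝ) ^ (3 / 2 : ℝ)) :=
    ((summable_nat_add_iff 1).mpr (Real.summable_one_div_nat_rpow.mpr (by norm_num))).mul_left _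
  refine Summable.of_nonneg_of_le (fun n => by positivity) (fun n => ?_) h1
  have h0 : (0 : ℝ) < n + 1 := by positivity
  rw [div_pow, ← pow_mul, div_le_iff₀ (by positivity)]
  refine (h ((n : ℝ) + 1) (by linarith [n.cast_nonneg (α := ℝ)])).trans (le_of_eq ?_)
  push_cast
  have h2 : ((n : ℝ) + 1) ^ 2 = ((n : ℝ) + 1) ^ (1 / 2 : ℝ) * ((n : ℝ) + 1) ^ (3 / 2 : ℝ) := by
    rw [← Real.rpow_add h0, ← Real.rpow_natCast]
    norm_num
  rw [h2]
  field_simp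

namespace EigenSystem

variable {S : EigenSystem P} {f g : ℝ → HSpace P}

/-- Mode by mode both sides equal (C_g S_f − S_g C_f)/ω_n, with C and S the cosine and sine
transforms of the coefficients. The commutator of the quantum fields is thus the pairing with the
classical solution. -/
theorem integral_E_inner (hA : P.Positive) (hf : P.IsTest f) (hg : P.IsTest g) :
    ∫ t, (⟪S.E f t, g t⟫_ℂ).re = (⟪S.oneParticle g, S.oneParticle f⟫_ℂ).im := by
  have hω0 := S.ω_pos 0
  have hq : Summable fun n => (2 * S.mass f n / S.ω 0) ^ 2 := by
    refine ((summable_mass_sq (S := S) hf.1 hf.2.1).mul_left ((2 / S.ω 0) ^ 2)).congr fun n => ?_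
    ring
  have h1 := hasSum_integral_smul (continuous_coef (S := S) hg.1) (hasCompactSupport_coef hg.2.1)
    (summable_mass_sq hg.1 hg.2.1) (fun n => continuous_amplitude (S := S) (f := f) n) hq
    (fun n t => by
      refine (abs_amplitudes_le hf.1 hf.2.1 n t).1.trans ?_
      have := mass_nonneg (S := S) (f := f) n
      gcongr
      exact S.ω_strictMono.monotone (Nat.zero_le n))
  have h2 : ∀ t, (⟪S.E f t, g t⟫_ℂ).re = ∑' n, S.coef g n t • S.amplitude f n t := fun t => by
    have h3 := ((hasSum_E (S := S) hA hf t).mapL (innerSL ℂ (g t))).mapL Complex.reCLM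
    rw [← inner_conj_symm, Complex.conj_re]
    refine h3.tsum_eq.symm.trans (tsum_congr fun n => ?_)
    have h4 : ⟪g t, (S.amplitude f n t : ℂ) • S.basis n⟫_ℂ =
        ((S.coef g n t * S.amplitude f n t : ℝ) : ℂ) := by
      rw [inner_smul_right, ← inner_conj_symm, inner_eq_coef hg, Complex.conj_ofReal,
        Complex.ofReal_mul, mul_comm]
    exact congrArg Complex.re h4
  have h5 : Summable fun n => starRingEnd ℂ (S.oneParticle g n) * S.oneParticle f n := by
    refine Summable.of_norm ((summable_mul_of_sq (summable_lp_sq (S.oneParticle g))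
      (summable_lp_sq (S.oneParticle f))).congr fun n => ?_)
    rw [norm_mul, RCLike.norm_conj]
  have h6 := h5.hasSum.mapL Complex.imCLM
  rw [oneParticle_inner]
  simp_rw [h2]
  refine h1.unique ?_
  have h7 : (fun n => ∫ t, S.coef g n t • S.amplitude f n t) = fun n => Complex.imCLM
      (starRingEnd ℂ (S.oneParticle g n) * S.oneParticle f n) := funext fun n => by
    have hi : ∀ h : ℝ → ℝ, Continuous h → Integrable fun s => h s * S.coef g n s := fun h hh =>
      (hh.mul (continuous_coef hg.1 n)).integrable_of_hasCompactSupport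
        (hasCompactSupport_coef hg.2.1 n).mul_left
    rw [oneParticle_apply hf, oneParticle_apply hg, Complex.imCLM_apply]
    set Cf := ∫ s, Real.cos (S.ω n * s) * S.coef f n s with hCf
    set Sf := ∫ s, Real.sin (S.ω n * s) * S.coef f n s with hSf
    set Cg := ∫ s, Real.cos (S.ω n * s) * S.coef g n s with hCg
    set Sg := ∫ s, Real.sin (S.ω n * s) * S.coef g n s with hSg
    have h8 : ∀ t, S.coef g n t • S.amplitude f n t =
        Sf / S.ω n * (Real.cos (S.ω n * t) * S.coef g n t) -
          Cf / S.ω n * (Real.sin (S.ω n * t) * S.coef g n t) := fun t => by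
      rw [smul_eq_mul, amplitude]
      ring
    simp_rw [h8]
    rw [integral_sub ((hi _ (by fun_prop)).const_mul _) ((hi _ (by fun_prop)).const_mul _),
      integral_const_mul, integral_const_mul, ← hCg, ← hSg]
    have hs : Real.sqrt (S.ω n) * Real.sqrt (S.ω n) = S.ω n := Real.mul_self_sqrt (S.ω_pos n).le
    have hs0 : Real.sqrt (S.ω n) ≠ 0 := (Real.sqrt_pos.mpr (S.ω_pos n)).ne'
    have h9 : starRingEnd ℂ (((Real.sqrt (S.ω n))⁻¹ : ℂ) * ((Cg : ℂ) + Complex.I * (Sg : ℂ))) *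
        (((Real.sqrt (S.ω n))⁻¹ : ℂ) * ((Cf : ℂ) + Complex.I * (Sf : ℂ))) =
        (((S.ω n)⁻¹ * (Cg * Cf + Sg * Sf) : ℝ) : ℂ) +
          (((S.ω n)⁻¹ * (Cg * Sf - Sg * Cf) : ℝ) : ℂ) * Complex.I := by
      generalize Real.sqrt (S.ω n) = r at hs hs0 ⊢
      rw [← hs]
      simp only [map_mul, map_add, map_inv₀, Complex.conj_ofReal, Complex.conj_I]
      push_cast
      have : (Complex.I) ^ 2 = -1 := Complex.I_sq
      linear_combination (-(Sf : ℂ) * Sg * (r : ℂ)⁻¹ ^ 2) * this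
    rw [h9]
    simp
    ring
  rw [h7]
  exact h6

/-- The element of `ℓ²(ℕ)` that defines the `N`-th partial sum of the field at a point. -/
def pointVector (S : EigenSystem P) (N : ℕ) (x : Pt) : OneParticle :=
  ∑ n ∈ Finset.range N, lp.single 2 n
    (Complex.exp (Complex.I * (S.ω n * x.1 : ℝ)) / (Real.sqrt (S.ω n) : ℂ) * (S.mode x.2 n : ℂ))

/-- The `N`-th partial sum of the classical solution. -/
def partialPhi (S : EigenSystem P) (f : ℝ → HSpace P) (N : ℕ) (x : Pt) : ℝ :=
  ∑ n ∈ Finset.range N, S.mode x.2 n * S.amplitude f n x.1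

/-- The same computation with the test function replaced by finitely many modes at a point. At a
finite cutoff the shift is the partial sum of the classical solution, and not yet its limit. -/
theorem inner_pointVector (hf : P.IsTest f) (N : ℕ) (x : Pt) :
    (⟪S.pointVector N x, S.oneParticle f⟫_ℂ).im = S.partialPhi f N x := by
  rw [pointVector, sum_inner, Complex.im_sum, partialPhi]
  refine Finset.sum_congr rfl fun n _ => ?_
  rw [lp.inner_single_left, RCLike.inner_apply, oneParticle_apply hf, amplitude]
  set Cf := ∫ s, Real.cos (S.ω n * s) * S.coef f n s
  set Sf := ∫ s, Real.sin (S.ω n * s) * S.coef f n s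
  rw [mul_comm Complex.I ((S.ω n * x.1 : ℝ) : ℂ), Complex.exp_mul_I, ← Complex.ofReal_cos,
    ← Complex.ofReal_sin]
  have hs : Real.sqrt (S.ω n) * Real.sqrt (S.ω n) = S.ω n := Real.mul_self_sqrt (S.ω_pos n).le
  have hs0 : Real.sqrt (S.ω n) ≠ 0 := (Real.sqrt_pos.mpr (S.ω_pos n)).ne'
  set c := Real.cos (S.ω n * x.1)
  set s := Real.sin (S.ω n * x.1)
  have h9 : (((Real.sqrt (S.ω n))⁻¹ : ℂ) * ((Cf : ℂ) + Complex.I * (Sf : ℂ))) *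
      starRingEnd ℂ (((c : ℂ) + (s : ℂ) * Complex.I) / (Real.sqrt (S.ω n) : ℂ) *
        (S.mode x.2 n : ℂ)) =
      (((S.ω n)⁻¹ * S.mode x.2 n * (c * Cf + s * Sf) : ℝ) : ℂ) +
        (((S.ω n)⁻¹ * S.mode x.2 n * (c * Sf - s * Cf) : ℝ) : ℂ) * Complex.I := by
    generalize Real.sqrt (S.ω n) = r at hs hs0 ⊢
    rw [← hs]
    simp only [map_mul, map_add, map_div₀, Complex.conj_ofReal, Complex.conj_I]
    push_cast
    have : (Complex.I) ^ 2 = -1 := Complex.I_sq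
    linear_combination (-(Sf : ℂ) * s * S.mode x.2 n * (r : ℂ)⁻¹ ^ 2) * this
  rw [h9]
  simp
  ring

/-- The squared norm is ∑ Ψ_n(x)²/ω_n over n < N, at most a multiple of a harmonic sum. The square
root is wasted through 2t ≤ 1 + t², since any power of the logarithm is acceptable. -/
theorem exists_norm_pointVector_le (hA : P.Positive) : ∃ K, 0 ≤ K ∧ ∀ N (x : Pt), P.IsPt x →
    ‖S.pointVector N x‖ ≤ K * logGrowth N := by
  obtain ⟨C, hC, hm⟩ := exists_mode_bound (S := S) hA
  obtain ⟨c, hc, hω⟩ := S.exists_linear_growth hA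
  refine ⟨1 + C ^ 2 / c, by positivity, fun N x hx => ?_⟩
  have h1 : ‖S.pointVector N x‖ ^ 2 = ∑ n ∈ Finset.range N, S.mode x.2 n ^ 2 / S.ω n := by
    have h2 := lp.norm_sum_single (p := 2) (by norm_num) (fun n => (Complex.exp (Complex.I *
      (S.ω n * x.1 : ℝ)) / (Real.sqrt (S.ω n) : ℂ) * (S.mode x.2 n : ℂ) : ℂ)) (Finset.range N)
    simp only [ENNReal.toReal_ofNat, Real.rpow_ofNat] at h2
    refine h2.trans (Finset.sum_congr rfl fun n _ => ?_)
    rw [norm_mul, norm_div, mul_comm Complex.I, Complex.norm_exp_ofReal_mul_I, Complex.norm_real,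
      Complex.norm_real, Real.norm_of_nonneg (Real.sqrt_nonneg _), mul_pow, div_pow,
      Real.sq_sqrt (S.ω_pos n).le, Real.norm_eq_abs, sq_abs]
    ring
  have h3 : ∑ n ∈ Finset.range N, S.mode x.2 n ^ 2 / S.ω n ≤
      ∑ n ∈ Finset.range N, C ^ 2 / c * ((n : ℝ) + 1)⁻¹ := by
    refine Finset.sum_le_sum fun n _ => ?_
    rw [div_mul_eq_mul_div, ← div_eq_mul_inv, div_div, mul_comm _ c]
    have h4 : S.mode x.2 n ^ 2 ≤ C ^ 2 := sq_le_sq.mpr ((hm x hx n).trans (le_abs_self C))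
    gcongr
    exact hω n
  have h5 : ∑ n ∈ Finset.range N, ((n : ℝ) + 1)⁻¹ ≤ logGrowth N := by
    have h6 := harmonic_le_one_add_log N
    rw [harmonic] at h6
    push_cast at h6
    refine h6.trans ?_
    unfold logGrowth
    rcases Nat.eq_zero_or_pos N with rfl | hN
    · simp
    · gcongr
      linarith
  rw [← Finset.mul_sum] at h3
  have h7 : ‖S.pointVector N x‖ ^ 2 ≤ C ^ 2 / c * logGrowth N :=
    h1.le.trans (h3.trans (mul_le_mul_of_nonneg_left h5 (by positivity)))
  nlinarith [sq_nonneg (‖S.pointVector N x‖ - 1), one_le_logGrowth N]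

/-- The partial sums of the classical solution converge faster than any power of a logarithm. -/
theorem exists_partialPhi_rate (hA : P.Positive) (hf : Continuous f) (hs : HasCompactSupport f) :
    ∃ (B : ℝ) (δ : ℕ → ℝ), 0 ≤ B ∧ (∀ N (x : Pt), P.IsPt x → |S.partialPhi f N x| ≤ B ∧
      |S.phi f x| ≤ B ∧ |S.phi f x - S.partialPhi f N x| ≤ δ N) ∧
      ∀ k, Tendsto (fun N => δ N * logGrowth N ^ k) atTop (𝓝 0) := by
  obtain ⟨C, hC, hm⟩ := exists_mode_bound (S := S) hA
  obtain ⟨c, hc, hω⟩ := S.exists_linear_growth hA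
  set u : ℕ → ℝ := fun n => C * (2 * S.mass f n / S.ω n) with hu
  have hm0 := mass_nonneg (S := S) (f := f)
  have hu0 : ∀ n, 0 ≤ u n := fun n => mul_nonneg hC (div_nonneg (by linarith [hm0 n]) (S.ω_pos n).le)
  have hus : Summable u := by
    refine ((summable_mass_div (S := S) hA hf hs).mul_left (C * 2)).congr fun n => ?_
    rw [hu]
    ring
  have hterm : ∀ (x : Pt), P.IsPt x → ∀ n, |S.mode x.2 n * S.amplitude f n x.1| ≤ u n :=
    fun x hx n => by
      rw [abs_mul]
      exact mul_le_mul (hm x hx n) (abs_amplitudes_le hf hs n x.1).1 (abs_nonneg _) hC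
  refine ⟨∑' n, u n, fun N => ∑' n, u (n + N), tsum_nonneg hu0, fun N x hx => ⟨?_, ?_, ?_⟩,
    fun k => ?_⟩
  · exact (Finset.abs_sum_le_sum_abs _ _).trans ((Finset.sum_le_sum fun n _ => hterm x hx n).trans
      (hus.sum_le_tsum _ fun n _ => hu0 n))
  · rw [← (hasSum_phi hA hf hs hx).tsum_eq]
    refine tsum_of_norm_bounded (E := ℝ) hus.hasSum fun n => ?_
    exact hterm x hx n
  · have h1 := hasSum_phi (S := S) hA hf hs hx
    have h2 := (hasSum_nat_add_iff' N).mpr h1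
    rw [← partialPhi] at h2
    rw [← h2.tsum_eq]
    refine tsum_of_norm_bounded (E := ℝ) ((summable_nat_add_iff N).mpr hus).hasSum fun n => ?_
    exact hterm x hx _
  -- Cauchy–Schwarz pairs the square summable masses with log^k n / n. As `logGrowth` is increasing,
  -- the tail of u times the growth at its first index is at most the tail of this series.
  · have hv : Summable fun n => u n * logGrowth n ^ k := by
      have h1 := summable_mul_of_sq_real (summable_mass_sq (S := S) hf hs) (summable_logGrowth k)
      refine Summable.of_nonneg_of_le (fun n => mul_nonneg (hu0 n)
        (pow_nonneg (zero_le_one.trans (one_le_logGrowth n)) _)) (fun n => ?_)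
        (h1.mul_left (2 * C / c))
      have hg : 0 ≤ logGrowth n ^ k := pow_nonneg (zero_le_one.trans (one_le_logGrowth n)) _
      rw [abs_of_nonneg (hm0 n), abs_of_nonneg (by positivity)]
      calc u n * logGrowth n ^ k ≤ C * (2 * S.mass f n / (c * (n + 1))) * logGrowth n ^ k := by
            have := hm0 n
            show C * (2 * S.mass f n / S.ω n) * _ ≤ _
            gcongr
            exact hω n
        _ = _ := by field_simp
    refine squeeze_zero (fun N => mul_nonneg (tsum_nonneg fun n => hu0 _)
      (pow_nonneg (zero_le_one.trans (one_le_logGrowth N)) _)) (fun N => ?_)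
      (tendsto_sum_nat_add fun n => u n * logGrowth n ^ k)
    rw [← tsum_mul_right]
    refine Summable.tsum_le_tsum (fun n => ?_) (((summable_nat_add_iff N).mpr hus).mul_right _)
      ((summable_nat_add_iff N).mpr hv)
    have := zero_le_one.trans (one_le_logGrowth N)
    exact mul_le_mul_of_nonneg_left (pow_le_pow_left₀ this (logGrowth_mono (Nat.le_add_left N n)) k)
      (hu0 _)

end EigenSystem

variable {P : Params}

/-! ## `n`-point functions at points -/

theorem list_prod_le_pow {B : ℝ} : ∀ L : List ℝ, (∀ a ∈ L, 0 ≤ a ∧ a ≤ B) →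
    0 ≤ L.prod ∧ L.prod ≤ B ^ L.length
  | [], _ => by simp
  | a :: L, h => by
    obtain ⟨h1, h2⟩ := list_prod_le_pow L fun b hb => h b (List.mem_cons_of_mem _ hb)
    obtain ⟨h3, h4⟩ := h a List.mem_cons_self
    rw [List.prod_cons, List.length_cons, pow_succ']
    exact ⟨mul_nonneg h3 h1, mul_le_mul h4 h2 h1 (h3.trans h4)⟩

namespace IsMomentFunctional

variable {η : State} {M : List (OneParticle × ℝ) → ℂ}

/-- Telescoping: the shifts are changed from c to c' one at a time, X holding the points already
changed and Y the others. Each change costs |c' − c| times a moment with one factor fewer. -/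
theorem exists_norm_sub_le (h : IsMomentFunctional η M) (k : ℕ) :
    ∃ K, 0 ≤ K ∧ ∀ (b : Pt → OneParticle) (c c' : Pt → ℝ) (B δ : ℝ) (X Y : List Pt),
      X.length + Y.length = k + 1 →
      (∀ x ∈ X ++ Y, ‖b x‖ + |c x| ≤ B ∧ ‖b x‖ + |c' x| ≤ B ∧ |c' x - c x| ≤ δ) →
      ‖M (X.map (fun x => (b x, c' x)) ++ Y.map fun x => (b x, c x)) -
        M ((X ++ Y).map fun x => (b x, c' x))‖ ≤ Y.length * (δ * (K * B ^ k)) := by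
  obtain ⟨K, hK, hb⟩ := h.bound k
  refine ⟨K, hK, fun b c c' B δ X Y => ?_⟩
  induction Y generalizing X with
  | nil =>
    intro _ _
    simp
  | cons y Y ih =>
    intro hlen hB
    have h1 := ih (X ++ [y]) (by simp at hlen ⊢; omega) (by simpa using hB)
    have h2 := h.replace (X.map fun x => (b x, c' x)) (Y.map fun x => (b x, c x)) (b y) (c y) (c' y)
    have hy := hB y (by simp)
    have h3 : ‖M (X.map (fun x => (b x, c' x)) ++ Y.map fun x => (b x, c x))‖ ≤ K * B ^ k := by
      refine (hb _ (by simp at hlen ⊢; omega)).trans (mul_le_mul_of_nonneg_left ?_ hK)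
      refine (list_prod_le_pow (B := B) _ ?_).2.trans (le_of_eq ?_)
      · intro a ha
        obtain ⟨p, hp, rfl⟩ := List.mem_map.mp ha
        refine ⟨by positivity, ?_⟩
        rcases List.mem_append.mp hp with hp | hp
        · obtain ⟨x, hx, rfl⟩ := List.mem_map.mp hp
          exact (hB x (by simp [hx])).2.1
        · obtain ⟨x, hx, rfl⟩ := List.mem_map.mp hp
          exact (hB x (by simp [hx])).1
      · congr 1
        simp at hlen ⊢
        omega
    have h4 : ‖((c' y - c y : ℝ) : ℂ) *
        M (X.map (fun x => (b x, c' x)) ++ Y.map fun x => (b x, c x))‖ ≤ δ * (K * B ^ k) := by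
      rw [norm_mul, Complex.norm_real]
      exact mul_le_mul hy.2.2 h3 (norm_nonneg _) ((abs_nonneg _).trans hy.2.2)
    rw [← h2] at h4
    simp only [List.map_append, List.map_cons, List.map_nil, List.append_assoc, List.cons_append,
      List.nil_append, List.length_cons] at h1 ⊢
    have h5 := (norm_sub_le_norm_sub_add_norm_sub _ _ _).trans (add_le_add h4 h1)
    push_cast
    linarith

/-- Expanding in the two shifts, the linear terms vanish with the one-point functions, and the
product of the shifts multiplies M [] = 1. -/
theorem pair (h : IsMomentFunctional η M) (b b' : OneParticle) (c c' : ℝ) :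
    M [(b, c), (b', c')] = M [(b, 0), (b', 0)] + ((c * c' : ℝ) : ℂ) := by
  have h1 := h.replace [] [(b', c')] b c 0
  have h2 := h.replace [(b, 0)] [] b' c' 0
  have h3 := h.replace [] [] b' c' 0
  have h4 := h.odd b'
  have h5 := h.odd b
  have h6 := h.nil
  simp only [List.nil_append, List.cons_append, List.append_nil] at h1 h2 h3
  rw [h4, h6] at h3
  rw [h5] at h2
  push_cast at *
  linear_combination h1 + h2 - (c : ℂ) * h3

end IsMomentFunctional

namespace EigenSystem

variable {S : EigenSystem P} {f : ℝ → HSpace P} {η ηf : State}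

theorem hasLimitExp_iff {ops : ℕ → List FockOp} {m : ℕ → ℂ} (h : ∀ N v, η (ops N) v ↔ v = m N)
    (v : ℂ) : HasLimitExp η ops v ↔ Tendsto m atTop (𝓝 v) := by
  constructor
  · rintro ⟨u, hu, hv⟩
    exact hv.congr fun N => (h N _).mp (hu N)
  · exact fun hv => ⟨m, fun N => (h N _).mpr rfl, hv⟩

/-- Expectations of products of partial sums of fields in a state and in the associated coherent
state. -/
theorem IsCoherentPair.exists_pointMoments (hA : P.Positive) (hf : P.IsTest f)
    (h : S.IsCoherentPair f η ηf) : ∃ M, IsMomentFunctional η M ∧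
      (∀ N (X : List Pt) v, ηf (X.map (S.pointField N)) v ↔
        v = M (X.map fun x => (S.pointVector N x, S.partialPhi f N x))) ∧
      ∀ N (X : List Pt) v (c : Pt → ℝ), η (X.map fun x => shift (S.pointField N x) (c x)) v ↔
        v = M (X.map fun x => (S.pointVector N x, c x)) := by
  obtain ⟨c, hc, hω⟩ := S.exists_linear_growth hA
  obtain ⟨M, hM, hMf⟩ := h.exists_momentFunctional hc hω
  refine ⟨M, hM, fun N X v => ?_, fun N X v c => ?_⟩
  · have h1 := hMf (X.map (S.pointVector N)) v
    rw [List.map_map, List.map_map] at h1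
    refine h1.trans ?_
    have h2 : (fun b => (b, (⟪b, S.oneParticle f⟫_ℂ).im)) ∘ S.pointVector N =
        fun x => (S.pointVector N x, S.partialPhi f N x) := funext fun x => by
      rw [Function.comp_apply, inner_pointVector hf]
    rw [h2]
  · have h1 := hM.iff (X.map fun x => (S.pointVector N x, c x)) v
    rw [List.map_map] at h1
    exact h1

/-- At cutoff N the coherent moments carry the partial sums of φ_f as shifts, whereas the claim has
φ_f itself. The telescoping bound is O(δ N · logGrowth N ^ (n − 1)) for n points, which tends to
zero, so the two sequences have the same limit or none. -/
theorem IsCoherentPair.hasNPoint_iff (hA : P.Positive) (hf : P.IsTest f)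
    (h : S.IsCoherentPair f η ηf) {X : List Pt} (hX : ∀ x ∈ X, P.IsPt x) (v : ℂ) :
    S.HasNPoint ηf X v ↔ S.HasShiftedNPoint η (S.phi f) X v := by
  obtain ⟨M, hM, hMf, hMs⟩ := h.exists_pointMoments hA hf
  refine (hasLimitExp_iff (fun N v => hMf N X v) v).trans
    (Iff.trans ?_ (hasLimitExp_iff (fun N v => hMs N X v (S.phi f)) v).symm)
  suffices hsub : Tendsto (fun N => M (X.map fun x => (S.pointVector N x, S.partialPhi f N x)) -
      M (X.map fun x => (S.pointVector N x, S.phi f x))) atTop (𝓝 0) by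
    constructor
    · intro h1
      have h2 := h1.sub hsub
      simpa using h2
    · intro h1
      have h2 := h1.add hsub
      simpa using h2
  rcases X with _ | ⟨x₀, X⟩
  · simp
  set Y := x₀ :: X with hY
  obtain ⟨K₁, hK₁, hv⟩ := exists_norm_pointVector_le (S := S) hA
  obtain ⟨B, δ, hB, hδ, hlim⟩ := exists_partialPhi_rate (S := S) hA hf.1 hf.2.1
  obtain ⟨K, hK, hbound⟩ := hM.exists_norm_sub_le X.length
  refine squeeze_zero_norm (a := fun N => Y.length * (K * (K₁ + B) ^ X.length) *
    (δ N * logGrowth N ^ X.length)) (fun N => ?_) (by simpa using (hlim X.length).const_mul _)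
  have h1 := hbound (S.pointVector N) (S.partialPhi f N) (S.phi f) ((K₁ + B) * logGrowth N) (δ N)
    [] Y (by simp [hY]) (fun x hx => by
      have hx' := hX x hx
      obtain ⟨h2, h3, h4⟩ := hδ N x hx'
      have h5 := hv N x hx'
      have h6 : B ≤ B * logGrowth N := le_mul_of_one_le_right hB (one_le_logGrowth N)
      exact ⟨by linarith, by linarith, h4⟩)
  refine h1.trans (le_of_eq ?_)
  rw [mul_pow]
  ring

/-- For two points the difference at each cutoff is exactly the product of two partial sums, so
plain convergence of the classical series is enough. -/
theorem IsCoherentPair.exists_twoPoint (hA : P.Positive) (hf : P.IsTest f)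
    (h : S.IsCoherentPair f η ηf) {x x' : Pt} (hx : P.IsPt x) (hx' : P.IsPt x') :
    ∃ u uf : ℕ → ℂ,
      (∀ N v, η [S.pointField N x, S.pointField N x'] v ↔ v = u N) ∧
      (∀ N v, ηf [S.pointField N x, S.pointField N x'] v ↔ v = uf N) ∧
      Tendsto (fun N => uf N - u N) atTop (𝓝 ((S.phi f x * S.phi f x' : ℝ) : ℂ)) := by
  obtain ⟨M, hM, hMf, hMs⟩ := h.exists_pointMoments hA hf
  refine ⟨fun N => M [(S.pointVector N x, 0), (S.pointVector N x', 0)],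
    fun N => M [(S.pointVector N x, S.partialPhi f N x), (S.pointVector N x', S.partialPhi f N x')],
    fun N v => ?_, fun N v => hMf N [x, x'] v, ?_⟩
  · have h1 := hMs N [x, x'] v 0
    simpa [shift_zero] using h1
  · have h1 : ∀ y : Pt, P.IsPt y → Tendsto (fun N => S.partialPhi f N y) atTop (𝓝 (S.phi f y)) :=
      fun y hy => (hasSum_phi (S := S) hA hf.1 hf.2.1 hy).tendsto_sum_nat
    have h2 := (Complex.continuous_ofReal.tendsto _).comp ((h1 x hx).mul (h1 x' hx'))
    refine h2.congr fun N => ?_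
    beta_reduce
    rw [hM.pair, add_sub_cancel_left]
    rfl

/-- The two-point functions of a coherent state and of the underlying state differ by the product
of the values of the classical solution. -/
theorem IsCoherentPair.hasNPoint_pair_iff (hA : P.Positive) (hf : P.IsTest f)
    (h : S.IsCoherentPair f η ηf) {x x' : Pt} (hx : P.IsPt x) (hx' : P.IsPt x') (v : ℂ) :
    S.HasNPoint η [x, x'] v ↔
      S.HasNPoint ηf [x, x'] (v + ((S.phi f x * S.phi f x' : ℝ) : ℂ)) := by
  obtain ⟨u, uf, hu, huf, hlim⟩ := h.exists_twoPoint hA hf hx hx'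
  refine (hasLimitExp_iff hu v).trans (Iff.trans ?_ (hasLimitExp_iff huf _).symm)
  constructor
  · intro h1
    have h2 := h1.add hlim
    simpa using h2
  · intro h1
    have h2 := h1.sub hlim
    simpa using h2

theorem IsCoherentPair.smeared (hA : P.Positive) (hf : P.IsTest f)
    (h : S.IsCoherentPair f η ηf) {g : List (ℝ → HSpace P)} (hg : ∀ h ∈ g, P.IsTest h) :
    ∃ v : ℂ, ηf (g.map S.field) v ∧
      η (g.map fun h => shift (S.field h) (∫ t, (⟪S.E f t, h t⟫_ℂ).re)) v := by
  obtain ⟨c, hc, hω⟩ := S.exists_linear_growth hA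
  obtain ⟨M, hM, hMf⟩ := h.exists_momentFunctional hc hω
  refine ⟨M (g.map fun h => (S.oneParticle h, ∫ t, (⟪S.E f t, h t⟫_ℂ).re)), ?_, ?_⟩
  · have h1 := hMf (g.map S.oneParticle)
      (M (g.map fun h => (S.oneParticle h, ∫ t, (⟪S.E f t, h t⟫_ℂ).re)))
    rw [List.map_map, List.map_map] at h1
    refine h1.mpr (congrArg M (List.map_congr_left fun k hk => ?_))
    rw [Function.comp_apply, integral_E_inner hA hf (hg k hk)]
  · have h1 := hM.iff (g.map fun h => (S.oneParticle h, ∫ t, (⟪S.E f t, h t⟫_ℂ).re))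
      (M (g.map fun h => (S.oneParticle h, ∫ t, (⟪S.E f t, h t⟫_ℂ).re)))
    rw [List.map_map] at h1
    exact h1.mpr rfl

end EigenSystem

variable {P : Params}

/-! ## Regularity of the classical solution and renormalized quantities -/

theorem isPt_bulkPt {x : ℝ × ℝ} (hx : x.2 ∈ Icc 0 P.ell) : P.IsPt (bulkPt x) := fun z hz => by
  obtain rfl : x.2 = z := Option.some_injective _ hz
  exact hx

theorem isPt_bdryPt (t : ℝ) : P.IsPt (bdryPt t) := fun z hz => by simp [bdryPt] at hz

theorem HasMixedDerivAt.add_mul {g : ℝ → ℝ → ℂ} {D : ℂ} {a b : ℝ} (h : HasMixedDerivAt g D a b)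
    {u w : ℝ → ℝ} {u' w' : ℝ} (hu : HasDerivAt u u' a) (hw : HasDerivAt w w' b) (ε : ℝ) :
    HasMixedDerivAt (fun s s' => g s s' + ((ε * (u s * w s') : ℝ) : ℂ))
      (D + ((ε * (u' * w') : ℝ) : ℂ)) a b := by
  obtain ⟨k, h1, h2⟩ := h
  refine ⟨fun s => k s + ((ε * (u s * w') : ℝ) : ℂ), ?_, ?_⟩
  · filter_upwards [h1] with s hs
    exact hs.add (((hw.const_mul (u s)).const_mul ε).ofReal_comp)
  · exact h2.add (((hu.mul_const w').const_mul ε).ofReal_comp)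

namespace EigenSystem

variable {S : EigenSystem P} {f : ℝ → HSpace P} {η ηf : State}

/-- The coefficients of √A f are ω_n times those of f, and √A f is again continuous with compact
support. The masses of f are those of √A f divided by ω_n, hence summable, which is the gain of one
derivative. -/
theorem summable_mass (hA : P.Positive) (hf : S.IsRegularTest f) : Summable (S.mass f) := by
  obtain ⟨⟨hc, hs, -⟩, h2, h3⟩ := hf
  set g : ℝ → HSpace P := fun t => S.sqrtA (f t) with hg
  have hgs : HasCompactSupport g := by
    refine hs.comp_left (g := S.sqrtA) ?_
    simp [sqrtA, spectral]
  have h4 : ∀ n t, S.coef g n t = S.ω n * S.coef f n t := fun n t => by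
    have h5 : Summable fun n => ‖(S.ω n : ℂ) * ⟪S.basis n, f t⟫_ℂ‖ ^ 2 := by
      refine (h2 t).congr fun n => ?_
      rw [norm_mul, mul_pow, Complex.norm_real, Real.norm_eq_abs, sq_abs]
    have h6 : ⟪S.basis n, g t⟫_ℂ = (S.ω n : ℂ) * ⟪S.basis n, f t⟫_ℂ := (hasSum_spectral h5).2 n
    rw [coef, h6, Complex.re_ofReal_mul]
    rfl
  refine (summable_mass_div (S := S) hA h3 hgs).congr fun n => ?_
  have h7 : S.mass g n = S.ω n * S.mass f n := by
    unfold mass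
    rw [← integral_const_mul]
    congr 1
    funext t
    rw [h4, abs_mul, abs_of_pos (S.ω_pos n)]
  rw [h7, mul_div_cancel_left₀ _ (S.ω_pos n).ne']

/-- The time derivative of the classical solution. -/
def phiTime (S : EigenSystem P) (f : ℝ → HSpace P) (x : Pt) : ℝ :=
  ∑' n, S.mode x.2 n * S.amplitudeDeriv f n x.1

/-- The spatial derivative of the classical solution. -/
def phiSpace (S : EigenSystem P) (f : ℝ → HSpace P) (x : ℝ × ℝ) : ℝ :=
  ∑' n, S.dψ n x.2 * S.amplitude f n x.1

theorem continuousOn_comp_snd {h : ℝ → ℝ} (hh : ContinuousOn h (Icc 0 P.ell)) :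
    ContinuousOn (fun x : ℝ × ℝ => h x.2) (univ ×ˢ Icc 0 P.ell) :=
  hh.comp continuousOn_snd fun _ hx => hx.2

theorem bulk_mem_nhds {x : ℝ × ℝ} (hx : x.2 ∈ Ioo 0 P.ell) :
    (univ : Set ℝ) ×ˢ Icc 0 P.ell ∈ 𝓝 x :=
  prod_mem_nhds univ_mem (Icc_mem_nhds hx.1 hx.2)

theorem continuousAt_phi_bulk (hA : P.Positive) (hf : P.IsTest f) {x : ℝ × ℝ}
    (hx : x.2 ∈ Ioo 0 P.ell) : ContinuousAt (fun y => S.phi f (bulkPt y)) x := by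
  obtain ⟨C, hC, hm⟩ := exists_mode_bound (S := S) hA
  have h1 : ContinuousOn (fun y : ℝ × ℝ => ∑' n, S.mode (bulkPt y).2 n * S.amplitude f n y.1)
      (univ ×ˢ Icc 0 P.ell) := by
    refine continuousOn_tsum (u := fun n => C * (2 * S.mass f n / S.ω n)) (fun n => ?_) ?_
      fun n y hy => ?_
    · exact (continuousOn_comp_snd (S.continuousOn_ψ n)).mul
        ((continuous_amplitude n).comp continuous_fst).continuousOn
    · refine ((summable_mass_div (S := S) hA hf.1 hf.2.1).mul_left (C * 2)).congr fun n => ?_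
      ring
    · rw [Real.norm_eq_abs, abs_mul]
      exact mul_le_mul (hm _ (isPt_bulkPt hy.2) n) (abs_amplitudes_le hf.1 hf.2.1 n _).1
        (abs_nonneg _) hC
  refine (h1.congr fun y hy => ?_).continuousAt (bulk_mem_nhds hx)
  exact (hasSum_phi hA hf.1 hf.2.1 (isPt_bulkPt hy.2)).tsum_eq.symm

theorem continuous_phi_bdry (hA : P.Positive) (hf : P.IsTest f) :
    Continuous fun t => S.phi f (bdryPt t) := by
  obtain ⟨C, hC, hm⟩ := exists_mode_bound (S := S) hA
  have h1 : Continuous fun t => ∑' n, S.mode none n * S.amplitude f n t := by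
    refine continuous_tsum (u := fun n => C * (2 * S.mass f n / S.ω n))
      (fun n => continuous_const.mul (continuous_amplitude n)) ?_ fun n t => ?_
    · refine ((summable_mass_div (S := S) hA hf.1 hf.2.1).mul_left (C * 2)).congr fun n => ?_
      ring
    · rw [Real.norm_eq_abs, abs_mul]
      exact mul_le_mul (hm _ (isPt_bdryPt t) n) (abs_amplitudes_le hf.1 hf.2.1 n _).1
        (abs_nonneg _) hC
  refine h1.congr fun t => ?_
  exact (hasSum_phi hA hf.1 hf.2.1 (isPt_bdryPt t)).tsum_eq

theorem hasDerivAt_phi_time (hA : P.Positive) (hf : S.IsRegularTest f) {x : Pt} (hx : P.IsPt x) :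
    HasDerivAt (fun s => S.phi f (s, x.2)) (S.phiTime f x) x.1 := by
  obtain ⟨C, hC, hm⟩ := exists_mode_bound (S := S) hA
  have hpt : ∀ s, P.IsPt (s, x.2) := fun s => hx
  have h1 := hasDerivAt_tsum (u := fun n => C * (2 * S.mass f n)) (y₀ := x.1)
    (g := fun n s => S.mode x.2 n * S.amplitude f n s)
    (g' := fun n s => S.mode x.2 n * S.amplitudeDeriv f n s)
    (((summable_mass hA hf).mul_left 2).mul_left C)
    (fun n s => (hasDerivAt_amplitude n s).const_mul _) (fun n s => by
      rw [Real.norm_eq_abs, abs_mul]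
      exact mul_le_mul (hm x hx n) (abs_amplitudes_le hf.1.1 hf.1.2.1 n s).2 (abs_nonneg _) hC)
    (hasSum_phi hA hf.1.1 hf.1.2.1 hx).summable x.1
  refine h1.congr_of_eventuallyEq (Eventually.of_forall fun s => ?_)
  exact (hasSum_phi hA hf.1.1 hf.1.2.1 (hpt s)).tsum_eq.symm

theorem abs_dψ_mul_amplitude_le {C : ℝ} (hC : 0 ≤ C) {n : ℕ} {z : ℝ}
    (hd : |S.dψ n z| ≤ C * S.ω n) (hf : P.IsTest f) (t : ℝ) :
    |S.dψ n z * S.amplitude f n t| ≤ C * (2 * S.mass f n) := by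
  have hω := S.ω_pos n
  rw [abs_mul]
  calc |S.dψ n z| * |S.amplitude f n t| ≤ C * S.ω n * (2 * S.mass f n / S.ω n) :=
        mul_le_mul hd (abs_amplitudes_le hf.1 hf.2.1 n t).1 (abs_nonneg _) (by positivity)
    _ = C * (2 * S.mass f n) := by field_simp

/-- Term-by-term differentiation: the growth of the derivative of Ψ_n, of order ω_n, is compensated
by the ω_n⁻¹ in the amplitude, and the masses are summable. -/
theorem hasDerivAt_phi_space (hA : P.Positive) (hf : S.IsRegularTest f) {x : ℝ × ℝ}
    (hx : x.2 ∈ Ioo 0 P.ell) :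
    HasDerivAt (fun y => S.phi f (bulkPt (x.1, y))) (S.phiSpace f x) x.2 := by
  obtain ⟨C, hC, hb⟩ := S.exists_bounds hA
  have hpt : ∀ y ∈ Ioo 0 P.ell, P.IsPt (bulkPt (x.1, y)) := fun y hy =>
    isPt_bulkPt (Ioo_subset_Icc_self hy)
  have h1 := hasDerivAt_tsum_of_isPreconnected (u := fun n => C * (2 * S.mass f n)) (y₀ := x.2)
    (g := fun n y => S.ψ n y * S.amplitude f n x.1)
    (g' := fun n y => S.dψ n y * S.amplitude f n x.1)
    (((summable_mass hA hf).mul_left 2).mul_left C) isOpen_Ioo isPreconnected_Ioo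
    (fun n y hy => (S.hasDerivAt_ψ n hy).mul_const _)
    (fun n y hy => abs_dψ_mul_amplitude_le hC ((hb n).1 y (Ioo_subset_Icc_self hy)).2 hf.1 _)
    hx (hasSum_phi hA hf.1.1 hf.1.2.1 (hpt _ hx)).summable hx
  refine h1.congr_of_eventuallyEq ?_
  filter_upwards [Ioo_mem_nhds hx.1 hx.2] with y hy
  exact (hasSum_phi hA hf.1.1 hf.1.2.1 (hpt y hy)).tsum_eq.symm

theorem continuousAt_phiTime_bulk (hA : P.Positive) (hf : S.IsRegularTest f) {x : ℝ × ℝ}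
    (hx : x.2 ∈ Ioo 0 P.ell) : ContinuousAt (fun y => S.phiTime f (bulkPt y)) x := by
  obtain ⟨C, hC, hm⟩ := exists_mode_bound (S := S) hA
  have h1 : ContinuousOn (fun y : ℝ × ℝ => S.phiTime f (bulkPt y)) (univ ×ˢ Icc 0 P.ell) := by
    refine continuousOn_tsum (u := fun n => C * (2 * S.mass f n)) (fun n => ?_)
      (((summable_mass hA hf).mul_left 2).mul_left C) fun n y hy => ?_
    · exact (continuousOn_comp_snd (S.continuousOn_ψ n)).mul
        ((continuous_amplitudeDeriv n).comp continuous_fst).continuousOn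
    · rw [Real.norm_eq_abs, abs_mul]
      exact mul_le_mul (hm _ (isPt_bulkPt hy.2) n) (abs_amplitudes_le hf.1.1 hf.1.2.1 n _).2
        (abs_nonneg _) hC
  exact h1.continuousAt (bulk_mem_nhds hx)

theorem continuous_phiTime_bdry (hA : P.Positive) (hf : S.IsRegularTest f) :
    Continuous fun t => S.phiTime f (bdryPt t) := by
  obtain ⟨C, hC, hm⟩ := exists_mode_bound (S := S) hA
  refine continuous_tsum (u := fun n => C * (2 * S.mass f n))
    (fun n => continuous_const.mul (continuous_amplitudeDeriv n))
    (((summable_mass hA hf).mul_left 2).mul_left C) fun n t => ?_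
  rw [Real.norm_eq_abs, abs_mul]
  exact mul_le_mul (hm _ (isPt_bdryPt t) n) (abs_amplitudes_le hf.1.1 hf.1.2.1 n _).2
    (abs_nonneg _) hC

theorem continuousAt_phiSpace (hA : P.Positive) (hf : S.IsRegularTest f) {x : ℝ × ℝ}
    (hx : x.2 ∈ Ioo 0 P.ell) : ContinuousAt (S.phiSpace f) x := by
  obtain ⟨C, hC, hb⟩ := S.exists_bounds hA
  have h1 : ContinuousOn (S.phiSpace f) (univ ×ˢ Icc 0 P.ell) := by
    refine continuousOn_tsum (u := fun n => C * (2 * S.mass f n)) (fun n => ?_)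
      (((summable_mass hA hf).mul_left 2).mul_left C) fun n y hy =>
        abs_dψ_mul_amplitude_le hC ((hb n).1 y.2 hy.2).2 hf.1 _
    exact (continuousOn_comp_snd (S.continuousOn_dψ n)).mul
        ((continuous_amplitude n).comp continuous_fst).continuousOn
  exact h1.continuousAt (bulk_mem_nhds hx)

/-! ### Transfer of renormalized quantities between the two states -/

/-- The two-point functions of `η'` arise from those of `η` by adding `ε φ(x) φ(x')`, where `φ` is
the classical solution. -/
def IsTwoPointShift (S : EigenSystem P) (f : ℝ → HSpace P) (ε : ℝ) (η η' : State) : Prop :=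
  ∀ (x x' : Pt), P.IsPt x → P.IsPt x' → ∀ v, S.HasNPoint η [x, x'] v →
    S.HasNPoint η' [x, x'] (v + ((ε * (S.phi f x * S.phi f x') : ℝ) : ℂ))

/-- The sign ε = −1 exchanges the two states, so a transfer statement proved in one direction for
general ε yields an equivalence. -/
theorem IsCoherentPair.isTwoPointShift (hA : P.Positive) (hf : P.IsTest f)
    (h : S.IsCoherentPair f η ηf) :
    S.IsTwoPointShift f 1 η ηf ∧ S.IsTwoPointShift f (-1) ηf η := by
  refine ⟨fun x x' hx hx' v hv => ?_, fun x x' hx hx' v hv => ?_⟩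
  · rw [one_mul]
    exact (h.hasNPoint_pair_iff hA hf hx hx' v).mp hv
  · refine (h.hasNPoint_pair_iff hA hf hx hx' _).mpr ?_
    convert hv using 1
    push_cast
    ring

namespace IsTwoPointShift

variable {ε : ℝ} {η' : State} {L : ℂ}

/-- The Hadamard term is untouched; the added product φ(x)φ(x') tends to φ(x)² by continuity of the
classical solution. -/
theorem bulkPolarization (hA : P.Positive) (hf : P.IsTest f) (h : S.IsTwoPointShift f ε η η')
    {x : ℝ × ℝ} (hx : x.2 ∈ Ioo 0 P.ell) (hL : S.HasBulkPolarization η x L) :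
    S.HasBulkPolarization η' x (L + ((ε * S.phi f (bulkPt x) ^ 2 : ℝ) : ℂ)) := by
  obtain ⟨G, h1, h2⟩ := hL
  refine ⟨fun x' => G x' + ((ε * (S.phi f (bulkPt x) * S.phi f (bulkPt x')) : ℝ) : ℂ), ?_, ?_⟩
  · filter_upwards [h1, mem_nhdsWithin_of_mem_nhds (bulk_mem_nhds hx)] with x' h3 h4
    have h5 := h _ _ (isPt_bulkPt (Ioo_subset_Icc_self hx)) (isPt_bulkPt h4.2) _ h3
    convert h5 using 1
    ring
  · refine h2.add ((Complex.continuous_ofReal.tendsto _).comp ?_)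
    rw [sq]
    exact (((continuousAt_phi_bulk hA hf hx).tendsto.mono_left nhdsWithin_le_nhds).const_mul
      _).const_mul ε

theorem bdryPolarization (hA : P.Positive) (hf : P.IsTest f) (h : S.IsTwoPointShift f ε η η')
    {t : ℝ} (hL : S.HasBdryPolarization η t L) :
    S.HasBdryPolarization η' t (L + ((ε * S.phi f (bdryPt t) ^ 2 : ℝ) : ℂ)) := by
  obtain ⟨G, h1, h2⟩ := hL
  refine ⟨fun t' => G t' + ((ε * (S.phi f (bdryPt t) * S.phi f (bdryPt t')) : ℝ) : ℂ), ?_, ?_⟩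
  · filter_upwards [h1] with t' h3
    exact h _ _ (isPt_bdryPt t) (isPt_bdryPt t') _ h3
  · refine h2.add ((Complex.continuous_ofReal.tendsto _).comp ?_)
    rw [sq]
    exact (((continuous_phi_bdry hA hf).continuousAt.tendsto.mono_left
      nhdsWithin_le_nhds).const_mul _).const_mul ε

/-- The mixed derivatives of the added product factor into derivatives of φ at x and at x'.
Continuity of those derivatives gives their squares in the coincidence limit. -/
theorem bulkEnergy (hA : P.Positive) (hf : S.IsRegularTest f) (h : S.IsTwoPointShift f ε η η')
    {x : ℝ × ℝ} (hx : x.2 ∈ Ioo 0 P.ell) (hL : S.HasBulkEnergy η x L) :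
    S.HasBulkEnergy η' x (L + ((ε * S.classicalBulkEnergy f x : ℝ) : ℂ)) := by
  obtain ⟨G, Dt, Dz, h1, h2, h3⟩ := hL
  have ht : ∀ y : ℝ × ℝ, y.2 ∈ Icc 0 P.ell →
      HasDerivAt (fun s => S.phi f (bulkPt (s, y.2))) (S.phiTime f (bulkPt y)) y.1 := fun y hy =>
    hasDerivAt_phi_time hA hf (isPt_bulkPt hy)
  have hx' := Ioo_subset_Icc_self hx
  refine ⟨fun p p' => G p p' + ((ε * (S.phi f (bulkPt p) * S.phi f (bulkPt p')) : ℝ) : ℂ),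
    fun x' => Dt x' + ((ε * (S.phiTime f (bulkPt x) * S.phiTime f (bulkPt x')) : ℝ) : ℂ),
    fun x' => Dz x' + ((ε * (S.phiSpace f x * S.phiSpace f x') : ℝ) : ℂ), ?_, ?_, ?_⟩
  -- Near an interior point both arguments stay in the bulk interval, where the two-point shift is
  -- available.
  · filter_upwards [h1, mem_nhdsWithin_of_mem_nhds
      (prod_mem_nhds (bulk_mem_nhds hx) (bulk_mem_nhds hx))] with p h4 h5
    have h6 := h _ _ (isPt_bulkPt h5.1.2) (isPt_bulkPt h5.2.2) _ h4
    convert h6 using 1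
    ring
  · filter_upwards [h2, mem_nhdsWithin_of_mem_nhds (prod_mem_nhds univ_mem
      (Ioo_mem_nhds hx.1 hx.2) : (univ : Set ℝ) ×ˢ Ioo 0 P.ell ∈ 𝓝 x)] with x' h4 h5
    exact ⟨h4.1.add_mul (ht x hx') (ht x' (Ioo_subset_Icc_self h5.2)) ε,
      h4.2.add_mul (hasDerivAt_phi_space hA hf hx) (hasDerivAt_phi_space hA hf h5.2) ε⟩
  · have hlim : ∀ {u : ℝ × ℝ → ℝ}, ContinuousAt u x →
        Tendsto u (𝓝[{x' | 0 < sigma x x'}] x) (𝓝 (u x)) := fun hu =>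
      hu.tendsto.mono_left nhdsWithin_le_nhds
    have h4 := (((((hlim (continuousAt_phiTime_bulk hA hf hx)).const_mul
      (S.phiTime f (bulkPt x))).add ((hlim (continuousAt_phiSpace hA hf hx)).const_mul
        (S.phiSpace f x))).add (((hlim (continuousAt_phi_bulk (S := S) hA hf.1 hx)).const_mul
          (S.phi f (bulkPt x))).const_mul (P.m ^ 2))).const_mul (ε * (1 / 2)))
    have h5 := h3.add ((Complex.continuous_ofReal.tendsto _).comp h4)
    refine (h5.congr fun x' => ?_).trans_eq ?_
    · simp only [Function.comp_apply]
      push_cast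
      ring
    · rw [classicalBulkEnergy, (ht x hx').deriv, (hasDerivAt_phi_space hA hf hx).deriv]
      congr 3
      ring

theorem bdryEnergy (hA : P.Positive) (hf : S.IsRegularTest f) (h : S.IsTwoPointShift f ε η η')
    {t : ℝ} (hL : S.HasBdryEnergy η t L) :
    S.HasBdryEnergy η' t (L + ((ε * S.classicalBdryEnergy f t : ℝ) : ℂ)) := by
  obtain ⟨G, Dt, h1, h2, h3⟩ := hL
  have ht : ∀ t : ℝ, HasDerivAt (fun s => S.phi f (bdryPt s)) (S.phiTime f (bdryPt t)) t :=
    fun t => hasDerivAt_phi_time hA hf (isPt_bdryPt t)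
  refine ⟨fun s s' => G s s' + ((ε * (S.phi f (bdryPt s) * S.phi f (bdryPt s')) : ℝ) : ℂ),
    fun t' => Dt t' + ((ε * (S.phiTime f (bdryPt t) * S.phiTime f (bdryPt t')) : ℝ) : ℂ),
    ?_, ?_, ?_⟩
  · filter_upwards [h1] with p h4
    exact h _ _ (isPt_bdryPt _) (isPt_bdryPt _) _ h4
  · filter_upwards [h2] with t' h4
    exact h4.add_mul (ht t) (ht t') ε
  · have hlim : ∀ {u : ℝ → ℝ}, Continuous u → Tendsto u (𝓝[≠] t) (𝓝 (u t)) := fun hu =>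
      hu.continuousAt.tendsto.mono_left nhdsWithin_le_nhds
    have h4 := ((((hlim (continuous_phiTime_bdry hA hf)).const_mul
      (S.phiTime f (bdryPt t))).const_mul |P.b₁'|).sub (((hlim (continuous_phi_bdry (S := S) hA
        hf.1)).const_mul (S.phi f (bdryPt t))).const_mul (Real.sign P.b₁' * P.b₁))).const_mul
          (ε * (1 / 2))
    have h5 := h3.add ((Complex.continuous_ofReal.tendsto _).comp h4)
    refine (h5.congr fun x' => ?_).trans_eq ?_
    · simp only [Function.comp_apply]
      push_cast
      ring
    · rw [classicalBdryEnergy, (ht t).deriv]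
      congr 3
      ring

end IsTwoPointShift

end EigenSystem

end CoherentCasimir

end

/-! ### The main theorem -/

theorem mainTheorem6 (P : CoherentCasimir.Params) (hA : P.Positive) :
    Nonempty (CoherentCasimir.EigenSystem P) ∧
    ∀ S : CoherentCasimir.EigenSystem P,
      -- the Weyl operators and the classical solution are well defined
      (∀ f, P.IsTest f → ∃ U, CoherentCasimir.IsUnitaryGroupOf (S.field f) U) ∧
      (∀ f, P.IsTest f → ∀ t : ℝ,
        (⇑(S.E f t).fst =ᵐ[P.bulkMeasure] fun z => (S.phi f (t, some z) : ℂ)) ∧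
        (S.E f t).snd.val = (S.phi f (t, none) : ℂ)) ∧
      -- n-point functions of smeared fields
      (∀ f, P.IsTest f → ∀ η ηf, S.IsCoherentPair f η ηf →
        ∀ g : List (ℝ → CoherentCasimir.HSpace P), (∀ h ∈ g, P.IsTest h) →
          ∃ v : ℂ, ηf (g.map S.field) v ∧
            η (g.map fun h => CoherentCasimir.shift (S.field h)
              (∫ t, (inner ℂ (S.E f t) (h t)).re)) v) ∧
      -- n-point functions at points
      (∀ f, P.IsTest f → ∀ η ηf, S.IsCoherentPair f η ηf →
        ∀ X : List CoherentCasimir.Pt, (∀ x ∈ X, P.IsPt x) →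
          ∀ v : ℂ, S.HasNPoint ηf X v ↔ S.HasShiftedNPoint η (S.phi f) X v) ∧
      -- two-point functions
      (∀ f, P.IsTest f → ∀ η ηf, S.IsCoherentPair f η ηf →
        ∀ x x' : CoherentCasimir.Pt, P.IsPt x → P.IsPt x' →
          ∃ u uf : ℕ → ℂ,
            (∀ N, η [S.pointField N x, S.pointField N x'] (u N)) ∧
            (∀ N, ηf [S.pointField N x, S.pointField N x'] (uf N)) ∧
            Filter.Tendsto (fun N => uf N - u N) Filter.atTop
              (nhds ((S.phi f x * S.phi f x' : ℝ) : ℂ))) ∧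
      -- renormalized state polarizations
      (∀ f, P.IsTest f → ∀ η ηf, S.IsCoherentPair f η ηf →
        (∀ x : ℝ × ℝ, x.2 ∈ Set.Ioo 0 P.ell → ∀ L : ℂ,
          S.HasBulkPolarization η x L ↔
            S.HasBulkPolarization ηf x
              (L + ((S.phi f (CoherentCasimir.bulkPt x) ^ 2 : ℝ) : ℂ))) ∧
        (∀ (t : ℝ) (L : ℂ),
          S.HasBdryPolarization η t L ↔
            S.HasBdryPolarization ηf t
              (L + ((S.phi f (CoherentCasimir.bdryPt t) ^ 2 : ℝ) : ℂ)))) ∧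
      -- local Casimir energies
      (∀ f, S.IsRegularTest f →
        (∀ x : ℝ × ℝ, x.2 ∈ Set.Ioo 0 P.ell →
          DifferentiableAt ℝ (fun s => S.phi f (CoherentCasimir.bulkPt (s, x.2))) x.1 ∧
          DifferentiableAt ℝ (fun y => S.phi f (CoherentCasimir.bulkPt (x.1, y))) x.2) ∧
        (∀ t : ℝ, DifferentiableAt ℝ (fun s => S.phi f (CoherentCasimir.bdryPt s)) t) ∧
        ∀ η ηf, S.IsCoherentPair f η ηf →
          (∀ x : ℝ × ℝ, x.2 ∈ Set.Ioo 0 P.ell → ∀ L : ℂ,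
            S.HasBulkEnergy η x L ↔
              S.HasBulkEnergy ηf x (L + (S.classicalBulkEnergy f x : ℂ))) ∧
          (∀ (t : ℝ) (L : ℂ),
            S.HasBdryEnergy η t L ↔
              S.HasBdryEnergy ηf t (L + (S.classicalBdryEnergy f t : ℂ)))) := by
  open CoherentCasimir EigenSystem in
  refine ⟨nonempty_eigenSystem hA, fun S => ⟨fun f _ => ?_, fun f hf t => ⟨E_fst hA hf t,
    E_snd hA hf t⟩, fun f hf η ηf h g hg => h.smeared hA hf hg,
    fun f hf η ηf h X hX v => h.hasNPoint_iff hA hf hX v, fun f hf η ηf h x x' hx hx' => ?_,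
    fun f hf η ηf h => ⟨fun x hx L => ⟨fun hL => ?_, fun hL => ?_⟩,
      fun t L => ⟨fun hL => ?_, fun hL => ?_⟩⟩,
    fun f hf => ⟨fun x hx => ⟨?_, ?_⟩, fun t => ?_, fun η ηf h =>
      ⟨fun x hx L => ⟨fun hL => ?_, fun hL => ?_⟩, fun t L => ⟨fun hL => ?_, fun hL => ?_⟩⟩⟩⟩⟩
  · obtain ⟨V, hV, -⟩ := exists_segal_group (S.oneParticle f)
    exact ⟨V, (isUnitaryGroupOf_segal_iff _ V).mpr hV⟩
  · obtain ⟨u, uf, hu, huf, hlim⟩ := h.exists_twoPoint hA hf hx hx'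
    exact ⟨u, uf, fun N => (hu N _).mpr rfl, fun N => (huf N _).mpr rfl, hlim⟩
  · simpa using (h.isTwoPointShift hA hf).1.bulkPolarization hA hf hx hL
  · simpa using (h.isTwoPointShift hA hf).2.bulkPolarization hA hf hx hL
  · simpa using (h.isTwoPointShift hA hf).1.bdryPolarization hA hf hL
  · simpa using (h.isTwoPointShift hA hf).2.bdryPolarization hA hf hL
  · exact (hasDerivAt_phi_time hA hf (isPt_bulkPt (Set.Ioo_subset_Icc_self hx))).differentiableAt
  · exact (hasDerivAt_phi_space hA hf hx).differentiableAt
  · exact (hasDerivAt_phi_time hA hf (isPt_bdryPt t)).differentiableAt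
  · simpa using (h.isTwoPointShift hA hf.1).1.bulkEnergy hA hf hx hL
  · simpa using (h.isTwoPointShift hA hf.1).2.bulkEnergy hA hf hx hL
  · simpa using (h.isTwoPointShift hA hf.1).1.bdryEnergy hA hf hL
  · simpa using (h.isTwoPointShift hA hf.1).2.bdryEnergy hA hf hL
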